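/- Let $m_1,m_2\in\mathbb N$, $m=m_1+m_2$, $j=\mathrm{diag}(I_{m_1},-I_{m_2})$. For $r>0$ let $\mathcal U^{p\times q}[0,r]$ be the class of $p\times q$ matrix functions $G$ that are differentiable on $[0,r]$ and satisfy $G'(x)=G'(0)+\int_0^xG''(t)\,dt$ with $G''\in L_2^{p\times q}(0,r)$. Let $\beta=[\beta_1\ \ \beta_2]$ be an $m_2\times m$ matrix function with blocks $\beta_1$ ($m_2\times m_1$) and $\beta_2$ ($m_2\times m_2$). We say that $\beta$ is admissible on $[0,r]$ if $\beta\in\mathcal U^{m_2\times m}[0,r]$ and $$\beta(x)j\beta(x)^*\equiv0,\qquad \beta'(x)j\beta(x)^*\equiv \mathrm i I_{m_2}\qquad(0\le x\le r);$$ this is the condition on the generalised canonical system $w'=\mathrm i\lambda jHw$ with Hamiltonian $H=\beta^*\beta$ on $[0,r]$. In $L_2^{m_2}(0,r)$ put $$(Af)(x)=\int_0^x(t-x)f(t)\,dt,\qquad (Kf)(x)=\mathrm i\beta(x)j\int_0^x\beta(t)^*f(t)\,dt .$$ A normalised transformation operator $E$ is an operator $E=VV_0$, where * $(Vf)(x)=u(x)\big(f(x)+\int_0^x\mathcal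 V(x,t)f(t)\,dt\big)$ is invertible on $L_2^{m_2}(0,r)$ with $K=VAV^{-1}$, where $u\in\mathcal U^{m_2\times m_2}[0,r]$, $u(x)^*=u(x)^{-1}$, $u(0)=I_{m_2}$, and $\mathcal V$ is measurable and bounded on $0\le t\le x\le r$; * $V^{-1}\beta_2\in\mathcal U^{m_2\times m_2}[0,r]$, and $(V_0f)(x)=\beta_2(0)f(x)+\int_0^x\mathcal V_0(x-t)f(t)\,dt$ with $\mathcal V_0=(V^{-1}\beta_2)'$. Here operators are applied to matrix functions columnwise. (a) Let $r>0$ and let $\beta$ be admissible on $[0,r]$. Then there is an invertible normalised transformation operator $E$, so that $\Phi_1:=E^{-1}\beta_1\in L_2^{m_2\times m_1}(0,r)$ is defined, and for every such $E$ the function $\Phi_1=E^{-1}\beta_1$ satisfies $$\int_0^\xi\Phi_1(\xi-t)\,\Phi_1(t)^*\,dt=\xi I_{m_2}\qquad\text{for all }\xi\in[0,r].$$ (b) Let $\beta$ be admissible on $[0,r]$ for every $r>0$. Then there is a function $\Phi_1$ on $[0,\infty)$ whose restriction to $(0,r)$ is, for every $r>0$, of the form $E^{-1}\beta_1$ with an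 invertible normalised transformation operator $E$ on $(0,r)$; and every such $\Phi_1$ satisfies the identity in (a) for all $\xi\in[0,\infty)$. -/

import Mathlib

open scoped Matrix

namespace GenCanonical

open MeasureTheory Set

/-- Lebesgue measure on the interval `(0, r)`. -/
noncomputable abbrev vol (r : ℝ) : Measure ℝ := volume.restrict (Ioo 0 r)

/-! ### Function classes -/

/-- `L_2^p(0,r)`: vector functions that are square integrable on `(0,r)`. (The norm on `Fin p → ℂ`
is equivalent to the Euclidean one.) -/
def MemL2 {p : ℕ} (r : ℝ) (f : ℝ → Fin p → ℂ) : Prop := MemLp f 2 (vol r)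

/-- Entrywise derivative of a matrix function on `[0,r]`, one-sided at the end points. -/
noncomputable def mderiv {ι κ : Type*} (r : ℝ) (G : ℝ → Matrix ι κ ℂ) (x : ℝ) : Matrix ι κ ℂ :=
  Matrix.of fun i k => derivWithin (fun y => G y i k) (Icc 0 r) x

/-- Entrywise integral of a matrix function over `[a,b]`. -/
noncomputable def mint {ι κ : Type*} (a b : ℝ) (G : ℝ → Matrix ι κ ℂ) : Matrix ι κ ℂ :=
  Matrix.of fun i k => ∫ t in a..b, G t i k

/-- The class `𝒰[0,r]`: matrix functions `G` that are differentiable on `[0,r]` and satisfy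
`G'(x) = G'(0) + ∫_0^x G''(t) dt` with `G''` having square integrable entries on `(0,r)`. -/
def MemU {ι κ : Type*} (r : ℝ) (G : ℝ → Matrix ι κ ℂ) : Prop :=
  (∀ i k, DifferentiableOn ℝ (fun x => G x i k) (Icc 0 r)) ∧
  ∃ G₂ : ℝ → Matrix ι κ ℂ, (∀ i k, MemLp (fun x => G₂ x i k) 2 (vol r)) ∧
    ∀ x ∈ Icc 0 r, mderiv r G x = mderiv r G 0 + mint 0 x G₂

/-! ### The data of the canonical system -/

section System

variable {m₁ m₂ : ℕ}

/-- `j = diag(I_{m₁}, -I_{m₂})`. -/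
def jmat (m₁ m₂ : ℕ) : Matrix (Fin m₁ ⊕ Fin m₂) (Fin m₁ ⊕ Fin m₂) ℂ :=
  Matrix.fromBlocks 1 0 0 (-1)

/-- The block `β₁` of `β = [β₁ β₂]`. -/
def blk₁ (β : ℝ → Matrix (Fin m₂) (Fin m₁ ⊕ Fin m₂) ℂ) (x : ℝ) : Matrix (Fin m₂) (Fin m₁) ℂ :=
  (β x).toCols₁

/-- The block `β₂` of `β = [β₁ β₂]`. -/
def blk₂ (β : ℝ → Matrix (Fin m₂) (Fin m₁ ⊕ Fin m₂) ℂ) (x : ℝ) : Matrix (Fin m₂) (Fin m₂) ℂ :=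
  (β x).toCols₂

/-- The conditions on the system `w' = iλ j H w`, `H = β* β`, on `[0,r]`: `β ∈ 𝒰[0,r]`,
`β j β* ≡ 0` and `β' j β* ≡ i I`. -/
structure Admissible (β : ℝ → Matrix (Fin m₂) (Fin m₁ ⊕ Fin m₂) ℂ) (r : ℝ) : Prop where
  memU : MemU r β
  isotropic : ∀ x ∈ Icc 0 r, β x * jmat m₁ m₂ * (β x)ᴴ = 0
  normalised : ∀ x ∈ Icc 0 r, mderiv r β x * jmat m₁ m₂ * (β x)ᴴ = Complex.I • 1

/-! ### Operators on vector functions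

Operators in `L_2^{m₂}(0,r)` are given by explicit formulas on functions; equality in `L_2` is
equality almost everywhere on `(0,r)`. -/

/-- Operators on `m₂`-vector functions. -/
abbrev Op (m₂ : ℕ) : Type := (ℝ → Fin m₂ → ℂ) → ℝ → Fin m₂ → ℂ

/-- `(A f)(x) = ∫_0^x (t - x) f(t) dt`. -/
noncomputable def opA (m₂ : ℕ) : Op m₂ := fun f x => ∫ t in (0 : ℝ)..x, (t - x) • f t

/-- `(K f)(x) = i β(x) j ∫_0^x β(t)* f(t) dt`. -/
noncomputable def opK (β : ℝ → Matrix (Fin m₂) (Fin m₁ ⊕ Fin m₂) ℂ) : Op m₂ := fun f x =>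
  Complex.I • ((β x * jmat m₁ m₂) *ᵥ ∫ t in (0 : ℝ)..x, (β t)ᴴ *ᵥ f t)

/-- `(V f)(x) = u(x) (f(x) + ∫_0^x 𝒱(x,t) f(t) dt)`. -/
noncomputable def opV (u : ℝ → Matrix (Fin m₂) (Fin m₂) ℂ)
    (kV : ℝ → ℝ → Matrix (Fin m₂) (Fin m₂) ℂ) : Op m₂ := fun f x =>
  u x *ᵥ (f x + ∫ t in (0 : ℝ)..x, kV x t *ᵥ f t)

/-- `(V₀ f)(x) = b f(x) + ∫_0^x v(x - t) f(t) dt`. -/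
noncomputable def opV₀ (b : Matrix (Fin m₂) (Fin m₂) ℂ) (v : ℝ → Matrix (Fin m₂) (Fin m₂) ℂ) :
    Op m₂ := fun f x => b *ᵥ f x + ∫ t in (0 : ℝ)..x, v (x - t) *ᵥ f t

/-- `T` induces a bijection of `L_2^{m₂}(0,r)`. -/
structure InvertibleOnL2 (r : ℝ) (T : Op m₂) : Prop where
  mapsTo : ∀ f, MemL2 r f → MemL2 r (T f)
  inj : ∀ f g, MemL2 r f → MemL2 r g → T f =ᵐ[vol r] T g → f =ᵐ[vol r] g
  surj : ∀ g, MemL2 r g → ∃ f, MemL2 r f ∧ T f =ᵐ[vol r] g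

/-- `F = T⁻¹ G` in `L_2(0,r)`, where the inverse operator is applied to the matrix function `G`
columnwise. -/
structure IsInvApply {n : ℕ} (r : ℝ) (T : Op m₂) (G F : ℝ → Matrix (Fin m₂) (Fin n) ℂ) :
    Prop where
  invertible : InvertibleOnL2 r T
  memL2 : ∀ k, MemL2 r (fun x => (F x).col k)
  apply_eq : ∀ k, T (fun x => (F x).col k) =ᵐ[vol r] fun x => (G x).col k

/-- `V = u(x)(I + ∫_0^x 𝒱(x,t) · dt)` is a similarity transformation of `A` into `K`, that is,
`K = V A V⁻¹`, where `u ∈ 𝒰[0,r]` is unitary, `u(0) = I`, and `𝒱` is bounded on `0 ≤ t ≤ x ≤ r`. -/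
structure IsTransformation (β : ℝ → Matrix (Fin m₂) (Fin m₁ ⊕ Fin m₂) ℂ) (r : ℝ)
    (u : ℝ → Matrix (Fin m₂) (Fin m₂) ℂ) (kV : ℝ → ℝ → Matrix (Fin m₂) (Fin m₂) ℂ) : Prop where
  u_memU : MemU r u
  u_unitary : ∀ x ∈ Icc 0 r, u x ∈ Matrix.unitaryGroup (Fin m₂) ℂ
  u_zero : u 0 = 1
  kernel_measurable : ∀ i k, Measurable fun p : ℝ × ℝ => kV p.1 p.2 i k
  kernel_bounded : ∃ C : ℝ, ∀ x t, 0 ≤ t → t ≤ x → x ≤ r → ∀ i k, ‖kV x t i k‖ ≤ C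
  invertible : InvertibleOnL2 r (opV u kV)
  similar : ∀ f, MemL2 r f → opK β (opV u kV f) =ᵐ[vol r] opV u kV (opA m₂ f)

/-- `E` is the normalised transformation operator: `E = V V₀`, where `V` is a similarity
transformation as above, `V₀ f = β₂(0) f + ∫_0^x 𝒱₀(x - t) f(t) dt` and `𝒱₀ = (V⁻¹ β₂)'`.
Here `g` is the representative of `V⁻¹ β₂` in the class `𝒰[0,r]`. -/
def IsNormalisedTransformation (β : ℝ → Matrix (Fin m₂) (Fin m₁ ⊕ Fin m₂) ℂ) (r : ℝ)
    (E : Op m₂) : Prop :=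
  ∃ (u : ℝ → Matrix (Fin m₂) (Fin m₂) ℂ) (kV : ℝ → ℝ → Matrix (Fin m₂) (Fin m₂) ℂ)
    (g : ℝ → Matrix (Fin m₂) (Fin m₂) ℂ),
    IsTransformation β r u kV ∧ MemU r g ∧ IsInvApply r (opV u kV) (blk₂ β) g ∧
      E = fun f => opV u kV (opV₀ (blk₂ β 0) (mderiv r g) f)

/-- `Φ₁ = E⁻¹ β₁` on `(0,r)`, with the normalised transformation operator `E`. -/
def IsPhi₁ (β : ℝ → Matrix (Fin m₂) (Fin m₁ ⊕ Fin m₂) ℂ) (r : ℝ)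
    (Φ₁ : ℝ → Matrix (Fin m₂) (Fin m₁) ℂ) : Prop :=
  ∃ E : Op m₂, IsNormalisedTransformation β r E ∧ IsInvApply r E (blk₁ β) Φ₁

end System

end GenCanonical

open scoped Matrix

namespace GenCanonical

open MeasureTheory Set Filter
open scoped Topology

/-! ### Exponential weights and a fixed point principle -/

/-! Existence. A unitary gauge `u` with `u' = M u`, `M = (i/2) β' j β'*`, turns `β` into `c₀ = u* β`
with `c₁ j c₁* = 0` for `c₁ = c₀'` (`Admissible.exists_gauge`). Since `A` inverts `-d²/dx²`, two
differentiations of the operator `K` of `c₀` give `K = A (I - N)`, where `N` is a Volterra operator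
containing `c₂ = c₀''`. In this gauge `c₂ j c₀* = 0` almost everywhere, and a linear differential
equation expresses `N f` through `K f` alone: `N = Q K` with `Q h = q h + a ∫₀ˣ b h`
(`IsGauged.exists_coeff`). Thus `(I + AQ) K = A`, and because `I + AQ` is injective, `K X = X A`
follows from `A X - X A = A Q X A`.

For `X = I + v` the last equation is the integrated form of the wave equation `v_xx - v_tt = QX` for
the kernel `v(x,t)`, with Neumann condition at `t = 0`. Its coefficients are only square integrable,
so it is solved in integrated form: `v` is a superposition of the explicit fundamental solutions
`waveKer`, with the kernel of `QX` as source density, and this is a fixed point equation which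
contracts in an exponentially weighted sup norm (`IsCoeff.exists_kernel`). The equation leaves an
additive constant matrix in `v` free. Choosing it as `c₁₂(0) c₀₂(0)⁻¹`, where the index 2 denotes
the second block, makes the Taylor expansions at `0` match, and then the solution of `X g = c₀₂`
lies in `𝒰` (`IsGauged.exists_memU_preimage`). The operator `V = u X` is the required similarity;
`V₀` is invertible because `β₂(0)` is.

Identity. Convolutions commute with `A`, and `V₀ = g(0) + g' *` maps a constant `v` to `g v`.
Therefore every `E = V V₀` satisfies `K E = E A` and `E v = β₂ v` (`Intertwines`), and nothing else
about `E` is used. Let `a(x,v) = (E⁻¹)* χ_(0,x) v`. The operator `K - K*` has finite rank, namely `i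
β j ∫₀ʳ β* f`; evaluating it on `a(x,v)` and `a(t,w)` involves only the primitives of `Φ₁ = E⁻¹ β₁`
and of the constants `E⁻¹ β₂ = I` (`dual_identity`). In operator form this is the identity for `A S
- S A*` with `S = E⁻¹ (E⁻¹)*`. Now put `t = ξ - x` and integrate over `0 < x < ξ`: the left side
cancels (`integral_ramp_antisymm`), and what remains says that the convolution of the primitives of
`Φ₁` and `Φ₁*` equals that of the primitives of `I` and `I`. Convolutions of `L²` functions are
continuous, so two differentiations give the claim.

Half line. The relations `K E = E A` and `E v = β₂ v` determine `E`: applying powers of `A` to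
constants yields all even powers of `x`, which together span a dense set (`Intertwines.ae_eq`). As
the operators are causal, the functions `Φ₁` on different intervals agree almost everywhere and can
be glued. -/

theorem exists_exp_weight {r : ℝ} {γ : ℝ → ℝ} (hγ : Integrable γ (vol r)) (hγ0 : ∀ x, 0 ≤ γ x) :
    ∃ κ : ℝ, 0 < κ ∧ ∀ x ∈ Icc 0 r,
      ∫ s in (0 : ℝ)..x, γ s * Real.exp (κ * s) ≤ 1 / 2 * Real.exp (κ * x) := by
  -- The mass of `γ` above level `n` tends to `0`. So `γ ≤ N + τ` with `∫ τ < 1/4`: a large `κ`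
  -- handles the constant part, and `τ` is handled by its small integral. Integrability of `γ` alone
  -- suffices.
  have htail : Tendsto (fun n : ℕ => ∫ s, {s | (n : ℝ) < γ s}.indicator γ s ∂(vol r)) atTop
      (𝓝 (∫ s, (0 : ℝ) ∂(vol r))) := by
    refine tendsto_integral_filter_of_dominated_convergence γ ?_ ?_ hγ ?_
    · refine Eventually.of_forall fun n => ?_
      exact hγ.aestronglyMeasurable.indicator₀
        (nullMeasurableSet_lt aemeasurable_const hγ.aemeasurable)
    · refine Eventually.of_forall fun n => ae_of_all _ fun s => ?_
      by_cases h : s ∈ {s | (n : ℝ) < γ s}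
      · rw [indicator_of_mem h, Real.norm_of_nonneg (hγ0 s)]
      · rw [indicator_of_notMem h]; simpa using hγ0 s
    · refine ae_of_all _ fun s => ?_
      obtain ⟨N, hN⟩ := exists_nat_gt (γ s)
      refine tendsto_const_nhds.congr' ?_
      filter_upwards [eventually_ge_atTop N] with n hn
      rw [indicator_of_notMem]
      simp only [mem_ofPred_eq, not_lt]
      exact hN.le.trans (by exact_mod_cast hn)
  rw [integral_zero] at htail
  obtain ⟨N, hN⟩ := (htail.eventually (gt_mem_nhds (show (0 : ℝ) < 1 / 4 by norm_num))).exists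
  set τ : ℝ → ℝ := {s | (N : ℝ) < γ s}.indicator γ with hτ
  have hτ0 : ∀ s, 0 ≤ τ s := fun s => indicator_nonneg (fun s _ => hγ0 s) s
  have hτi : Integrable τ (vol r) := hγ.mono
    (hγ.aestronglyMeasurable.indicator₀ (nullMeasurableSet_lt aemeasurable_const hγ.aemeasurable))
    (ae_of_all _ fun s => by
      rw [Real.norm_of_nonneg (hτ0 s), Real.norm_of_nonneg (hγ0 s)]
      exact indicator_le_self' (fun s _ => hγ0 s) s)
  have hle : ∀ s, γ s ≤ N + τ s := by
    intro s
    by_cases h : (N : ℝ) < γ s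
    · have : τ s = γ s := indicator_of_mem (s := {s | (N : ℝ) < γ s}) h γ
      rw [this]; exact le_add_of_nonneg_left N.cast_nonneg
    · have := hτ0 s; linarith
  -- With this `κ` the constant part contributes `N / κ ≤ 1/4`, and `τ` contributes the other
  -- quarter. The summand `1` keeps `κ` positive when `N = 0`.
  refine ⟨4 * N + 1, by positivity, fun x hx => ?_⟩
  set κ : ℝ := 4 * N + 1 with hκ
  have hκ0 : 0 < κ := by positivity
  have hsub : Ioc 0 x ⊆ Ioc 0 r := Ioc_subset_Ioc_right hx.2
  have hIoc : ∀ {f : ℝ → ℝ}, Integrable f (vol r) → IntervalIntegrable f volume 0 x := by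
    intro f hf
    rw [intervalIntegrable_iff_integrableOn_Ioc_of_le hx.1]
    exact ((integrableOn_Ioc_iff_integrableOn_Ioo).2 hf).mono_set hsub
  have hc : ContinuousOn (fun s => Real.exp (κ * s)) (uIcc 0 x) := by fun_prop
  have h1 : ∫ s in (0 : ℝ)..x, γ s * Real.exp (κ * s) ≤
      ∫ s in (0 : ℝ)..x, (N * Real.exp (κ * s) + τ s * Real.exp (κ * x)) := by
    refine intervalIntegral.integral_mono_on hx.1 ((hIoc hγ).mul_continuousOn hc) ?_ ?_
    · exact (hc.const_smul (N : ℝ)).intervalIntegrable.add ((hIoc hτi).mul_const _)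
    · intro s hs
      calc γ s * Real.exp (κ * s) ≤ (N + τ s) * Real.exp (κ * s) := by
            gcongr; exact hle s
        _ = N * Real.exp (κ * s) + τ s * Real.exp (κ * s) := by ring
        _ ≤ _ := by
            gcongr
            · exact hτ0 s
            · exact hs.2
  have h2 : ∫ s in (0 : ℝ)..x, Real.exp (κ * s) ≤ Real.exp (κ * x) / κ := by
    have : ∫ s in (0 : ℝ)..x, Real.exp (κ * s) = (Real.exp (κ * x) - 1) / κ := by
      rw [intervalIntegral.integral_comp_mul_left (fun s => Real.exp s) hκ0.ne']
      simp [integral_exp, div_eq_inv_mul]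
    rw [this]; gcongr; linarith
  have h3 : ∫ s in (0 : ℝ)..x, τ s ≤ 1 / 4 := by
    refine le_trans ?_ hN.le
    rw [intervalIntegral.integral_of_le hx.1, ← integral_Ioc_eq_integral_Ioo]
    exact setIntegral_mono_set (((integrableOn_Ioc_iff_integrableOn_Ioo).2 hτi))
      (ae_of_all _ hτ0) (Eventually.of_forall hsub)
  have hcN : IntervalIntegrable (fun s => (N : ℝ) * Real.exp (κ * s)) volume 0 x :=
    hc.intervalIntegrable.const_mul _
  rw [intervalIntegral.integral_add hcN ((hIoc hτi).mul_const _), intervalIntegral.integral_const_mul,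
    intervalIntegral.integral_mul_const] at h1
  have h4 : (N : ℝ) * ∫ s in (0 : ℝ)..x, Real.exp (κ * s) ≤ 1 / 4 * Real.exp (κ * x) := by
    calc (N : ℝ) * ∫ s in (0 : ℝ)..x, Real.exp (κ * s) ≤ N * (Real.exp (κ * x) / κ) := by gcongr
      _ = N / κ * Real.exp (κ * x) := by ring
      _ ≤ 1 / 4 * Real.exp (κ * x) := by
        refine mul_le_mul_of_nonneg_right ?_ (Real.exp_pos _).le
        rw [div_le_iff₀ hκ0]; linarith
  have h5 : (∫ s in (0 : ℝ)..x, τ s) * Real.exp (κ * x) ≤ 1 / 4 * Real.exp (κ * x) := by gcongr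
  linarith

/-- A linear map which halves a weighted sup norm has an affine fixed point. -/
theorem exists_fixedPoint {Ω M : Type*} [NormedAddCommGroup M] [CompleteSpace M]
    (P : (Ω → M) → Prop) (hadd : ∀ f g, P f → P g → P (f + g)) (hneg : ∀ f, P f → P (-f))
    (hlim : ∀ s : ℕ → Ω → M, (∀ n, P (s n)) → ∀ f, (∀ ω, Tendsto (s · ω) atTop (𝓝 (f ω))) → P f)
    (w : Ω → ℝ) (hw : ∀ ω, 0 ≤ w ω) (T : (Ω → M) → Ω → M)
    (hT : ∀ f c, P f → 0 ≤ c → (∀ ω, ‖f ω‖ ≤ c * w ω) → P (T f) ∧ ∀ ω, ‖T f ω‖ ≤ c / 2 * w ω)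
    (hsub : ∀ f g c, P f → P g → (∀ ω, ‖f ω‖ ≤ c * w ω) → (∀ ω, ‖g ω‖ ≤ c * w ω) →
      T (f - g) = T f - T g)
    {v₀ : Ω → M} {c₀ : ℝ} (hv₀ : P v₀) (hc₀ : 0 ≤ c₀) (hb : ∀ ω, ‖v₀ ω‖ ≤ c₀ * w ω) :
    ∃ v, P v ∧ (∀ ω, ‖v ω‖ ≤ 2 * c₀ * w ω) ∧ ∀ ω, v ω = v₀ ω + T v ω := by
  have hPsub : ∀ f g, P f → P g → P (f - g) := fun f g hf hg => by
    rw [sub_eq_add_neg]; exact hadd _ _ hf (hneg _ hg)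
  -- Picard iterates. Additivity of `T` is available only under a weighted bound, so the bound `2
  -- c₀` is carried along; the successive differences then decay like `2⁻ⁿ`, pointwise in `ω`.
  let s : ℕ → Ω → M := fun n => Nat.rec v₀ (fun _ f => v₀ + T f) n
  have hs1 : ∀ n, s (n + 1) = v₀ + T (s n) := fun n => rfl
  have hs : ∀ n, P (s n) ∧ ∀ ω, ‖s n ω‖ ≤ 2 * c₀ * w ω := by
    intro n
    induction n with
    | zero => exact ⟨hv₀, fun ω => (hb ω).trans (by nlinarith [hw ω, mul_nonneg hc₀ (hw ω)])⟩
    | succ n ih =>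
      obtain ⟨h1, h2⟩ := hT (s n) (2 * c₀) ih.1 (by positivity) ih.2
      refine ⟨hadd _ _ hv₀ h1, fun ω => ?_⟩
      calc ‖v₀ ω + T (s n) ω‖ ≤ c₀ * w ω + 2 * c₀ / 2 * w ω :=
            (norm_add_le _ _).trans (add_le_add (hb ω) (h2 ω))
        _ = _ := by ring
  have hd : ∀ n ω, ‖s (n + 1) ω - s n ω‖ ≤ 4 * c₀ * (1 / 2) ^ n * w ω := by
    intro n
    induction n with
    | zero =>
      intro ω
      calc ‖s 1 ω - s 0 ω‖ ≤ 2 * c₀ * w ω + 2 * c₀ * w ω :=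
            (norm_sub_le _ _).trans (add_le_add ((hs 1).2 ω) ((hs 0).2 ω))
        _ = _ := by ring
    | succ n ih =>
      have h1 := (hT (s (n + 1) - s n) _ (hPsub _ _ (hs (n + 1)).1 (hs n).1) (by positivity) ih).2
      rw [hsub _ _ _ (hs (n + 1)).1 (hs n).1 (hs (n + 1)).2 (hs n).2] at h1
      intro ω
      have : s (n + 1 + 1) ω - s (n + 1) ω = (T (s (n + 1)) - T (s n)) ω := by
        rw [hs1 (n + 1), hs1 n]; simp
      rw [this]
      refine (h1 ω).trans (le_of_eq (by ring))
  have hdist : ∀ ω n, dist (s n ω) (s (n + 1) ω) ≤ 8 * c₀ * w ω / 2 / 2 ^ n := by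
    intro ω n
    rw [dist_comm, dist_eq_norm]
    refine (hd n ω).trans (le_of_eq ?_)
    rw [one_div, inv_pow]; ring
  choose v hv using fun ω => cauchySeq_tendsto_of_complete (cauchySeq_of_le_geometric_two (hdist ω))
  have hvs : ∀ n ω, ‖(v - s n) ω‖ ≤ 8 * c₀ * (1 / 2) ^ n * w ω := by
    intro n ω
    have := dist_le_of_le_geometric_two_of_tendsto (hdist ω) (hv ω) n
    rw [dist_comm, dist_eq_norm] at this
    refine this.trans (le_of_eq ?_)
    rw [one_div, inv_pow]; ring
  have hPv : P v := hlim s (fun n => (hs n).1) v hv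
  have hbv : ∀ ω, ‖v ω‖ ≤ 2 * c₀ * w ω := fun ω =>
    le_of_tendsto (hv ω).norm (Eventually.of_forall fun n => (hs n).2 ω)
  refine ⟨v, hPv, hbv, fun ω => ?_⟩
  have h1 : Tendsto (fun n => T (s n) ω) atTop (𝓝 (T v ω)) := by
    rw [tendsto_iff_norm_sub_tendsto_zero]
    refine squeeze_zero (fun _ => norm_nonneg _) (g := fun n => 4 * c₀ * w ω * (1 / 2) ^ n)
      (fun n => ?_) ?_
    · have h2 := (hT _ _ (hPsub _ _ hPv (hs n).1) (by positivity) (hvs n)).2 ω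
      rw [hsub _ _ _ hPv (hs n).1 hbv (hs n).2] at h2
      rw [norm_sub_rev]
      refine h2.trans (le_of_eq (by ring))
    · simpa using (tendsto_pow_atTop_nhds_zero_of_lt_one (r := (1 / 2 : ℝ)) (by norm_num)
        (by norm_num)).const_mul (4 * c₀ * w ω)
  exact tendsto_nhds_unique ((tendsto_add_atTop_iff_nat 1).2 (hv ω)) (h1.const_add (v₀ ω))

/-- Weighted bounds which improve by a factor `1/2` force a function to vanish. -/
theorem eq_zero_of_halving {Ω M : Type*} [NormedAddCommGroup M] {f : Ω → M} {w : Ω → ℝ} {c₀ : ℝ}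
    (hc₀ : 0 ≤ c₀) (hb : ∀ ω, ‖f ω‖ ≤ c₀ * w ω)
    (h : ∀ c, 0 ≤ c → (∀ ω, ‖f ω‖ ≤ c * w ω) → ∀ ω, ‖f ω‖ ≤ c / 2 * w ω) (ω : Ω) : f ω = 0 := by
  have h1 : ∀ n : ℕ, ∀ ω, ‖f ω‖ ≤ c₀ * (1 / 2) ^ n * w ω := by
    intro n
    induction n with
    | zero => simpa using hb
    | succ n ih =>
      intro ω
      refine (h _ (by positivity) ih ω).trans (le_of_eq (by ring))
  have h2 : Tendsto (fun n : ℕ => c₀ * (1 / 2) ^ n * w ω) atTop (𝓝 0) := by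
    simpa using ((tendsto_pow_atTop_nhds_zero_of_lt_one (r := (1 / 2 : ℝ)) (by norm_num)
        (by norm_num)).const_mul c₀).mul_const (w ω)
  exact norm_le_zero_iff.1 (ge_of_tendsto h2 (Eventually.of_forall fun n => h1 n ω))

/-! ### Integrals over `[0,x]` -/

section Interval

variable {E : Type*} [NormedAddCommGroup E] {r : ℝ}

theorem intervalIntegrable_of_vol {f : ℝ → E} (hf : Integrable f (vol r)) {a b : ℝ}
    (ha : a ∈ Icc 0 r) (hb : b ∈ Icc 0 r) : IntervalIntegrable f volume a b := by
  rw [intervalIntegrable_iff]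
  have h : IntegrableOn f (Icc 0 r) := by
    rw [integrableOn_Icc_iff_integrableOn_Ioc (by finiteness)]
    exact (integrableOn_Ioc_iff_integrableOn_Ioo).2 hf
  exact h.mono_set (uIoc_subset_uIcc.trans (uIcc_subset_Icc ha hb))

theorem integrable_vol_of_intervalIntegrable {f : ℝ → E} (hr : 0 ≤ r)
    (hf : IntervalIntegrable f volume 0 r) : Integrable f (vol r) := by
  rw [intervalIntegrable_iff_integrableOn_Ioc_of_le hr] at hf
  exact (integrableOn_Ioc_iff_integrableOn_Ioo).1 hf

theorem vol_mono {x : ℝ} (hx : x ≤ r) : vol x ≤ vol r :=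
  Measure.restrict_mono (Ioo_subset_Ioo_right hx) le_rfl

theorem integrable_vol_mono {f : ℝ → E} (hf : Integrable f (vol r)) {x : ℝ} (hx : x ≤ r) :
    Integrable f (vol x) := hf.mono_measure (GenCanonical.vol_mono hx)

variable [NormedSpace ℝ E]

theorem intervalIntegral_eq_vol (f : ℝ → E) {x : ℝ} (hx : 0 ≤ x) :
    ∫ t in (0 : ℝ)..x, f t = ∫ t, f t ∂(vol x) := by
  rw [intervalIntegral.integral_of_le hx, integral_Ioc_eq_integral_Ioo]

theorem intervalIntegral_congr_vol {f g : ℝ → E} (h : f =ᵐ[vol r] g) {x : ℝ} (hx : x ∈ Icc 0 r) :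
    ∫ t in (0 : ℝ)..x, f t = ∫ t in (0 : ℝ)..x, g t := by
  rw [intervalIntegral_eq_vol f hx.1, intervalIntegral_eq_vol g hx.1]
  exact integral_congr_ae (h.filter_mono (ae_mono (vol_mono hx.2)))

theorem intervalIntegral_congr_Ioo {f g : ℝ → E} {x : ℝ} (hx : 0 ≤ x)
    (h : ∀ t ∈ Ioo 0 x, f t = g t) : ∫ t in (0 : ℝ)..x, f t = ∫ t in (0 : ℝ)..x, g t := by
  rw [intervalIntegral_eq_vol f hx, intervalIntegral_eq_vol g hx]
  exact setIntegral_congr_fun measurableSet_Ioo h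

theorem ae_vol_of_forall {p : ℝ → Prop} (h : ∀ x ∈ Ioo 0 r, p x) : ∀ᵐ x ∂(vol r), p x :=
  (ae_restrict_iff' measurableSet_Ioo).2 (ae_of_all _ h)

theorem norm_intervalIntegral_le_vol {f : ℝ → E} {g : ℝ → ℝ} {x : ℝ} (hx : 0 ≤ x)
    (hg : Integrable g (vol x)) (h : ∀ t ∈ Ioo 0 x, ‖f t‖ ≤ g t) :
    ‖∫ t in (0 : ℝ)..x, f t‖ ≤ ∫ t in (0 : ℝ)..x, g t := by
  rw [intervalIntegral_eq_vol f hx, intervalIntegral_eq_vol g hx]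
  exact norm_integral_le_of_norm_le hg (ae_vol_of_forall h)

/-- The moving end points are absorbed into the indicator of a measurable subset of `X × ℝ`, after
which the measurability of ordinary parameter integrals applies. -/
theorem stronglyMeasurable_intervalIntegral {X : Type*} [MeasurableSpace X] {F : X → ℝ → E}
    (hF : StronglyMeasurable fun p : X × ℝ => F p.1 p.2) {a b : X → ℝ} (ha : Measurable a)
    (hb : Measurable b) : StronglyMeasurable fun x => ∫ t in a x..b x, F x t := by
  have key : ∀ {c d : X → ℝ}, Measurable c → Measurable d →
      StronglyMeasurable fun x => ∫ t in Ioc (c x) (d x), F x t := by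
    intro c d hc hd
    have hS : MeasurableSet {p : X × ℝ | p.2 ∈ Ioc (c p.1) (d p.1)} :=
      (measurableSet_lt (hc.comp measurable_fst) measurable_snd).inter
        (measurableSet_le measurable_snd (hd.comp measurable_fst))
    have h := (hF.indicator hS).integral_prod_right' (ν := (volume : Measure ℝ))
    convert h using 2 with x
    rw [← integral_indicator measurableSet_Ioc]
    rfl
  simp only [intervalIntegral]
  exact (key ha hb).sub (key hb ha)

end Interval

/-! ### Interchanging the order of integration over a triangle -/

section Triangle

variable {x : ℝ} {φ f : ℝ → ℂ} {k : ℝ → ℝ → ℂ} {C : ℝ}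

theorem triangle_integrable (hφ : Integrable φ (vol x)) (hf : Integrable f (vol x))
    (hk : Measurable fun p : ℝ × ℝ => k p.1 p.2)
    (hC : ∀ w t, 0 < t → t < w → w < x → ‖k w t‖ ≤ C) :
    Integrable (fun p : ℝ × ℝ => {p : ℝ × ℝ | p.2 < p.1}.indicator
      (fun p => φ p.1 * k p.1 p.2 * f p.2) p) ((vol x).prod (vol x)) := by
  have hS : MeasurableSet {p : ℝ × ℝ | p.2 < p.1} := measurableSet_lt measurable_snd measurable_fst
  have h1 : Integrable (fun p : ℝ × ℝ => C * (‖φ p.1‖ * ‖f p.2‖)) ((vol x).prod (vol x)) :=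
    (hφ.norm.mul_prod hf.norm).const_mul C
  refine h1.mono' ?_ ?_
  · refine AEStronglyMeasurable.indicator ?_ hS
    exact (hφ.aestronglyMeasurable.comp_fst.mul hk.aestronglyMeasurable).mul
      hf.aestronglyMeasurable.comp_snd
  · rw [Measure.prod_restrict, ae_restrict_iff' (measurableSet_Ioo.prod measurableSet_Ioo)]
    refine ae_of_all _ fun p hp => ?_
    by_cases h : p.2 < p.1
    · rw [indicator_of_mem (show p ∈ {p : ℝ × ℝ | p.2 < p.1} from h), norm_mul, norm_mul]
      have := hC p.1 p.2 hp.2.1 h hp.1.2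
      calc ‖φ p.1‖ * ‖k p.1 p.2‖ * ‖f p.2‖ ≤ ‖φ p.1‖ * C * ‖f p.2‖ := by gcongr
        _ = _ := by ring
    · rw [indicator_of_notMem (show p ∉ {p : ℝ × ℝ | p.2 < p.1} from h), norm_zero]
      -- No sign of `C` is assumed. If `C < 0`, the hypothesis at `t = w / 2` is contradictory as
      -- soon as the triangle is nonempty.
      by_cases hC0 : 0 ≤ C
      · positivity
      · exfalso
        have h1 := hp.1.1; have h2 := hp.1.2
        have := hC p.1 (p.1 / 2) (by linarith) (by linarith) h2
        linarith [norm_nonneg (k p.1 (p.1 / 2))]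

theorem triangle_inner_fst {w : ℝ} (hw : w ∈ Ioo 0 x) :
    φ w * ∫ t in (0 : ℝ)..w, k w t * f t = ∫ t, {p : ℝ × ℝ | p.2 < p.1}.indicator
      (fun p => φ p.1 * k p.1 p.2 * f p.2) (w, t) ∂(vol x) := by
  have h1 : (fun t => {p : ℝ × ℝ | p.2 < p.1}.indicator
      (fun p => φ p.1 * k p.1 p.2 * f p.2) (w, t)) =
      (Iio w).indicator fun t => φ w * (k w t * f t) := by
    funext t
    by_cases h : t < w
    · rw [indicator_of_mem (show (w, t) ∈ {p : ℝ × ℝ | p.2 < p.1} from h),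
        indicator_of_mem (show t ∈ Iio w from h), mul_assoc]
    · rw [indicator_of_notMem (show (w, t) ∉ {p : ℝ × ℝ | p.2 < p.1} from h),
        indicator_of_notMem (show t ∉ Iio w from h)]
  rw [h1, integral_indicator measurableSet_Iio, Measure.restrict_restrict measurableSet_Iio,
    show Iio w ∩ Ioo 0 x = Ioo 0 w by
      ext t; simp only [mem_inter_iff, mem_Iio, mem_Ioo]
      exact ⟨fun h => ⟨h.2.1, h.1⟩, fun h => ⟨h.2, h.1, h.2.trans hw.2⟩⟩,
    integral_const_mul, intervalIntegral_eq_vol _ hw.1.le]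

theorem triangle_inner_snd {t : ℝ} (ht : t ∈ Ioo 0 x) :
    (∫ w in t..x, φ w * k w t) * f t = ∫ w, {p : ℝ × ℝ | p.2 < p.1}.indicator
      (fun p => φ p.1 * k p.1 p.2 * f p.2) (w, t) ∂(vol x) := by
  have h1 : (fun w => {p : ℝ × ℝ | p.2 < p.1}.indicator
      (fun p => φ p.1 * k p.1 p.2 * f p.2) (w, t)) =
      (Ioi t).indicator fun w => φ w * k w t * f t := by
    funext w
    by_cases h : t < w
    · rw [indicator_of_mem (show (w, t) ∈ {p : ℝ × ℝ | p.2 < p.1} from h),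
        indicator_of_mem (show w ∈ Ioi t from h)]
    · rw [indicator_of_notMem (show (w, t) ∉ {p : ℝ × ℝ | p.2 < p.1} from h),
        indicator_of_notMem (show w ∉ Ioi t from h)]
  rw [h1, integral_indicator measurableSet_Ioi, Measure.restrict_restrict measurableSet_Ioi,
    show Ioi t ∩ Ioo 0 x = Ioo t x by
      ext w; simp only [mem_inter_iff, mem_Ioi, mem_Ioo]
      exact ⟨fun h => ⟨h.1, h.2.2⟩, fun h => ⟨h.1, ht.1.trans h.1, h.2⟩⟩,
    integral_mul_const, intervalIntegral.integral_of_le ht.2.le, integral_Ioc_eq_integral_Ioo]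

theorem triangle_swap (hx : 0 ≤ x) (hφ : Integrable φ (vol x)) (hf : Integrable f (vol x))
    (hk : Measurable fun p : ℝ × ℝ => k p.1 p.2)
    (hC : ∀ w t, 0 < t → t < w → w < x → ‖k w t‖ ≤ C) :
    ∫ w in (0 : ℝ)..x, φ w * ∫ t in (0 : ℝ)..w, k w t * f t =
      ∫ t in (0 : ℝ)..x, (∫ w in t..x, φ w * k w t) * f t := by
  have hI := triangle_integrable hφ hf hk hC
  rw [intervalIntegral_eq_vol _ hx, intervalIntegral_eq_vol _ hx,
    setIntegral_congr_fun measurableSet_Ioo fun w hw => triangle_inner_fst hw,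
    setIntegral_congr_fun measurableSet_Ioo fun t ht => triangle_inner_snd ht]
  exact integral_integral_swap hI

theorem triangle_integrable_fst (hφ : Integrable φ (vol x)) (hf : Integrable f (vol x))
    (hk : Measurable fun p : ℝ × ℝ => k p.1 p.2)
    (hC : ∀ w t, 0 < t → t < w → w < x → ‖k w t‖ ≤ C) :
    Integrable (fun w => φ w * ∫ t in (0 : ℝ)..w, k w t * f t) (vol x) :=
  (triangle_integrable hφ hf hk hC).integral_prod_left.congr
    (ae_vol_of_forall fun _ hw => (triangle_inner_fst hw).symm)

theorem triangle_integrable_snd (hφ : Integrable φ (vol x)) (hf : Integrable f (vol x))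
    (hk : Measurable fun p : ℝ × ℝ => k p.1 p.2)
    (hC : ∀ w t, 0 < t → t < w → w < x → ‖k w t‖ ≤ C) :
    Integrable (fun t => (∫ w in t..x, φ w * k w t) * f t) (vol x) :=
  (triangle_integrable hφ hf hk hC).integral_prod_right.congr
    (ae_vol_of_forall fun _ ht => (triangle_inner_snd ht).symm)

end Triangle

/-! ### Primitives of integrable functions -/

/-- `F` is a primitive on `[0,r]` of the integrable function `f`. -/
def HasPrim (r : ℝ) (F f : ℝ → ℂ) : Prop :=
  Integrable f (vol r) ∧ ∀ x ∈ Icc 0 r, F x = F 0 + ∫ t in (0 : ℝ)..x, f t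

namespace HasPrim

variable {r : ℝ} {F f G g : ℝ → ℂ}

theorem congr (h : HasPrim r F f) (hfg : f =ᵐ[vol r] g) : HasPrim r F g :=
  ⟨h.1.congr hfg, fun x hx => by rw [h.2 x hx, intervalIntegral_congr_vol hfg hx]⟩

theorem congr_left (h : HasPrim r F f) (hFG : ∀ x ∈ Icc 0 r, F x = G x) : HasPrim r G f :=
  ⟨h.1, fun x hx => by
    rw [← hFG x hx, ← hFG 0 ⟨le_rfl, hx.1.trans hx.2⟩, h.2 x hx]⟩

theorem const (c : ℂ) : HasPrim r (fun _ => c) fun _ => 0 :=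
  ⟨integrable_zero _ _ _, fun x _ => by simp⟩

theorem add (hF : HasPrim r F f) (hG : HasPrim r G g) :
    HasPrim r (fun x => F x + G x) fun x => f x + g x := by
  refine ⟨hF.1.add hG.1, fun x hx => ?_⟩
  have h0 : (0 : ℝ) ∈ Icc 0 r := ⟨le_rfl, hx.1.trans hx.2⟩
  rw [intervalIntegral.integral_add (intervalIntegrable_of_vol hF.1 h0 hx)
    (intervalIntegrable_of_vol hG.1 h0 hx)]
  simp only [hF.2 x hx, hG.2 x hx]
  ring

theorem const_mul (c : ℂ) (hF : HasPrim r F f) :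
    HasPrim r (fun x => c * F x) fun x => c * f x := by
  refine ⟨hF.1.const_mul c, fun x hx => ?_⟩
  simp only [intervalIntegral.integral_const_mul, hF.2 x hx]
  ring

theorem sum {ι : Type*} (s : Finset ι) {F f : ι → ℝ → ℂ} (h : ∀ i ∈ s, HasPrim r (F i) (f i)) :
    HasPrim r (fun x => ∑ i ∈ s, F i x) fun x => ∑ i ∈ s, f i x := by
  induction s using Finset.cons_induction with
  | empty => simpa using const (r := r) 0
  | cons a s ha ih =>
    simp only [Finset.sum_cons]
    exact (h a (by simp)).add (ih fun i hi => h i (by simp [hi]))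

theorem star (hF : HasPrim r F f) : HasPrim r (fun x => star (F x)) fun x => star (f x) := by
  refine ⟨(LinearIsometryEquiv.integrable_comp_iff Complex.conjLIE).2 hF.1, fun x hx => ?_⟩
  have h := intervalIntegral.intervalIntegral_conj (f := f) (a := 0) (b := x) (μ := volume)
  simp only [Complex.star_def]
  rw [h, hF.2 x hx, map_add]

theorem continuousOn (hF : HasPrim r F f) : ContinuousOn F (Icc 0 r) := by
  rcases le_or_gt 0 r with hr | hr
  · have h := intervalIntegral.continuousOn_primitive_interval' (f := f) (μ := volume) (a := 0)
      (b₁ := 0) (b₂ := r) (intervalIntegrable_of_vol hF.1 ⟨le_rfl, hr⟩ ⟨hr, le_rfl⟩) (by simp)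
    rw [uIcc_of_le hr] at h
    exact (continuousOn_const.add h).congr hF.2
  · rw [Icc_eq_empty (by linarith)]; exact continuousOn_empty _

/-- Integration by parts for absolutely continuous functions, without pointwise derivatives:
inserting the primitives produces two double integrals over `0 < t < w < x`, and these agree by
`triangle_swap` with kernel `1`. -/
theorem mul (hF : HasPrim r F f) (hG : HasPrim r G g) :
    HasPrim r (fun x => F x * G x) fun x => f x * G x + F x * g x := by
  rcases le_or_gt 0 r with hr | hr
  swap
  · refine ⟨?_, fun x hx => absurd (hx.1.trans hx.2) (not_le.2 hr)⟩
    rw [vol, Ioo_eq_empty (by linarith), Measure.restrict_empty]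
    exact integrable_zero_measure
  have h0 : (0 : ℝ) ∈ Icc 0 r := ⟨le_rfl, hr⟩
  have hrr : r ∈ Icc 0 r := ⟨hr, le_rfl⟩
  have hi1 : IntervalIntegrable (fun x => f x * G x) volume 0 r :=
    (intervalIntegrable_of_vol hF.1 h0 hrr).mul_continuousOn (by
      rw [uIcc_of_le hr]; exact hG.continuousOn)
  have hi2 : IntervalIntegrable (fun x => F x * g x) volume 0 r :=
    (intervalIntegrable_of_vol hG.1 h0 hrr).continuousOn_mul (by
      rw [uIcc_of_le hr]; exact hF.continuousOn)
  refine ⟨integrable_vol_of_intervalIntegrable hr (hi1.add hi2), fun x hx => ?_⟩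
  have hsub : uIcc 0 x ⊆ uIcc 0 r := by
    rw [uIcc_of_le hx.1, uIcc_of_le hr]; exact Icc_subset_Icc_right hx.2
  rw [intervalIntegral.integral_add (hi1.mono_set hsub) (hi2.mono_set hsub)]
  have hfx := intervalIntegrable_of_vol hF.1 h0 hx
  have hgx := intervalIntegrable_of_vol hG.1 h0 hx
  have hswap := triangle_swap (x := x) (φ := f) (f := g) (k := fun _ _ => 1) (C := 1) hx.1
    (integrable_vol_mono hF.1 hx.2) (integrable_vol_mono hG.1 hx.2) measurable_const (by simp)
  have hmem : ∀ {w}, w ∈ Ioo 0 x → w ∈ Icc 0 r := fun hw => ⟨hw.1.le, hw.2.le.trans hx.2⟩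
  have e1 : ∫ w in (0 : ℝ)..x, f w * G w =
      G 0 * (∫ w in (0 : ℝ)..x, f w) + ∫ w in (0 : ℝ)..x, f w * ∫ t in (0 : ℝ)..w, 1 * g t := by
    rw [← intervalIntegral.integral_const_mul, ← intervalIntegral.integral_add]
    · refine intervalIntegral_congr_Ioo hx.1 fun w hw => ?_
      rw [hG.2 w (hmem hw)]; simp only [one_mul]; ring
    · exact hfx.const_mul _
    · simp only [one_mul]
      refine hfx.mul_continuousOn ?_
      exact intervalIntegral.continuousOn_primitive_interval' hgx (by simp)
  have e2 : ∫ w in (0 : ℝ)..x, F w * g w =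
      (F 0 + ∫ w in (0 : ℝ)..x, f w) * (∫ w in (0 : ℝ)..x, g w) -
        ∫ t in (0 : ℝ)..x, (∫ w in t..x, f w * 1) * g t := by
    rw [← intervalIntegral.integral_const_mul, ← intervalIntegral.integral_sub]
    · refine intervalIntegral_congr_Ioo hx.1 fun w hw => ?_
      simp only [mul_one]
      rw [hF.2 w (hmem hw), ← intervalIntegral.integral_add_adjacent_intervals
        (intervalIntegrable_of_vol hF.1 h0 (hmem hw)) (intervalIntegrable_of_vol hF.1 (hmem hw) hx)]
      ring
    · exact hgx.const_mul _
    · simp only [mul_one]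
      refine hgx.continuousOn_mul ?_
      have := intervalIntegral.continuousOn_primitive_interval_left (f := f) (μ := volume)
        (a := 0) (b := x) ?_
      · exact this
      · exact (intervalIntegrable_iff').1 hfx
  rw [e1, e2, hswap]
  simp only [hF.2 x hx, hG.2 x hx]
  ring

/-- Lebesgue's differentiation theorem. This is the means by which identities between absolutely
continuous functions are differentiated. -/
theorem ae_eq_zero (hF : HasPrim r F f) (h : ∀ x ∈ Icc 0 r, F x = F 0) : f =ᵐ[vol r] 0 := by
  rcases le_or_gt 0 r with hr | hr
  swap
  · rw [vol, Ioo_eq_empty (by linarith), Measure.restrict_empty]; rfl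
  have h0 : (0 : ℝ) ∈ Icc 0 r := ⟨le_rfl, hr⟩
  have hrr : r ∈ Icc 0 r := ⟨hr, le_rfl⟩
  have hI := (intervalIntegrable_of_vol hF.1 h0 hrr).ae_hasDerivAt_integral
  rw [uIcc_of_le hr] at hI
  refine (ae_restrict_iff' measurableSet_Ioo).2 ?_
  filter_upwards [hI] with x hx hxr
  have h1 := hx (Ioo_subset_Icc_self hxr) 0 h0
  have h2 : HasDerivAt (fun b => ∫ t in (0 : ℝ)..b, f t) 0 x := by
    refine (hasDerivAt_const x (0 : ℂ)).congr_of_eventuallyEq ?_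
    filter_upwards [Icc_mem_nhds hxr.1 hxr.2] with y hy
    have := hF.2 y hy
    rw [h y hy] at this
    simpa using this
  exact h1.unique h2

end HasPrim

/-! ### The entrywise `ℓ¹` norm of a matrix -/

section EntrySum

variable {ι κ ν : Type*} [Fintype ι] [Fintype κ] [Fintype ν]

/-- The sum of the absolute values of the entries of a matrix. -/
noncomputable def entrySum (A : Matrix ι κ ℂ) : ℝ := ∑ i, ∑ j, ‖A i j‖

theorem entrySum_nonneg (A : Matrix ι κ ℂ) : 0 ≤ entrySum A :=
  Finset.sum_nonneg fun _ _ => Finset.sum_nonneg fun _ _ => norm_nonneg _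

theorem norm_entry_le_entrySum (A : Matrix ι κ ℂ) (i : ι) (j : κ) : ‖A i j‖ ≤ entrySum A :=
  (Finset.single_le_sum (f := fun j => ‖A i j‖) (fun _ _ => norm_nonneg _)
    (Finset.mem_univ j)).trans
  (Finset.single_le_sum (f := fun i => ∑ j, ‖A i j‖)
    (fun _ _ => Finset.sum_nonneg fun _ _ => norm_nonneg _) (Finset.mem_univ i))

theorem entrySum_le {A : Matrix ι κ ℂ} {C : ℝ} (h : ∀ i j, ‖A i j‖ ≤ C) :
    entrySum A ≤ Fintype.card ι * (Fintype.card κ * C) := by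
  calc entrySum A ≤ ∑ _i : ι, ∑ _j : κ, C :=
        Finset.sum_le_sum fun i _ => Finset.sum_le_sum fun j _ => h i j
    _ = _ := by simp

theorem entrySum_add_le (A B : Matrix ι κ ℂ) : entrySum (A + B) ≤ entrySum A + entrySum B := by
  simp only [entrySum, ← Finset.sum_add_distrib]
  exact Finset.sum_le_sum fun i _ => Finset.sum_le_sum fun j _ => norm_add_le _ _

theorem entrySum_mul_le (A : Matrix ι κ ℂ) (B : Matrix κ ν ℂ) :
    entrySum (A * B) ≤ entrySum A * entrySum B := by
  calc entrySum (A * B) ≤ ∑ i, ∑ j, ∑ l, ‖A i l‖ * ‖B l j‖ := by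
        refine Finset.sum_le_sum fun i _ => Finset.sum_le_sum fun j _ => ?_
        rw [Matrix.mul_apply]
        exact (norm_sum_le _ _).trans (le_of_eq (by simp))
    _ = ∑ i, ∑ l, ‖A i l‖ * ∑ j, ‖B l j‖ := by
        refine Finset.sum_congr rfl fun i _ => ?_
        rw [Finset.sum_comm]
        simp only [Finset.mul_sum]
    _ ≤ ∑ i, ∑ l, ‖A i l‖ * entrySum B := by
        gcongr with i _ l _
        exact Finset.single_le_sum (f := fun l => ∑ j, ‖B l j‖)
          (fun _ _ => Finset.sum_nonneg fun _ _ => norm_nonneg _) (Finset.mem_univ l)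
    _ = _ := by simp only [entrySum, Finset.sum_mul]

theorem entrySum_conjTranspose (A : Matrix ι κ ℂ) : entrySum Aᴴ = entrySum A := by
  simp only [entrySum, Matrix.conjTranspose_apply, norm_star]
  exact Finset.sum_comm

theorem norm_mulVec_le (A : Matrix ι κ ℂ) (v : κ → ℂ) : ‖A *ᵥ v‖ ≤ entrySum A * ‖v‖ := by
  refine (pi_norm_le_iff_of_nonneg (mul_nonneg (entrySum_nonneg A) (norm_nonneg _))).2 fun i => ?_
  calc ‖(A *ᵥ v) i‖ ≤ ∑ j, ‖A i j‖ * ‖v j‖ := by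
        simp only [Matrix.mulVec, dotProduct]
        exact (norm_sum_le _ _).trans (le_of_eq (by simp))
    _ ≤ ∑ j, ‖A i j‖ * ‖v‖ := by gcongr with j _; exact norm_le_pi_norm v j
    _ = (∑ j, ‖A i j‖) * ‖v‖ := by rw [Finset.sum_mul]
    _ ≤ entrySum A * ‖v‖ := by
        gcongr
        exact Finset.single_le_sum (f := fun i => ∑ j, ‖A i j‖)
          (fun _ _ => Finset.sum_nonneg fun _ _ => norm_nonneg _) (Finset.mem_univ i)

theorem memLp_entrySum {X : Type*} [MeasurableSpace X] {μ : Measure X} {q : ENNReal}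
    {A : X → Matrix ι κ ℂ} (h : ∀ i j, MemLp (fun x => A x i j) q μ) :
    MemLp (fun x => entrySum (A x)) q μ :=
  memLp_finsetSum _ fun i _ => memLp_finsetSum _ fun j _ => (h i j).norm

end EntrySum

/-! ### Volterra equations in `L²` -/

section Volterra

variable {p : ℕ} {r : ℝ}

theorem memL2_congr {f g : ℝ → Fin p → ℂ} (h : f =ᵐ[vol r] g) (hf : MemL2 r f) : MemL2 r g :=
  (memLp_congr_ae h).1 hf

theorem memL2_iff {f : ℝ → Fin p → ℂ} : MemL2 r f ↔ ∀ i, MemLp (fun x => f x i) 2 (vol r) :=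
  memLp_pi_iff

theorem MemL2.integrable {f : ℝ → Fin p → ℂ} (hf : MemL2 r f) : Integrable f (vol r) :=
  MemLp.integrable one_le_two hf

theorem memLp_of_norm_le {E F : Type*} [NormedAddCommGroup E] [NormedAddCommGroup F]
    {f : ℝ → E} {g : ℝ → F} {q : ENNReal} {C : ℝ} (hg : MemLp g q (vol r))
    (hf : AEStronglyMeasurable f (vol r)) (h : ∀ x ∈ Ioo 0 r, ‖f x‖ ≤ C * ‖g x‖) :
    MemLp f q (vol r) :=
  hg.of_le_mul hf (ae_vol_of_forall h)

theorem memLp_of_bounded {E : Type*} [NormedAddCommGroup E] {f : ℝ → E} {C : ℝ}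
    (hf : AEStronglyMeasurable f (vol r)) (h : ∀ x ∈ Ioo 0 r, ‖f x‖ ≤ C) (q : ENNReal) :
    MemLp f q (vol r) :=
  MemLp.of_bound hf C (ae_vol_of_forall h)

theorem measurable_mulVec {X : Type*} [MeasurableSpace X] {m n : ℕ} {A : X → Matrix (Fin m) (Fin n) ℂ}
    {v : X → Fin n → ℂ} (hA : ∀ i j, Measurable fun x => A x i j) (hv : Measurable v) :
    Measurable fun x => A x *ᵥ v x := by
  refine measurable_pi_iff.2 fun i => ?_
  simp only [Matrix.mulVec, dotProduct]
  exact Finset.measurable_fun_sum _ fun j _ => (hA i j).mul (measurable_pi_iff.1 hv j)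

theorem aestronglyMeasurable_mulVec {X : Type*} [MeasurableSpace X] {μ : Measure X} {m n : ℕ}
    {A : X → Matrix (Fin m) (Fin n) ℂ}
    {v : X → Fin n → ℂ} (hA : ∀ i j, AEStronglyMeasurable (fun x => A x i j) μ)
    (hv : AEStronglyMeasurable v μ) : AEStronglyMeasurable (fun x => A x *ᵥ v x) μ := by
  refine AEMeasurable.aestronglyMeasurable (aemeasurable_pi_iff.2 fun i => ?_)
  simp only [Matrix.mulVec, dotProduct]
  exact Finset.aemeasurable_fun_sum _ fun j _ =>
    (hA i j).aemeasurable.mul (aemeasurable_pi_iff.1 hv.aemeasurable j)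

/-- A measurable kernel on the triangle `0 < t < x < r` dominated by a product `a(x) b(t)` of square
integrable functions. -/
structure IsVolterraKernel (r : ℝ) (k : ℝ → ℝ → Matrix (Fin p) (Fin p) ℂ) (a b : ℝ → ℝ) :
    Prop where
  meas : ∀ i j, Measurable fun z : ℝ × ℝ => k z.1 z.2 i j
  left_nonneg : ∀ x, 0 ≤ a x
  right_nonneg : ∀ x, 0 ≤ b x
  left_memLp : MemLp a 2 (vol r)
  right_memLp : MemLp b 2 (vol r)
  bound : ∀ x ∈ Ioo 0 r, ∀ t ∈ Ioo 0 x, entrySum (k x t) ≤ a x * b t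

theorem isVolterraKernel_of_bounded {k : ℝ → ℝ → Matrix (Fin p) (Fin p) ℂ} {C : ℝ}
    (hk : ∀ i j, Measurable fun z : ℝ × ℝ => k z.1 z.2 i j)
    (hC : ∀ x ∈ Ioo 0 r, ∀ t ∈ Ioo 0 x, ∀ i j, ‖k x t i j‖ ≤ C) :
    ∃ C', IsVolterraKernel r k (fun _ => C') fun _ => 1 := by
  refine ⟨|Fintype.card (Fin p) * (Fintype.card (Fin p) * C)|, hk, fun _ => abs_nonneg _,
    fun _ => zero_le_one, memLp_const _, memLp_const _, fun x hx t ht => ?_⟩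
  rw [mul_one]
  exact (entrySum_le (hC x hx t ht)).trans (le_abs_self _)

namespace IsVolterraKernel

variable {k : ℝ → ℝ → Matrix (Fin p) (Fin p) ℂ} {a b : ℝ → ℝ}

theorem norm_integrand_le (hk : IsVolterraKernel r k a b) {x : ℝ} (hx : x ∈ Ioo 0 r)
    (f : ℝ → Fin p → ℂ) {t : ℝ} (ht : t ∈ Ioo 0 x) :
    ‖k x t *ᵥ f t‖ ≤ a x * (b t * ‖f t‖) := by
  calc ‖k x t *ᵥ f t‖ ≤ entrySum (k x t) * ‖f t‖ := norm_mulVec_le _ _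
    _ ≤ a x * b t * ‖f t‖ := by gcongr; exact hk.bound x hx t ht
    _ = _ := by ring

theorem integrable_mul_norm (hk : IsVolterraKernel r k a b) {f : ℝ → Fin p → ℂ}
    (hf : MemL2 r f) : Integrable (fun t => b t * ‖f t‖) (vol r) :=
  hk.right_memLp.integrable_mul (MemLp.norm hf)

theorem integrable_integrand (hk : IsVolterraKernel r k a b) {x : ℝ} (hx : x ∈ Ioo 0 r)
    {f : ℝ → Fin p → ℂ} (hf : MemL2 r f) : Integrable (fun t => k x t *ᵥ f t) (vol x) := by
  have h1 : Integrable (fun t => a x * (b t * ‖f t‖)) (vol x) :=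
    (integrable_vol_mono (hk.integrable_mul_norm hf) hx.2.le).const_mul _
  refine h1.mono' ?_ (ae_vol_of_forall fun t ht => hk.norm_integrand_le hx f ht)
  refine aestronglyMeasurable_mulVec (fun i j => ?_)
    (hf.aestronglyMeasurable.mono_measure (vol_mono hx.2.le))
  exact ((hk.meas i j).comp (measurable_const.prodMk measurable_id)).aestronglyMeasurable

theorem intervalIntegrable_integrand (hk : IsVolterraKernel r k a b) {x : ℝ} (hx : x ∈ Ioo 0 r)
    {f : ℝ → Fin p → ℂ} (hf : MemL2 r f) :
    IntervalIntegrable (fun t => k x t *ᵥ f t) volume 0 x :=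
  intervalIntegrable_of_vol (hk.integrable_integrand hx hf) ⟨le_rfl, hx.1.le⟩ ⟨hx.1.le, le_rfl⟩

theorem norm_integral_le (hk : IsVolterraKernel r k a b) {x : ℝ} (hx : x ∈ Ioo 0 r)
    {f : ℝ → Fin p → ℂ} (hf : MemL2 r f) :
    ‖∫ t in (0 : ℝ)..x, k x t *ᵥ f t‖ ≤ (∫ t, b t * ‖f t‖ ∂(vol r)) * a x := by
  have hi := hk.integrable_mul_norm hf
  calc ‖∫ t in (0 : ℝ)..x, k x t *ᵥ f t‖ ≤ ∫ t in (0 : ℝ)..x, a x * (b t * ‖f t‖) :=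
        norm_intervalIntegral_le_vol hx.1.le ((integrable_vol_mono hi hx.2.le).const_mul _)
          fun t ht => hk.norm_integrand_le hx f ht
    _ = a x * ∫ t, b t * ‖f t‖ ∂(vol x) := by
        rw [intervalIntegral.integral_const_mul, intervalIntegral_eq_vol _ hx.1.le]
    _ ≤ a x * ∫ t, b t * ‖f t‖ ∂(vol r) := by
        gcongr ?_ * ?_
        · exact hk.left_nonneg x
        · exact integral_mono_measure (vol_mono hx.2.le)
            (ae_of_all _ fun t => mul_nonneg (hk.right_nonneg t) (norm_nonneg _)) hi
    _ = _ := mul_comm _ _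

theorem aestronglyMeasurable_integral (hk : IsVolterraKernel r k a b)
    {f : ℝ → Fin p → ℂ} (hf : MemL2 r f) :
    AEStronglyMeasurable (fun x => ∫ t in (0 : ℝ)..x, k x t *ᵥ f t) (vol r) := by
  obtain ⟨f', hf', hff'⟩ := hf.aestronglyMeasurable
  have h1 : StronglyMeasurable fun x => ∫ t in (0 : ℝ)..x, k x t *ᵥ f' t :=
    stronglyMeasurable_intervalIntegral
      (measurable_mulVec hk.meas (hf'.measurable.comp measurable_snd)).stronglyMeasurable
      measurable_const measurable_id
  refine ⟨_, h1, ae_vol_of_forall fun x hx => ?_⟩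
  refine intervalIntegral_congr_vol (r := r) ?_ ⟨hx.1.le, hx.2.le⟩
  filter_upwards [hff'] with t ht
  rw [ht]

theorem memL2_integral (hk : IsVolterraKernel r k a b) {f : ℝ → Fin p → ℂ} (hf : MemL2 r f) :
    MemL2 r fun x => ∫ t in (0 : ℝ)..x, k x t *ᵥ f t := by
  refine memLp_of_norm_le (C := ∫ t, b t * ‖f t‖ ∂(vol r)) hk.left_memLp
    (hk.aestronglyMeasurable_integral hf) fun x hx => ?_
  rw [Real.norm_of_nonneg (hk.left_nonneg x)]
  exact hk.norm_integral_le hx hf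

/-- The left factor `a` of the kernel is only square integrable, so it has to be part of the weight.
What must be halved is then `∫ b a e^{κt}`, and `b a` is integrable as a product of `L²` functions.
-/
theorem exists_halving (hk : IsVolterraKernel r k a b) : ∃ κ : ℝ, 0 < κ ∧
    ∀ (f : ℝ → Fin p → ℂ) (c : ℝ), 0 ≤ c →
      (∀ x, ‖f x‖ ≤ c * (a x * Real.exp (κ * x))) → ∀ x ∈ Ioo 0 r,
        ‖∫ t in (0 : ℝ)..x, k x t *ᵥ f t‖ ≤ c / 2 * (a x * Real.exp (κ * x)) := by
  have hγ : Integrable (fun x => b x * a x) (vol r) := hk.right_memLp.integrable_mul hk.left_memLp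
  obtain ⟨κ, hκ, h⟩ := exists_exp_weight hγ
    fun x => mul_nonneg (hk.right_nonneg x) (hk.left_nonneg x)
  refine ⟨κ, hκ, fun f c hc hf x hx => ?_⟩
  have hi : Integrable (fun t => b t * a t * Real.exp (κ * t)) (vol x) := by
    have := (intervalIntegrable_of_vol hγ (a := 0) (b := x) ⟨le_rfl, hx.1.le.trans hx.2.le⟩
      ⟨hx.1.le, hx.2.le⟩).mul_continuousOn (g := fun t => Real.exp (κ * t)) (by fun_prop)
    exact integrable_vol_of_intervalIntegrable hx.1.le this
  calc ‖∫ t in (0 : ℝ)..x, k x t *ᵥ f t‖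
      ≤ ∫ t in (0 : ℝ)..x, a x * c * (b t * a t * Real.exp (κ * t)) := by
        refine norm_intervalIntegral_le_vol hx.1.le (hi.const_mul _) fun t ht => ?_
        refine (hk.norm_integrand_le hx f ht).trans ?_
        calc a x * (b t * ‖f t‖) ≤ a x * (b t * (c * (a t * Real.exp (κ * t)))) := by
              gcongr
              · exact hk.left_nonneg x
              · exact hk.right_nonneg t
              · exact hf t
          _ = _ := by ring
    _ = a x * c * ∫ t in (0 : ℝ)..x, b t * a t * Real.exp (κ * t) :=
        intervalIntegral.integral_const_mul _ _
    _ ≤ a x * c * (1 / 2 * Real.exp (κ * x)) := by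
        gcongr
        · exact mul_nonneg (hk.left_nonneg x) hc
        · exact h x ⟨hx.1.le, hx.2.le⟩
    _ = _ := by ring

theorem memL2_of_weight (hk : IsVolterraKernel r k a b) {κ c : ℝ} (hc : 0 ≤ c) (hκ : 0 < κ)
    {f : ℝ → Fin p → ℂ} (hf : AEStronglyMeasurable f (vol r))
    (h : ∀ x, ‖f x‖ ≤ c * (a x * Real.exp (κ * x))) : MemL2 r f := by
  refine memLp_of_norm_le (C := c * Real.exp (κ * r)) hk.left_memLp hf fun x hx => (h x).trans ?_
  rw [Real.norm_of_nonneg (hk.left_nonneg x)]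
  calc c * (a x * Real.exp (κ * x)) ≤ c * (a x * Real.exp (κ * r)) := by
        gcongr
        · exact hk.left_nonneg x
        · exact hx.2.le
    _ = _ := by ring

/-- Volterra equations of the second kind are solvable in `L²`. -/
theorem exists_solution (hk : IsVolterraKernel r k a b) {g : ℝ → Fin p → ℂ} (hg : MemL2 r g) :
    ∃ f, MemL2 r f ∧ ∀ x ∈ Ioo 0 r, f x + ∫ t in (0 : ℝ)..x, k x t *ᵥ f t = g x := by
  obtain ⟨κ, hκ, hhalf⟩ := hk.exists_halving
  obtain ⟨g', hg', hgg'⟩ := hg.aestronglyMeasurable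
  have hg2 : MemL2 r g' := memL2_congr hgg' hg
  -- Let `S` be the Volterra operator. The unknown is `h = g - f`, which solves `h = S g - S h`.
  -- Unlike `g`, the function `S g` is bounded pointwise by a multiple of `a`, hence by the weight.
  let S : (ℝ → Fin p → ℂ) → ℝ → Fin p → ℂ := fun f =>
    (Ioo 0 r).indicator fun x => ∫ t in (0 : ℝ)..x, k x t *ᵥ f t
  have hSm : ∀ f, Measurable f → Measurable (S f) := fun f hf =>
    (stronglyMeasurable_intervalIntegral
      (measurable_mulVec hk.meas (hf.comp measurable_snd)).stronglyMeasurable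
      measurable_const measurable_id).measurable.indicator measurableSet_Ioo
  have hS : ∀ f x, x ∈ Ioo 0 r → S f x = ∫ t in (0 : ℝ)..x, k x t *ᵥ f t :=
    fun f x hx => indicator_of_mem hx _
  have hS0 : ∀ f x, x ∉ Ioo 0 r → S f x = 0 := fun f x hx => indicator_of_notMem hx _
  have hw : ∀ x, 0 ≤ a x * Real.exp (κ * x) :=
    fun x => mul_nonneg (hk.left_nonneg x) (Real.exp_pos _).le
  set c₀ : ℝ := ∫ t, b t * ‖g' t‖ ∂(vol r)
  have hc₀ : 0 ≤ c₀ := integral_nonneg fun t => mul_nonneg (hk.right_nonneg t) (norm_nonneg _)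
  obtain ⟨h, hhm, hhb, hh⟩ := exists_fixedPoint (Ω := ℝ) (M := Fin p → ℂ) Measurable
    (fun f g hf hg => hf.add hg) (fun f hf => hf.neg)
    (fun s hs f hf => measurable_of_tendsto_metrizable hs (tendsto_pi_nhds.2 hf))
    (fun x => a x * Real.exp (κ * x)) hw (fun f => -S f)
    (fun f c hf hc hb => ⟨(hSm f hf).neg, fun x => by
      rw [Pi.neg_apply, norm_neg]
      by_cases hx : x ∈ Ioo 0 r
      · rw [hS f x hx]; exact hhalf f c hc hb x hx
      · rw [hS0 f x hx, norm_zero]; exact mul_nonneg (by positivity) (hw x)⟩)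
    (fun f g c hf hg hbf hbg => by
      funext x
      have hc : 0 ≤ |c| := abs_nonneg c
      have hle : ∀ {f : ℝ → Fin p → ℂ}, (∀ x, ‖f x‖ ≤ c * (a x * Real.exp (κ * x))) →
          ∀ x, ‖f x‖ ≤ |c| * (a x * Real.exp (κ * x)) := fun h x =>
        (h x).trans (mul_le_mul_of_nonneg_right (le_abs_self c) (hw x))
      simp only [Pi.sub_apply, Pi.neg_apply]
      by_cases hx : x ∈ Ioo 0 r
      · rw [hS _ x hx, hS _ x hx, hS _ x hx]
        simp only [Pi.sub_apply, Matrix.mulVec_sub]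
        rw [intervalIntegral.integral_sub
          (hk.intervalIntegrable_integrand hx (hk.memL2_of_weight hc hκ
            hf.aestronglyMeasurable (hle hbf)))
          (hk.intervalIntegrable_integrand hx (hk.memL2_of_weight hc hκ
            hg.aestronglyMeasurable (hle hbg)))]
        abel
      · simp [hS0 _ x hx])
    (v₀ := S g') (c₀ := c₀) (hSm g' hg'.measurable) hc₀ (fun x => by
      by_cases hx : x ∈ Ioo 0 r
      · rw [hS g' x hx]
        refine (hk.norm_integral_le hx hg2).trans ?_
        gcongr
        refine le_mul_of_one_le_right (hk.left_nonneg x) (Real.one_le_exp ?_)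
        exact mul_nonneg hκ.le hx.1.le
      · rw [hS0 g' x hx, norm_zero]; exact mul_nonneg hc₀ (hw x))
  have hh2 : MemL2 r h := hk.memL2_of_weight (by positivity) hκ hhm.aestronglyMeasurable hhb
  refine ⟨fun x => g x - h x, hg.sub hh2, fun x hx => ?_⟩
  simp only [Matrix.mulVec_sub]
  rw [intervalIntegral.integral_sub (hk.intervalIntegrable_integrand hx hg)
    (hk.intervalIntegrable_integrand hx hh2)]
  have e1 := hh x
  simp only [Pi.neg_apply] at e1
  rw [hS _ x hx, hS _ x hx] at e1
  have e2 : ∫ t in (0 : ℝ)..x, k x t *ᵥ g t = ∫ t in (0 : ℝ)..x, k x t *ᵥ g' t := by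
    refine intervalIntegral_congr_vol (r := r) ?_ ⟨hx.1.le, hx.2.le⟩
    filter_upwards [hgg'] with t ht
    rw [ht]
  rw [e2, e1]
  abel

theorem eq_zero_of_solution (hk : IsVolterraKernel r k a b) {f : ℝ → Fin p → ℂ} (hf : MemL2 r f)
    (h : ∀ᵐ x ∂(vol r), f x + ∫ t in (0 : ℝ)..x, k x t *ᵥ f t = 0) : f =ᵐ[vol r] 0 := by
  obtain ⟨κ, hκ, hhalf⟩ := hk.exists_halving
  -- The equation itself supplies a representative of `f` with a pointwise bound by a multiple of
  -- `a`. The halving argument needs a bound at every point.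
  let g : ℝ → Fin p → ℂ := (Ioo 0 r).indicator fun x => -∫ t in (0 : ℝ)..x, k x t *ᵥ f t
  have hg : ∀ x ∈ Ioo 0 r, g x = -∫ t in (0 : ℝ)..x, k x t *ᵥ f t :=
    fun x hx => indicator_of_mem hx _
  have hg0 : ∀ x, x ∉ Ioo 0 r → g x = 0 := fun x hx => indicator_of_notMem hx _
  have hfg : f =ᵐ[vol r] g := by
    filter_upwards [h, ae_restrict_mem measurableSet_Ioo] with x hx hxr
    rw [hg x hxr]; exact eq_neg_of_add_eq_zero_left hx
  have hgg : ∀ x ∈ Ioo 0 r, g x = -∫ t in (0 : ℝ)..x, k x t *ᵥ g t := by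
    intro x hx
    rw [hg x hx]
    congr 1
    refine intervalIntegral_congr_vol (r := r) ?_ ⟨hx.1.le, hx.2.le⟩
    filter_upwards [hfg] with t ht
    rw [ht]
  have hw : ∀ x, 0 ≤ a x * Real.exp (κ * x) :=
    fun x => mul_nonneg (hk.left_nonneg x) (Real.exp_pos _).le
  have hc₀ : 0 ≤ ∫ t, b t * ‖f t‖ ∂(vol r) :=
    integral_nonneg fun t => mul_nonneg (hk.right_nonneg t) (norm_nonneg _)
  have hz : ∀ x, g x = 0 := by
    refine eq_zero_of_halving (w := fun x => a x * Real.exp (κ * x)) hc₀ (fun x => ?_)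
      (fun c hc hb x => ?_)
    · by_cases hx : x ∈ Ioo 0 r
      · rw [hg x hx, norm_neg]
        refine (hk.norm_integral_le hx hf).trans ?_
        gcongr
        exact le_mul_of_one_le_right (hk.left_nonneg x)
          (Real.one_le_exp (mul_nonneg hκ.le hx.1.le))
      · rw [hg0 x hx, norm_zero]; exact mul_nonneg hc₀ (hw x)
    · by_cases hx : x ∈ Ioo 0 r
      · rw [hgg x hx, norm_neg]; exact hhalf g c hc hb x hx
      · rw [hg0 x hx, norm_zero]; exact mul_nonneg (by positivity) (hw x)
  filter_upwards [hfg] with x hx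
  rw [hx, hz x]; rfl

end IsVolterraKernel

/-! ### Invertible operators on `L²` -/

theorem InvertibleOnL2.congr {T T' : Op p} (hT : InvertibleOnL2 r T)
    (h : ∀ f, MemL2 r f → T f =ᵐ[vol r] T' f) : InvertibleOnL2 r T' where
  mapsTo f hf := memL2_congr (h f hf) (hT.mapsTo f hf)
  inj f g hf hg hfg := hT.inj f g hf hg ((h f hf).trans (hfg.trans (h g hg).symm))
  surj g hg := by
    obtain ⟨f, hf, hfg⟩ := hT.surj g hg
    exact ⟨f, hf, (h f hf).symm.trans hfg⟩

theorem InvertibleOnL2.comp {T T' : Op p} (hT : InvertibleOnL2 r T) (hT' : InvertibleOnL2 r T')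
    (hcongr : ∀ f g, f =ᵐ[vol r] g → T f =ᵐ[vol r] T g) : InvertibleOnL2 r fun f => T (T' f) where
  mapsTo f hf := hT.mapsTo _ (hT'.mapsTo f hf)
  inj f g hf hg hfg := hT'.inj f g hf hg
    (hT.inj _ _ (hT'.mapsTo f hf) (hT'.mapsTo g hg) hfg)
  surj g hg := by
    obtain ⟨h, hh, hhg⟩ := hT.surj g hg
    obtain ⟨f, hf, hfh⟩ := hT'.surj h hh
    exact ⟨f, hf, (hcongr _ _ hfh).trans hhg⟩

theorem opV_congr_ae (u : ℝ → Matrix (Fin p) (Fin p) ℂ) (k : ℝ → ℝ → Matrix (Fin p) (Fin p) ℂ)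
    {f g : ℝ → Fin p → ℂ} (h : f =ᵐ[vol r] g) : opV u k f =ᵐ[vol r] opV u k g := by
  filter_upwards [h, ae_restrict_mem measurableSet_Ioo] with x hx hxr
  simp only [opV]
  rw [hx, intervalIntegral_congr_vol (r := r) (g := fun t => k x t *ᵥ g t) ?_
    ⟨hxr.1.le, hxr.2.le⟩]
  filter_upwards [h] with t ht
  rw [ht]

theorem memL2_mulVec {u : ℝ → Matrix (Fin p) (Fin p) ℂ} {C : ℝ}
    (hu : ∀ i j, AEStronglyMeasurable (fun x => u x i j) (vol r))
    (hC : ∀ x ∈ Ioo 0 r, entrySum (u x) ≤ C) {f : ℝ → Fin p → ℂ} (hf : MemL2 r f) :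
    MemL2 r fun x => u x *ᵥ f x :=
  memLp_of_norm_le hf (aestronglyMeasurable_mulVec hu hf.aestronglyMeasurable) fun x hx =>
    (norm_mulVec_le _ _).trans (by gcongr; exact hC x hx)

/-- A Volterra perturbation of the identity is bijective, and the factor `u` is undone by its
pointwise inverse `u'`. -/
theorem invertibleOnL2_opV {u u' : ℝ → Matrix (Fin p) (Fin p) ℂ} {C : ℝ}
    {k : ℝ → ℝ → Matrix (Fin p) (Fin p) ℂ} {a b : ℝ → ℝ} (hk : IsVolterraKernel r k a b)
    (hu : ∀ i j, AEStronglyMeasurable (fun x => u x i j) (vol r))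
    (hu' : ∀ i j, AEStronglyMeasurable (fun x => u' x i j) (vol r))
    (hC : ∀ x ∈ Ioo 0 r, entrySum (u x) ≤ C) (hC' : ∀ x ∈ Ioo 0 r, entrySum (u' x) ≤ C)
    (huu : ∀ x ∈ Ioo 0 r, u' x * u x = 1) : InvertibleOnL2 r (opV u k) where
  mapsTo f hf := memL2_mulVec hu hC (hf.add (hk.memL2_integral hf))
  inj f g hf hg hfg := by
    have h1 : (f - g) =ᵐ[vol r] 0 := by
      refine hk.eq_zero_of_solution (hf.sub hg) ?_
      filter_upwards [hfg, ae_restrict_mem measurableSet_Ioo] with x hx hxr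
      have h2 := congrArg (fun v => u' x *ᵥ v) hx
      simp only [opV, Matrix.mulVec_mulVec, huu x hxr, Matrix.one_mulVec] at h2
      simp only [Pi.sub_apply, Matrix.mulVec_sub]
      rw [intervalIntegral.integral_sub (hk.intervalIntegrable_integrand hxr hf)
        (hk.intervalIntegrable_integrand hxr hg), sub_add_sub_comm, h2, sub_self]
    filter_upwards [h1] with x hx
    exact sub_eq_zero.1 hx
  surj g hg := by
    obtain ⟨f, hf, hfg⟩ := hk.exists_solution (memL2_mulVec hu' hC' hg)
    refine ⟨f, hf, ae_vol_of_forall fun x hx => ?_⟩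
    simp only [opV]
    rw [hfg x hx, Matrix.mulVec_mulVec, mul_eq_one_comm.1 (huu x hx), Matrix.one_mulVec]

end Volterra

/-! ### The fundamental solution of the wave equation on the half line -/

/-- The forward fundamental solution, with source `(s, τ)`, of the wave equation on the half line
with Neumann boundary condition. -/
noncomputable def waveKer (s τ x t : ℝ) : ℝ :=
  1 / 2 * ((if s + |t - τ| < x then 1 else 0) + if s + t + τ < x then 1 else 0)

theorem waveKer_nonneg (s τ x t : ℝ) : 0 ≤ waveKer s τ x t := by
  unfold waveKer; split_ifs <;> norm_num

theorem waveKer_le_one (s τ x t : ℝ) : waveKer s τ x t ≤ 1 := by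
  unfold waveKer; split_ifs <;> norm_num

theorem norm_waveKer_le (s τ x t : ℝ) : ‖(waveKer s τ x t : ℂ)‖ ≤ 1 := by
  rw [Complex.norm_real, Real.norm_of_nonneg (waveKer_nonneg s τ x t)]
  exact waveKer_le_one s τ x t

theorem waveKer_eq_zero {s τ x t : ℝ} (hτ : 0 ≤ τ) (ht : 0 ≤ t) (h : x ≤ s) :
    waveKer s τ x t = 0 := by
  unfold waveKer
  rw [if_neg (by have := abs_nonneg (t - τ); linarith), if_neg (by linarith)]
  norm_num

theorem measurable_waveKer :
    Measurable fun z : (ℝ × ℝ) × ℝ × ℝ => waveKer z.1.1 z.1.2 z.2.1 z.2.2 := by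
  unfold waveKer
  refine Measurable.const_mul (Measurable.add ?_ ?_) _
  · refine Measurable.ite (measurableSet_lt ?_ ?_) measurable_const measurable_const <;> fun_prop
  · refine Measurable.ite (measurableSet_lt ?_ ?_) measurable_const measurable_const <;> fun_prop

theorem measurable_waveKer_comp {X : Type*} [MeasurableSpace X] {s τ x t : X → ℝ}
    (hs : Measurable s) (hτ : Measurable τ) (hx : Measurable x) (ht : Measurable t) :
    Measurable fun ω => waveKer (s ω) (τ ω) (x ω) (t ω) :=
  measurable_waveKer.comp ((hs.prodMk hτ).prodMk (hx.prodMk ht))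

theorem integral_sub_mul_step {t x A : ℝ} (htx : t ≤ x) (hA : t ≤ A) :
    ∫ w in t..x, (w - x) * (if A < w then 1 else 0) = -(1 / 2) * max (x - A) 0 ^ 2 := by
  have h1 : (fun w : ℝ => (w - x) * (if A < w then (1 : ℝ) else 0)) =
      (Ioi A).indicator fun w => w - x := by
    funext w; by_cases h : A < w <;> simp [h]
  rw [intervalIntegral.integral_of_le htx, h1, integral_indicator measurableSet_Ioi,
    Measure.restrict_restrict measurableSet_Ioi]
  have h2 : Ioi A ∩ Ioc t x = Ioc A x := by
    ext w; simp only [mem_inter_iff, mem_Ioi, mem_Ioc]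
    exact ⟨fun h => ⟨h.1, h.2.2⟩, fun h => ⟨h.1, hA.trans_lt h.1, h.2⟩⟩
  rw [h2]
  rcases le_total A x with h | h
  · rw [← intervalIntegral.integral_of_le h, max_eq_left (by linarith),
      intervalIntegral.integral_sub (by simp) (by simp)]
    simp; ring
  · rw [Ioc_eq_empty (by linarith), Measure.restrict_empty, integral_zero_measure,
      max_eq_right (by linarith)]
    simp

theorem integral_step_mul_sub {t x B B' : ℝ} (htx : t ≤ x) (hB : B ≤ x) (hBB : B' ≤ B) :
    ∫ y in t..x, (if B' < y ∧ y < B then 1 else 0) * (t - y) =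
      -(1 / 2) * max (B - t) 0 ^ 2 + 1 / 2 * max (B' - t) 0 ^ 2 := by
  have h1 : (fun y : ℝ => (if B' < y ∧ y < B then (1 : ℝ) else 0) * (t - y)) =
      (Ioo B' B).indicator fun y => t - y := by
    funext w; by_cases h : B' < w ∧ w < B <;> simp [h]
  rw [intervalIntegral.integral_of_le htx, integral_Ioc_eq_integral_Ioo, h1,
    integral_indicator measurableSet_Ioo, Measure.restrict_restrict measurableSet_Ioo, Ioo_inter_Ioo,
    min_eq_left hB, sup_comm]
  rcases le_total (max t B') B with h | h
  · rw [← integral_Ioc_eq_integral_Ioo, ← intervalIntegral.integral_of_le h,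
      max_eq_left (a := B - t) (by linarith [le_max_left t B']),
      intervalIntegral.integral_sub (by simp) (by simp)]
    simp only [intervalIntegral.integral_const, integral_id, smul_eq_mul]
    rcases le_total t B' with h' | h'
    · rw [max_eq_right h', max_eq_left (by linarith)]; ring
    · rw [max_eq_left h', max_eq_right (by linarith)]; ring
  · rw [Ioo_eq_empty (not_lt.2 h), Measure.restrict_empty, integral_zero_measure]
    rcases le_total t B' with h' | h'
    · rw [max_eq_right h'] at h
      have : B = B' := le_antisymm h hBB
      subst this; ring
    · rw [max_eq_left h'] at h
      rw [max_eq_right (by linarith), max_eq_right (by linarith)]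
      ring

theorem intervalIntegrable_of_bounded {f : ℝ → ℝ} (hf : Measurable f) {C a b : ℝ}
    (h : ∀ x, ‖f x‖ ≤ C) : IntervalIntegrable f volume a b :=
  (intervalIntegrable_const (c := C)).mono_fun hf.aestronglyMeasurable
    (ae_of_all _ fun x => (h x).trans (le_abs_self C))

/-- The kernel form of `A G - G A = A δ_(s,τ) A`: with the kernel `A(x,t) = t - x` for `t ≤ x`, the
right side is `A(x,s) A(τ,t)`. It is the wave equation with a point source, integrated twice in both
variables. The reflected front `s + t + τ < x` provides the Neumann condition at `t = 0`, and `τ ≤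
s` keeps the support inside `t ≤ x`. All integrals are truncated squares, so that the proof is a
comparison of cases. -/
theorem wave_identity {s τ t x : ℝ} (hτ : 0 ≤ τ) (hτs : τ ≤ s) (ht : 0 ≤ t) (htx : t ≤ x) :
    (∫ w in t..x, (w - x) * waveKer s τ w t) - ∫ y in t..x, waveKer s τ x y * (t - y) =
      (if s ≤ x then s - x else 0) * if t ≤ τ then t - τ else 0 := by
  have hint : ∀ {g : ℝ → ℝ} {q : ℝ → Prop} [DecidablePred q], Continuous g →
      MeasurableSet {w | q w} → IntervalIntegrable (fun w => g w * if q w then 1 else 0)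
        volume t x := by
    intro g q _ hg hq
    have h1 : Measurable fun w => if q w then (1 : ℝ) else 0 :=
      Measurable.ite hq measurable_const measurable_const
    refine (hg.intervalIntegrable t x).mono_fun (hg.measurable.mul h1).aestronglyMeasurable
      (ae_of_all _ fun w => ?_)
    by_cases h : q w <;> simp [h]
  have hq1 : MeasurableSet {w : ℝ | s + |t - τ| < w} := measurableSet_Ioi
  have hq2 : MeasurableSet {w : ℝ | s + t + τ < w} := measurableSet_Ioi
  have e1 : ∫ w in t..x, (w - x) * waveKer s τ w t =
      1 / 2 * (-(1 / 2) * max (x - (s + |t - τ|)) 0 ^ 2 +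
        -(1 / 2) * max (x - (s + t + τ)) 0 ^ 2) := by
    rw [← integral_sub_mul_step htx (show t ≤ s + |t - τ| by
        have := le_abs_self (t - τ); linarith), ← integral_sub_mul_step htx
        (show t ≤ s + t + τ by linarith), ← intervalIntegral.integral_add
        (hint (by fun_prop) hq1) (hint (by fun_prop) hq2), ← intervalIntegral.integral_const_mul]
    refine intervalIntegral.integral_congr fun w _ => ?_
    simp only [waveKer]; ring
  rcases le_or_gt x s with hxs | hxs
  · have e2 : ∫ y in t..x, waveKer s τ x y * (t - y) = 0 := by
      rw [intervalIntegral.integral_congr (g := fun _ => 0)]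
      · simp
      · intro y hy
        rw [uIcc_of_le htx] at hy
        simp only
        rw [waveKer_eq_zero hτ (ht.trans hy.1) hxs, zero_mul]
    have h3 : (if s ≤ x then s - x else 0) = 0 := by
      split_ifs with h
      · linarith
      · rfl
    rw [e1, e2, h3, max_eq_right (by have := abs_nonneg (t - τ); linarith),
      max_eq_right (by linarith)]
    ring
  -- The reflected front is a condition without a lower end. The artificial lower end `min (-1) (x -
  -- s - τ)` is negative, so it changes nothing for `y ≥ 0`, and its square vanishes for `t ≥ 0`.
  · have e2 : ∫ y in t..x, waveKer s τ x y * (t - y) =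
        1 / 2 * ((-(1 / 2) * max (τ + (x - s) - t) 0 ^ 2 + 1 / 2 * max (τ - (x - s) - t) 0 ^ 2) +
          (-(1 / 2) * max ((x - s - τ) - t) 0 ^ 2 + 1 / 2 * max (min (-1) (x - s - τ) - t) 0 ^ 2)) := by
      rw [← integral_step_mul_sub (B := τ + (x - s)) (B' := τ - (x - s)) htx (by linarith)
        (by linarith), ← integral_step_mul_sub (B := x - s - τ) (B' := min (-1) (x - s - τ)) htx
        (by linarith) (min_le_right _ _),
        ← intervalIntegral.integral_add, ← intervalIntegral.integral_const_mul]
      · refine intervalIntegral.integral_congr fun y hy => ?_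
        rw [uIcc_of_le htx] at hy
        have hy0 : 0 ≤ y := ht.trans hy.1
        have c1 : (s + |y - τ| < x) ↔ (τ - (x - s) < y ∧ y < τ + (x - s)) := by
          rw [show s + |y - τ| < x ↔ |y - τ| < x - s by constructor <;> intro h <;> linarith, abs_lt]
          constructor <;> rintro ⟨h1, h2⟩ <;> constructor <;> linarith
        have c2 : (s + y + τ < x) ↔ (min (-1) (x - s - τ) < y ∧ y < x - s - τ) := by
          constructor
          · intro h
            exact ⟨(min_le_left _ _).trans_lt (by linarith), by linarith⟩
          · rintro ⟨-, h⟩; linarith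
        simp only [waveKer, c1, c2]; ring
      · simp_rw [mul_comm _ (t - _)]
        exact hint (by fun_prop) measurableSet_Ioo
      · simp_rw [mul_comm _ (t - _)]
        exact hint (by fun_prop) measurableSet_Ioo
    have h0 : max (min (-1) (x - s - τ) - t) 0 = 0 :=
      max_eq_right (by have := min_le_left (-1) (x - s - τ); linarith)
    rw [e1, e2, h0, if_pos hxs.le, show x - (s + t + τ) = x - s - τ - t by ring]
    rcases le_total t τ with h | h
    · rw [if_pos h, abs_of_nonpos (by linarith)]
      rw [max_eq_left (a := τ + (x - s) - t) (by linarith),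
        show x - (s + -(t - τ)) = x - s - τ + t by ring]
      rcases le_total (τ - (x - s) - t) 0 with h' | h'
      · rw [max_eq_left (a := x - s - τ + t) (by linarith), max_eq_right h']; ring
      · rw [max_eq_right (a := x - s - τ + t) (by linarith), max_eq_left h']; ring
    · rw [abs_of_nonneg (by linarith), max_eq_right (a := τ - (x - s) - t) (by linarith),
        show x - (s + (t - τ)) = τ + (x - s) - t by ring]
      have h3 : (if t ≤ τ then t - τ else 0) = 0 := by
        split_ifs with h'
        · linarith
        · rfl
      rw [h3]; ring

/-- The direct part is half the indicator of an interval of length `2 (x - s)`; whatever the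
boundary `t = 0` cuts off is returned by the reflected part. This conservation of mass gives the
action of the transformation operator on constants. -/
theorem integral_waveKer {s τ x : ℝ} (hτ : 0 ≤ τ) (hτs : τ ≤ s) (hx : 0 ≤ x) :
    ∫ t in (0 : ℝ)..x, waveKer s τ x t = if s ≤ x then x - s else 0 := by
  rcases le_or_gt x s with hxs | hxs
  · rw [intervalIntegral.integral_congr (g := fun _ => 0)]
    · split_ifs with h
      · simp; linarith
      · simp
    · intro y hy
      rw [uIcc_of_le hx] at hy
      exact waveKer_eq_zero hτ hy.1 hxs
  · have hstep : ∀ B B' : ℝ, ∫ y in (0 : ℝ)..x, (if B' < y ∧ y < B then (1 : ℝ) else 0) =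
        max (min x B - max 0 B') 0 := by
      intro B B'
      have h1 : (fun y : ℝ => if B' < y ∧ y < B then (1 : ℝ) else 0) =
          (Ioo B' B).indicator fun _ => 1 := by
        funext w; by_cases h : B' < w ∧ w < B <;> simp [h]
      rw [intervalIntegral.integral_of_le hx, integral_Ioc_eq_integral_Ioo, h1,
        integral_indicator measurableSet_Ioo, Measure.restrict_restrict measurableSet_Ioo,
        Ioo_inter_Ioo, setIntegral_const, measureReal_def, Real.volume_Ioo, smul_eq_mul, mul_one,
        ENNReal.toReal_ofReal', sup_comm B' 0]
      simp only [inf_comm]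
    have hint : ∀ B B' : ℝ, IntervalIntegrable
        (fun y => if B' < y ∧ y < B then (1 : ℝ) else 0) volume 0 x := fun B B' =>
      intervalIntegrable_of_bounded (C := 1)
        (Measurable.ite measurableSet_Ioo measurable_const measurable_const)
        (fun y => by split_ifs <;> simp)
    rw [if_pos hxs.le]
    have e : ∫ t in (0 : ℝ)..x, waveKer s τ x t = 1 / 2 *
        (max (min x (τ + (x - s)) - max 0 (τ - (x - s))) 0 +
          max (min x (x - s - τ) - max 0 (-1)) 0) := by
      rw [← hstep, ← hstep, ← intervalIntegral.integral_add (hint _ _) (hint _ _),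
        ← intervalIntegral.integral_const_mul]
      refine intervalIntegral.integral_congr fun y hy => ?_
      rw [uIcc_of_le hx] at hy
      have c1 : (s + |y - τ| < x) ↔ (τ - (x - s) < y ∧ y < τ + (x - s)) := by
        rw [show s + |y - τ| < x ↔ |y - τ| < x - s by constructor <;> intro h <;> linarith, abs_lt]
        constructor <;> rintro ⟨h1, h2⟩ <;> constructor <;> linarith
      have c2 : (s + y + τ < x) ↔ (-1 < y ∧ y < x - s - τ) := by
        constructor
        · intro h; exact ⟨by linarith [hy.1], by linarith⟩
        · rintro ⟨-, h⟩; linarith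
      simp only [waveKer, c1, c2]
    rw [e, min_eq_right (show τ + (x - s) ≤ x by linarith), min_eq_right (by linarith),
      max_eq_left (show (-1 : ℝ) ≤ 0 by norm_num)]
    rcases le_total 0 (τ - (x - s)) with h | h
    · rw [max_eq_right h, max_eq_left (by linarith), max_eq_right (by linarith)]; ring
    · rw [max_eq_left h, max_eq_left (by linarith), max_eq_left (by linarith)]; ring

/-! ### Superposition of fundamental solutions -/

section Superposition

variable {Z : Type*} [MeasurableSpace Z] {μ : Measure Z} {s τ : Z → ℝ} {y : Z → ℂ}

/-- The solution of the wave equation with source density `y` at the points `(s z, τ z)`. -/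
noncomputable def waveSol (μ : Measure Z) (s τ : Z → ℝ) (y : Z → ℂ) (x t : ℝ) : ℂ :=
  ∫ z, y z * waveKer (s z) (τ z) x t ∂μ

theorem waveSol_integrable (hs : Measurable s) (hτ : Measurable τ) (hy : Integrable y μ) (x t : ℝ) :
    Integrable (fun z => y z * (waveKer (s z) (τ z) x t : ℂ)) μ := by
  refine hy.mul_bdd (c := 1) ?_ (ae_of_all _ fun z => norm_waveKer_le _ _ _ _)
  exact (Complex.measurable_ofReal.comp
    (measurable_waveKer_comp hs hτ measurable_const measurable_const)).aestronglyMeasurable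

theorem norm_waveSol_le (hy : Integrable y μ) (x t : ℝ) :
    ‖waveSol μ s τ y x t‖ ≤ ∫ z, ‖y z‖ ∂μ := by
  refine norm_integral_le_of_norm_le hy.norm (ae_of_all _ fun z => ?_)
  rw [norm_mul]
  exact mul_le_of_le_one_right (norm_nonneg _) (norm_waveKer_le _ _ _ _)

variable [SFinite μ]

theorem measurable_waveSol (hs : Measurable s) (hτ : Measurable τ) (hy : Measurable y) :
    Measurable fun z : ℝ × ℝ => waveSol μ s τ y z.1 z.2 := by
  refine (StronglyMeasurable.integral_prod_right' (f := fun w : (ℝ × ℝ) × Z =>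
    y w.2 * (waveKer (s w.2) (τ w.2) w.1.1 w.1.2 : ℂ)) ?_).measurable
  refine ((hy.comp measurable_snd).mul (Complex.measurable_ofReal.comp
    (measurable_waveKer_comp ?_ ?_ ?_ ?_))).stronglyMeasurable <;> fun_prop

theorem intervalIntegral_swap {g : ℝ → Z → ℂ} {t x : ℝ} (htx : t ≤ x) {C : ℝ}
    (hg : Measurable fun w : ℝ × Z => g w.1 w.2) (hy : Integrable y μ)
    (hC : ∀ w ∈ Ioc t x, ∀ z, ‖g w z‖ ≤ C) :
    ∫ w in t..x, ∫ z, y z * g w z ∂μ = ∫ z, (y z * ∫ w in t..x, g w z) ∂μ := by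
  simp only [intervalIntegral.integral_of_le htx]
  rw [integral_integral_swap]
  · simp only [integral_const_mul]
  · have h1 : Integrable (fun w : ℝ × Z => C * (1 * ‖y w.2‖))
        ((volume.restrict (Ioc t x)).prod μ) :=
      ((integrable_const (1 : ℝ)).mul_prod hy.norm).const_mul C
    refine h1.mono' (hy.aestronglyMeasurable.comp_snd.mul hg.aestronglyMeasurable) ?_
    have : ∀ᵐ w ∂((volume.restrict (Ioc t x)).prod μ), w.1 ∈ Ioc t x :=
      Measure.quasiMeasurePreserving_fst.ae (ae_restrict_mem measurableSet_Ioc)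
    filter_upwards [this] with w hw
    simp only [Function.uncurry]
    rw [norm_mul, one_mul, mul_comm]
    gcongr
    exact hC _ hw _

theorem waveSol_identity (hs : Measurable s) (hτ : Measurable τ) (hy : Integrable y μ)
    (hsupp : ∀ z, y z ≠ 0 → 0 ≤ τ z ∧ τ z ≤ s z) {t x : ℝ} (ht : 0 ≤ t) (htx : t ≤ x) :
    (∫ w in t..x, ((w - x : ℝ) : ℂ) * waveSol μ s τ y w t) -
        ∫ w in t..x, waveSol μ s τ y x w * ((t - w : ℝ) : ℂ) =
      ∫ z, y z * (((if s z ≤ x then s z - x else 0) * if t ≤ τ z then t - τ z else 0 : ℝ) : ℂ) ∂μ := by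
  have hbd : ∀ w ∈ Ioc t x, ∀ a b c d u : ℝ, |u| ≤ x - t → ‖((u * waveKer a b c d : ℝ) : ℂ)‖ ≤ x - t := by
    intro w _ a b c d u hu
    rw [Complex.norm_real, norm_mul, Real.norm_eq_abs u,
      Real.norm_of_nonneg (waveKer_nonneg _ _ _ _)]
    exact (mul_le_of_le_one_right (abs_nonneg _) (waveKer_le_one _ _ _ _)).trans hu
  have e1 : ∫ w in t..x, ((w - x : ℝ) : ℂ) * waveSol μ s τ y w t =
      ∫ z, (y z * ∫ w in t..x, (((w - x) * waveKer (s z) (τ z) w t : ℝ) : ℂ)) ∂μ := by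
    rw [← intervalIntegral_swap (C := x - t) htx ?_ hy ?_]
    · refine intervalIntegral.integral_congr fun w _ => ?_
      simp only [waveSol]
      rw [← integral_const_mul]
      refine integral_congr_ae (ae_of_all _ fun z => ?_)
      push_cast; ring
    · refine Complex.measurable_ofReal.comp (Measurable.mul (by fun_prop)
        (measurable_waveKer_comp ?_ ?_ ?_ ?_)) <;> fun_prop
    · intro w hw z
      exact hbd w hw _ _ _ _ _ (by rw [abs_le]; constructor <;> linarith [hw.1, hw.2])
  have e2 : ∫ w in t..x, waveSol μ s τ y x w * ((t - w : ℝ) : ℂ) =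
      ∫ z, (y z * ∫ w in t..x, (((t - w) * waveKer (s z) (τ z) x w : ℝ) : ℂ)) ∂μ := by
    rw [← intervalIntegral_swap (C := x - t) htx ?_ hy ?_]
    · refine intervalIntegral.integral_congr fun w _ => ?_
      simp only [waveSol]
      rw [← integral_mul_const]
      refine integral_congr_ae (ae_of_all _ fun z => ?_)
      push_cast; ring
    · refine Complex.measurable_ofReal.comp (Measurable.mul (by fun_prop)
        (measurable_waveKer_comp ?_ ?_ ?_ ?_)) <;> fun_prop
    · intro w hw z
      exact hbd w hw _ _ _ _ _ (by rw [abs_le]; constructor <;> linarith [hw.1, hw.2])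
  have hI : ∀ {g : ℝ → Z → ℝ}, (Measurable fun w : Z × ℝ => g w.2 w.1) →
      (∀ w ∈ Ioc t x, ∀ z, ‖(g w z : ℂ)‖ ≤ x - t) →
      Integrable (fun z => y z * ∫ w in t..x, ((g w z : ℝ) : ℂ)) μ := by
    intro g hg hb
    refine hy.mul_bdd (c := (x - t) * |x - t|) ?_ (ae_of_all _ fun z => ?_)
    · exact (stronglyMeasurable_intervalIntegral (F := fun z w => ((g w z : ℝ) : ℂ))
        (Complex.measurable_ofReal.comp hg).stronglyMeasurable measurable_const
        measurable_const).aestronglyMeasurable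
    · refine intervalIntegral.norm_integral_le_of_norm_le_const fun w hw => ?_
      rw [uIoc_of_le htx] at hw
      exact hb w hw z
  rw [e1, e2, ← integral_sub]
  · refine integral_congr_ae (ae_of_all _ fun z => ?_)
    by_cases hz : y z = 0
    · simp [hz]
    · obtain ⟨h1, h2⟩ := hsupp z hz
      simp only
      rw [← mul_sub, intervalIntegral.integral_ofReal, intervalIntegral.integral_ofReal,
        ← Complex.ofReal_sub, ← wave_identity h1 h2 ht htx]
      simp only [mul_comm (waveKer _ _ _ _) (t - _)]
  · refine hI (Measurable.mul (by fun_prop)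
        (measurable_waveKer_comp ?_ ?_ ?_ ?_)) (fun w hw z =>
      hbd w hw _ _ _ _ _ (by rw [abs_le]; constructor <;> linarith [hw.1, hw.2])) <;> fun_prop
  · refine hI (Measurable.mul (by fun_prop)
        (measurable_waveKer_comp ?_ ?_ ?_ ?_)) (fun w hw z =>
      hbd w hw _ _ _ _ _ (by rw [abs_le]; constructor <;> linarith [hw.1, hw.2])) <;> fun_prop

/-- The integral operator `Z` with kernel `waveSol` solves `AZ - ZA = AYA`, where
`(Yf)` is the superposition of the values `f (τ z)` placed at `s z` with density `y`. -/
theorem waveSol_commutator (hs : Measurable s) (hτ : Measurable τ) (hym : Measurable y)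
    (hy : Integrable y μ) (hsupp : ∀ z, y z ≠ 0 → 0 ≤ τ z ∧ τ z ≤ s z) {x : ℝ} (hx : 0 ≤ x)
    {f : ℝ → ℂ} (hf : Integrable f (vol x)) :
    (∫ w in (0 : ℝ)..x, ((w - x : ℝ) : ℂ) * ∫ t in (0 : ℝ)..w, waveSol μ s τ y w t * f t) -
        ∫ w in (0 : ℝ)..x, waveSol μ s τ y x w * ∫ t in (0 : ℝ)..w, ((t - w : ℝ) : ℂ) * f t =
      ∫ z, y z * (((if s z ≤ x then s z - x else 0 : ℝ) : ℂ) *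
        ∫ t in (0 : ℝ)..τ z, ((t - τ z : ℝ) : ℂ) * f t) ∂μ := by
  have hm := measurable_waveSol (μ := μ) hs hτ hym
  have hlin : Integrable (fun w : ℝ => ((w - x : ℝ) : ℂ)) (vol x) :=
    integrable_vol_of_intervalIntegrable hx
      (Continuous.intervalIntegrable (by fun_prop) _ _)
  have hrow : Integrable (fun w : ℝ => waveSol μ s τ y x w) (vol x) :=
    (memLp_of_bounded (hm.comp (measurable_const.prodMk measurable_id)).aestronglyMeasurable
      (fun w _ => norm_waveSol_le hy x w) 1).integrable le_rfl
  have hm2 : Measurable fun q : ℝ × ℝ => ((q.2 - q.1 : ℝ) : ℂ) := by fun_prop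
  have hb2 : ∀ w t : ℝ, 0 < t → t < w → w < x → ‖((t - w : ℝ) : ℂ)‖ ≤ x := fun w t h1 h2 h3 => by
    rw [Complex.norm_real, Real.norm_eq_abs, abs_le]; constructor <;> linarith
  -- Both compositions become integral operators applied to `f`. The difference of their kernels is
  -- `waveSol_identity`, after which the integrals over `t` and over the sources are exchanged.
  rw [triangle_swap hx hlin hf hm (fun w t _ _ _ => norm_waveSol_le hy w t),
    triangle_swap (k := fun w t => ((t - w : ℝ) : ℂ)) hx hrow hf hm2 hb2,
    ← intervalIntegral.integral_sub]
  rotate_left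
  · exact intervalIntegrable_of_vol (triangle_integrable_snd hlin hf hm
      (fun w t _ _ _ => norm_waveSol_le hy w t)) ⟨le_rfl, hx⟩ ⟨hx, le_rfl⟩
  · exact intervalIntegrable_of_vol (triangle_integrable_snd (k := fun w t => ((t - w : ℝ) : ℂ))
      hrow hf hm2 hb2) ⟨le_rfl, hx⟩ ⟨hx, le_rfl⟩
  have hker : Measurable fun w : ℝ × Z => ((((if s w.2 ≤ x then s w.2 - x else 0) *
      if w.1 ≤ τ w.2 then w.1 - τ w.2 else 0 : ℝ)) : ℂ) := by
    refine Complex.measurable_ofReal.comp (Measurable.mul ?_ ?_)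
    · refine Measurable.ite (measurableSet_le ?_ ?_) ?_ ?_ <;> fun_prop
    · refine Measurable.ite (measurableSet_le ?_ ?_) ?_ ?_ <;> fun_prop
  have hprod : Integrable (fun w : ℝ × Z => y w.2 * ((((if s w.2 ≤ x then s w.2 - x else 0) *
      if w.1 ≤ τ w.2 then w.1 - τ w.2 else 0 : ℝ)) : ℂ) * f w.1) ((vol x).prod μ) := by
    have h1 : Integrable (fun w : ℝ × Z => x ^ 2 * (‖f w.1‖ * ‖y w.2‖)) ((vol x).prod μ) :=
      (hf.norm.mul_prod hy.norm).const_mul _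
    refine h1.mono' ((hy.aestronglyMeasurable.comp_snd.mul hker.aestronglyMeasurable).mul
      hf.aestronglyMeasurable.comp_fst) ?_
    have : ∀ᵐ w ∂((vol x).prod μ), w.1 ∈ Ioo 0 x :=
      Measure.quasiMeasurePreserving_fst.ae (ae_restrict_mem measurableSet_Ioo)
    filter_upwards [this] with w hw
    by_cases hz : y w.2 = 0
    · rw [hz, zero_mul, zero_mul, norm_zero]; positivity
    obtain ⟨h1, h2⟩ := hsupp w.2 hz
    rw [norm_mul, norm_mul, Complex.norm_real]
    have : ‖(if s w.2 ≤ x then s w.2 - x else 0) * (if w.1 ≤ τ w.2 then w.1 - τ w.2 else 0)‖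
        ≤ x ^ 2 := by
      split_ifs with h3 h4
      · rw [norm_mul, Real.norm_eq_abs, Real.norm_eq_abs, sq]
        refine mul_le_mul ?_ ?_ (abs_nonneg _) hx
        · rw [abs_le]; constructor <;> linarith
        · rw [abs_le]; constructor <;> linarith [hw.1]
      all_goals simp; try positivity
    calc ‖y w.2‖ * _ * ‖f w.1‖ ≤ ‖y w.2‖ * x ^ 2 * ‖f w.1‖ := by gcongr
      _ = _ := by ring
  calc _ = ∫ t in (0 : ℝ)..x, ∫ z, y z * ((((if s z ≤ x then s z - x else 0) *
      if t ≤ τ z then t - τ z else 0 : ℝ)) : ℂ) * f t ∂μ := by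
        refine intervalIntegral_congr_Ioo hx fun t ht => ?_
        rw [← sub_mul, waveSol_identity hs hτ hy hsupp ht.1.le ht.2.le, integral_mul_const]
    _ = ∫ z, (∫ t in (0 : ℝ)..x, y z * ((((if s z ≤ x then s z - x else 0) *
      if t ≤ τ z then t - τ z else 0 : ℝ)) : ℂ) * f t) ∂μ := by
        simp only [intervalIntegral_eq_vol _ hx]
        exact integral_integral_swap hprod
    _ = _ := by
        refine integral_congr_ae (ae_of_all _ fun z => ?_)
        by_cases hz : y z = 0
        · simp [hz]
        obtain ⟨h1, h2⟩ := hsupp z hz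
        simp only
        by_cases hsx : s z ≤ x
        · rw [if_pos hsx, ← intervalIntegral.integral_const_mul,
            ← intervalIntegral.integral_const_mul, intervalIntegral_eq_vol _ hx,
            intervalIntegral_eq_vol _ h1]
          have hset : Ioo 0 (τ z) ⊆ Ioo 0 x := Ioo_subset_Ioo_right (h2.trans hsx)
          rw [setIntegral_eq_of_subset_of_forall_sdiff_eq_zero measurableSet_Ioo hset]
          · refine setIntegral_congr_fun measurableSet_Ioo fun t ht => ?_
            rw [if_pos ht.2.le]
            push_cast; ring
          · intro t ht
            have : ¬ t < τ z := fun h => ht.2 ⟨ht.1.1, h⟩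
            rcases eq_or_lt_of_le (not_lt.1 this) with h | h
            · simp [h]
            · simp [not_le.2 h]
        · simp [if_neg hsx]

end Superposition

/-! ### The perturbation `Q` and the kernel of the transformation operator -/

section Coefficients

variable {p : ℕ} {ν : Type*} [Fintype ν] {r : ℝ}

theorem intervalIntegral_apply {ι : Type*} [Fintype ι] {F : ℝ → ι → ℂ} {a b : ℝ}
    (hF : IntervalIntegrable F volume a b) (i : ι) :
    (∫ t in a..b, F t) i = ∫ t in a..b, F t i :=
  ((ContinuousLinearMap.proj (R := ℝ) (φ := fun _ : ι => ℂ) i).intervalIntegral_comp_comm hF).symm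

/-- The coefficients of the operator `h ↦ q h + a ∫_0^x b h`. -/
structure IsCoeff (r : ℝ) (q : ℝ → Matrix (Fin p) (Fin p) ℂ) (a : ℝ → Matrix (Fin p) ν ℂ)
    (b : ℝ → Matrix ν (Fin p) ℂ) : Prop where
  meas_q : ∀ i j, Measurable fun s => q s i j
  meas_a : ∀ i j, Measurable fun s => a s i j
  meas_b : ∀ i j, Measurable fun s => b s i j
  memLp_q : ∀ i j, MemLp (fun s => q s i j) 2 (vol r)
  memLp_a : ∀ i j, MemLp (fun s => a s i j) 2 (vol r)
  memLp_b : ∀ i j, MemLp (fun s => b s i j) 2 (vol r)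

/-- `(Q h)(x) = q(x) h(x) + a(x) ∫_0^x b(t) h(t) dt`. -/
noncomputable def opQ (q : ℝ → Matrix (Fin p) (Fin p) ℂ) (a : ℝ → Matrix (Fin p) ν ℂ)
    (b : ℝ → Matrix ν (Fin p) ℂ) : Op p := fun h x =>
  q x *ᵥ h x + a x *ᵥ ∫ t in (0 : ℝ)..x, b t *ᵥ h t

/-- The kernel of `opQ q a b ∘ v` for an integral operator with kernel `v`. -/
noncomputable def srcKer (q : ℝ → Matrix (Fin p) (Fin p) ℂ) (a : ℝ → Matrix (Fin p) ν ℂ)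
    (b : ℝ → Matrix ν (Fin p) ℂ) (v : ℝ → ℝ → Matrix (Fin p) (Fin p) ℂ) (s τ : ℝ) :
    Matrix (Fin p) (Fin p) ℂ :=
  q s * v s τ + a s * mint τ s fun σ => b σ * v σ τ

/-- The open triangle `0 < τ < s < r`. -/
def triangle (r : ℝ) : Set (ℝ × ℝ) := {z | 0 < z.2 ∧ z.2 < z.1 ∧ z.1 < r}

theorem measurableSet_triangle : MeasurableSet (triangle r) :=
  (measurableSet_lt measurable_const measurable_snd).inter
    ((measurableSet_lt measurable_snd measurable_fst).inter
      (measurableSet_lt measurable_fst measurable_const))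

theorem triangle_subset : triangle r ⊆ Ioo 0 r ×ˢ Ioo 0 r := fun _ hz =>
  ⟨⟨hz.1.trans hz.2.1, hz.2.2⟩, hz.1, hz.2.1.trans hz.2.2⟩

namespace IsCoeff

variable {q : ℝ → Matrix (Fin p) (Fin p) ℂ} {a : ℝ → Matrix (Fin p) ν ℂ}
  {b : ℝ → Matrix ν (Fin p) ℂ}

/-- The integrable function which controls the kernels `srcKer q a b v`. -/
noncomputable def majorant (r : ℝ) (q : ℝ → Matrix (Fin p) (Fin p) ℂ) (a : ℝ → Matrix (Fin p) ν ℂ)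
    (b : ℝ → Matrix ν (Fin p) ℂ) (s : ℝ) : ℝ :=
  entrySum (q s) * (p * p) + entrySum (a s) *
    (Fintype.card ν * (p * ((p * p) * ∫ σ, entrySum (b σ) ∂(vol r))))

theorem majorant_nonneg (s : ℝ) : 0 ≤ majorant r q a b s := by
  have h1 := entrySum_nonneg (q s)
  have h2 := entrySum_nonneg (a s)
  have h3 : 0 ≤ ∫ σ, entrySum (b σ) ∂(vol r) := integral_nonneg fun σ => entrySum_nonneg _
  unfold majorant; positivity

theorem integrable_majorant (h : IsCoeff r q a b) : Integrable (majorant r q a b) (vol r) :=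
  (((memLp_entrySum h.memLp_q).integrable one_le_two).mul_const _).add
    (((memLp_entrySum h.memLp_a).integrable one_le_two).mul_const _)

theorem integrable_entrySum_b (h : IsCoeff r q a b) : Integrable (fun s => entrySum (b s)) (vol r) :=
  (memLp_entrySum h.memLp_b).integrable one_le_two

/-- Only the values `v(σ,τ)` with `τ ≤ σ ≤ s` enter. This causality is what makes a weight in the
first variable effective. -/
theorem norm_srcKer_le (h : IsCoeff r q a b) {v : ℝ → ℝ → Matrix (Fin p) (Fin p) ℂ} {s τ M : ℝ}
    (hM : 0 ≤ M) (hz : (s, τ) ∈ triangle r) (hv : ∀ σ ∈ Icc τ s, ∀ l k, ‖v σ τ l k‖ ≤ M) (i k : Fin p) :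
    ‖srcKer q a b v s τ i k‖ ≤ M * majorant r q a b s := by
  obtain ⟨h1, h2, h3⟩ := hz
  simp only at h1 h2 h3
  have hes : ∀ σ ∈ Icc τ s, entrySum (v σ τ) ≤ p * p * M := fun σ hσ =>
    (entrySum_le (hv σ hσ)).trans (le_of_eq (by simp; ring))
  have hb := h.integrable_entrySum_b
  have hint : ∀ l k, ‖mint τ s (fun σ => b σ * v σ τ) l k‖ ≤
      (p * p * M) * ∫ σ, entrySum (b σ) ∂(vol r) := by
    intro l k
    have hbi := intervalIntegrable_of_vol hb (a := τ) (b := s) ⟨h1.le, (h2.trans h3).le⟩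
      ⟨(h1.trans h2).le, h3.le⟩
    simp only [mint, Matrix.of_apply]
    calc ‖∫ σ in τ..s, (b σ * v σ τ) l k‖ ≤ ∫ σ in τ..s, (p * p * M) * entrySum (b σ) := by
          refine intervalIntegral.norm_integral_le_of_norm_le h2.le ?_ (hbi.const_mul _)
          refine ae_of_all _ fun σ hσ => (norm_entry_le_entrySum _ l k).trans ?_
          refine (entrySum_mul_le _ _).trans ?_
          rw [mul_comm]
          gcongr
          · exact entrySum_nonneg _
          · exact hes σ (Ioc_subset_Icc_self hσ)
      _ = (p * p * M) * ∫ σ in τ..s, entrySum (b σ) := intervalIntegral.integral_const_mul _ _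
      _ ≤ _ := by
          gcongr
          rw [intervalIntegral.integral_of_le h2.le, integral_Ioc_eq_integral_Ioo]
          exact setIntegral_mono_set hb (ae_of_all _ fun σ => entrySum_nonneg _)
            (Eventually.of_forall fun σ hσ => ⟨h1.trans hσ.1, hσ.2.trans h3⟩)
  calc ‖srcKer q a b v s τ i k‖
      ≤ entrySum (q s * v s τ) + entrySum (a s * mint τ s fun σ => b σ * v σ τ) :=
        (norm_entry_le_entrySum _ i k).trans (entrySum_add_le _ _)
    _ ≤ entrySum (q s) * (p * p * M) + entrySum (a s) * (Fintype.card ν * (p *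
          ((p * p * M) * ∫ σ, entrySum (b σ) ∂(vol r)))) := by
        refine add_le_add ((entrySum_mul_le _ _).trans ?_) ((entrySum_mul_le _ _).trans ?_)
        · gcongr
          · exact entrySum_nonneg _
          · exact hes s ⟨h2.le, le_rfl⟩
        · gcongr
          · exact entrySum_nonneg _
          · exact (entrySum_le hint).trans (le_of_eq (by simp))
    _ = _ := by unfold majorant; ring

theorem measurable_srcKer (h : IsCoeff r q a b) {v : ℝ → ℝ → Matrix (Fin p) (Fin p) ℂ}
    (hv : ∀ i k, Measurable fun z : ℝ × ℝ => v z.1 z.2 i k) (i k : Fin p) :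
    Measurable fun z : ℝ × ℝ => srcKer q a b v z.1 z.2 i k := by
  simp only [srcKer, Matrix.add_apply, Matrix.mul_apply]
  refine (Finset.measurable_fun_sum _ fun l _ => ((h.meas_q i l).comp measurable_fst).mul
    (hv l k)).add (Finset.measurable_fun_sum _ fun l _ => ((h.meas_a i l).comp measurable_fst).mul ?_)
  refine (stronglyMeasurable_intervalIntegral (X := ℝ × ℝ)
    (F := fun z σ => ∑ j, b σ l j * v σ z.2 j k) (Measurable.stronglyMeasurable ?_)
    measurable_snd measurable_fst).measurable
  refine Finset.measurable_fun_sum _ fun j _ => ((h.meas_b l j).comp measurable_snd).mul ?_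
  exact (hv j k).comp (measurable_snd.prodMk (measurable_snd.comp measurable_fst))

theorem norm_indicator_srcKer_le (h : IsCoeff r q a b) {v : ℝ → ℝ → Matrix (Fin p) (Fin p) ℂ}
    {M : ℝ → ℝ} (hM : ∀ s, 0 ≤ M s) (hmono : Monotone M)
    (hv : ∀ s τ, s < r → ∀ l k, ‖v s τ l k‖ ≤ M s) (i k : Fin p) (z : ℝ × ℝ) :
    ‖(triangle r).indicator (fun z => srcKer q a b v z.1 z.2 i k) z‖ ≤
      (Ioo 0 r).indicator (fun s => M s * majorant r q a b s) z.1 *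
        (Ioo 0 r).indicator (fun _ => 1) z.2 := by
  by_cases hz : z ∈ triangle r
  · rw [indicator_of_mem hz, indicator_of_mem (triangle_subset hz).1,
      indicator_of_mem (triangle_subset hz).2, mul_one]
    exact h.norm_srcKer_le (hM _) hz (fun σ hσ l k =>
      (hv σ _ (hσ.2.trans_lt hz.2.2) l k).trans (hmono hσ.2)) i k
  · rw [indicator_of_notMem hz, norm_zero]
    exact mul_nonneg (indicator_nonneg (fun s _ => mul_nonneg (hM s) (majorant_nonneg s)) _)
      (indicator_nonneg (fun _ _ => zero_le_one) _)

theorem integrable_indicator_srcKer (h : IsCoeff r q a b)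
    {v : ℝ → ℝ → Matrix (Fin p) (Fin p) ℂ}
    (hvm : ∀ i k, Measurable fun z : ℝ × ℝ => v z.1 z.2 i k) {C : ℝ} (hC : 0 ≤ C)
    (hv : ∀ s τ, s < r → ∀ l k, ‖v s τ l k‖ ≤ C) (i k : Fin p) :
    Integrable ((triangle r).indicator fun z => srcKer q a b v z.1 z.2 i k) := by
  have h1 : Integrable (fun z : ℝ × ℝ => (Ioo 0 r).indicator (fun s => C * majorant r q a b s) z.1 *
      (Ioo 0 r).indicator (fun _ => (1 : ℝ)) z.2) := by
    refine Integrable.mul_prod (f := (Ioo 0 r).indicator (fun s => C * majorant r q a b s))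
      (g := (Ioo 0 r).indicator (fun _ => (1 : ℝ))) ?_ ?_
    · exact (integrable_indicator_iff measurableSet_Ioo).2 (h.integrable_majorant.const_mul C)
    · exact (integrable_indicator_iff measurableSet_Ioo).2 (integrable_const _)
  refine h1.mono' ((h.measurable_srcKer hvm i k).indicator
    measurableSet_triangle).aestronglyMeasurable (ae_of_all _ fun z => ?_)
  exact h.norm_indicator_srcKer_le (M := fun _ => C) (fun _ => hC) monotone_const hv i k z

theorem integrable_indicator_mul (h : IsCoeff r q a b) (i k : Fin p) :
    Integrable ((triangle r).indicator fun z => (a z.1 * b z.2) i k) := by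
  have h1 : Integrable (fun z : ℝ × ℝ => (Ioo 0 r).indicator (fun s => entrySum (a s)) z.1 *
      (Ioo 0 r).indicator (fun s => entrySum (b s)) z.2) := by
    refine Integrable.mul_prod (f := (Ioo 0 r).indicator (fun s => entrySum (a s)))
      (g := (Ioo 0 r).indicator (fun s => entrySum (b s))) ?_ ?_
    · exact (integrable_indicator_iff measurableSet_Ioo).2
        ((memLp_entrySum h.memLp_a).integrable one_le_two)
    · exact (integrable_indicator_iff measurableSet_Ioo).2 h.integrable_entrySum_b
  refine h1.mono' (Measurable.indicator ?_ measurableSet_triangle).aestronglyMeasurable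
    (ae_of_all _ fun z => ?_)
  · simp only [Matrix.mul_apply]
    exact Finset.measurable_fun_sum _ fun l _ => ((h.meas_a i l).comp measurable_fst).mul
      ((h.meas_b l k).comp measurable_snd)
  · by_cases hz : z ∈ triangle r
    · rw [indicator_of_mem hz, indicator_of_mem (triangle_subset hz).1,
        indicator_of_mem (triangle_subset hz).2]
      exact (norm_entry_le_entrySum _ i k).trans (entrySum_mul_le _ _)
    · rw [indicator_of_notMem hz, norm_zero]
      exact mul_nonneg (indicator_nonneg (fun s _ => entrySum_nonneg _) _)
        (indicator_nonneg (fun _ _ => entrySum_nonneg _) _)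

theorem srcKer_sub (h : IsCoeff r q a b) {v w : ℝ → ℝ → Matrix (Fin p) (Fin p) ℂ}
    (hvm : ∀ i k, Measurable fun z : ℝ × ℝ => v z.1 z.2 i k)
    (hwm : ∀ i k, Measurable fun z : ℝ × ℝ => w z.1 z.2 i k) {C : ℝ}
    (hv : ∀ s τ, s < r → ∀ l k, ‖v s τ l k‖ ≤ C) (hw : ∀ s τ, s < r → ∀ l k, ‖w s τ l k‖ ≤ C)
    {z : ℝ × ℝ} (hz : z ∈ triangle r) :
    srcKer q a b (fun s τ => v s τ - w s τ) z.1 z.2 =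
      srcKer q a b v z.1 z.2 - srcKer q a b w z.1 z.2 := by
  have hint : ∀ {v : ℝ → ℝ → Matrix (Fin p) (Fin p) ℂ},
      (∀ i k, Measurable fun z : ℝ × ℝ => v z.1 z.2 i k) →
      (∀ s τ, s < r → ∀ l k, ‖v s τ l k‖ ≤ C) → ∀ l k,
      IntervalIntegrable (fun σ => (b σ * v σ z.2) l k) volume z.2 z.1 := by
    intro v hvm hv l k
    obtain ⟨h1, h2, h3⟩ := hz
    refine intervalIntegrable_of_vol (r := r) ?_ ⟨h1.le, (h2.trans h3).le⟩
      ⟨(h1.trans h2).le, h3.le⟩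
    simp only [Matrix.mul_apply]
    refine integrable_finsetSum _ fun j _ => ?_
    refine ((h.memLp_b l j).integrable one_le_two).mul_bdd (c := C) ?_
      (ae_vol_of_forall fun σ hσ => hv σ _ hσ.2 j k)
    exact ((hvm j k).comp (measurable_id.prodMk measurable_const)).aestronglyMeasurable
  have hm : mint z.2 z.1 (fun σ => b σ * (v σ z.2 - w σ z.2)) =
      mint z.2 z.1 (fun σ => b σ * v σ z.2) - mint z.2 z.1 (fun σ => b σ * w σ z.2) := by
    ext l k
    simp only [mint, Matrix.of_apply, Matrix.mul_sub, Matrix.sub_apply]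
    exact intervalIntegral.integral_sub (hint hvm hv l k) (hint hwm hw l k)
  simp only [srcKer]
  rw [hm, Matrix.mul_sub, Matrix.mul_sub]
  abel

/-- Since `waveKer` vanishes for `s ≥ x`, the value at `x` depends only on sources with `s < x`,
which leaves an integral of the majorant against `e^{κs}` over `(0,x)`. The integration over `τ`
costs a factor `r`, which is why `κ` is chosen for `|r|` times the majorant. -/
theorem exists_halving (h : IsCoeff r q a b) : ∃ κ : ℝ, 0 < κ ∧
    ∀ (v : ℝ → ℝ → Matrix (Fin p) (Fin p) ℂ) (c : ℝ), 0 ≤ c →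
      (∀ s τ l k, ‖v s τ l k‖ ≤ c * Real.exp (κ * s)) → ∀ x ∈ Ioo 0 r, ∀ t, 0 < t → ∀ i k,
        ‖waveSol volume Prod.fst Prod.snd
          ((triangle r).indicator fun z => srcKer q a b v z.1 z.2 i k) x t‖ ≤
            c / 2 * Real.exp (κ * x) := by
  obtain ⟨κ, hκ, hw⟩ := exists_exp_weight (γ := fun s => |r| * majorant r q a b s)
    (h.integrable_majorant.const_mul _) fun s => mul_nonneg (abs_nonneg r) (majorant_nonneg s)
  refine ⟨κ, hκ, fun v c hc hv x hx t ht i k => ?_⟩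
  have hr : 0 ≤ r := (hx.1.trans hx.2).le
  have hi : Integrable (fun s => c * (majorant r q a b s * Real.exp (κ * s))) (vol x) := by
    have := (intervalIntegrable_of_vol h.integrable_majorant (a := 0) (b := x) ⟨le_rfl, hr⟩
      ⟨hx.1.le, hx.2.le⟩).mul_continuousOn (g := fun t => Real.exp (κ * t)) (by fun_prop)
    exact (integrable_vol_of_intervalIntegrable hx.1.le this).const_mul c
  set G : ℝ × ℝ → ℝ := fun z =>
    (Ioo 0 x).indicator (fun s => c * (majorant r q a b s * Real.exp (κ * s))) z.1 *
      (Ioo 0 r).indicator (fun _ => (1 : ℝ)) z.2 with hG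
  have hGi : Integrable G := by
    refine Integrable.mul_prod
      (f := (Ioo 0 x).indicator fun s => c * (majorant r q a b s * Real.exp (κ * s)))
      (g := (Ioo 0 r).indicator (fun _ => (1 : ℝ))) ?_ ?_
    · exact (integrable_indicator_iff measurableSet_Ioo).2 hi
    · exact (integrable_indicator_iff measurableSet_Ioo).2 (integrable_const _)
  have hle : ∀ z : ℝ × ℝ, ‖(triangle r).indicator (fun z => srcKer q a b v z.1 z.2 i k) z *
      (waveKer z.1 z.2 x t : ℂ)‖ ≤ G z := by
    intro z
    have hG0 : 0 ≤ G z := mul_nonneg (indicator_nonneg (fun s _ => mul_nonneg hc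
      (mul_nonneg (majorant_nonneg s) (Real.exp_pos _).le)) _)
      (indicator_nonneg (fun _ _ => zero_le_one) _)
    by_cases hz : z ∈ triangle r
    · by_cases hzx : z.1 < x
      · rw [norm_mul]
        refine (mul_le_of_le_one_right (norm_nonneg _) (norm_waveKer_le _ _ _ _)).trans ?_
        refine (h.norm_indicator_srcKer_le (M := fun s => c * Real.exp (κ * s))
          (fun s => by positivity) (fun s s' hs => mul_le_mul_of_nonneg_left
            (Real.exp_le_exp.2 (mul_le_mul_of_nonneg_left hs hκ.le)) hc) (fun s τ _ => hv s τ) i k z).trans ?_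
        rw [hG]
        simp only
        rw [indicator_of_mem (triangle_subset hz).1,
          indicator_of_mem (show z.1 ∈ Ioo 0 x from ⟨(triangle_subset hz).1.1, hzx⟩)]
        refine le_of_eq ?_
        ring
      · rw [waveKer_eq_zero hz.1.le ht.le (not_lt.1 hzx)]
        simpa using hG0
    · rw [indicator_of_notMem hz, zero_mul, norm_zero]; exact hG0
  calc _ ≤ ∫ z, G z := norm_integral_le_of_norm_le hGi (ae_of_all _ hle)
    _ = (∫ s, (Ioo 0 x).indicator (fun s => c * (majorant r q a b s * Real.exp (κ * s))) s) *
        ∫ s, (Ioo 0 r).indicator (fun _ => (1 : ℝ)) s := integral_prod_mul _ _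
    _ = (c * ∫ s in (0 : ℝ)..x, majorant r q a b s * Real.exp (κ * s)) * r := by
        rw [integral_indicator measurableSet_Ioo, integral_indicator measurableSet_Ioo,
          integral_const_mul, intervalIntegral_eq_vol _ hx.1.le]
        simp [hr]
    _ = c * ∫ s in (0 : ℝ)..x, |r| * majorant r q a b s * Real.exp (κ * s) := by
        rw [abs_of_nonneg hr]
        simp only [mul_assoc r]
        rw [intervalIntegral.integral_const_mul]
        ring
    _ ≤ c * (1 / 2 * Real.exp (κ * x)) := by
        gcongr
        exact hw x ⟨hx.1.le, hx.2.le⟩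
    _ = _ := by ring

/-- The kernel of the solution `X = I + v` of `AX - XA = A Q X A` with value `c` at the corner. -/
theorem exists_kernel (h : IsCoeff r q a b) (c : Matrix (Fin p) (Fin p) ℂ) :
    ∃ v : ℝ → ℝ → Matrix (Fin p) (Fin p) ℂ, (∀ i k, Measurable fun z : ℝ × ℝ => v z.1 z.2 i k) ∧
      (∃ C : ℝ, 0 ≤ C ∧ ∀ s τ, s < r → ∀ i k, ‖v s τ i k‖ ≤ C) ∧
      ∀ x ∈ Ioo 0 r, ∀ t, 0 < t → ∀ i k, v x t i k = c i k +
        waveSol volume id id ((Ioo 0 r).indicator fun s => q s i k) x t +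
        waveSol volume Prod.fst Prod.snd ((triangle r).indicator fun z => (a z.1 * b z.2) i k) x t +
        waveSol volume Prod.fst Prod.snd
          ((triangle r).indicator fun z => srcKer q a b v z.1 z.2 i k) x t := by
  obtain ⟨κ, hκ, hhalf⟩ := h.exists_halving
  -- Matrix kernels are encoded as scalar functions of an index pair and a point, so that the fixed
  -- point principle applies with values in `ℂ`.
  let toK : ((Fin p × Fin p) × ℝ × ℝ → ℂ) → ℝ → ℝ → Matrix (Fin p) (Fin p) ℂ :=
    fun f s τ => Matrix.of fun i k => f ((i, k), (s, τ))
  -- The halving estimate needs `0 < x < r` and `t > 0`. Outside this set the iteration is replaced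
  -- by `0`, where the weighted bound is trivial.
  let S : Set (ℝ × ℝ) := {z | z.1 ∈ Ioo 0 r ∧ 0 < z.2}
  have hS : MeasurableSet S := (measurable_fst measurableSet_Ioo).inter
    (measurableSet_lt measurable_const measurable_snd)
  let T : ((Fin p × Fin p) × ℝ × ℝ → ℂ) → (Fin p × Fin p) × ℝ × ℝ → ℂ := fun f ω =>
    S.indicator (fun z => waveSol volume Prod.fst Prod.snd ((triangle r).indicator
      fun z => srcKer q a b (toK f) z.1 z.2 ω.1.1 ω.1.2) z.1 z.2) ω.2
  let v₀ : (Fin p × Fin p) × ℝ × ℝ → ℂ := fun ω =>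
    S.indicator (fun z => c ω.1.1 ω.1.2 +
      waveSol volume id id ((Ioo 0 r).indicator fun s => q s ω.1.1 ω.1.2) z.1 z.2 +
      waveSol volume Prod.fst Prod.snd
        ((triangle r).indicator fun z => (a z.1 * b z.2) ω.1.1 ω.1.2) z.1 z.2) ω.2
  have hqi : ∀ i k, Integrable ((Ioo 0 r).indicator fun s => q s i k) := fun i k =>
    (integrable_indicator_iff measurableSet_Ioo).2 ((h.memLp_q i k).integrable one_le_two)
  let c₀ : ℝ := ∑ ik : Fin p × Fin p, (‖c ik.1 ik.2‖ +
    (∫ s, ‖(Ioo 0 r).indicator (fun s => q s ik.1 ik.2) s‖) +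
    ∫ z, ‖(triangle r).indicator (fun z => (a z.1 * b z.2) ik.1 ik.2) z‖)
  have hterm : ∀ ik : Fin p × Fin p, 0 ≤ (‖c ik.1 ik.2‖ +
    (∫ s, ‖(Ioo 0 r).indicator (fun s => q s ik.1 ik.2) s‖) +
    ∫ z, ‖(triangle r).indicator (fun z => (a z.1 * b z.2) ik.1 ik.2) z‖) := fun ik =>
    add_nonneg (add_nonneg (norm_nonneg _) (integral_nonneg fun _ => norm_nonneg _))
      (integral_nonneg fun _ => norm_nonneg _)
  have hc₀ : 0 ≤ c₀ := Finset.sum_nonneg fun ik _ => hterm ik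
  have hTm : ∀ f, (∀ i k, Measurable fun z => f ((i, k), z)) →
      ∀ i k, Measurable fun z => T f ((i, k), z) := fun f hf i k =>
    Measurable.indicator (measurable_waveSol measurable_fst measurable_snd
      ((h.measurable_srcKer (v := toK f) hf i k).indicator measurableSet_triangle)) hS
  have hbr : ∀ {f : (Fin p × Fin p) × ℝ × ℝ → ℂ} {d : ℝ},
      (∀ ω, ‖f ω‖ ≤ d * Real.exp (κ * ω.2.1)) →
      ∀ s τ, s < r → ∀ l k, ‖toK f s τ l k‖ ≤ |d| * Real.exp (κ * r) := by
    intro f d hf s τ hs l k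
    refine (hf ((l, k), (s, τ))).trans ?_
    gcongr
    exact le_abs_self d
  obtain ⟨f, hfm, hfb, hf⟩ := exists_fixedPoint (Ω := (Fin p × Fin p) × ℝ × ℝ) (M := ℂ)
    (fun f => ∀ i k, Measurable fun z => f ((i, k), z))
    (fun f g hf hg i k => (hf i k).add (hg i k)) (fun f hf i k => (hf i k).neg)
    (fun s hs f hf i k => measurable_of_tendsto_metrizable (fun n => hs n i k)
      (tendsto_pi_nhds.2 fun z => hf ((i, k), z)))
    (fun ω => Real.exp (κ * ω.2.1)) (fun ω => (Real.exp_pos _).le) T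
    (fun f d hf hd hb => ⟨hTm f hf, fun ω => by
      by_cases hω : ω.2 ∈ S
      · simp only [T]
        rw [indicator_of_mem hω]
        exact hhalf (toK f) d hd (fun s τ l k => hb ((l, k), (s, τ))) _ hω.1 _ hω.2 _ _
      · simp only [T]
        rw [indicator_of_notMem hω, norm_zero]; positivity⟩)
    (fun f g d hf hg hbf hbg => by
      funext ω
      simp only [T, Pi.sub_apply]
      by_cases hω : ω.2 ∈ S
      · rw [indicator_of_mem hω, indicator_of_mem hω, indicator_of_mem hω]
        simp only [waveSol]
        rw [← integral_sub
          (waveSol_integrable measurable_fst measurable_snd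
            (h.integrable_indicator_srcKer hf (by positivity) (hbr hbf) _ _) _ _)
          (waveSol_integrable measurable_fst measurable_snd
            (h.integrable_indicator_srcKer hg (by positivity) (hbr hbg) _ _) _ _)]
        refine integral_congr_ae (ae_of_all _ fun z => ?_)
        simp only
        rw [← sub_mul]
        congr 1
        by_cases hz : z ∈ triangle r
        · rw [indicator_of_mem hz, indicator_of_mem hz, indicator_of_mem hz, ← Matrix.sub_apply,
            ← h.srcKer_sub hf hg (hbr hbf) (hbr hbg) hz]
          rfl
        · rw [indicator_of_notMem hz, indicator_of_notMem hz, indicator_of_notMem hz, sub_zero]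
      · rw [indicator_of_notMem hω, indicator_of_notMem hω, indicator_of_notMem hω, sub_zero])
    (v₀ := v₀) (c₀ := c₀)
    (fun i k => by
      have h1 : Measurable fun z : ℝ × ℝ => waveSol volume id id
          ((Ioo 0 r).indicator fun s => q s i k) z.1 z.2 :=
        measurable_waveSol measurable_id measurable_id ((h.meas_q i k).indicator measurableSet_Ioo)
      have h2 : Measurable fun z : ℝ × ℝ => (a z.1 * b z.2) i k := by
        simp only [Matrix.mul_apply]
        exact Finset.measurable_fun_sum _ fun l _ => ((h.meas_a i l).comp measurable_fst).mul
          ((h.meas_b l k).comp measurable_snd)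
      have h3 : Measurable fun z : ℝ × ℝ => waveSol volume Prod.fst Prod.snd
          ((triangle r).indicator fun z => (a z.1 * b z.2) i k) z.1 z.2 :=
        measurable_waveSol measurable_fst measurable_snd (h2.indicator measurableSet_triangle)
      exact ((h1.const_add (c i k)).add h3).indicator hS) hc₀
    (fun ω => by
      by_cases hω : ω.2 ∈ S
      · simp only [v₀]
        rw [indicator_of_mem hω]
        have h1 : (1 : ℝ) ≤ Real.exp (κ * ω.2.1) := Real.one_le_exp (mul_nonneg hκ.le hω.1.1.le)
        refine le_trans ?_ (le_mul_of_one_le_right hc₀ h1)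
        refine le_trans ?_ (Finset.single_le_sum (fun ik _ => hterm ik) (Finset.mem_univ ω.1))
        refine (norm_add_le _ _).trans (add_le_add ((norm_add_le _ _).trans
          (add_le_add le_rfl ?_)) ?_)
        · exact norm_waveSol_le (hqi _ _) _ _
        · exact norm_waveSol_le (h.integrable_indicator_mul _ _) _ _
      · simp only [v₀]
        rw [indicator_of_notMem hω, norm_zero]; positivity)
  refine ⟨toK f, hfm, ⟨_, by positivity, hbr hfb⟩, fun x hx t ht i k => ?_⟩
  have h1 := hf ((i, k), (x, t))
  have hω : ((x, t) : ℝ × ℝ) ∈ S := ⟨hx, ht⟩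
  simp only [v₀, T] at h1
  rw [indicator_of_mem hω, indicator_of_mem hω] at h1
  exact h1

end IsCoeff

end Coefficients

/-! ### Entrywise integration of vector functions -/

section VectorIntegrals

theorem mulVec_apply_sum {ι κ : Type*} [Fintype κ] (A : Matrix ι κ ℂ) (w : κ → ℂ) (i : ι) :
    (A *ᵥ w) i = ∑ k, A i k * w k := rfl

variable {ι κ : Type*} [Fintype ι] [Fintype κ]

theorem intervalIntegrable_pi {F : ℝ → ι → ℂ} {a b : ℝ}
    (h : ∀ i, IntervalIntegrable (fun t => F t i) volume a b) : IntervalIntegrable F volume a b := by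
  rw [intervalIntegrable_iff]
  exact Integrable.of_eval fun i => (intervalIntegrable_iff.1 (h i))

theorem intervalIntegrable_sum {F : κ → ℝ → ℂ} {a b : ℝ}
    (h : ∀ k, IntervalIntegrable (F k) volume a b) :
    IntervalIntegrable (fun t => ∑ k, F k t) volume a b := by
  have := IntervalIntegrable.sum Finset.univ fun k _ => h k
  rwa [show ∑ k, F k = fun t => ∑ k, F k t from funext fun t => Finset.sum_apply _ _ _] at this

theorem intervalIntegrable_mulVec {M : ℝ → Matrix ι κ ℂ} {f : ℝ → κ → ℂ} {a b : ℝ}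
    (h : ∀ i k, IntervalIntegrable (fun t => M t i k * f t k) volume a b) :
    IntervalIntegrable (fun t => M t *ᵥ f t) volume a b := by
  refine intervalIntegrable_pi fun i => ?_
  simp only [mulVec_apply_sum]
  exact intervalIntegrable_sum fun k => h i k

theorem intervalIntegral_mulVec_apply {M : ℝ → Matrix ι κ ℂ} {f : ℝ → κ → ℂ} {a b : ℝ}
    (h : ∀ i k, IntervalIntegrable (fun t => M t i k * f t k) volume a b) (i : ι) :
    (∫ t in a..b, M t *ᵥ f t) i = ∑ k, ∫ t in a..b, M t i k * f t k := by
  rw [intervalIntegral_apply (intervalIntegrable_mulVec h)]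
  simp only [mulVec_apply_sum]
  exact intervalIntegral.integral_finsetSum fun k _ => h i k

theorem mulVec_intervalIntegral (A : Matrix ι κ ℂ) {f : ℝ → κ → ℂ} {a b : ℝ}
    (hf : IntervalIntegrable f volume a b) :
    A *ᵥ ∫ t in a..b, f t = ∫ t in a..b, A *ᵥ f t :=
  ((Matrix.mulVecLin A).toContinuousLinearMap.intervalIntegral_comp_comm hf).symm

theorem intervalIntegrable_const_mulVec (A : Matrix ι κ ℂ) {f : ℝ → κ → ℂ} {a b : ℝ}
    (hf : IntervalIntegrable f volume a b) : IntervalIntegrable (fun t => A *ᵥ f t) volume a b := by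
  rw [intervalIntegrable_iff] at hf ⊢
  exact (Matrix.mulVecLin A).toContinuousLinearMap.integrable_comp hf

end VectorIntegrals

/-! ### The commutator of a Volterra kernel with double integration -/

section Commutator

variable {r x : ℝ} {k k' : ℝ → ℝ → ℂ} {C C' : ℝ} {f : ℝ → ℂ}

/-- The commutator with `A` of the integral operator with kernel `k`, applied to `f`. -/
noncomputable def comm (k : ℝ → ℝ → ℂ) (f : ℝ → ℂ) (x : ℝ) : ℂ :=
  (∫ w in (0 : ℝ)..x, ((w - x : ℝ) : ℂ) * ∫ t in (0 : ℝ)..w, k w t * f t) -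
    ∫ w in (0 : ℝ)..x, k x w * ∫ t in (0 : ℝ)..w, ((t - w : ℝ) : ℂ) * f t

theorem integrable_sub_vol (hx : 0 ≤ x) : Integrable (fun w : ℝ => ((w - x : ℝ) : ℂ)) (vol x) :=
  integrable_vol_of_intervalIntegrable hx (Continuous.intervalIntegrable (by fun_prop) _ _)

theorem integrable_of_kernel_row (hk : Measurable fun z : ℝ × ℝ => k z.1 z.2)
    (hC : ∀ t ∈ Ioo 0 x, ‖k x t‖ ≤ C) : Integrable (fun t => k x t) (vol x) :=
  (memLp_of_bounded (hk.comp (measurable_const.prodMk measurable_id)).aestronglyMeasurable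
    hC 1).integrable le_rfl

theorem integrable_kernel_mul (hk : Measurable fun z : ℝ × ℝ => k z.1 z.2)
    (hC : ∀ t ∈ Ioo 0 x, ‖k x t‖ ≤ C) (hf : Integrable f (vol x)) :
    Integrable (fun t => k x t * f t) (vol x) :=
  hf.bdd_mul (hk.comp (measurable_const.prodMk measurable_id)).aestronglyMeasurable
    (ae_vol_of_forall hC)

theorem intervalIntegrable_zero_of_vol {E : Type*} [NormedAddCommGroup E] {f : ℝ → E} (hx : 0 ≤ x)
    (hf : Integrable f (vol x)) : IntervalIntegrable f volume 0 x :=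
  intervalIntegrable_of_vol hf ⟨le_rfl, hx⟩ ⟨hx, le_rfl⟩

theorem integrable_lin_kernel (hf : Integrable f (vol x)) :
    Integrable (fun w => ∫ t in (0 : ℝ)..w, ((t - w : ℝ) : ℂ) * f t) (vol x) := by
  have := triangle_integrable_fst (φ := fun _ => 1) (k := fun w t => ((t - w : ℝ) : ℂ)) (C := x)
    (integrable_const _) hf (by fun_prop) (fun w t h1 h2 h3 => by
      rw [Complex.norm_real, Real.norm_eq_abs, abs_le]; constructor <;> linarith)
  simpa using this

/-- Both kernels equal `-c (x - t)² / 2`. A constant kernel is therefore invisible in the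
intertwining relation, and the constant can be used to prescribe the action of `X` on constant
functions. -/
theorem comm_const (hx : 0 ≤ x) (hf : Integrable f (vol x)) (c : ℂ) :
    comm (fun _ _ => c) f x = 0 := by
  unfold comm
  rw [triangle_swap (C := ‖c‖) (k := fun _ _ => c) hx (integrable_sub_vol hx) hf measurable_const
      (by simp),
    triangle_swap (φ := fun _ => c) (k := fun w t => ((t - w : ℝ) : ℂ)) (C := x) hx
      (integrable_const _) hf (by fun_prop) (fun w t h1 h2 h3 => by
        rw [Complex.norm_real, Real.norm_eq_abs, abs_le]; constructor <;> linarith), sub_eq_zero]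
  refine intervalIntegral.integral_congr fun t _ => ?_
  refine congrArg (· * f t) ?_
  rw [intervalIntegral.integral_mul_const, intervalIntegral.integral_const_mul,
    intervalIntegral.integral_ofReal, intervalIntegral.integral_ofReal,
    intervalIntegral.integral_sub (by simp) (by simp),
    intervalIntegral.integral_sub (by simp) (by simp)]
  simp only [integral_id, intervalIntegral.integral_const, smul_eq_mul]
  push_cast; ring

theorem comm_add (hx : 0 ≤ x) (hf : Integrable f (vol x))
    (hk : Measurable fun z : ℝ × ℝ => k z.1 z.2) (hk' : Measurable fun z : ℝ × ℝ => k' z.1 z.2)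
    (hC : ∀ w t, 0 < t → t < w → w ≤ x → ‖k w t‖ ≤ C)
    (hC' : ∀ w t, 0 < t → t < w → w ≤ x → ‖k' w t‖ ≤ C') :
    comm (fun w t => k w t + k' w t) f x = comm k f x + comm k' f x := by
  have hA := integrable_lin_kernel hf
  unfold comm
  have e1 : ∫ w in (0 : ℝ)..x, ((w - x : ℝ) : ℂ) * ∫ t in (0 : ℝ)..w, (k w t + k' w t) * f t =
      (∫ w in (0 : ℝ)..x, ((w - x : ℝ) : ℂ) * ∫ t in (0 : ℝ)..w, k w t * f t) +
      ∫ w in (0 : ℝ)..x, ((w - x : ℝ) : ℂ) * ∫ t in (0 : ℝ)..w, k' w t * f t := by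
    rw [← intervalIntegral.integral_add
      (intervalIntegrable_zero_of_vol hx (triangle_integrable_fst (integrable_sub_vol hx) hf hk
        fun w t h1 h2 h3 => hC w t h1 h2 h3.le))
      (intervalIntegrable_zero_of_vol hx (triangle_integrable_fst (integrable_sub_vol hx) hf hk'
        fun w t h1 h2 h3 => hC' w t h1 h2 h3.le))]
    refine intervalIntegral_congr_Ioo hx fun w hw => ?_
    rw [← mul_add, ← intervalIntegral.integral_add
      (intervalIntegrable_zero_of_vol hw.1.le (integrable_kernel_mul hk
        (fun t ht => hC w t ht.1 ht.2 hw.2.le) (integrable_vol_mono hf hw.2.le)))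
      (intervalIntegrable_zero_of_vol hw.1.le (integrable_kernel_mul hk'
        (fun t ht => hC' w t ht.1 ht.2 hw.2.le) (integrable_vol_mono hf hw.2.le)))]
    simp only [add_mul]
  have e2 : ∫ w in (0 : ℝ)..x, (k x w + k' x w) * ∫ t in (0 : ℝ)..w, ((t - w : ℝ) : ℂ) * f t =
      (∫ w in (0 : ℝ)..x, k x w * ∫ t in (0 : ℝ)..w, ((t - w : ℝ) : ℂ) * f t) +
      ∫ w in (0 : ℝ)..x, k' x w * ∫ t in (0 : ℝ)..w, ((t - w : ℝ) : ℂ) * f t := by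
    rw [← intervalIntegral.integral_add
      (intervalIntegrable_zero_of_vol hx (integrable_kernel_mul hk
        (fun t ht => hC x t ht.1 ht.2 le_rfl) hA))
      (intervalIntegrable_zero_of_vol hx (integrable_kernel_mul hk'
        (fun t ht => hC' x t ht.1 ht.2 le_rfl) hA))]
    simp only [add_mul]
  rw [e1, e2]; ring

theorem comm_congr (hx : 0 ≤ x) (h : ∀ w t, 0 < t → t < w → w ≤ x → k w t = k' w t) :
    comm k f x = comm k' f x := by
  unfold comm
  congr 1
  · refine intervalIntegral_congr_Ioo hx fun w hw => ?_
    congr 1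
    refine intervalIntegral_congr_Ioo hw.1.le fun t ht => ?_
    rw [h w t ht.1 ht.2 hw.2.le]
  · refine intervalIntegral_congr_Ioo hx fun w hw => ?_
    rw [h x w hw.1 hw.2 le_rfl]

/-- Point sources on the diagonal with density `q` superpose to multiplication by `q`, so the
commutator is `A q A f`. The analogue for sources in the open triangle is `comm_waveSol_triangle`,
where the middle factor is the integral operator with kernel `y`. -/
theorem comm_waveSol_diag (hx : 0 ≤ x) (hxr : x ≤ r) (hf : Integrable f (vol x)) {q : ℝ → ℂ}
    (hqm : Measurable q) (hq : Integrable q (vol r)) :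
    comm (waveSol volume id id ((Ioo 0 r).indicator q)) f x =
      ∫ s in (0 : ℝ)..x, ((s - x : ℝ) : ℂ) * (q s * ∫ t in (0 : ℝ)..s, ((t - s : ℝ) : ℂ) * f t) := by
  unfold comm
  rw [waveSol_commutator measurable_id measurable_id (hqm.indicator measurableSet_Ioo)
    ((integrable_indicator_iff measurableSet_Ioo).2 hq) ?_ hx hf, intervalIntegral_eq_vol _ hx,
    ← integral_indicator measurableSet_Ioo]
  · refine integral_congr_ae (ae_of_all _ fun s => ?_)
    simp only [id]
    by_cases hs : s ∈ Ioo 0 x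
    · rw [indicator_of_mem hs, indicator_of_mem (show s ∈ Ioo 0 r from ⟨hs.1, hs.2.trans_le hxr⟩),
        if_pos hs.2.le]
      ring
    · rw [indicator_of_notMem hs]
      by_cases hs0 : s ∈ Ioo 0 r
      · rcases lt_trichotomy s x with h | h | h
        · exact absurd ⟨hs0.1, h⟩ hs
        · simp [h]
        · simp [not_le.2 h]
      · rw [indicator_of_notMem hs0, zero_mul]
  · intro s hs
    have : s ∈ Ioo 0 r := mem_of_indicator_ne_zero hs
    exact ⟨this.1.le, le_rfl⟩

theorem norm_lin_integral_le (hf : Integrable f (vol x)) {τ : ℝ} (hτ : τ ∈ Icc 0 x) :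
    ‖∫ t in (0 : ℝ)..τ, ((t - τ : ℝ) : ℂ) * f t‖ ≤ x * ∫ t, ‖f t‖ ∂(vol x) := by
  calc ‖∫ t in (0 : ℝ)..τ, ((t - τ : ℝ) : ℂ) * f t‖ ≤ ∫ t in (0 : ℝ)..τ, x * ‖f t‖ := by
        refine norm_intervalIntegral_le_vol hτ.1
          ((integrable_vol_mono hf hτ.2).norm.const_mul x) fun t ht => ?_
        rw [norm_mul]
        gcongr
        rw [Complex.norm_real, Real.norm_eq_abs, abs_le]
        constructor <;> linarith [ht.1, ht.2, hτ.2]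
    _ = x * ∫ t, ‖f t‖ ∂(vol τ) := by
        rw [intervalIntegral.integral_const_mul, intervalIntegral_eq_vol _ hτ.1]
    _ ≤ _ := by
        refine mul_le_mul_of_nonneg_left ?_ (hτ.1.trans hτ.2)
        exact integral_mono_measure (vol_mono hτ.2) (ae_of_all _ fun t => norm_nonneg _) hf.norm

theorem integrable_triangle_inner {y : ℝ × ℝ → ℂ} (hy : Integrable ((triangle r).indicator y))
    {G : ℝ → ℂ} (hGm : Measurable G) (hG : ∀ τ ∈ Ioo 0 r, ‖G τ‖ ≤ C) :
    Integrable (fun s => ∫ τ in (0 : ℝ)..s, y (s, τ) * G τ) (vol r) := by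
  have h1 : Integrable (fun z : ℝ × ℝ => (triangle r).indicator y z * (Ioo 0 r).indicator G z.2)
      (volume.prod volume) := by
    rw [← Measure.volume_eq_prod]
    refine hy.mul_bdd (c := |C|) ((hGm.indicator measurableSet_Ioo).comp
      measurable_snd).aestronglyMeasurable (ae_of_all _ fun z => ?_)
    by_cases hz : z.2 ∈ Ioo 0 r
    · rw [indicator_of_mem hz]; exact (hG _ hz).trans (le_abs_self C)
    · rw [indicator_of_notMem hz]; simp
  refine h1.integral_prod_left.restrict.congr (ae_vol_of_forall fun s hs => ?_)
  simp only
  rw [intervalIntegral_eq_vol _ hs.1.le, ← integral_indicator measurableSet_Ioo]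
  refine integral_congr_ae (ae_of_all _ fun τ => ?_)
  simp only
  by_cases hτ : τ ∈ Ioo 0 s
  · rw [indicator_of_mem hτ, indicator_of_mem (show (s, τ) ∈ triangle r from ⟨hτ.1, hτ.2, hs.2⟩),
      indicator_of_mem (show τ ∈ Ioo 0 r from ⟨hτ.1, hτ.2.trans hs.2⟩)]
  · rw [indicator_of_notMem hτ, indicator_of_notMem (fun h => hτ ⟨h.1, h.2.1⟩), zero_mul]

theorem comm_waveSol_triangle (hx : 0 ≤ x) (hxr : x ≤ r) (hfm : Measurable f)
    (hf : Integrable f (vol x)) {y : ℝ × ℝ → ℂ} (hym : Measurable y)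
    (hy : Integrable ((triangle r).indicator y)) :
    comm (waveSol volume Prod.fst Prod.snd ((triangle r).indicator y)) f x =
      ∫ s in (0 : ℝ)..x, ((s - x : ℝ) : ℂ) *
        ∫ τ in (0 : ℝ)..s, y (s, τ) * ∫ t in (0 : ℝ)..τ, ((t - τ : ℝ) : ℂ) * f t := by
  unfold comm
  set G : ℝ → ℂ := fun τ => ∫ t in (0 : ℝ)..τ, ((t - τ : ℝ) : ℂ) * f t with hG
  have hGm : Measurable G := (stronglyMeasurable_intervalIntegral
    (F := fun τ t => ((t - τ : ℝ) : ℂ) * f t) (Measurable.stronglyMeasurable (by fun_prop))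
    measurable_const measurable_id).measurable
  have hGb : ∀ τ ∈ Icc 0 x, ‖G τ‖ ≤ x * ∫ t, ‖f t‖ ∂(vol x) :=
    fun τ hτ => norm_lin_integral_le hf hτ
  have hsupp : ∀ z : ℝ × ℝ, (triangle r).indicator y z ≠ 0 → z ∈ triangle r :=
    fun z hz => mem_of_indicator_ne_zero hz
  rw [waveSol_commutator measurable_fst measurable_snd (hym.indicator measurableSet_triangle)
    hy (fun z hz => ⟨(hsupp z hz).1.le, (hsupp z hz).2.1.le⟩) hx hf]
  have hint : Integrable fun z : ℝ × ℝ => (triangle r).indicator y z *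
      (((if z.1 ≤ x then z.1 - x else 0 : ℝ) : ℂ) * G z.2) := by
    have h1 : Integrable fun z : ℝ × ℝ => (x * (x * ∫ t, ‖f t‖ ∂(vol x))) *
        ‖(triangle r).indicator y z‖ := hy.norm.const_mul _
    refine h1.mono' ?_ (ae_of_all _ fun z => ?_)
    · refine hy.aestronglyMeasurable.mul (Measurable.mul ?_
        (hGm.comp measurable_snd)).aestronglyMeasurable
      exact Complex.measurable_ofReal.comp (Measurable.ite (measurableSet_le (by fun_prop)
        (by fun_prop)) (by fun_prop) (by fun_prop))
    · by_cases hz : (triangle r).indicator y z = 0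
      · simp [hz]
      · have hz' := hsupp z hz
        rw [norm_mul, mul_comm]
        gcongr
        by_cases hzx : z.1 ≤ x
        · rw [if_pos hzx, norm_mul]
          refine mul_le_mul ?_ (hGb _ ⟨hz'.1.le, hz'.2.1.le.trans hzx⟩) (norm_nonneg _) hx
          rw [Complex.norm_real, Real.norm_eq_abs, abs_le]
          constructor <;> linarith [hz'.1, hz'.2.1]
        · have : 0 ≤ ∫ t, ‖f t‖ ∂(vol x) := integral_nonneg fun _ => norm_nonneg _
          rw [if_neg hzx]; simp; positivity
  rw [Measure.volume_eq_prod] at hint ⊢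
  rw [integral_prod _ hint, intervalIntegral_eq_vol _ hx, ← integral_indicator measurableSet_Ioo]
  refine integral_congr_ae (ae_of_all _ fun s => ?_)
  simp only
  by_cases hs : s ∈ Ioo 0 x
  · rw [indicator_of_mem hs, intervalIntegral_eq_vol _ hs.1.le,
      ← integral_indicator measurableSet_Ioo, ← integral_const_mul]
    refine integral_congr_ae (ae_of_all _ fun τ => ?_)
    simp only
    by_cases hτ : τ ∈ Ioo 0 s
    · rw [indicator_of_mem hτ, indicator_of_mem (show (s, τ) ∈ triangle r from
        ⟨hτ.1, hτ.2, hs.2.trans_le hxr⟩), if_pos hs.2.le]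
      ring
    · rw [indicator_of_notMem hτ, indicator_of_notMem (fun h => hτ ⟨h.1, h.2.1⟩)]
      ring
  · rw [indicator_of_notMem hs]
    rw [integral_eq_zero_of_ae]
    refine ae_of_all _ fun τ => ?_
    by_cases hz : (s, τ) ∈ triangle r
    · have hs0 : 0 < s := hz.1.trans hz.2.1
      rcases lt_trichotomy s x with h | h | h
      · exact absurd ⟨hs0, h⟩ hs
      · simp [h]
      · simp [not_le.2 h]
    · simp only [indicator_of_notMem hz, zero_mul, Pi.zero_apply]

end Commutator

/-! ### The intertwining relation `AX - XA = AQXA` -/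

section Intertwining

variable {p : ℕ} {ν : Type*} [Fintype ν] {r : ℝ} {q : ℝ → Matrix (Fin p) (Fin p) ℂ}
  {a : ℝ → Matrix (Fin p) ν ℂ} {b : ℝ → Matrix ν (Fin p) ℂ}
  {v : ℝ → ℝ → Matrix (Fin p) (Fin p) ℂ} {C : ℝ}

/-- The integral operator `f ↦ f + ∫_0^x v(x,t) f(t) dt`. -/
noncomputable abbrev opX (v : ℝ → ℝ → Matrix (Fin p) (Fin p) ℂ) : Op p := opV (fun _ => 1) v

theorem opX_apply (v : ℝ → ℝ → Matrix (Fin p) (Fin p) ℂ) (f : ℝ → Fin p → ℂ) (x : ℝ) :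
    opX v f x = f x + ∫ t in (0 : ℝ)..x, v x t *ᵥ f t := by
  simp [opX, opV]

/-- The complete source density of `X = I + v`. -/
noncomputable def fullKer (q : ℝ → Matrix (Fin p) (Fin p) ℂ) (a : ℝ → Matrix (Fin p) ν ℂ)
    (b : ℝ → Matrix ν (Fin p) ℂ) (v : ℝ → ℝ → Matrix (Fin p) (Fin p) ℂ) (s τ : ℝ) :
    Matrix (Fin p) (Fin p) ℂ := a s * b τ + srcKer q a b v s τ

/-- This explains the density `fullKer`: in the composition `Q (I + v)` the multiplication `q` stays
on the diagonal, `Q` itself contributes `a(s) b(τ)`, and exchanging the integrals in `a ∫ b (v g)`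
gives the remaining term of `srcKer`. -/
theorem opQ_opX (h : IsCoeff r q a b) (hvm : ∀ i k, Measurable fun z : ℝ × ℝ => v z.1 z.2 i k)
    (hv : ∀ s τ, s < r → ∀ i k, ‖v s τ i k‖ ≤ C) {g : ℝ → Fin p → ℂ} (hg : MemL2 r g) {s : ℝ}
    (hs : s ∈ Ioo 0 r) :
    opQ q a b (opX v g) s = q s *ᵥ g s + ∫ τ in (0 : ℝ)..s, fullKer q a b v s τ *ᵥ g τ := by
  have hs0 := hs.1.le
  have hgs : ∀ k, Integrable (fun τ => g τ k) (vol s) := fun k =>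
    integrable_vol_mono ((memL2_iff.1 hg k).integrable one_le_two) hs.2.le
  have hvC : ∀ i k, ∀ w t : ℝ, 0 < t → t < w → w < s → ‖v w t i k‖ ≤ C :=
    fun i k w t _ _ hw => hv w t (hw.trans hs.2) i k
  have hbs : ∀ l k, Integrable (fun σ => b σ l k) (vol s) := fun l k =>
    integrable_vol_mono ((h.memLp_b l k).integrable one_le_two) hs.2.le
  have hbg : ∀ l k, IntervalIntegrable (fun σ => b σ l k * g σ k) volume 0 s := fun l k => by
    refine intervalIntegrable_zero_of_vol hs0 (integrable_vol_mono ?_ hs.2.le)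
    exact (h.memLp_b l k).integrable_mul (memL2_iff.1 hg k)
  have hvg : ∀ w ∈ Ioc 0 s, ∀ i k, IntervalIntegrable (fun t => v w t i k * g t k) volume 0 w :=
    fun w hw i k => intervalIntegrable_zero_of_vol hw.1.le (integrable_kernel_mul
      (k := fun w t => v w t i k) (hvm i k) (fun t _ => hv w t (hw.2.trans_lt hs.2) i k)
      (integrable_vol_mono (hgs k) hw.2))
  have hfst : ∀ l m k, IntervalIntegrable
      (fun σ => b σ l m * ∫ t in (0 : ℝ)..σ, v σ t m k * g t k) volume 0 s := fun l m k =>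
    intervalIntegrable_zero_of_vol hs0 (triangle_integrable_fst (hbs l m) (hgs k) (hvm m k) (hvC m k))
  have hsnd : ∀ l m k, IntervalIntegrable
      (fun t => (∫ σ in t..s, b σ l m * v σ t m k) * g t k) volume 0 s := fun l m k =>
    intervalIntegrable_zero_of_vol hs0 (triangle_integrable_snd (hbs l m) (hgs k) (hvm m k) (hvC m k))
  have hmint : ∀ t ∈ Ioo 0 s, ∀ l k, mint t s (fun σ => b σ * v σ t) l k =
      ∑ m, ∫ σ in t..s, b σ l m * v σ t m k := by
    intro t ht l k
    simp only [mint, Matrix.of_apply, Matrix.mul_apply]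
    refine intervalIntegral.integral_finsetSum fun m _ => ?_
    refine intervalIntegrable_of_vol (r := s) ?_ ⟨ht.1.le, ht.2.le⟩ ⟨hs0, le_rfl⟩
    refine (hbs l m).mul_bdd (c := C) ?_
      (ae_vol_of_forall fun σ hσ => hv σ _ (hσ.2.trans hs.2) m k)
    exact ((hvm m k).comp (measurable_id.prodMk measurable_const)).aestronglyMeasurable
  have hmg : ∀ l k, IntervalIntegrable
      (fun t => mint t s (fun σ => b σ * v σ t) l k * g t k) volume 0 s := by
    intro l k
    refine (intervalIntegrable_sum fun m => hsnd l m k).congr_ae ?_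
    rw [uIoc_of_le hs0, ← Measure.restrict_congr_set Ioo_ae_eq_Ioc]
    refine ae_vol_of_forall fun t ht => ?_
    simp only [hmint t ht, Finset.sum_mul]
  have hiv : IntervalIntegrable (fun σ => b σ *ᵥ ∫ t in (0 : ℝ)..σ, v σ t *ᵥ g t) volume 0 s := by
    refine intervalIntegrable_mulVec fun l m => ?_
    refine (intervalIntegrable_sum fun k => hfst l m k).congr_ae ?_
    rw [uIoc_of_le hs0]
    refine (ae_restrict_iff' measurableSet_Ioc).2 (ae_of_all _ fun σ hσ => ?_)
    simp only [intervalIntegral_mulVec_apply (hvg σ hσ), Finset.mul_sum]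
  have hswap : ∫ t in (0 : ℝ)..s, mint t s (fun σ => b σ * v σ t) *ᵥ g t =
      ∫ σ in (0 : ℝ)..s, b σ *ᵥ ∫ t in (0 : ℝ)..σ, v σ t *ᵥ g t := by
    funext l
    rw [intervalIntegral_mulVec_apply hmg, intervalIntegral_apply hiv]
    have e1 : ∀ k, ∫ t in (0 : ℝ)..s, mint t s (fun σ => b σ * v σ t) l k * g t k =
        ∑ m, ∫ σ in (0 : ℝ)..s, b σ l m * ∫ t in (0 : ℝ)..σ, v σ t m k * g t k := by
      intro k
      rw [intervalIntegral_congr_Ioo hs0 (g := fun t => ∑ m, (∫ σ in t..s, b σ l m * v σ t m k) * g t k)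
        (fun t ht => by rw [hmint t ht, Finset.sum_mul]),
        intervalIntegral.integral_finsetSum fun m _ => hsnd l m k]
      exact Finset.sum_congr rfl fun m _ =>
        (triangle_swap hs0 (hbs l m) (hgs k) (hvm m k) (hvC m k)).symm
    have e2 : ∫ σ in (0 : ℝ)..s, (b σ *ᵥ ∫ t in (0 : ℝ)..σ, v σ t *ᵥ g t) l =
        ∑ m, ∑ k, ∫ σ in (0 : ℝ)..s, b σ l m * ∫ t in (0 : ℝ)..σ, v σ t m k * g t k := by
      rw [intervalIntegral_congr_Ioo hs0
        (g := fun σ => ∑ m, ∑ k, b σ l m * ∫ t in (0 : ℝ)..σ, v σ t m k * g t k)]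
      · rw [intervalIntegral.integral_finsetSum]
        · exact Finset.sum_congr rfl fun m _ =>
            intervalIntegral.integral_finsetSum fun k _ => hfst l m k
        · exact fun m _ => intervalIntegrable_sum fun k => hfst l m k
      · intro σ hσ
        rw [mulVec_apply_sum]
        refine Finset.sum_congr rfl fun m _ => ?_
        rw [intervalIntegral_mulVec_apply (hvg σ ⟨hσ.1, hσ.2.le⟩), Finset.mul_sum]
    rw [Finset.sum_congr rfl fun k _ => e1 k, e2, Finset.sum_comm]
  have hb1 : IntervalIntegrable (fun σ => b σ *ᵥ g σ) volume 0 s := intervalIntegrable_mulVec hbg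
  have hv1 : IntervalIntegrable (fun t => v s t *ᵥ g t) volume 0 s :=
    intervalIntegrable_mulVec (hvg s ⟨hs.1, le_rfl⟩)
  have hm1 := intervalIntegrable_mulVec hmg
  have hR : ∫ τ in (0 : ℝ)..s, fullKer q a b v s τ *ᵥ g τ = (a s *ᵥ ∫ σ in (0 : ℝ)..s, b σ *ᵥ g σ) +
      ((q s *ᵥ ∫ t in (0 : ℝ)..s, v s t *ᵥ g t) +
        a s *ᵥ ∫ t in (0 : ℝ)..s, mint t s (fun σ => b σ * v σ t) *ᵥ g t) := by
    rw [mulVec_intervalIntegral _ hb1, mulVec_intervalIntegral _ hv1, mulVec_intervalIntegral _ hm1,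
      ← intervalIntegral.integral_add (intervalIntegrable_const_mulVec (q s) hv1)
        (intervalIntegrable_const_mulVec (a s) hm1),
      ← intervalIntegral.integral_add (intervalIntegrable_const_mulVec (a s) hb1)
        ((intervalIntegrable_const_mulVec (q s) hv1).add
          (intervalIntegrable_const_mulVec (a s) hm1))]
    refine intervalIntegral.integral_congr fun τ _ => ?_
    simp only [fullKer, srcKer, Matrix.add_mulVec, Matrix.mulVec_mulVec]
  rw [hR, hswap]
  simp only [opQ, opX_apply, Matrix.mulVec_add]
  rw [intervalIntegral.integral_add hb1 hiv, Matrix.mulVec_add]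
  abel

theorem opA_apply_apply {f : ℝ → Fin p → ℂ} {x : ℝ} (hx : 0 ≤ x) (hf : Integrable f (vol x))
    (i : Fin p) : opA p f x i = ∫ t in (0 : ℝ)..x, ((t - x : ℝ) : ℂ) * f t i := by
  have h : IntervalIntegrable (fun t => (t - x) • f t) volume 0 x :=
    (intervalIntegrable_zero_of_vol hx hf).continuousOn_smul (by fun_prop)
  rw [opA, intervalIntegral_apply h]
  simp

theorem memL2_opA {f : ℝ → Fin p → ℂ} (hf : MemL2 r f) : MemL2 r (opA p f) := by
  let k : ℝ → ℝ → Matrix (Fin p) (Fin p) ℂ := fun x t => ((t - x : ℝ) : ℂ) • 1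
  obtain ⟨C', hk⟩ := isVolterraKernel_of_bounded (r := r) (k := k) (C := |r|)
    (fun i j => by simp only [k, Matrix.smul_apply]; exact Measurable.smul_const (by fun_prop) _)
    (fun x hx t ht i j => by
      simp only [k, Matrix.smul_apply, smul_eq_mul, norm_mul, Complex.norm_real, Real.norm_eq_abs]
      have h1 : |t - x| ≤ |r| := by
        rw [abs_le]
        have := le_abs_self r
        constructor <;> linarith [ht.1, ht.2, hx.2, abs_nonneg r]
      refine (mul_le_mul h1 ?_ (norm_nonneg _) (abs_nonneg r)).trans (mul_one _).le
      rw [Matrix.one_apply]; split_ifs <;> simp)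
  have h := hk.memL2_integral hf
  convert h using 2
  simp only [opA, k]
  refine intervalIntegral.integral_congr fun t _ => ?_
  simp only [Matrix.smul_mulVec, Matrix.one_mulVec]
  ext i; simp

theorem memL2_opX (hvm : ∀ i k, Measurable fun z : ℝ × ℝ => v z.1 z.2 i k)
    (hv : ∀ s τ, s < r → ∀ i k, ‖v s τ i k‖ ≤ C) {f : ℝ → Fin p → ℂ} (hf : MemL2 r f) :
    MemL2 r (opX v f) := by
  obtain ⟨C', hk⟩ := isVolterraKernel_of_bounded (r := r) (k := v) hvm
    (fun x hx t _ => hv x t hx.2)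
  rw [show opX v f = fun x => f x + ∫ t in (0 : ℝ)..x, v x t *ᵥ f t from funext (opX_apply v f)]
  exact hf.add (hk.memL2_integral hf)

theorem measurable_opA {f : ℝ → Fin p → ℂ} (hf : Measurable f) : Measurable (opA p f) :=
  (stronglyMeasurable_intervalIntegral (F := fun x t => (t - x) • f t)
    (Measurable.stronglyMeasurable (by fun_prop)) measurable_const measurable_id).measurable

theorem measurable_fullKer (h : IsCoeff r q a b)
    (hvm : ∀ i k, Measurable fun z : ℝ × ℝ => v z.1 z.2 i k) (i k : Fin p) :
    Measurable fun z : ℝ × ℝ => fullKer q a b v z.1 z.2 i k := by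
  simp only [fullKer, Matrix.add_apply]
  refine Measurable.add ?_ (h.measurable_srcKer hvm i k)
  simp only [Matrix.mul_apply]
  exact Finset.measurable_fun_sum _ fun l _ => ((h.meas_a i l).comp measurable_fst).mul
    ((h.meas_b l k).comp measurable_snd)

theorem integrable_fullKer (h : IsCoeff r q a b)
    (hvm : ∀ i k, Measurable fun z : ℝ × ℝ => v z.1 z.2 i k) (hC : 0 ≤ C)
    (hv : ∀ s τ, s < r → ∀ i k, ‖v s τ i k‖ ≤ C) (i k : Fin p) :
    Integrable ((triangle r).indicator fun z => fullKer q a b v z.1 z.2 i k) := by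
  refine ((h.integrable_indicator_mul i k).add
    (h.integrable_indicator_srcKer hvm hC hv i k)).congr (ae_of_all _ fun z => ?_)
  by_cases hz : z ∈ triangle r
  · simp only [Pi.add_apply, indicator_of_mem hz, fullKer, Matrix.add_apply]
  · simp only [Pi.add_apply, indicator_of_notMem hz, add_zero]

theorem intervalIntegrable_fullKer_mul (h : IsCoeff r q a b)
    (hvm : ∀ i k, Measurable fun z : ℝ × ℝ => v z.1 z.2 i k) (hC : 0 ≤ C)
    (hv : ∀ s τ, s < r → ∀ i k, ‖v s τ i k‖ ≤ C) {g : ℝ → Fin p → ℂ} (hg : MemL2 r g) {s : ℝ}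
    (hs : s ∈ Ioo 0 r) (i k : Fin p) :
    IntervalIntegrable (fun τ => fullKer q a b v s τ i k * g τ k) volume 0 s := by
  simp only [fullKer, Matrix.add_apply, add_mul]
  refine (intervalIntegrable_zero_of_vol hs.1.le ?_).add
    (intervalIntegrable_zero_of_vol hs.1.le ?_)
  · refine integrable_vol_mono ?_ hs.2.le
    simp only [Matrix.mul_apply, Finset.sum_mul, mul_assoc]
    exact integrable_finsetSum _ fun l _ =>
      ((h.memLp_b l k).integrable_mul (memL2_iff.1 hg k)).const_mul _
  · refine integrable_kernel_mul (k := fun s τ => srcKer q a b v s τ i k)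
      (h.measurable_srcKer hvm i k) (fun τ hτ => h.norm_srcKer_le hC ⟨hτ.1, hτ.2, hs.2⟩
        (fun σ hσ => hv σ τ (hσ.2.trans_lt hs.2)) i k)
      (integrable_vol_mono ((memL2_iff.1 hg k).integrable one_le_two) hs.2.le)

theorem opQ_opX_apply (h : IsCoeff r q a b)
    (hvm : ∀ i k, Measurable fun z : ℝ × ℝ => v z.1 z.2 i k) (hC : 0 ≤ C)
    (hv : ∀ s τ, s < r → ∀ i k, ‖v s τ i k‖ ≤ C) {g : ℝ → Fin p → ℂ} (hg : MemL2 r g) {s : ℝ}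
    (hs : s ∈ Ioo 0 r) (i : Fin p) :
    opQ q a b (opX v g) s i =
      ∑ k, (q s i k * g s k + ∫ τ in (0 : ℝ)..s, fullKer q a b v s τ i k * g τ k) := by
  rw [opQ_opX h hvm hv hg hs, Pi.add_apply, mulVec_apply_sum, intervalIntegral_mulVec_apply
    (fun i k => intervalIntegrable_fullKer_mul h hvm hC hv hg hs i k), Finset.sum_add_distrib]

/-- The identity part of `X = I + v` commutes with `A`, so only the commutators of the entries of
`v` are left. -/
theorem opA_opX_sub_apply (hvm : ∀ i k, Measurable fun z : ℝ × ℝ => v z.1 z.2 i k)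
    (hv : ∀ s τ, s < r → ∀ i k, ‖v s τ i k‖ ≤ C) {f : ℝ → Fin p → ℂ} (hf : MemL2 r f) {x : ℝ}
    (hx : x ∈ Ioo 0 r) (i : Fin p) :
    opA p (opX v f) x i - opX v (opA p f) x i =
      ∑ k, comm (fun w t => v w t i k) (fun t => f t k) x := by
  have hx0 := hx.1.le
  have hfx : ∀ k, Integrable (fun t => f t k) (vol x) := fun k =>
    integrable_vol_mono ((memL2_iff.1 hf k).integrable one_le_two) hx.2.le
  have hAfx : ∀ k, Integrable (fun t => opA p f t k) (vol x) := fun k =>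
    integrable_vol_mono ((memL2_iff.1 (memL2_opA hf) k).integrable one_le_two) hx.2.le
  have hG : ∀ s ∈ Icc 0 x, ∀ k, opA p f s k = ∫ t in (0 : ℝ)..s, ((t - s : ℝ) : ℂ) * f t k :=
    fun s hs k => opA_apply_apply hs.1 (integrable_vol_mono hf.integrable (hs.2.trans hx.2.le)) k
  have hXf := memL2_opX hvm hv hf
  have hvf : ∀ w ∈ Ioc 0 x, ∀ i k, IntervalIntegrable (fun t => v w t i k * f t k) volume 0 w :=
    fun w hw i k => intervalIntegrable_zero_of_vol hw.1.le (integrable_kernel_mul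
      (k := fun w t => v w t i k) (hvm i k) (fun t _ => hv w t (hw.2.trans_lt hx.2) i k)
      (integrable_vol_mono (hfx k) hw.2))
  have hvA : ∀ i k, IntervalIntegrable (fun t => v x t i k * opA p f t k) volume 0 x :=
    fun i k => intervalIntegrable_zero_of_vol hx0 (integrable_kernel_mul
      (k := fun w t => v w t i k) (hvm i k) (fun t _ => hv x t hx.2 i k) (hAfx k))
  have hfst : ∀ i k, IntervalIntegrable
      (fun w => ((w - x : ℝ) : ℂ) * ∫ t in (0 : ℝ)..w, v w t i k * f t k) volume 0 x := fun i k =>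
    intervalIntegrable_zero_of_vol hx0 (triangle_integrable_fst (integrable_sub_vol hx0) (hfx k)
      (hvm i k) fun w t _ _ hw => hv w t (hw.trans hx.2) i k)
  have e1 : opA p (opX v f) x i = opA p f x i +
      ∑ k, ∫ w in (0 : ℝ)..x, ((w - x : ℝ) : ℂ) * ∫ t in (0 : ℝ)..w, v w t i k * f t k := by
    rw [opA_apply_apply hx0 (integrable_vol_mono hXf.integrable hx.2.le),
      opA_apply_apply hx0 (integrable_vol_mono hf.integrable hx.2.le),
      ← intervalIntegral.integral_finsetSum fun k _ => hfst i k, ← intervalIntegral.integral_add]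
    · refine intervalIntegral_congr_Ioo hx0 fun w hw => ?_
      rw [opX_apply, Pi.add_apply, intervalIntegral_mulVec_apply (hvf w ⟨hw.1, hw.2.le⟩), mul_add,
        Finset.mul_sum]
    · exact (intervalIntegrable_zero_of_vol hx0 (hfx i)).continuousOn_mul (by fun_prop)
    · exact intervalIntegrable_sum fun k => hfst i k
  have e2 : opX v (opA p f) x i = opA p f x i + ∑ k, ∫ w in (0 : ℝ)..x, v x w i k *
      ∫ t in (0 : ℝ)..w, ((t - w : ℝ) : ℂ) * f t k := by
    rw [opX_apply, Pi.add_apply, intervalIntegral_mulVec_apply hvA]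
    congr 1
    refine Finset.sum_congr rfl fun k _ => intervalIntegral_congr_Ioo hx0 fun w hw => ?_
    rw [hG w ⟨hw.1.le, hw.2.le⟩]
  rw [e1, e2, add_sub_add_left_eq_sub, ← Finset.sum_sub_distrib]
  rfl

/-- The kernel `v` is the sum of a constant, a wave with sources on the diagonal and a wave with
sources in the triangle. Their commutators are `0`, `A q A` and `A Y A` with `Y` the operator with
kernel `fullKer`, and `q + Y = Q X` by `opQ_opX_apply`. -/
theorem opA_opX_sub (h : IsCoeff r q a b) {c : Matrix (Fin p) (Fin p) ℂ}
    (hvm : ∀ i k, Measurable fun z : ℝ × ℝ => v z.1 z.2 i k) (hC : 0 ≤ C)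
    (hv : ∀ s τ, s < r → ∀ i k, ‖v s τ i k‖ ≤ C)
    (hveq : ∀ x ∈ Ioo 0 r, ∀ t, 0 < t → ∀ i k, v x t i k = c i k +
        waveSol volume id id ((Ioo 0 r).indicator fun s => q s i k) x t +
        waveSol volume Prod.fst Prod.snd
          ((triangle r).indicator fun z => fullKer q a b v z.1 z.2 i k) x t)
    {f : ℝ → Fin p → ℂ} (hfm : Measurable f) (hf : MemL2 r f) {x : ℝ} (hx : x ∈ Ioo 0 r) :
    opA p (opX v f) x - opX v (opA p f) x = opA p (opQ q a b (opX v (opA p f))) x := by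
  have hx0 := hx.1.le
  have hfx : ∀ k, Integrable (fun t => f t k) (vol x) := fun k =>
    integrable_vol_mono ((memL2_iff.1 hf k).integrable one_le_two) hx.2.le
  have hAf := memL2_opA hf
  have hAfx : ∀ k, Integrable (fun t => opA p f t k) (vol x) := fun k =>
    integrable_vol_mono ((memL2_iff.1 hAf k).integrable one_le_two) hx.2.le
  have hq : ∀ i k, Integrable (fun s => q s i k) (vol r) := fun i k =>
    (h.memLp_q i k).integrable one_le_two
  have hym : ∀ i k, Measurable fun z : ℝ × ℝ => fullKer q a b v z.1 z.2 i k :=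
    measurable_fullKer h hvm
  have hyi : ∀ i k, Integrable
      ((triangle r).indicator fun z => fullKer q a b v z.1 z.2 i k) :=
    integrable_fullKer h hvm hC hv
  have hAfb : ∀ k, ∀ τ ∈ Ioo 0 r, ‖opA p f τ k‖ ≤ r * ∫ t, ‖f t k‖ ∂(vol r) := by
    intro k τ hτ
    rw [opA_apply_apply hτ.1.le (integrable_vol_mono hf.integrable hτ.2.le)]
    exact norm_lin_integral_le ((memL2_iff.1 hf k).integrable one_le_two) ⟨hτ.1.le, hτ.2.le⟩
  have hi1 : ∀ i k, Integrable (fun s => q s i k * opA p f s k) (vol x) := fun i k =>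
    integrable_vol_mono ((h.memLp_q i k).integrable_mul (memL2_iff.1 hAf k)) hx.2.le
  have hi2 : ∀ i k, Integrable
      (fun s => ∫ τ in (0 : ℝ)..s, fullKer q a b v s τ i k * opA p f τ k) (vol x) := fun i k =>
    integrable_vol_mono (integrable_triangle_inner (hyi i k)
      (measurable_pi_iff.1 (measurable_opA hfm) k) (hAfb k)) hx.2.le
  have hG : ∀ s ∈ Icc 0 x, ∀ k, opA p f s k = ∫ t in (0 : ℝ)..s, ((t - s : ℝ) : ℂ) * f t k :=
    fun s hs k => opA_apply_apply hs.1 (integrable_vol_mono hf.integrable (hs.2.trans hx.2.le)) k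
  have hcomm : ∀ i k, comm (fun w t => v w t i k) (fun t => f t k) x =
      ∫ s in (0 : ℝ)..x, ((s - x : ℝ) : ℂ) * (q s i k * opA p f s k +
        ∫ τ in (0 : ℝ)..s, fullKer q a b v s τ i k * opA p f τ k) := by
    intro i k
    have hqi := (integrable_indicator_iff measurableSet_Ioo).2 (hq i k)
    have m1 := measurable_waveSol (μ := volume) measurable_id measurable_id
      ((h.meas_q i k).indicator (measurableSet_Ioo (a := (0 : ℝ)) (b := r)))
    have m2 := measurable_waveSol (μ := volume) measurable_fst measurable_snd
      ((hym i k).indicator (measurableSet_triangle (r := r)))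
    rw [comm_congr hx0 (k' := fun w t => (c i k +
        waveSol volume id id ((Ioo 0 r).indicator fun s => q s i k) w t) +
        waveSol volume Prod.fst Prod.snd
          ((triangle r).indicator fun z => fullKer q a b v z.1 z.2 i k) w t)
        (fun w t h1 h2 h3 => hveq w ⟨h1.trans h2, h3.trans_lt hx.2⟩ t h1 i k),
      comm_add hx0 (hfx k) (m1.const_add (c i k)) m2
        (fun w t _ _ _ => (norm_add_le _ _).trans (add_le_add le_rfl (norm_waveSol_le hqi w t)))
        (fun w t _ _ _ => norm_waveSol_le (hyi i k) w t),
      comm_add (k := fun _ _ => c i k) hx0 (hfx k) measurable_const m1 (fun _ _ _ _ _ => le_rfl)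
        (fun w t _ _ _ => norm_waveSol_le hqi w t),
      comm_const hx0 (hfx k), zero_add,
      comm_waveSol_diag hx0 hx.2.le (hfx k) (h.meas_q i k) (hq i k),
      comm_waveSol_triangle hx0 hx.2.le (measurable_pi_iff.1 hfm k) (hfx k) (hym i k) (hyi i k),
      ← intervalIntegral.integral_add]
    · refine intervalIntegral_congr_Ioo hx0 fun s hs => ?_
      rw [← mul_add, hG s ⟨hs.1.le, hs.2.le⟩]
      congr 2
      refine intervalIntegral_congr_Ioo hs.1.le fun τ hτ => ?_
      rw [hG τ ⟨hτ.1.le, hτ.2.le.trans hs.2.le⟩]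
    · refine (intervalIntegrable_zero_of_vol hx0 ?_).continuousOn_mul (by fun_prop)
      refine (hi1 i k).congr (ae_vol_of_forall fun s hs => ?_)
      simp only [hG s ⟨hs.1.le, hs.2.le⟩]
    · refine (intervalIntegrable_zero_of_vol hx0 ?_).continuousOn_mul (by fun_prop)
      refine (hi2 i k).congr (ae_vol_of_forall fun s hs => ?_)
      refine intervalIntegral_congr_Ioo hs.1.le fun τ hτ => ?_
      rw [hG τ ⟨hτ.1.le, hτ.2.le.trans hs.2.le⟩]
  have hQi : Integrable (opQ q a b (opX v (opA p f))) (vol x) := by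
    refine Integrable.of_eval fun i => ?_
    refine (integrable_finsetSum Finset.univ fun k _ => (hi1 i k).add (hi2 i k)).congr
      (ae_vol_of_forall fun s hs => ?_)
    exact (opQ_opX_apply h hvm hC hv hAf ⟨hs.1, hs.2.trans hx.2⟩ i).symm
  funext i
  rw [Pi.sub_apply, opA_opX_sub_apply hvm hv hf hx, opA_apply_apply hx0 hQi]
  calc _ = ∑ k, ∫ s in (0 : ℝ)..x, ((s - x : ℝ) : ℂ) * (q s i k * opA p f s k +
        ∫ τ in (0 : ℝ)..s, fullKer q a b v s τ i k * opA p f τ k) :=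
      Finset.sum_congr rfl fun k _ => hcomm i k
    _ = _ := by
      rw [← intervalIntegral.integral_finsetSum]
      · refine intervalIntegral_congr_Ioo hx0 fun s hs => ?_
        rw [← Finset.mul_sum, opQ_opX_apply h hvm hC hv hAf ⟨hs.1, hs.2.trans hx.2⟩]
      · exact fun k _ => (intervalIntegrable_zero_of_vol hx0
          ((hi1 i k).add (hi2 i k))).continuousOn_mul (by fun_prop)

end Intertwining

/-! ### Action of the transformation operator on constant functions -/

section ConstantFunctions

variable {Z : Type*} [MeasurableSpace Z] {μ : Measure Z} [SFinite μ] {s τ : Z → ℝ} {y : Z → ℂ}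

theorem integral_waveSol (hs : Measurable s) (hτ : Measurable τ) (hy : Integrable y μ)
    (hsupp : ∀ z, y z ≠ 0 → 0 ≤ τ z ∧ τ z ≤ s z) {x : ℝ} (hx : 0 ≤ x) :
    ∫ t in (0 : ℝ)..x, waveSol μ s τ y x t =
      ∫ z, y z * ((if s z ≤ x then x - s z else 0 : ℝ) : ℂ) ∂μ := by
  unfold waveSol
  rw [intervalIntegral_swap (C := 1) (g := fun w z => (waveKer (s z) (τ z) x w : ℂ)) hx ?_ hy
    (fun w _ z => norm_waveKer_le _ _ _ _)]
  · refine integral_congr_ae (ae_of_all _ fun z => ?_)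
    by_cases hz : y z = 0
    · simp [hz]
    · obtain ⟨h1, h2⟩ := hsupp z hz
      simp only [intervalIntegral.integral_ofReal, integral_waveKer h1 h2 hx]
  · refine Complex.measurable_ofReal.comp (measurable_waveKer_comp ?_ ?_ ?_ ?_) <;> fun_prop

end ConstantFunctions

section ConstantFunctions

variable {p : ℕ} {ν : Type*} [Fintype ν] {r : ℝ} {q : ℝ → Matrix (Fin p) (Fin p) ℂ}
  {a : ℝ → Matrix (Fin p) ν ℂ} {b : ℝ → Matrix ν (Fin p) ℂ}
  {v : ℝ → ℝ → Matrix (Fin p) (Fin p) ℂ} {C : ℝ}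

theorem memL2_const (w : Fin p → ℂ) : MemL2 r fun _ => w := memLp_const w

theorem integral_waveSol_diag {x : ℝ} (hx : x ∈ Ioo 0 r) {y : ℝ → ℂ} (hy : Integrable y (vol r)) :
    ∫ t in (0 : ℝ)..x, waveSol volume id id ((Ioo 0 r).indicator y) x t =
      -∫ s in (0 : ℝ)..x, ((s - x : ℝ) : ℂ) * y s := by
  rw [integral_waveSol measurable_id measurable_id ((integrable_indicator_iff measurableSet_Ioo).2 hy)
    (fun s hs => ⟨(mem_of_indicator_ne_zero hs).1.le, le_rfl⟩) hx.1.le,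
    ← intervalIntegral.integral_neg, intervalIntegral_eq_vol _ hx.1.le,
    ← integral_indicator measurableSet_Ioo]
  refine integral_congr_ae (ae_of_all _ fun s => ?_)
  simp only [id]
  by_cases hs : s ∈ Ioo 0 x
  · rw [indicator_of_mem hs, indicator_of_mem (show s ∈ Ioo 0 r from ⟨hs.1, hs.2.trans hx.2⟩),
      if_pos hs.2.le]
    push_cast; ring
  · rw [indicator_of_notMem hs]
    by_cases hs0 : s ∈ Ioo 0 r
    · rcases lt_trichotomy s x with h | h | h
      · exact absurd ⟨hs0.1, h⟩ hs
      · simp [h]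
      · simp [not_le.2 h]
    · rw [indicator_of_notMem hs0, zero_mul]

theorem integral_waveSol_triangle {x : ℝ} (hx : x ∈ Ioo 0 r) {y : ℝ × ℝ → ℂ}
    (hy : Integrable ((triangle r).indicator y)) :
    ∫ t in (0 : ℝ)..x, waveSol volume Prod.fst Prod.snd ((triangle r).indicator y) x t =
      -∫ s in (0 : ℝ)..x, ((s - x : ℝ) : ℂ) * ∫ τ in (0 : ℝ)..s, y (s, τ) := by
  have hsupp : ∀ z : ℝ × ℝ, (triangle r).indicator y z ≠ 0 → z ∈ triangle r :=
    fun z hz => mem_of_indicator_ne_zero hz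
  rw [integral_waveSol measurable_fst measurable_snd hy
    (fun z hz => ⟨(hsupp z hz).1.le, (hsupp z hz).2.1.le⟩) hx.1.le,
    ← intervalIntegral.integral_neg, intervalIntegral_eq_vol _ hx.1.le,
    ← integral_indicator measurableSet_Ioo]
  have hint : Integrable fun z : ℝ × ℝ => (triangle r).indicator y z *
      ((if z.1 ≤ x then x - z.1 else 0 : ℝ) : ℂ) := by
    refine (hy.norm.const_mul x).mono' ?_ (ae_of_all _ fun z => ?_)
    · refine hy.aestronglyMeasurable.mul (Complex.measurable_ofReal.comp
        (Measurable.ite (measurableSet_le (by fun_prop) (by fun_prop)) (by fun_prop)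
          (by fun_prop))).aestronglyMeasurable
    · by_cases hz : (triangle r).indicator y z = 0
      · simp [hz]
      · rw [norm_mul, mul_comm]
        gcongr
        rw [Complex.norm_real, Real.norm_eq_abs, abs_le]
        have h1 := (hsupp z hz).1
        have h2 := (hsupp z hz).2.1
        have h3 := hx.1
        split_ifs <;> constructor <;> linarith
  rw [Measure.volume_eq_prod] at hint ⊢
  rw [integral_prod _ hint]
  refine integral_congr_ae (ae_of_all _ fun s => ?_)
  simp only
  rw [integral_mul_const]
  by_cases hs : s ∈ Ioo 0 x
  · rw [indicator_of_mem hs, if_pos hs.2.le, intervalIntegral_eq_vol _ hs.1.le,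
      ← integral_indicator measurableSet_Ioo, ← neg_mul, mul_comm]
    congr 1
    · push_cast; ring
    · refine integral_congr_ae (ae_of_all _ fun t => ?_)
      simp only
      by_cases ht : t ∈ Ioo 0 s
      · rw [indicator_of_mem ht,
          indicator_of_mem (show (s, t) ∈ triangle r from ⟨ht.1, ht.2, hs.2.trans hx.2⟩)]
      · rw [indicator_of_notMem ht, indicator_of_notMem (fun h => ht ⟨h.1, h.2.1⟩)]
  · rw [indicator_of_notMem hs]
    by_cases hs0 : s ∈ Ioo 0 r
    · rcases lt_trichotomy s x with h | h | h
      · exact absurd ⟨hs0.1, h⟩ hs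
      · simp [h]
      · simp [not_le.2 h]
    · rw [integral_congr_ae (g := fun _ => (0 : ℂ)), integral_zero, zero_mul]
      refine ae_of_all _ fun t => indicator_of_notMem (fun h => hs0 ?_) _
      exact ⟨h.1.trans h.2.1, h.2.2⟩

/-- Integrated over `0 < t < x`, the constant part of `v` yields `x c`, and a source at time `s`
yields its mass times `x - s`, by conservation of mass. The sources add up to the kernel of `Q X`,
hence the term `-A Q X w`. -/
theorem opX_const (h : IsCoeff r q a b) {c : Matrix (Fin p) (Fin p) ℂ}
    (hvm : ∀ i k, Measurable fun z : ℝ × ℝ => v z.1 z.2 i k) (hC : 0 ≤ C)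
    (hv : ∀ s τ, s < r → ∀ i k, ‖v s τ i k‖ ≤ C)
    (hveq : ∀ x ∈ Ioo 0 r, ∀ t, 0 < t → ∀ i k, v x t i k = c i k +
        waveSol volume id id ((Ioo 0 r).indicator fun s => q s i k) x t +
        waveSol volume Prod.fst Prod.snd
          ((triangle r).indicator fun z => fullKer q a b v z.1 z.2 i k) x t)
    (w : Fin p → ℂ) {x : ℝ} (hx : x ∈ Ioo 0 r) :
    opX v (fun _ => w) x =
      w + x • (c *ᵥ w) - opA p (opQ q a b (opX v fun _ => w)) x := by
  have hx0 := hx.1.le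
  have hw : MemL2 r fun _ => w := memL2_const w
  have hq : ∀ i k, Integrable (fun s => q s i k) (vol r) := fun i k =>
    (h.memLp_q i k).integrable one_le_two
  have hyi : ∀ i k, Integrable
      ((triangle r).indicator fun z => fullKer q a b v z.1 z.2 i k) :=
    integrable_fullKer h hvm hC hv
  have hi1 : ∀ i k, Integrable (fun s => q s i k * w k) (vol x) := fun i k =>
    integrable_vol_mono ((hq i k).mul_const _) hx.2.le
  have hi2 : ∀ i k, Integrable
      (fun s => ∫ τ in (0 : ℝ)..s, fullKer q a b v s τ i k * w k) (vol x) := fun i k =>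
    integrable_vol_mono (integrable_triangle_inner (hyi i k) (G := fun _ => w k) (C := ‖w k‖)
      measurable_const (fun _ _ => le_rfl)) hx.2.le
  have hQi : Integrable (opQ q a b (opX v fun _ => w)) (vol x) := by
    refine Integrable.of_eval fun i => ?_
    refine (integrable_finsetSum Finset.univ fun k _ => (hi1 i k).add (hi2 i k)).congr
      (ae_vol_of_forall fun s hs => ?_)
    exact (opQ_opX_apply h hvm hC hv hw ⟨hs.1, hs.2.trans hx.2⟩ i).symm
  have hvw : ∀ i k, IntervalIntegrable (fun t => v x t i k * w k) volume 0 x :=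
    fun i k => intervalIntegrable_zero_of_vol hx0 (integrable_kernel_mul
      (k := fun w t => v w t i k) (f := fun _ => w k) (hvm i k) (fun t _ => hv x t hx.2 i k)
      (integrable_const _))
  funext i
  have key : ∀ k, ∫ t in (0 : ℝ)..x, v x t i k * w k = x * (c i k * w k) -
      ∫ s in (0 : ℝ)..x, ((s - x : ℝ) : ℂ) * (q s i k * w k +
        ∫ τ in (0 : ℝ)..s, fullKer q a b v s τ i k * w k) := by
    intro k
    have hqi := (integrable_indicator_iff measurableSet_Ioo).2 (hq i k)
    have m1 := measurable_waveSol (μ := volume) measurable_id measurable_id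
      ((h.meas_q i k).indicator (measurableSet_Ioo (a := (0 : ℝ)) (b := r)))
    have m2 := measurable_waveSol (μ := volume) measurable_fst measurable_snd
      ((measurable_fullKer h hvm i k).indicator (measurableSet_triangle (r := r)))
    have n1 : IntervalIntegrable (fun t => waveSol volume id id
        ((Ioo 0 r).indicator fun s => q s i k) x t) volume 0 x :=
      intervalIntegrable_zero_of_vol hx0 (integrable_of_kernel_row m1
        fun t _ => norm_waveSol_le hqi x t)
    have n2 : IntervalIntegrable (fun t => waveSol volume Prod.fst Prod.snd
        ((triangle r).indicator fun z => fullKer q a b v z.1 z.2 i k) x t) volume 0 x :=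
      intervalIntegrable_zero_of_vol hx0 (integrable_of_kernel_row m2
        fun t _ => norm_waveSol_le (hyi i k) x t)
    rw [intervalIntegral.integral_mul_const, intervalIntegral_congr_Ioo hx0
      (fun t ht => hveq x hx t ht.1 i k), intervalIntegral.integral_add
        (intervalIntegrable_const.add n1) n2,
      intervalIntegral.integral_add intervalIntegrable_const n1,
      integral_waveSol_diag hx (hq i k), integral_waveSol_triangle hx (hyi i k),
      intervalIntegral.integral_const]
    have e : ∀ s : ℝ, ((s - x : ℝ) : ℂ) * (q s i k * w k +
        ∫ τ in (0 : ℝ)..s, fullKer q a b v s τ i k * w k) =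
        (((s - x : ℝ) : ℂ) * q s i k +
        ((s - x : ℝ) : ℂ) * ∫ τ in (0 : ℝ)..s, fullKer q a b v s τ i k) * w k := by
      intro s
      rw [intervalIntegral.integral_mul_const]
      ring
    simp only [e]
    have hi2' : Integrable (fun s => ∫ τ in (0 : ℝ)..s, fullKer q a b v s τ i k) (vol x) := by
      have := integrable_triangle_inner (hyi i k) (G := fun _ => 1) (C := 1)
        measurable_const (fun _ _ => by simp)
      simp only [mul_one] at this
      exact integrable_vol_mono this hx.2.le
    rw [intervalIntegral.integral_mul_const, intervalIntegral.integral_add]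
    · simp only [sub_zero, Complex.real_smul]
      ring
    · exact (intervalIntegrable_zero_of_vol hx0
        (integrable_vol_mono (hq i k) hx.2.le)).continuousOn_mul (by fun_prop)
    · exact (intervalIntegrable_zero_of_vol hx0 hi2').continuousOn_mul (by fun_prop)
  rw [opX_apply, Pi.add_apply, Pi.sub_apply, intervalIntegral_mulVec_apply hvw,
    opA_apply_apply hx0 hQi, Finset.sum_congr rfl fun k _ => key k, Finset.sum_sub_distrib,
    ← intervalIntegral.integral_finsetSum]
  · rw [Pi.add_apply, Pi.smul_apply, mulVec_apply_sum, Complex.real_smul, Finset.mul_sum,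
      add_sub_assoc]
    congr 2
    refine intervalIntegral_congr_Ioo hx0 fun s hs => ?_
    rw [← Finset.mul_sum, opQ_opX_apply h hvm hC hv hw ⟨hs.1, hs.2.trans hx.2⟩]
  · exact fun k _ => (intervalIntegrable_zero_of_vol hx0
      ((hi1 i k).add (hi2 i k))).continuousOn_mul (by fun_prop)

theorem opA_congr {f g : ℝ → Fin p → ℂ} (h : f =ᵐ[vol r] g) {x : ℝ} (hx : x ∈ Icc 0 r) :
    opA p f x = opA p g x :=
  intervalIntegral_congr_vol (h.mono fun t ht => by simp only [ht]) hx

theorem IsCoeff.exists_intertwiner (h : IsCoeff r q a b) (c : Matrix (Fin p) (Fin p) ℂ) :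
    ∃ v : ℝ → ℝ → Matrix (Fin p) (Fin p) ℂ, (∀ i k, Measurable fun z : ℝ × ℝ => v z.1 z.2 i k) ∧
      (∃ C : ℝ, 0 ≤ C ∧ ∀ s τ, s < r → ∀ i k, ‖v s τ i k‖ ≤ C) ∧
      (∀ f, MemL2 r f → ∀ x ∈ Ioo 0 r,
        opA p (opX v f) x - opX v (opA p f) x = opA p (opQ q a b (opX v (opA p f))) x) ∧
      ∀ w, ∀ x ∈ Ioo 0 r, opX v (fun _ => w) x =
        w + x • (c *ᵥ w) - opA p (opQ q a b (opX v fun _ => w)) x := by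
  obtain ⟨v, hvm, ⟨C, hC, hv⟩, hveq⟩ := h.exists_kernel c
  have hveq' : ∀ x ∈ Ioo 0 r, ∀ t, 0 < t → ∀ i k, v x t i k = c i k +
      waveSol volume id id ((Ioo 0 r).indicator fun s => q s i k) x t +
      waveSol volume Prod.fst Prod.snd
        ((triangle r).indicator fun z => fullKer q a b v z.1 z.2 i k) x t := by
    intro x hx t ht i k
    rw [hveq x hx t ht i k, add_assoc _ (waveSol volume Prod.fst Prod.snd _ x t)]
    congr 1
    unfold waveSol
    rw [← integral_add (waveSol_integrable measurable_fst measurable_snd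
      (h.integrable_indicator_mul i k) x t) (waveSol_integrable measurable_fst measurable_snd
      (h.integrable_indicator_srcKer hvm hC hv i k) x t)]
    refine integral_congr_ae (ae_of_all _ fun z => ?_)
    by_cases hz : z ∈ triangle r
    · simp only [indicator_of_mem hz, fullKer, Matrix.add_apply, add_mul]
    · simp only [indicator_of_notMem hz, zero_mul, add_zero]
  refine ⟨v, hvm, ⟨C, hC, hv⟩, fun f hf x hx => ?_, fun w x hx => opX_const h hvm hC hv hveq' w hx⟩
  -- The commutator formula was proved for functions measurable everywhere. Each operator involved
  -- depends only on the almost everywhere class of `f`, so a measurable representative may be used.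
  obtain ⟨g, hgm, hfg⟩ := hf.aestronglyMeasurable
  have hg : MemL2 r g := memL2_congr hfg hf
  have hA : ∀ y ∈ Icc 0 r, opA p f y = opA p g y := fun y hy => opA_congr hfg hy
  have hXA : ∀ y ∈ Ioo 0 r, opX v (opA p f) y = opX v (opA p g) y := by
    intro y hy
    rw [opX_apply, opX_apply, hA y ⟨hy.1.le, hy.2.le⟩]
    congr 1
    refine intervalIntegral_congr_Ioo hy.1.le fun t ht => ?_
    rw [hA t ⟨ht.1.le, (ht.2.trans hy.2).le⟩]
  rw [opA_congr (opV_congr_ae _ v hfg) ⟨hx.1.le, hx.2.le⟩, hXA x hx,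
    opA_congr (f := opQ q a b (opX v (opA p f))) (g := opQ q a b (opX v (opA p g)))
      (ae_vol_of_forall fun y hy => ?_) ⟨hx.1.le, hx.2.le⟩]
  · exact opA_opX_sub h hvm hC hv hveq' hgm.measurable hg hx
  · simp only [opQ]
    rw [hXA y hy]
    congr 2
    refine intervalIntegral_congr_Ioo hy.1.le fun t ht => ?_
    rw [hXA t ⟨ht.1, ht.2.trans hy.2⟩]

end ConstantFunctions

/-! ### Calculus of matrix functions -/

/-- The nearest point of `[0,r]`. -/
def clamp (r x : ℝ) : ℝ := max 0 (min x r)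

section Clamp

variable {r : ℝ}

theorem continuous_clamp : Continuous (clamp r) := by unfold clamp; fun_prop

theorem clamp_mem (hr : 0 ≤ r) (x : ℝ) : clamp r x ∈ Icc 0 r :=
  ⟨le_max_left _ _, max_le hr (min_le_right _ _)⟩

theorem clamp_eq {x : ℝ} (hx : x ∈ Icc 0 r) : clamp r x = x := by
  unfold clamp; rw [min_eq_left hx.2, max_eq_right hx.1]

theorem continuous_comp_clamp {X : Type*} [TopologicalSpace X] {F : ℝ → X} (hr : 0 ≤ r)
    (hF : ContinuousOn F (Icc 0 r)) : Continuous fun x => F (clamp r x) :=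
  hF.comp_continuous continuous_clamp (clamp_mem hr)

end Clamp

/-- Entrywise primitives of matrix functions. -/
def MPrim {ι κ : Type*} (r : ℝ) (F f : ℝ → Matrix ι κ ℂ) : Prop :=
  ∀ i k, HasPrim r (fun x => F x i k) fun x => f x i k

/-- Measurable matrix functions with square integrable entries. -/
structure IsL2Mat {ι κ : Type*} (r : ℝ) (f : ℝ → Matrix ι κ ℂ) : Prop where
  meas : ∀ i k, Measurable fun x => f x i k
  memLp : ∀ i k, MemLp (fun x => f x i k) 2 (vol r)

section MatrixCalculus

variable {ι κ ν : Type*} {r : ℝ} {F f f' : ℝ → Matrix ι κ ℂ} {G g : ℝ → Matrix κ ν ℂ}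

namespace MPrim

theorem congr (h : MPrim r F f) (hf : ∀ᵐ x ∂(vol r), f x = f' x) : MPrim r F f' := fun i k =>
  (h i k).congr (hf.mono fun x hx => by simp only [hx])

theorem congr_left {F' : ℝ → Matrix ι κ ℂ} (h : MPrim r F f) (hF : ∀ x ∈ Icc 0 r, F x = F' x) :
    MPrim r F' f := fun i k => (h i k).congr_left fun x hx => by rw [hF x hx]

theorem const (A : Matrix ι κ ℂ) : MPrim r (fun _ => A) fun _ => 0 := fun i k =>
  HasPrim.const (A i k)

theorem add {F' : ℝ → Matrix ι κ ℂ} (h : MPrim r F f) (h' : MPrim r F' f') :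
    MPrim r (fun x => F x + F' x) fun x => f x + f' x := fun i k => (h i k).add (h' i k)

theorem smul (c : ℂ) (h : MPrim r F f) : MPrim r (fun x => c • F x) fun x => c • f x :=
  fun i k => (h i k).const_mul c

theorem conjTranspose (h : MPrim r F f) : MPrim r (fun x => (F x)ᴴ) fun x => (f x)ᴴ :=
  fun i k => (h k i).star

theorem transpose (h : MPrim r F f) : MPrim r (fun x => (F x)ᵀ) fun x => (f x)ᵀ :=
  fun i k => h k i

theorem mul [Fintype κ] (h : MPrim r F f) (h' : MPrim r G g) :
    MPrim r (fun x => F x * G x) fun x => f x * G x + F x * g x := fun i k => by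
  simp only [Matrix.mul_apply, Matrix.add_apply, ← Finset.sum_add_distrib]
  exact HasPrim.sum _ fun l _ => (h i l).mul (h' l k)

theorem continuousOn_entry (h : MPrim r F f) (i : ι) (k : κ) :
    ContinuousOn (fun x => F x i k) (Icc 0 r) := (h i k).continuousOn

theorem continuousOn (h : MPrim r F f) : ContinuousOn F (Icc 0 r) :=
  continuousOn_pi.2 fun i => continuousOn_pi.2 fun k => (h i k).continuousOn

theorem ae_eq_zero [Finite ι] [Finite κ] (h : MPrim r F f) (hF : ∀ x ∈ Icc 0 r, F x = F 0) :
    ∀ᵐ x ∂(vol r), f x = 0 := by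
  have : ∀ᵐ x ∂(vol r), ∀ i k, f x i k = 0 := by
    rw [ae_all_iff]; intro i
    rw [ae_all_iff]; intro k
    exact (h i k).ae_eq_zero fun x hx => by rw [hF x hx]
  filter_upwards [this] with x hx
  ext i k; exact hx i k

theorem eq_of_zero (h : MPrim r F f) (hf : ∀ᵐ x ∂(vol r), f x = 0) {x : ℝ} (hx : x ∈ Icc 0 r) :
    F x = F 0 := by
  ext i k
  have h1 : F x i k = F 0 i k + ∫ t in (0 : ℝ)..x, f t i k := (h i k).2 x hx
  rw [h1, intervalIntegral_congr_vol (g := fun _ => 0)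
    (hf.mono fun x hx => by simp only [hx, Matrix.zero_apply]) hx]
  simp

end MPrim

namespace IsL2Mat

theorem add (h : IsL2Mat r f) (h' : IsL2Mat r f') : IsL2Mat r fun x => f x + f' x :=
  ⟨fun i k => (h.meas i k).add (h'.meas i k), fun i k => (h.memLp i k).add (h'.memLp i k)⟩

theorem smul (c : ℂ) (h : IsL2Mat r f) : IsL2Mat r fun x => c • f x :=
  ⟨fun i k => (h.meas i k).const_mul c, fun i k => (h.memLp i k).const_mul c⟩

theorem conjTranspose (h : IsL2Mat r f) : IsL2Mat r fun x => (f x)ᴴ := by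
  refine ⟨fun i k => Complex.continuous_conj.measurable.comp (h.meas k i), fun i k => ?_⟩
  refine MemLp.of_le (h.memLp k i) ((Complex.continuous_conj.measurable.comp
    (h.meas k i)).aestronglyMeasurable) (ae_of_all _ fun x => ?_)
  simp

theorem _root_.Continuous.exists_entry_bound {f : ℝ → Matrix ι κ ℂ} (hf : Continuous f) (r : ℝ)
    (i : ι) (k : κ) : ∃ C, ∀ x ∈ Icc 0 r, ‖f x i k‖ ≤ C :=
  isCompact_Icc.exists_bound_of_continuousOn (hf.matrix_elem i k).continuousOn

theorem of_continuous (hf : Continuous f) : IsL2Mat r f := by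
  refine ⟨fun i k => (hf.matrix_elem i k).measurable, fun i k => ?_⟩
  obtain ⟨C, hC⟩ := hf.exists_entry_bound r i k
  exact memLp_of_bounded (hf.matrix_elem i k).aestronglyMeasurable
    (fun x hx => hC x ⟨hx.1.le, hx.2.le⟩) 2

theorem mul_continuous [Fintype κ] (h : IsL2Mat r f) (hG : Continuous G) :
    IsL2Mat r fun x => f x * G x := by
  refine ⟨fun i k => ?_, fun i k => ?_⟩ <;> simp only [Matrix.mul_apply]
  · exact Finset.measurable_fun_sum _ fun l _ => (h.meas i l).mul (hG.matrix_elem l k).measurable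
  · refine memLp_finsetSum _ fun l _ => ?_
    obtain ⟨C, hC⟩ := hG.exists_entry_bound r l k
    refine ((h.memLp i l).norm.const_mul C).mono
      ((h.meas i l).mul (hG.matrix_elem l k).measurable).aestronglyMeasurable
      (ae_vol_of_forall fun x hx => ?_)
    rw [norm_mul, norm_mul, norm_norm, mul_comm]
    gcongr
    exact (hC x ⟨hx.1.le, hx.2.le⟩).trans (le_abs_self C)

theorem continuous_mul [Fintype κ] (hF : Continuous F) (h : IsL2Mat r g) :
    IsL2Mat r fun x => F x * g x := by
  have := ((h.conjTranspose.mul_continuous hF.matrix_conjTranspose)).conjTranspose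
  simpa only [Matrix.conjTranspose_mul, Matrix.conjTranspose_conjTranspose] using this

theorem neg (h : IsL2Mat r f) : IsL2Mat r fun x => -f x := by
  simpa using h.smul (-1)

end IsL2Mat

end MatrixCalculus

/-! ### The class `𝒰` in terms of successive primitives -/

section ClassU

variable {ι κ : Type*} {r : ℝ} {F f g : ℝ → Matrix ι κ ℂ}

theorem HasPrim.hasDerivWithinAt {F f : ℝ → ℂ} (hr : 0 ≤ r) (h : HasPrim r F f)
    (hf : ContinuousOn f (Icc 0 r)) {x : ℝ} (hx : x ∈ Icc 0 r) :
    HasDerivWithinAt F (f x) (Icc 0 r) x := by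
  have hc := continuous_comp_clamp hr hf
  have h1 : HasDerivAt (fun x => F 0 + ∫ t in (0 : ℝ)..x, f (clamp r t)) (f (clamp r x)) x :=
    (intervalIntegral.integral_hasDerivAt_right (hc.intervalIntegrable _ _)
      hc.aestronglyMeasurable.stronglyMeasurableAtFilter hc.continuousAt).const_add (F 0)
  rw [clamp_eq hx] at h1
  have h2 : ∀ y ∈ Icc 0 r, F y = F 0 + ∫ t in (0 : ℝ)..y, f (clamp r t) := by
    intro y hy
    rw [h.2 y hy]
    congr 1
    exact intervalIntegral_congr_Ioo hy.1 fun t ht => by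
      rw [clamp_eq ⟨ht.1.le, ht.2.le.trans hy.2⟩]
  exact h1.hasDerivWithinAt.congr h2 (h2 x hx)

theorem MPrim.mderiv_eq (hr : 0 < r) (h : MPrim r F f)
    (hf : ∀ i k, ContinuousOn (fun x => f x i k) (Icc 0 r)) {x : ℝ}
    (hx : x ∈ Icc 0 r) : mderiv r F x = f x := by
  ext i k
  exact ((h i k).hasDerivWithinAt hr.le (hf i k) hx).derivWithin
    (uniqueDiffOn_Icc hr x hx)

theorem MPrim.memU (hr : 0 < r) (h : MPrim r F f) (h' : MPrim r f g)
    (hg : ∀ i k, MemLp (fun x => g x i k) 2 (vol r)) : MemU r F := by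
  refine ⟨fun i k x hx => ((h i k).hasDerivWithinAt hr.le
    (h'.continuousOn_entry i k) hx).differentiableWithinAt, g, hg, fun x hx => ?_⟩
  rw [h.mderiv_eq hr h'.continuousOn_entry hx, h.mderiv_eq hr h'.continuousOn_entry ⟨le_rfl, hr.le⟩]
  ext i k
  exact (h' i k).2 x hx

/-- The first derivative is a primitive, hence continuous, so the fundamental theorem of calculus
recovers `F` from it. The second derivative is exchanged for a representative that is measurable
everywhere. -/
theorem MemU.exists_prim (hr : 0 < r) (h : MemU r F) : ∃ g : ℝ → Matrix ι κ ℂ,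
    IsL2Mat r g ∧ MPrim r F (mderiv r F) ∧ MPrim r (mderiv r F) g := by
  obtain ⟨hd, G₂, hG, hG2⟩ := h
  let g : ℝ → Matrix ι κ ℂ := fun x => Matrix.of fun i k => (hG i k).aestronglyMeasurable.mk _ x
  have hgm : ∀ i k, Measurable fun x => g x i k := fun i k =>
    (hG i k).aestronglyMeasurable.stronglyMeasurable_mk.measurable
  have hgG : ∀ i k, (fun x => G₂ x i k) =ᵐ[vol r] fun x => g x i k := fun i k =>
    (hG i k).aestronglyMeasurable.ae_eq_mk
  have h2 : MPrim r (mderiv r F) G₂ := fun i k => ⟨(hG i k).integrable one_le_two, fun x hx =>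
    congrFun (congrFun (hG2 x hx) i) k⟩
  have h2' : MPrim r (mderiv r F) g := fun i k => (h2 i k).congr (hgG i k)
  refine ⟨g, ⟨hgm, fun i k => (hG i k).ae_eq (hgG i k)⟩, fun i k => ?_, h2'⟩
  have hc : ContinuousOn (fun x => mderiv r F x i k) (Icc 0 r) := (h2' i k).continuousOn
  refine ⟨integrable_vol_of_intervalIntegrable hr.le (ContinuousOn.intervalIntegrable (by
    rwa [uIcc_of_le hr.le])), fun x hx => ?_⟩
  have hsub : Icc 0 x ⊆ Icc 0 r := Icc_subset_Icc_right hx.2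
  rw [intervalIntegral.integral_eq_sub_of_hasDerivAt_of_le hx.1
    ((hd i k).continuousOn.mono hsub) (fun y hy => ?_)
    (ContinuousOn.intervalIntegrable (by rw [uIcc_of_le hx.1]; exact hc.mono hsub))]
  · ring
  · have hy' : y ∈ Icc 0 r := hsub ⟨hy.1.le, hy.2.le⟩
    exact ((hd i k) y hy').hasDerivWithinAt.hasDerivAt
      (Icc_mem_nhds hy.1 (hy.2.trans_le hx.2))

end ClassU

/-! ### Linear differential equations with square integrable coefficients -/

section LinearODE

variable {r : ℝ}

/-- The equation `Θ = 1 + ∫₀ˣ M Θ` is a Volterra equation with kernel `-M(t)`, dominated by `1 ·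
entrySum (M t)`. It is solved column by column, so square integrable `M` is enough. -/
theorem exists_linear_solution_fin (hr : 0 ≤ r) {p : ℕ} {M : ℝ → Matrix (Fin p) (Fin p) ℂ}
    (hM : IsL2Mat r M) : ∃ Θ : ℝ → Matrix (Fin p) (Fin p) ℂ, Continuous Θ ∧ Θ 0 = 1 ∧
      MPrim r Θ fun x => M x * Θ x := by
  have hk : IsVolterraKernel r (fun _ t => -M t) (fun _ => 1) fun t => entrySum (M t) :=
    { meas := fun i j => ((hM.meas i j).comp measurable_snd).neg
      left_nonneg := fun _ => zero_le_one
      right_nonneg := fun _ => entrySum_nonneg _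
      left_memLp := memLp_const _
      right_memLp := memLp_entrySum hM.memLp
      bound := fun x _ t _ => by simp [entrySum] }
  choose f hf hfe using fun k : Fin p => hk.exists_solution (memL2_const (r := r) (Pi.single k 1))
  have hi : ∀ i k l, Integrable (fun t => M t i l * f k t l) (vol r) := fun i k l =>
    (hM.memLp i l).integrable_mul (memL2_iff.1 (hf k) l)
  -- The right side of the integral equation: it agrees with the `L²` solution inside the interval,
  -- and it is continuous up to the end points with value `1` at `0`.
  let Θ : ℝ → Matrix (Fin p) (Fin p) ℂ := fun x => Matrix.of fun i k =>
    (1 : Matrix (Fin p) (Fin p) ℂ) i k + ∫ t in (0 : ℝ)..x, ∑ l, M t i l * f k t l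
  have hΘ0 : Θ 0 = 1 := by ext i k; simp [Θ]
  have hΘf : ∀ x ∈ Ioo 0 r, ∀ i k, Θ x i k = f k x i := by
    intro x hx i k
    have h1 := congrFun (hfe k x hx) i
    have h2 : ∀ l, IntervalIntegrable (fun t => -M t i l * f k t l) volume 0 x := fun l =>
      intervalIntegrable_zero_of_vol hx.1.le (integrable_vol_mono ((hi i k l).neg.congr
        (ae_of_all _ fun t => (neg_mul _ _).symm)) hx.2.le)
    have h3 : ∀ l, IntervalIntegrable (fun t => M t i l * f k t l) volume 0 x := fun l =>
      intervalIntegrable_zero_of_vol hx.1.le (integrable_vol_mono (hi i k l) hx.2.le)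
    have h4 : ∀ i' l, IntervalIntegrable (fun t => (-M t) i' l * f k t l) volume 0 x := fun i' l =>
      intervalIntegrable_zero_of_vol hx.1.le (integrable_vol_mono ((hi i' k l).neg.congr
        (ae_of_all _ fun t => (neg_mul _ _).symm)) hx.2.le)
    rw [Pi.add_apply, intervalIntegral_mulVec_apply h4] at h1
    simp only [Matrix.neg_apply, neg_mul, intervalIntegral.integral_neg, Finset.sum_neg_distrib] at h1
    simp only [Θ, Matrix.of_apply]
    rw [intervalIntegral.integral_finsetSum fun l _ => h3 l, Matrix.one_eq_pi_single,
      Pi.single_comm]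
    rw [← sub_eq_add_neg, sub_eq_iff_eq_add] at h1
    exact h1.symm ▸ by simp
  have hprim : MPrim r Θ fun x => M x * Θ x := by
    have : MPrim r Θ fun x => Matrix.of fun i k => ∑ l, M x i l * f k x l := fun i k =>
      ⟨integrable_finsetSum Finset.univ fun l _ => hi i k l, fun x hx => by
        have h1 : Θ 0 i k = (1 : Matrix (Fin p) (Fin p) ℂ) i k := by rw [hΘ0]
        exact congrArg (· + ∫ t in (0 : ℝ)..x, ∑ l, M t i l * f k t l) h1.symm⟩
    refine this.congr (ae_vol_of_forall fun x hx => ?_)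
    ext i k
    simp only [Matrix.of_apply, Matrix.mul_apply]
    exact Finset.sum_congr rfl fun l _ => by rw [hΘf x hx]
  have h0 : (0 : ℝ) ∈ Icc 0 r := ⟨le_rfl, hr⟩
  refine ⟨fun x => Θ (clamp r x), continuous_comp_clamp hr hprim.continuousOn, by
    simp only [clamp_eq h0, hΘ0], (hprim.congr_left fun x hx => by rw [clamp_eq hx]).congr
    (ae_vol_of_forall fun x hx => by simp only [clamp_eq ⟨hx.1.le, hx.2.le⟩])⟩

variable {ι : Type*} [Fintype ι] [DecidableEq ι]

theorem exists_linear_solution (hr : 0 ≤ r) {M : ℝ → Matrix ι ι ℂ} (hM : IsL2Mat r M) :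
    ∃ Θ : ℝ → Matrix ι ι ℂ, Continuous Θ ∧ Θ 0 = 1 ∧ MPrim r Θ fun x => M x * Θ x := by
  let e := Fintype.equivFin ι
  obtain ⟨Θ, h1, h2, h3⟩ := exists_linear_solution_fin hr
    (M := fun x => (M x).submatrix e.symm e.symm)
    ⟨fun i k => hM.meas _ _, fun i k => hM.memLp _ _⟩
  refine ⟨fun x => (Θ x).submatrix e e, h1.matrix_submatrix e e, by simp only [h2, Matrix.submatrix_one_equiv], fun i k => ?_⟩
  have hmul : ∀ x, ((M x).submatrix e.symm e.symm * Θ x).submatrix e e =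
      M x * (Θ x).submatrix e e := fun x => by
    rw [← Matrix.submatrix_mul_equiv _ _ e e e]
    simp
  exact (h3 (e i) (e k)).congr (ae_of_all _ fun x => congrFun (congrFun (hmul x) i) k)

/-- A fundamental matrix and its inverse. -/
theorem exists_fundamental (hr : 0 ≤ r) {M : ℝ → Matrix ι ι ℂ} (hM : IsL2Mat r M) :
    ∃ Θ Y : ℝ → Matrix ι ι ℂ, Continuous Θ ∧ Continuous Y ∧
      (MPrim r Y fun x => -(Y x * M x)) ∧ ∀ x ∈ Icc 0 r, Θ x * Y x = 1 := by
  obtain ⟨Θ, h1, h2, h3⟩ := exists_linear_solution hr hM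
  -- The inverse is the transposed solution of the adjoint equation: `Y = Zᵀ` satisfies `Y' = -Y M`,
  -- so `(Y Θ)' = 0` and `Y Θ = 1`.
  obtain ⟨Z, k1, k2, k3⟩ := exists_linear_solution hr (M := fun x => -(M x)ᵀ)
    ⟨fun i k => (hM.meas k i).neg, fun i k => (hM.memLp k i).neg⟩
  have hY : MPrim r (fun x => (Z x)ᵀ) fun x => -((Z x)ᵀ * M x) :=
    k3.transpose.congr (ae_of_all _ fun x => by
      simp only [Matrix.transpose_mul, Matrix.transpose_neg, Matrix.transpose_transpose,
        Matrix.mul_neg])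
  refine ⟨Θ, fun x => (Z x)ᵀ, h1, k1.matrix_transpose, hY, fun x hx => mul_eq_one_comm.1 ?_⟩
  have := (hY.mul h3).eq_of_zero (ae_of_all _ fun x => by
    rw [Matrix.neg_mul, Matrix.mul_assoc, neg_add_cancel]) hx
  rw [this, h2, k2]; simp

/-- The fundamental matrix is unitary if the coefficient is skew-Hermitian. -/
theorem exists_unitary_solution (hr : 0 ≤ r) {M : ℝ → Matrix ι ι ℂ} (hM : IsL2Mat r M)
    (hskew : ∀ x, (M x)ᴴ = -M x) : ∃ u : ℝ → Matrix ι ι ℂ, Continuous u ∧ u 0 = 1 ∧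
      (MPrim r u fun x => M x * u x) ∧ ∀ x ∈ Icc 0 r, u x * (u x)ᴴ = 1 := by
  obtain ⟨u, h1, h2, h3⟩ := exists_linear_solution hr hM
  refine ⟨u, h1, h2, h3, fun x hx => mul_eq_one_comm.1 ?_⟩
  have := (h3.conjTranspose.mul h3).eq_of_zero (ae_of_all _ fun x => by
    rw [Matrix.conjTranspose_mul, hskew, Matrix.mul_neg, Matrix.neg_mul, Matrix.mul_assoc,
      neg_add_cancel]) hx
  rw [this, h2]; simp

end LinearODE

/-! ### The unitary gauge in which `β' j β'* = 0` -/

section Jmat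

variable {m₁ m₂ : ℕ}

theorem jmat_conjTranspose : (jmat m₁ m₂)ᴴ = jmat m₁ m₂ := by
  simp [jmat, Matrix.fromBlocks_conjTranspose]

end Jmat

/-- The data `β` of a canonical system together with its first two derivatives, in the gauge in
which `β' j β'* = 0`. -/
structure IsGauged {m₁ m₂ : ℕ} (r : ℝ) (c₀ c₁ c₂ : ℝ → Matrix (Fin m₂) (Fin m₁ ⊕ Fin m₂) ℂ) :
    Prop where
  cont₀ : Continuous c₀
  cont₁ : Continuous c₁
  isL2 : IsL2Mat r c₂
  prim₀ : MPrim r c₀ c₁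
  prim₁ : MPrim r c₁ c₂
  rel₀₀ : ∀ x, c₀ x * jmat m₁ m₂ * (c₀ x)ᴴ = 0
  rel₁₀ : ∀ x, c₁ x * jmat m₁ m₂ * (c₀ x)ᴴ = Complex.I • 1
  rel₁₁ : ∀ x, c₁ x * jmat m₁ m₂ * (c₁ x)ᴴ = 0

section Gauge

variable {m₁ m₂ : ℕ} {r : ℝ} {β : ℝ → Matrix (Fin m₂) (Fin m₁ ⊕ Fin m₂) ℂ}

theorem conj_rel {κ : Type*} [Fintype κ] (J : Matrix κ κ ℂ) (u : Matrix (Fin m₂) (Fin m₂) ℂ)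
    (x y : Matrix (Fin m₂) κ ℂ) : (uᴴ * x) * J * (uᴴ * y)ᴴ = uᴴ * (x * J * yᴴ) * u := by
  simp only [Matrix.conjTranspose_mul, Matrix.conjTranspose_conjTranspose, Matrix.mul_assoc]

/-- Replacing `b₁` by `b₁ - M b₀` changes `b₁ J b₁*` by `-b₁ J b₀* M* - M b₀ J b₁* = 2 i M`, because
`b₁ J b₀* = i`, `b₀ J b₁* = -i` and `M* = -M`; the quadratic term vanishes by isotropy. The factor
`i/2` in `M` makes the result zero. -/
theorem gauge_rel {κ : Type*} [Fintype κ] {J : Matrix κ κ ℂ} (hJ : Jᴴ = J)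
    {b₀ b₁ : Matrix (Fin m₂) κ ℂ} (h0 : b₀ * J * b₀ᴴ = 0) (h1 : b₁ * J * b₀ᴴ = Complex.I • 1)
    {M : Matrix (Fin m₂) (Fin m₂) ℂ} (hM : M = (Complex.I / 2) • (b₁ * J * b₁ᴴ)) (hM' : Mᴴ = -M) :
    (b₁ - M * b₀) * J * b₀ᴴ = Complex.I • 1 ∧
      (b₁ - M * b₀) * J * (b₁ - M * b₀)ᴴ = 0 := by
  have e : b₁ * J * b₁ᴴ = -(2 * Complex.I) • M := by
    rw [hM, smul_smul, show -(2 * Complex.I) * (Complex.I / 2) = -(Complex.I * Complex.I) by ring,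
      Complex.I_mul_I, neg_neg, one_smul]
  have h1' : b₀ * J * b₁ᴴ = -Complex.I • 1 := by
    have := congrArg Matrix.conjTranspose h1
    simpa [Matrix.conjTranspose_mul, hJ, Matrix.mul_assoc] using this
  refine ⟨?_, ?_⟩
  · rw [Matrix.sub_mul, Matrix.sub_mul, h1, Matrix.mul_assoc, Matrix.mul_assoc, ← Matrix.mul_assoc b₀,
      h0, Matrix.mul_zero, sub_zero]
  · rw [Matrix.conjTranspose_sub, Matrix.conjTranspose_mul, hM', Matrix.mul_sub, Matrix.sub_mul,
      Matrix.sub_mul, Matrix.sub_mul, e, ← Matrix.mul_assoc (b₁ * J), h1, Matrix.mul_assoc M,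
      Matrix.mul_assoc M, h1', ← Matrix.mul_assoc (M * (b₀ * J)), Matrix.mul_assoc M, h0]
    simp only [Matrix.mul_neg, Matrix.mul_zero, Matrix.zero_mul, Matrix.smul_mul, Matrix.one_mul,
      Matrix.mul_smul, Matrix.mul_one, neg_smul]
    module

theorem Admissible.exists_gauge (hr : 0 < r) (h : Admissible β r) :
    ∃ (u : ℝ → Matrix (Fin m₂) (Fin m₂) ℂ) (c₀ c₁ c₂ : ℝ → Matrix (Fin m₂) (Fin m₁ ⊕ Fin m₂) ℂ),
      Continuous u ∧ MemU r u ∧ (∀ x, u x * (u x)ᴴ = 1) ∧ u 0 = 1 ∧ IsGauged r c₀ c₁ c₂ ∧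
      ∀ x ∈ Icc 0 r, β x = u x * c₀ x := by
  obtain ⟨b₂, hb₂, hp0, hp1⟩ := h.memU.exists_prim hr
  -- The data are extended constantly beyond `[0,r]`, so that continuity and the algebraic relations
  -- hold on the whole line.
  let b₀ : ℝ → Matrix (Fin m₂) (Fin m₁ ⊕ Fin m₂) ℂ := fun x => β (clamp r x)
  let b₁ : ℝ → Matrix (Fin m₂) (Fin m₁ ⊕ Fin m₂) ℂ := fun x => mderiv r β (clamp r x)
  have hb0c : Continuous b₀ := continuous_comp_clamp hr.le hp0.continuousOn
  have hb1c : Continuous b₁ := continuous_comp_clamp hr.le hp1.continuousOn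
  have hb0 : MPrim r b₀ b₁ := (hp0.congr_left fun x hx => by simp only [b₀, clamp_eq hx]).congr
    (ae_vol_of_forall fun x hx => by simp only [b₁, clamp_eq ⟨hx.1.le, hx.2.le⟩])
  have hb1 : MPrim r b₁ b₂ := hp1.congr_left fun x hx => by simp only [b₁, clamp_eq hx]
  have r0 : ∀ x, b₀ x * jmat m₁ m₂ * (b₀ x)ᴴ = 0 := fun x => h.isotropic _ (clamp_mem hr.le x)
  have r1 : ∀ x, b₁ x * jmat m₁ m₂ * (b₀ x)ᴴ = Complex.I • 1 :=
    fun x => h.normalised _ (clamp_mem hr.le x)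
  -- If `u' = M u` with `M` skew-Hermitian, then `u` is unitary and `(u* β)' = u* (β' - M β)`;
  -- `gauge_rel` determines this choice of `M`.
  let M : ℝ → Matrix (Fin m₂) (Fin m₂) ℂ := fun x =>
    (Complex.I / 2) • (b₁ x * jmat m₁ m₂ * (b₁ x)ᴴ)
  have hMc : Continuous M := ((hb1c.matrix_mul continuous_const).matrix_mul
    hb1c.matrix_conjTranspose).const_smul (Complex.I / 2)
  have hMs : ∀ x, (M x)ᴴ = -M x := fun x => by
    simp only [M, Matrix.conjTranspose_smul, Matrix.conjTranspose_mul, jmat_conjTranspose,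
      Matrix.conjTranspose_conjTranspose, Matrix.mul_assoc, ← neg_smul]
    congr 1
    simp [neg_div]
  obtain ⟨u, hu1, hu2, hu3, hu4⟩ := exists_unitary_solution hr.le (IsL2Mat.of_continuous hMc) hMs
  let M' : ℝ → Matrix (Fin m₂) (Fin m₂) ℂ := fun x => (Complex.I / 2) •
    ((b₂ x * jmat m₁ m₂) * (b₁ x)ᴴ + (b₁ x * jmat m₁ m₂) * (b₂ x)ᴴ)
  have hJ : MPrim r (fun x => b₁ x * jmat m₁ m₂) fun x => b₂ x * jmat m₁ m₂ :=
    (hb1.mul (MPrim.const _)).congr (ae_of_all _ fun x => by simp)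
  have hM' : MPrim r M M' := ((hJ.mul hb1.conjTranspose).smul _)
  have hM'2 : IsL2Mat r M' := (((hb₂.mul_continuous continuous_const).mul_continuous
    hb1c.matrix_conjTranspose).add (IsL2Mat.continuous_mul (hb1c.matrix_mul continuous_const)
    hb₂.conjTranspose)).smul _
  let v : ℝ → Matrix (Fin m₂) (Fin m₂) ℂ := fun x => u (clamp r x)
  have hvc : Continuous v := continuous_comp_clamp hr.le hu1.continuousOn
  have hv : MPrim r v fun x => M x * v x :=
    (hu3.congr_left fun x hx => by simp only [v, clamp_eq hx]).congr
    (ae_vol_of_forall fun x hx => by simp only [v, clamp_eq ⟨hx.1.le, hx.2.le⟩])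
  have hvv : ∀ x, v x * (v x)ᴴ = 1 := fun x => hu4 _ (clamp_mem hr.le x)
  have hvv' : ∀ x, (v x)ᴴ * v x = 1 := fun x => mul_eq_one_comm.1 (hvv x)
  have hd : MPrim r (fun x => b₁ x - M x * b₀ x) fun x => b₂ x - (M' x * b₀ x + M x * b₁ x) := by
    simp only [sub_eq_add_neg]
    have := hb1.add ((hM'.mul hb0).smul (-1))
    simpa only [neg_smul, one_smul] using this
  have hd2 : IsL2Mat r fun x => b₂ x - (M' x * b₀ x + M x * b₁ x) := by
    simp only [sub_eq_add_neg]
    exact hb₂.add ((hM'2.mul_continuous hb0c).add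
      (IsL2Mat.of_continuous (hMc.matrix_mul hb1c))).neg
  have hdc : Continuous fun x => b₁ x - M x * b₀ x := hb1c.sub (hMc.matrix_mul hb0c)
  have hg := fun x => gauge_rel jmat_conjTranspose (r0 x) (r1 x) (M := M x) rfl (hMs x)
  refine ⟨v, fun x => (v x)ᴴ * b₀ x, fun x => (v x)ᴴ * (b₁ x - M x * b₀ x),
    fun x => (M x * v x)ᴴ * (b₁ x - M x * b₀ x) +
      (v x)ᴴ * (b₂ x - (M' x * b₀ x + M x * b₁ x)), hvc, ?_, hvv, ?_, ?_, ?_⟩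
  · refine hv.memU hr (hM'.mul hv) ?_
    exact ((hM'2.mul_continuous hvc).add (IsL2Mat.of_continuous
      (hMc.matrix_mul (hMc.matrix_mul hvc)))).memLp
  · simp only [v, clamp_eq ⟨le_rfl, hr.le⟩, hu2]
  · refine ⟨hvc.matrix_conjTranspose.matrix_mul hb0c, hvc.matrix_conjTranspose.matrix_mul hdc, ?_,
      ?_, hv.conjTranspose.mul hd, fun x => ?_, fun x => ?_, fun x => ?_⟩
    · exact (IsL2Mat.of_continuous ((hMc.matrix_mul hvc).matrix_conjTranspose.matrix_mul hdc)).add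
        (IsL2Mat.continuous_mul hvc.matrix_conjTranspose hd2)
    · refine (hv.conjTranspose.mul hb0).congr (ae_of_all _ fun x => ?_)
      rw [Matrix.conjTranspose_mul, hMs, Matrix.mul_sub, Matrix.mul_neg, Matrix.neg_mul,
        Matrix.mul_assoc, neg_add_eq_sub]
    · rw [conj_rel, r0, Matrix.mul_zero, Matrix.zero_mul]
    · rw [conj_rel, (hg x).1, Matrix.mul_smul, Matrix.smul_mul, Matrix.mul_one, hvv']
    · rw [conj_rel, (hg x).2, Matrix.mul_zero, Matrix.zero_mul]
  · intro x hx
    rw [← Matrix.mul_assoc, hvv, Matrix.one_mul]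
    simp only [b₀, clamp_eq hx]

end Gauge

/-! ### Vector functions -/

/-- Entrywise primitives of vector functions. -/
def VPrim {ι : Type*} (r : ℝ) (F f : ℝ → ι → ℂ) : Prop :=
  ∀ i, HasPrim r (fun x => F x i) fun x => f x i

namespace VPrim

variable {ι κ : Type*} {r : ℝ} {F f f' : ℝ → ι → ℂ}

theorem congr (h : VPrim r F f) (hf : ∀ᵐ x ∂(vol r), f x = f' x) : VPrim r F f' := fun i =>
  (h i).congr (hf.mono fun x hx => by simp only [hx])

theorem congr_left {F' : ℝ → ι → ℂ} (h : VPrim r F f) (hF : ∀ x ∈ Icc 0 r, F x = F' x) :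
    VPrim r F' f := fun i => (h i).congr_left fun x hx => by rw [hF x hx]

theorem mulVec [Fintype ι] {G g : ℝ → Matrix κ ι ℂ} (hG : MPrim r G g) (h : VPrim r F f) :
    VPrim r (fun x => G x *ᵥ F x) fun x => g x *ᵥ F x + G x *ᵥ f x := fun i => by
  simp only [mulVec_apply_sum, Pi.add_apply, ← Finset.sum_add_distrib]
  exact HasPrim.sum _ fun l _ => (hG i l).mul (h l)

theorem eq_of_ae_eq (h : VPrim r F f) {F' : ℝ → ι → ℂ} (h' : VPrim r F' f')
    (h0 : F 0 = F' 0) (hf : ∀ᵐ x ∂(vol r), f x = f' x) {x : ℝ} (hx : x ∈ Icc 0 r) :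
    F x = F' x := by
  ext i
  have h1 : F x i = F 0 i + ∫ t in (0 : ℝ)..x, f t i := (h i).2 x hx
  have h2 : F' x i = F' 0 i + ∫ t in (0 : ℝ)..x, f' t i := (h' i).2 x hx
  rw [h1, h2, h0, intervalIntegral_congr_vol (g := fun x => f' x i)
    (hf.mono fun x hx => by simp only [hx]) hx]

theorem continuousOn (h : VPrim r F f) : ContinuousOn F (Icc 0 r) :=
  continuousOn_pi.2 fun i => (h i).continuousOn

theorem of_integral [Fintype ι] (hf : Integrable f (vol r)) :
    VPrim r (fun x => ∫ t in (0 : ℝ)..x, f t) f := fun i =>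
  ⟨hf.eval i, fun x hx => by
    have := intervalIntegral_apply (intervalIntegrable_of_vol hf ⟨le_rfl, hx.1.trans hx.2⟩ hx) i
    simp only [this, intervalIntegral.integral_same, Pi.zero_apply, zero_add]⟩

/-- The second order Taylor formula. -/
theorem taylor {p : ℕ} {F f g : ℝ → Fin p → ℂ} (h : VPrim r F f) (h' : VPrim r f g) {x : ℝ}
    (hx : x ∈ Icc 0 r) : F x = F 0 + x • f 0 - opA p g x := by
  have h0 : (0 : ℝ) ∈ Icc 0 r := ⟨le_rfl, hx.1.trans hx.2⟩
  have hg : Integrable g (vol x) := Integrable.of_eval fun i => integrable_vol_mono (h' i).1 hx.2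
  ext i
  have hl : HasPrim r (fun t : ℝ => ((t - x : ℝ) : ℂ)) fun _ => 1 :=
    ⟨integrable_const _, fun y _ => by simp; ring⟩
  have h1 : F x i = F 0 i + ∫ t in (0 : ℝ)..x, f t i := (h i).2 x hx
  have h2 := (hl.mul (h' i)).2 x hx
  have h3 : IntervalIntegrable (fun t => 1 * f t i) volume 0 x := by
    simpa only [one_mul] using intervalIntegrable_of_vol (h i).1 h0 hx
  have h4 : IntervalIntegrable (fun t => ((t - x : ℝ) : ℂ) * g t i) volume 0 x :=
    (intervalIntegrable_of_vol (h' i).1 h0 hx).continuousOn_mul (by fun_prop)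
  rw [intervalIntegral.integral_add h3 h4] at h2
  simp only [one_mul, sub_self, Complex.ofReal_zero, zero_mul, zero_sub] at h2
  rw [Pi.sub_apply, Pi.add_apply, Pi.smul_apply, opA_apply_apply hx.1 hg, h1,
    Complex.real_smul]
  rw [Complex.ofReal_neg] at h2
  linear_combination -h2

/-- Double integration produces a twice differentiable function. -/
theorem opA {p : ℕ} {f : ℝ → Fin p → ℂ} (hf : Integrable f (vol r)) :
    VPrim r (opA p f) fun x => -∫ t in (0 : ℝ)..x, f t := by
  have h1 : VPrim r (fun x => -∫ t in (0 : ℝ)..x, f t) fun x => -f x := by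
    have := VPrim.of_integral hf.neg
    simp only [Pi.neg_apply, intervalIntegral.integral_neg] at this
    exact this
  have h2 : Integrable (fun x => -∫ t in (0 : ℝ)..x, f t) (vol r) := by
    rcases le_or_gt 0 r with hr | hr
    · refine integrable_vol_of_intervalIntegrable hr (ContinuousOn.intervalIntegrable ?_)
      rw [uIcc_of_le hr]
      exact h1.continuousOn
    · rw [vol, Ioo_eq_empty (by linarith), Measure.restrict_empty]
      exact integrable_zero_measure
  refine (VPrim.of_integral h2).congr_left fun x hx => ?_
  rw [(VPrim.of_integral h2).taylor h1 hx]
  simp only [intervalIntegral.integral_same, neg_zero, smul_zero, zero_add]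
  simp [GenCanonical.opA]

end VPrim

section SquareIntegrable

variable {p n : ℕ} {r : ℝ}

theorem memL2_of_continuousOn {f : ℝ → Fin p → ℂ} (hf : ContinuousOn f (Icc 0 r)) :
    MemL2 r f := by
  obtain ⟨C, hC⟩ := isCompact_Icc.exists_bound_of_continuousOn hf
  exact memLp_of_bounded ((hf.mono Ioo_subset_Icc_self).aestronglyMeasurable measurableSet_Ioo)
    (fun x hx => hC x ⟨hx.1.le, hx.2.le⟩) 2

theorem IsL2Mat.integrable_mulVec {κ : Type*} [Fintype κ] {M : ℝ → Matrix κ (Fin p) ℂ}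
    (hM : IsL2Mat r M) {f : ℝ → Fin p → ℂ} (hf : MemL2 r f) :
    Integrable (fun x => M x *ᵥ f x) (vol r) :=
  Integrable.of_eval fun i => by
    simp only [mulVec_apply_sum]
    exact integrable_finsetSum _ fun l _ => (hM.memLp i l).integrable_mul (memL2_iff.1 hf l)

/-- Matrix functions with square integrable entries map continuous functions to `L²`. -/
theorem IsL2Mat.memL2_mulVec {κ : Type*} [Fintype κ] {M : ℝ → Matrix (Fin p) κ ℂ}
    (hM : IsL2Mat r M) {f : ℝ → κ → ℂ} (hf : ContinuousOn f (Icc 0 r)) :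
    MemL2 r fun x => M x *ᵥ f x := by
  refine memL2_iff.2 fun i => ?_
  simp only [mulVec_apply_sum]
  refine memLp_finsetSum _ fun l _ => ?_
  have hl : ContinuousOn (fun x => f x l) (Icc 0 r) := continuousOn_pi.1 hf l
  obtain ⟨C, hC⟩ := isCompact_Icc.exists_bound_of_continuousOn hl
  refine ((hM.memLp i l).norm.const_mul C).mono
    ((hM.meas i l).aestronglyMeasurable.mul
      ((hl.mono Ioo_subset_Icc_self).aestronglyMeasurable measurableSet_Ioo))
    (ae_vol_of_forall fun x hx => ?_)
  rw [norm_mul, norm_mul, norm_norm, mul_comm]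
  gcongr
  exact (hC x ⟨hx.1.le, hx.2.le⟩).trans (le_abs_self C)

end SquareIntegrable

/-! ### The factorisation `K = A (I - N)` and the operator `Q` with `Q K = N` -/

section Coefficients

variable {m₁ m₂ : ℕ} {r : ℝ} {c₀ c₁ c₂ : ℝ → Matrix (Fin m₂) (Fin m₁ ⊕ Fin m₂) ℂ}

/-- The operator `f ↦ i c₂(x) j ∫_0^x c₀(t)* f(t) dt`. -/
noncomputable def opN (c₀ c₂ : ℝ → Matrix (Fin m₂) (Fin m₁ ⊕ Fin m₂) ℂ) : Op m₂ := fun f x =>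
  Complex.I • ((c₂ x * jmat m₁ m₂) *ᵥ ∫ t in (0 : ℝ)..x, (c₀ t)ᴴ *ᵥ f t)

namespace IsGauged

theorem vPrim_integral (h : IsGauged r c₀ c₁ c₂) {f : ℝ → Fin m₂ → ℂ} (hf : MemL2 r f) :
    VPrim r (fun x => ∫ t in (0 : ℝ)..x, (c₀ t)ᴴ *ᵥ f t) fun x => (c₀ x)ᴴ *ᵥ f x :=
  VPrim.of_integral ((IsL2Mat.of_continuous h.cont₀.matrix_conjTranspose).integrable_mulVec hf)

/-- Isotropy removes the term `i c₀ j c₀* f`, so the derivative of `K f` contains no value of `f`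
and is again absolutely continuous. -/
theorem vPrim_opK (h : IsGauged r c₀ c₁ c₂) {f : ℝ → Fin m₂ → ℂ} (hf : MemL2 r f) :
    VPrim r (opK c₀ f) fun x =>
      Complex.I • ((c₁ x * jmat m₁ m₂) *ᵥ ∫ t in (0 : ℝ)..x, (c₀ t)ᴴ *ᵥ f t) := by
  have h1 := VPrim.mulVec ((h.prim₀.mul (MPrim.const (jmat m₁ m₂))).smul Complex.I)
    (h.vPrim_integral hf)
  refine (h1.congr_left fun x _ => ?_).congr (ae_of_all _ fun x => ?_)
  · rw [opK, Matrix.smul_mulVec]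
  · rw [Matrix.mul_zero, add_zero, Matrix.smul_mulVec, Matrix.smul_mulVec, Matrix.mulVec_mulVec,
      h.rel₀₀, Matrix.zero_mulVec, smul_zero, add_zero]

/-- Here the normalisation enters: differentiating the integral gives `i c₁ j c₀* f = i² f = -f`,
the same leading term as for `A`. -/
theorem vPrim_opK_deriv (h : IsGauged r c₀ c₁ c₂) {f : ℝ → Fin m₂ → ℂ} (hf : MemL2 r f) :
    VPrim r (fun x => Complex.I • ((c₁ x * jmat m₁ m₂) *ᵥ ∫ t in (0 : ℝ)..x, (c₀ t)ᴴ *ᵥ f t))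
      fun x => opN c₀ c₂ f x - f x := by
  have h1 := VPrim.mulVec ((h.prim₁.mul (MPrim.const (jmat m₁ m₂))).smul Complex.I)
    (h.vPrim_integral hf)
  refine (h1.congr_left fun x _ => ?_).congr (ae_of_all _ fun x => ?_)
  · rw [Matrix.smul_mulVec]
  · rw [Matrix.mul_zero, add_zero, Matrix.smul_mulVec, Matrix.smul_mulVec, Matrix.mulVec_mulVec,
      h.rel₁₀, Matrix.smul_mulVec, Matrix.one_mulVec, smul_smul, Complex.I_mul_I, opN, neg_one_smul,
      sub_eq_add_neg]

theorem memL2_opN (h : IsGauged r c₀ c₁ c₂) {f : ℝ → Fin m₂ → ℂ} (hf : MemL2 r f) :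
    MemL2 r (opN c₀ c₂ f) := by
  have := (((h.isL2.mul_continuous (continuous_const (y := jmat m₁ m₂))).smul
    Complex.I).memL2_mulVec (h.vPrim_integral hf).continuousOn)
  simp only [Matrix.smul_mulVec] at this
  exact this

theorem opK_zero (c : ℝ → Matrix (Fin m₂) (Fin m₁ ⊕ Fin m₂) ℂ) (f : ℝ → Fin m₂ → ℂ) :
    opK c f 0 = 0 := by simp [opK]

theorem memL2_opK (h : IsGauged r c₀ c₁ c₂) {f : ℝ → Fin m₂ → ℂ} (hf : MemL2 r f) :
    MemL2 r (opK c₀ f) := memL2_of_continuousOn (h.vPrim_opK hf).continuousOn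

/-- `K = A (I - N)`. -/
theorem opK_eq (h : IsGauged r c₀ c₁ c₂) {f : ℝ → Fin m₂ → ℂ} (hf : MemL2 r f) {x : ℝ}
    (hx : x ∈ Icc 0 r) : opK c₀ f x = opA m₂ (fun t => f t - opN c₀ c₂ f t) x := by
  rw [(h.vPrim_opK hf).taylor (h.vPrim_opK_deriv hf) hx, opK_zero]
  simp only [intervalIntegral.integral_same, Matrix.mulVec_zero, smul_zero, zero_add, opA]
  rw [zero_sub, ← intervalIntegral.integral_neg]
  simp only [← smul_neg, neg_sub]

/-- Differentiating the constant `c₁ j c₀*` gives `c₂ j c₀* + c₁ j c₁* = 0`, and the second term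
vanishes in the chosen gauge. The gauge is introduced for this relation. -/
theorem rel₂₀ (h : IsGauged r c₀ c₁ c₂) :
    ∀ᵐ x ∂(vol r), c₂ x * jmat m₁ m₂ * (c₀ x)ᴴ = 0 := by
  have h1 := ((h.prim₁.mul (MPrim.const (jmat m₁ m₂))).mul h.prim₀.conjTranspose).ae_eq_zero
    fun x _ => by rw [h.rel₁₀, h.rel₁₀]
  filter_upwards [h1] with x hx
  rwa [h.rel₁₁, add_zero, Matrix.mul_zero, add_zero] at hx

/-- Here `w` stands for `W = ∫₀ˣ c₀* f` and `k` for `K f = i c₀ j W`. The aim is to express `N f = i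
c₂ j W` without `W`. The auxiliary vector `ψ = P W` differs from `j W` by a multiple of `k` and by a
term in `j c₀*`, which `c₂` annihilates; hence `N f = i c₂ ψ + q k`. The second equation turns `ψ' =
P' W` into a linear equation for `ψ` with source linear in `k`. -/
theorem source_algebra {κ : Type*} [Fintype κ] {J : Matrix κ κ ℂ}
    {c₀ c₁ c₂ : Matrix (Fin m₂) κ ℂ} (h : c₂ * J * c₀ᴴ = 0) (w : κ → ℂ) :
    let ψ := (J + (-Complex.I) • (J * c₁ᴴ * (c₀ * J)) + Complex.I • (J * c₀ᴴ * (c₁ * J))) *ᵥ w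
    let k := Complex.I • ((c₀ * J) *ᵥ w)
    let q := Complex.I • (c₂ * J * c₁ᴴ)
    Complex.I • ((c₂ * J) *ᵥ w) = (Complex.I • c₂) *ᵥ ψ + q *ᵥ k ∧
      ((-Complex.I) • (J * c₂ᴴ * (c₀ * J)) + Complex.I • (J * c₀ᴴ * (c₂ * J))) *ᵥ w =
        (Complex.I • (J * c₀ᴴ * c₂)) *ᵥ ψ + (J * c₀ᴴ * q + -(J * c₂ᴴ)) *ᵥ k := by
  intro ψ k q
  have h1 : c₂ *ᵥ ψ = (c₂ * J) *ᵥ w + Complex.I • (q *ᵥ k) := by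
    have e : c₂ * (J + (-Complex.I) • (J * c₁ᴴ * (c₀ * J)) + Complex.I • (J * c₀ᴴ * (c₁ * J))) =
        c₂ * J + (-Complex.I) • (c₂ * J * c₁ᴴ * (c₀ * J)) := by
      rw [Matrix.mul_add, Matrix.mul_add, Matrix.mul_smul, Matrix.mul_smul,
        ← Matrix.mul_assoc c₂ (J * c₀ᴴ), ← Matrix.mul_assoc c₂ J, h, Matrix.zero_mul, smul_zero,
        add_zero, ← Matrix.mul_assoc c₂ (J * c₁ᴴ), ← Matrix.mul_assoc c₂ J]
    simp only [ψ, k, q]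
    rw [Matrix.mulVec_mulVec, e, Matrix.add_mulVec]
    simp only [Matrix.smul_mulVec, Matrix.mulVec_smul, Matrix.mulVec_mulVec, smul_smul,
      Complex.I_mul_I, neg_smul, one_smul, Matrix.neg_mulVec, Matrix.smul_mul, smul_neg]
  have h2 : Complex.I • ((c₂ * J) *ᵥ w) = (Complex.I • c₂) *ᵥ ψ + q *ᵥ k := by
    rw [Matrix.smul_mulVec, h1, smul_add, smul_smul, Complex.I_mul_I]
    simp
  refine ⟨h2, ?_⟩
  have h3 : (Complex.I • (J * c₀ᴴ * (c₂ * J))) *ᵥ w =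
      (J * c₀ᴴ) *ᵥ (Complex.I • ((c₂ * J) *ᵥ w)) := by
    simp only [Matrix.smul_mulVec, Matrix.mulVec_smul, Matrix.mulVec_mulVec]
  have h4 : ((-Complex.I) • (J * c₂ᴴ * (c₀ * J))) *ᵥ w = -((J * c₂ᴴ) *ᵥ k) := by
    simp only [k, Matrix.smul_mulVec, Matrix.mulVec_smul, Matrix.mulVec_mulVec, neg_smul,
      Matrix.neg_mulVec]
  have h5 : (Complex.I • (J * c₀ᴴ * c₂)) *ᵥ ψ = (J * c₀ᴴ) *ᵥ ((Complex.I • c₂) *ᵥ ψ) := by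
    rw [Matrix.mulVec_mulVec ψ, Matrix.mul_smul]
  rw [Matrix.add_mulVec, h3, h2, h4, h5, Matrix.mulVec_add, Matrix.add_mulVec _ _ k,
    Matrix.neg_mulVec, Matrix.mulVec_mulVec k]
  abel

/-- The operator `A⁻¹ - K⁻¹` is of the form `h ↦ q h + a ∫_0^x b h`. -/
theorem exists_coeff (hr : 0 < r) (h : IsGauged r c₀ c₁ c₂) :
    ∃ (q : ℝ → Matrix (Fin m₂) (Fin m₂) ℂ) (a : ℝ → Matrix (Fin m₂) (Fin m₁ ⊕ Fin m₂) ℂ)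
      (b : ℝ → Matrix (Fin m₁ ⊕ Fin m₂) (Fin m₂) ℂ), IsCoeff r q a b ∧
      ∀ f, MemL2 r f → opQ q a b (opK c₀ f) =ᵐ[vol r] opN c₀ c₂ f := by
  let J := jmat m₁ m₂
  have hJ : Continuous fun _ : ℝ => J := continuous_const
  have h0s := h.cont₀.matrix_conjTranspose
  have h1s := h.cont₁.matrix_conjTranspose
  let q : ℝ → Matrix (Fin m₂) (Fin m₂) ℂ := fun x => Complex.I • (c₂ x * J * (c₁ x)ᴴ)
  have hq : IsL2Mat r q := ((h.isL2.mul_continuous hJ).mul_continuous h1s).smul _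
  let d₁ : ℝ → Matrix (Fin m₁ ⊕ Fin m₂) (Fin m₁ ⊕ Fin m₂) ℂ := fun x =>
    Complex.I • (J * (c₀ x)ᴴ * c₂ x)
  have hd₁ : IsL2Mat r d₁ := (IsL2Mat.continuous_mul (hJ.matrix_mul h0s) h.isL2).smul _
  let d₂ : ℝ → Matrix (Fin m₁ ⊕ Fin m₂) (Fin m₂) ℂ := fun x =>
    J * (c₀ x)ᴴ * q x + -(J * (c₂ x)ᴴ)
  have hd₂ : IsL2Mat r d₂ := (IsL2Mat.continuous_mul (hJ.matrix_mul h0s) hq).add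
    (IsL2Mat.continuous_mul hJ h.isL2.conjTranspose).neg
  -- Variation of constants for `ψ' = d₁ ψ + d₂ K f`, `ψ(0) = 0`: the solution is `ψ = Θ ∫₀ˣ Y d₂ K
  -- f`. Inserted into `N f = i c₂ ψ + q K f`, it dictates `a = i c₂ Θ` and `b = Y d₂`.
  obtain ⟨Θ, Y, hΘ, hY, hYp, hΘY⟩ := exists_fundamental hr.le hd₁
  have ha : IsL2Mat r fun x => (Complex.I • c₂ x) * Θ x := (h.isL2.smul _).mul_continuous hΘ
  have hb : IsL2Mat r fun x => Y x * d₂ x := IsL2Mat.continuous_mul hY hd₂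
  refine ⟨q, fun x => (Complex.I • c₂ x) * Θ x, fun x => Y x * d₂ x,
    ⟨hq.meas, ha.meas, hb.meas, hq.memLp, ha.memLp, hb.memLp⟩, fun f hf => ?_⟩
  have hW := h.vPrim_integral hf
  set W : ℝ → Fin m₁ ⊕ Fin m₂ → ℂ := fun x => ∫ t in (0 : ℝ)..x, (c₀ t)ᴴ *ᵥ f t with hWdef
  let P : ℝ → Matrix (Fin m₁ ⊕ Fin m₂) (Fin m₁ ⊕ Fin m₂) ℂ := fun x =>
    J + (-Complex.I) • (J * (c₁ x)ᴴ * (c₀ x * J)) + Complex.I • (J * (c₀ x)ᴴ * (c₁ x * J))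
  let P' : ℝ → Matrix (Fin m₁ ⊕ Fin m₂) (Fin m₁ ⊕ Fin m₂) ℂ := fun x =>
    (-Complex.I) • (J * (c₂ x)ᴴ * (c₀ x * J)) + Complex.I • (J * (c₀ x)ᴴ * (c₂ x * J))
  have hP : MPrim r P P' := by
    have hJl : ∀ {κ : Type} {F f : ℝ → Matrix (Fin m₁ ⊕ Fin m₂) κ ℂ}, MPrim r F f →
        MPrim r (fun x => J * F x) fun x => J * f x := fun hF =>
      ((MPrim.const J).mul hF).congr (ae_of_all _ fun x => by simp)
    have hJr : ∀ {F f : ℝ → Matrix (Fin m₂) (Fin m₁ ⊕ Fin m₂) ℂ}, MPrim r F f →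
        MPrim r (fun x => F x * J) fun x => f x * J := fun hF =>
      (hF.mul (MPrim.const J)).congr (ae_of_all _ fun x => by simp)
    refine (((MPrim.const J).add (((hJl h.prim₁.conjTranspose).mul (hJr h.prim₀)).smul
      (-Complex.I))).add (((hJl h.prim₀.conjTranspose).mul (hJr h.prim₁)).smul
        Complex.I)).congr (ae_of_all _ fun x => ?_)
    simp only [P', neg_smul, smul_add, zero_add]
    abel
  -- The two relations `c₀ j c₀* = 0` and `c₁ j c₀* = i` leave `j c₀* + i · i j c₀* = 0`.
  -- Consequently `f` drops out of the derivative of `P W`.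
  have hPc : ∀ x, P x * (c₀ x)ᴴ = 0 := by
    intro x
    have e1 : J * (c₁ x)ᴴ * (c₀ x * J) * (c₀ x)ᴴ = 0 := by
      rw [Matrix.mul_assoc, h.rel₀₀, Matrix.mul_zero]
    have e2 : J * (c₀ x)ᴴ * (c₁ x * J) * (c₀ x)ᴴ = Complex.I • (J * (c₀ x)ᴴ) := by
      rw [Matrix.mul_assoc, h.rel₁₀, Matrix.mul_smul, Matrix.mul_one]
    simp only [P, Matrix.add_mul, Matrix.smul_mul, e1, e2, smul_smul, Complex.I_mul_I]
    simp
  have hψ : VPrim r (fun x => P x *ᵥ W x) fun x => P' x *ᵥ W x :=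
    (VPrim.mulVec hP hW).congr (ae_of_all _ fun x => by
      rw [Matrix.mulVec_mulVec, hPc, Matrix.zero_mulVec, add_zero])
  have hk2 := h.memL2_opK hf
  have hY1 : VPrim r (fun x => Y x *ᵥ (P x *ᵥ W x)) fun x => (Y x * d₂ x) *ᵥ opK c₀ f x := by
    refine (VPrim.mulVec hYp hψ).congr ?_
    filter_upwards [h.rel₂₀] with x hx
    rw [(source_algebra (c₁ := c₁ x) hx (W x)).2, Matrix.neg_mulVec, Matrix.mulVec_add,
      ← Matrix.mulVec_mulVec _ (Y x) (d₁ x), ← Matrix.mulVec_mulVec _ (Y x) (d₂ x)]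
    exact neg_add_cancel_left _ _
  have hY2 : ∀ x ∈ Icc 0 r, P x *ᵥ W x =
      Θ x *ᵥ ∫ t in (0 : ℝ)..x, (Y t * d₂ t) *ᵥ opK c₀ f t := by
    intro x hx
    rw [← hY1.eq_of_ae_eq (VPrim.of_integral (hb.integrable_mulVec hk2))
      (by simp [W]) (ae_of_all _ fun _ => rfl) hx, Matrix.mulVec_mulVec, hΘY x hx,
      Matrix.one_mulVec]
  filter_upwards [h.rel₂₀, ae_restrict_mem measurableSet_Ioo] with x hx hxr
  have e := (source_algebra (c₁ := c₁ x) hx (W x)).1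
  rw [opN, opQ, ← Matrix.mulVec_mulVec, ← hY2 x ⟨hxr.1.le, hxr.2.le⟩, e, add_comm]
  rfl

end IsGauged

end Coefficients

/-! ### Injectivity of `I + AQ` -/

section Injectivity

variable {p : ℕ} {ν : Type*} {r : ℝ} {q : ℝ → Matrix (Fin p) (Fin p) ℂ}
  {a : ℝ → Matrix (Fin p) ν ℂ} {b : ℝ → Matrix ν (Fin p) ℂ}

namespace IsCoeff

theorem isL2_q (h : IsCoeff r q a b) : IsL2Mat r q := ⟨h.meas_q, h.memLp_q⟩
theorem isL2_a (h : IsCoeff r q a b) : IsL2Mat r a := ⟨h.meas_a, h.memLp_a⟩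
theorem isL2_b (h : IsCoeff r q a b) : IsL2Mat r b := ⟨h.meas_b, h.memLp_b⟩

variable [Fintype ν]

theorem memL2_opQ_right (h : IsCoeff r q a b) {f : ℝ → Fin p → ℂ} (hf : MemL2 r f) :
    MemL2 r fun x => a x *ᵥ ∫ t in (0 : ℝ)..x, b t *ᵥ f t :=
  h.isL2_a.memL2_mulVec (VPrim.of_integral (h.isL2_b.integrable_mulVec hf)).continuousOn

theorem integrable_opQ (h : IsCoeff r q a b) {f : ℝ → Fin p → ℂ} (hf : MemL2 r f) :
    Integrable (opQ q a b f) (vol r) :=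
  (h.isL2_q.integrable_mulVec hf).add (h.memL2_opQ_right hf).integrable

theorem memL2_opQ (h : IsCoeff r q a b) {f : ℝ → Fin p → ℂ} (hf : ContinuousOn f (Icc 0 r)) :
    MemL2 r (opQ q a b f) :=
  (h.isL2_q.memL2_mulVec hf).add (h.memL2_opQ_right (memL2_of_continuousOn hf))

theorem opQ_sub (h : IsCoeff r q a b) {f g : ℝ → Fin p → ℂ} (hf : MemL2 r f) (hg : MemL2 r g)
    {x : ℝ} (hx : x ∈ Icc 0 r) :
    opQ q a b (fun t => f t - g t) x = opQ q a b f x - opQ q a b g x := by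
  have h0 : (0 : ℝ) ∈ Icc 0 r := ⟨le_rfl, hx.1.trans hx.2⟩
  simp only [opQ, Matrix.mulVec_sub]
  rw [intervalIntegral.integral_sub
    (intervalIntegrable_of_vol (h.isL2_b.integrable_mulVec hf) h0 hx)
    (intervalIntegrable_of_vol (h.isL2_b.integrable_mulVec hg) h0 hx), Matrix.mulVec_sub]
  abel

theorem opQ_congr {f g : ℝ → Fin p → ℂ} (h : ∀ x ∈ Ioo 0 r, f x = g x) {x : ℝ}
    (hx : x ∈ Ioo 0 r) : opQ q a b f x = opQ q a b g x := by
  simp only [opQ]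
  rw [h x hx]
  congr 2
  exact intervalIntegral_congr_Ioo hx.1.le fun t ht => by rw [h t ⟨ht.1, ht.2.trans hx.2⟩]

theorem norm_opA_le {f : ℝ → Fin p → ℂ} {F : ℝ → ℝ} {x : ℝ} (hx : x ∈ Ioo 0 r)
    (hF : Integrable F (vol x)) (hf : ∀ t ∈ Ioo 0 x, ‖f t‖ ≤ F t) :
    ‖opA p f x‖ ≤ ∫ t in (0 : ℝ)..x, r * F t := by
  refine norm_intervalIntegral_le_vol hx.1.le (hF.const_mul r) fun t ht => ?_
  rw [norm_smul, Real.norm_eq_abs]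
  have h1 : |t - x| ≤ r := by
    rw [abs_le]; constructor <;> linarith [ht.1, ht.2, hx.1, hx.2]
  exact mul_le_mul h1 (hf t ht) (norm_nonneg _) (hx.1.trans hx.2).le

/-- `I + AQ` is injective. -/
theorem eq_zero_of_add_opA_opQ (h : IsCoeff r q a b) {d : ℝ → Fin p → ℂ} (hd : MemL2 r d)
    (hd' : ∀ x ∈ Ioo 0 r, d x + opA p (opQ q a b d) x = 0) : ∀ x ∈ Ioo 0 r, d x = 0 := by
  have hi := h.integrable_opQ hd
  set B : ℝ := ∫ σ, entrySum (b σ) ∂(vol r) with hB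
  have hB0 : 0 ≤ B := integral_nonneg fun σ => entrySum_nonneg _
  have hqi : Integrable (fun s => entrySum (q s)) (vol r) :=
    (memLp_entrySum h.memLp_q).integrable one_le_two
  have hai : Integrable (fun s => entrySum (a s)) (vol r) :=
    (memLp_entrySum h.memLp_a).integrable one_le_two
  have hbi := h.integrable_entrySum_b
  set γ : ℝ → ℝ := fun s => entrySum (q s) + entrySum (a s) * B with hγ
  have hγi : Integrable γ (vol r) := hqi.add (hai.mul_const _)
  have hγ0 : ∀ s, 0 ≤ γ s := fun s =>
    add_nonneg (entrySum_nonneg _) (mul_nonneg (entrySum_nonneg _) hB0)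
  obtain ⟨κ, hκ, hw⟩ := exists_exp_weight (hγi.const_mul |r|)
    fun s => mul_nonneg (abs_nonneg r) (hγ0 s)
  have hdx : ∀ x ∈ Ioo 0 r, ‖d x‖ = ‖opA p (opQ q a b d) x‖ := fun x hx => by
    rw [eq_neg_of_add_eq_zero_left (hd' x hx), norm_neg]
  have hone : ∀ x : ℝ, 0 < x → 1 ≤ Real.exp (κ * x) := fun x hx =>
    Real.one_le_exp (mul_pos hκ hx).le
  -- `Q d` is integrable, so `d = -A Q d` is bounded by `r ∫ ‖Q d‖`; this bound starts the halving.
  have key := eq_zero_of_halving (f := (Ioo 0 r).indicator d) (w := fun x => Real.exp (κ * x))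
    (c₀ := |r| * ∫ t, ‖opQ q a b d t‖ ∂(vol r))
    (mul_nonneg (abs_nonneg r) (integral_nonneg fun _ => norm_nonneg _)) ?_ ?_
  · intro x hx
    simpa only [indicator_of_mem hx] using key x
  · intro x
    by_cases hx : x ∈ Ioo 0 r
    · have hr : 0 < r := hx.1.trans hx.2
      rw [indicator_of_mem hx, hdx x hx, abs_of_pos hr]
      have hc : 0 ≤ r * ∫ t, ‖opQ q a b d t‖ ∂(vol r) :=
        mul_nonneg hr.le (integral_nonneg fun _ => norm_nonneg _)
      calc _ ≤ ∫ t in (0 : ℝ)..x, r * ‖opQ q a b d t‖ :=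
            norm_opA_le hx (integrable_vol_mono hi hx.2.le).norm fun t _ => le_rfl
        _ ≤ r * ∫ t, ‖opQ q a b d t‖ ∂(vol r) := by
            rw [intervalIntegral.integral_const_mul, intervalIntegral_eq_vol _ hx.1.le]
            gcongr
            · exact ae_of_all _ fun _ => norm_nonneg _
            · exact hi.norm
            · exact vol_mono hx.2.le
        _ ≤ _ := le_mul_of_one_le_right hc (hone x hx.1)
    · rw [indicator_of_notMem hx, norm_zero]
      exact mul_nonneg (mul_nonneg (abs_nonneg r) (integral_nonneg fun _ => norm_nonneg _))
        (Real.exp_pos _).le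
  · intro c hc hdc x
    by_cases hx : x ∈ Ioo 0 r
    · have hr : 0 < r := hx.1.trans hx.2
      have hdc' : ∀ s ∈ Ioo 0 r, ‖d s‖ ≤ c * Real.exp (κ * s) := fun s hs => by
        simpa only [indicator_of_mem hs] using hdc s
      have hQ : ∀ s ∈ Ioo 0 r, ‖opQ q a b d s‖ ≤ c * (γ s * Real.exp (κ * s)) := by
        intro s hs
        have h1 : ‖q s *ᵥ d s‖ ≤ entrySum (q s) * (c * Real.exp (κ * s)) :=
          (norm_mulVec_le _ _).trans
            (mul_le_mul_of_nonneg_left (hdc' s hs) (entrySum_nonneg _))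
        have h2 : ‖∫ t in (0 : ℝ)..s, b t *ᵥ d t‖ ≤ B * (c * Real.exp (κ * s)) := by
          calc _ ≤ ∫ t in (0 : ℝ)..s, entrySum (b t) * (c * Real.exp (κ * s)) := by
                refine norm_intervalIntegral_le_vol hs.1.le
                  ((integrable_vol_mono hbi hs.2.le).mul_const _) fun t ht => ?_
                refine (norm_mulVec_le _ _).trans
                  (mul_le_mul_of_nonneg_left ?_ (entrySum_nonneg _))
                refine (hdc' t ⟨ht.1, ht.2.trans hs.2⟩).trans ?_
                gcongr
                exact ht.2.le
            _ ≤ _ := by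
                rw [intervalIntegral.integral_mul_const, intervalIntegral_eq_vol _ hs.1.le]
                have := Real.exp_pos (κ * s)
                gcongr
                exact integral_mono_measure (vol_mono hs.2.le)
                  (ae_of_all _ fun t => entrySum_nonneg _) hbi
        calc _ ≤ ‖q s *ᵥ d s‖ + ‖a s *ᵥ ∫ t in (0 : ℝ)..s, b t *ᵥ d t‖ := norm_add_le _ _
          _ ≤ entrySum (q s) * (c * Real.exp (κ * s)) +
              entrySum (a s) * (B * (c * Real.exp (κ * s))) :=
            add_le_add h1 ((norm_mulVec_le _ _).trans
              (mul_le_mul_of_nonneg_left h2 (entrySum_nonneg _)))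
          _ = _ := by simp only [hγ]; ring
      have hFi : Integrable (fun s => c * (γ s * Real.exp (κ * s))) (vol x) := by
        have := (intervalIntegrable_of_vol hγi (a := 0) (b := x) ⟨le_rfl, hr.le⟩
          ⟨hx.1.le, hx.2.le⟩).mul_continuousOn (g := fun t => Real.exp (κ * t)) (by fun_prop)
        exact (integrable_vol_of_intervalIntegrable hx.1.le this).const_mul c
      rw [indicator_of_mem hx, hdx x hx]
      calc _ ≤ ∫ t in (0 : ℝ)..x, r * (c * (γ t * Real.exp (κ * t))) :=
            norm_opA_le hx hFi fun t ht => hQ t ⟨ht.1, ht.2.trans hx.2⟩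
        _ = c * ∫ t in (0 : ℝ)..x, |r| * γ t * Real.exp (κ * t) := by
            rw [← intervalIntegral.integral_const_mul, abs_of_pos hr]
            congr 1; ext t; ring
        _ ≤ c * (1 / 2 * Real.exp (κ * x)) :=
            mul_le_mul_of_nonneg_left (hw x ⟨hx.1.le, hx.2.le⟩) hc
        _ = _ := by ring
    · rw [indicator_of_notMem hx, norm_zero]
      exact mul_nonneg (by positivity) (Real.exp_pos _).le

end IsCoeff

end Injectivity

/-! ### Similarity of `K` and `A` -/

section Similarity

variable {m₁ m₂ : ℕ} {r : ℝ} {c₀ c₁ c₂ : ℝ → Matrix (Fin m₂) (Fin m₁ ⊕ Fin m₂) ℂ}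
  {ν : Type*} [Fintype ν] {q : ℝ → Matrix (Fin m₂) (Fin m₂) ℂ}
  {a : ℝ → Matrix (Fin m₂) ν ℂ} {b : ℝ → Matrix ν (Fin m₂) ℂ}
  {v : ℝ → ℝ → Matrix (Fin m₂) (Fin m₂) ℂ} {C : ℝ}

theorem opA_sub {p : ℕ} {f g : ℝ → Fin p → ℂ} (hf : Integrable f (vol r)) (hg : Integrable g (vol r))
    {x : ℝ} (hx : x ∈ Icc 0 r) : opA p (fun t => f t - g t) x = opA p f x - opA p g x := by
  have h0 : (0 : ℝ) ∈ Icc 0 r := ⟨le_rfl, hx.1.trans hx.2⟩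
  simp only [opA, smul_sub]
  exact intervalIntegral.integral_sub
    ((intervalIntegrable_of_vol hf h0 hx).continuousOn_smul (by fun_prop))
    ((intervalIntegrable_of_vol hg h0 hx).continuousOn_smul (by fun_prop))

/-- From `K = A (I - N)` and `N = Q K` one has `(I + AQ) K X = A X`, while the intertwining relation
says `(I + AQ) X A = A X`. Injectivity of `I + AQ` does the rest. -/
theorem IsGauged.similar (h : IsGauged r c₀ c₁ c₂) (hc : IsCoeff r q a b)
    (hQ : ∀ f, MemL2 r f → opQ q a b (opK c₀ f) =ᵐ[vol r] opN c₀ c₂ f)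
    (hvm : ∀ i k, Measurable fun z : ℝ × ℝ => v z.1 z.2 i k)
    (hv : ∀ s τ, s < r → ∀ i k, ‖v s τ i k‖ ≤ C)
    (hX : ∀ f, MemL2 r f → ∀ x ∈ Ioo 0 r,
      opA m₂ (opX v f) x - opX v (opA m₂ f) x = opA m₂ (opQ q a b (opX v (opA m₂ f))) x)
    {f : ℝ → Fin m₂ → ℂ} (hf : MemL2 r f) {x : ℝ} (hx : x ∈ Ioo 0 r) :
    opK c₀ (opX v f) x = opX v (opA m₂ f) x := by
  have hXf := memL2_opX hvm hv hf
  have hXA := memL2_opX hvm hv (memL2_opA hf)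
  have hK := h.memL2_opK hXf
  refine sub_eq_zero.1 (hc.eq_zero_of_add_opA_opQ
    (d := fun x => opK c₀ (opX v f) x - opX v (opA m₂ f) x) (hK.sub hXA) (fun y hy => ?_) x hx)
  have hy' : y ∈ Icc 0 r := ⟨hy.1.le, hy.2.le⟩
  rw [opA_congr (g := fun t => opQ q a b (opK c₀ (opX v f)) t -
      opQ q a b (opX v (opA m₂ f)) t)
      (ae_vol_of_forall fun t ht => hc.opQ_sub hK hXA ⟨ht.1.le, ht.2.le⟩) hy',
    opA_sub (hc.integrable_opQ hK) (hc.integrable_opQ hXA) hy', ← hX f hf y hy,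
    opA_congr (hQ _ hXf) hy', h.opK_eq hXf hy',
    opA_sub hXf.integrable (h.memL2_opN hXf).integrable hy']
  abel

section Blocks

variable {m₁ m₂ : ℕ}

theorem mul_jmat_mul_conjTranspose (X Y : Matrix (Fin m₂) (Fin m₁ ⊕ Fin m₂) ℂ) :
    X * jmat m₁ m₂ * Yᴴ = X.toCols₁ * Y.toCols₁ᴴ - X.toCols₂ * Y.toCols₂ᴴ := by
  ext i k
  simp [jmat, Matrix.mul_apply, Matrix.fromBlocks, Matrix.toCols₁, Matrix.toCols₂, Matrix.one_apply,
    sub_eq_add_neg]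

open scoped ComplexOrder in
-- If `X₂* v = 0`, then `X₁ X₁* = X₂ X₂*` forces `X₁* v = 0`, and the normalisation, both of whose
-- terms now vanish on `v`, gives `i v = 0`.
theorem isUnit_toCols₂ {X Y : Matrix (Fin m₂) (Fin m₁ ⊕ Fin m₂) ℂ} (h : X * jmat m₁ m₂ * Xᴴ = 0)
    (h' : Y * jmat m₁ m₂ * Xᴴ = Complex.I • 1) : IsUnit X.toCols₂ := by
  rw [← Matrix.isUnit_conjTranspose, ← Matrix.mulVec_injective_iff_isUnit]
  refine (injective_iff_map_eq_zero (Matrix.mulVecLin X.toCols₂ᴴ)).2 fun v hv => ?_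
  rw [Matrix.mulVecLin_apply] at hv
  rw [mul_jmat_mul_conjTranspose, sub_eq_zero] at h
  have h1 : X.toCols₁ᴴ *ᵥ v = 0 := by
    rw [← Matrix.self_mul_conjTranspose_mulVec_eq_zero, h, ← Matrix.mulVec_mulVec, hv,
      Matrix.mulVec_zero]
  have h2 := congrArg (· *ᵥ v) h'
  simp only [mul_jmat_mul_conjTranspose, Matrix.sub_mulVec, ← Matrix.mulVec_mulVec, hv, h1,
    Matrix.mulVec_zero, sub_zero, Matrix.smul_mulVec, Matrix.one_mulVec] at h2
  exact (smul_eq_zero.1 h2.symm).resolve_left Complex.I_ne_zero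

end Blocks

/-! ### Existence of `V` and of a representative of `V⁻¹ β₂` in `𝒰` -/

section Existence

variable {β : ℝ → Matrix (Fin m₂) (Fin m₁ ⊕ Fin m₂) ℂ}

/-- `I - N` is a Volterra operator whose kernel `-i c₂(x) j c₀(t)*` is only square integrable in
`x`. This is why kernels with product bounds `a(x) b(t)` are admitted. -/
theorem IsGauged.exists_eq_sub_opN (h : IsGauged r c₀ c₁ c₂) {g : ℝ → Fin m₂ → ℂ}
    (hg : MemL2 r g) : ∃ f, MemL2 r f ∧ ∀ x ∈ Ioo 0 r, f x - opN c₀ c₂ f x = g x := by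
  have h1 : IsL2Mat r fun x => (-Complex.I) • (c₂ x * jmat m₁ m₂) :=
    (h.isL2.mul_continuous continuous_const).smul _
  have h2 : IsL2Mat r fun x => (c₀ x)ᴴ := IsL2Mat.of_continuous h.cont₀.matrix_conjTranspose
  have hk : IsVolterraKernel r (fun x t => (-Complex.I) • (c₂ x * jmat m₁ m₂) * (c₀ t)ᴴ)
      (fun x => entrySum ((-Complex.I) • (c₂ x * jmat m₁ m₂))) fun x => entrySum (c₀ x)ᴴ :=
    { meas := fun i j => by
        simp only [Matrix.mul_apply]
        exact Finset.measurable_fun_sum _ fun l _ => ((h1.meas i l).comp measurable_fst).mul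
          ((h2.meas l j).comp measurable_snd)
      left_nonneg := fun _ => entrySum_nonneg _
      right_nonneg := fun _ => entrySum_nonneg _
      left_memLp := memLp_entrySum h1.memLp
      right_memLp := memLp_entrySum h2.memLp
      bound := fun x _ t _ => entrySum_mul_le _ _ }
  obtain ⟨f, hf, hfe⟩ := hk.exists_solution hg
  refine ⟨f, hf, fun x hx => ?_⟩
  rw [← hfe x hx, sub_eq_add_neg]
  congr 1
  simp only [← Matrix.mulVec_mulVec]
  rw [← mulVec_intervalIntegral _ (intervalIntegrable_of_vol (h2.integrable_mulVec hf)
    ⟨le_rfl, (hx.1.trans hx.2).le⟩ ⟨hx.1.le, hx.2.le⟩), Matrix.smul_mulVec, neg_smul]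
  rfl

theorem opX_add {f g : ℝ → Fin m₂ → ℂ} (hvm : ∀ i k, Measurable fun z : ℝ × ℝ => v z.1 z.2 i k)
    (hv : ∀ s τ, s < r → ∀ i k, ‖v s τ i k‖ ≤ C) (hf : MemL2 r f) (hg : MemL2 r g)
    {x : ℝ} (hx : x ∈ Ioo 0 r) : opX v (fun t => f t + g t) x = opX v f x + opX v g x := by
  obtain ⟨C', hk⟩ := isVolterraKernel_of_bounded (r := r) (k := v) hvm
    (fun x hx t _ => hv x t hx.2)
  simp only [opX_apply, Matrix.mulVec_add]
  rw [intervalIntegral.integral_add (hk.intervalIntegrable_integrand hx hf)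
    (hk.intervalIntegrable_integrand hx hg)]
  abel

theorem opK_congr {f g : ℝ → Fin m₂ → ℂ} (h : f =ᵐ[vol r] g) {x : ℝ} (hx : x ∈ Icc 0 r) :
    opK β f x = opK β g x := by
  simp only [opK]
  rw [intervalIntegral_congr_vol (g := fun t => (β t)ᴴ *ᵥ g t) ?_ hx]
  filter_upwards [h] with t ht
  rw [ht]

/-- The equation `X g = c₀₂` has a solution in `𝒰`, where `c₀₂` is the second block of `c₀`. -/
theorem IsGauged.exists_memU_preimage (hr : 0 < r) (h : IsGauged r c₀ c₁ c₂) (hc : IsCoeff r q a b)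
    (hvm : ∀ i k, Measurable fun z : ℝ × ℝ => v z.1 z.2 i k)
    (hv : ∀ s τ, s < r → ∀ i k, ‖v s τ i k‖ ≤ C)
    (hsim : ∀ f, MemL2 r f → ∀ x ∈ Ioo 0 r, opK c₀ (opX v f) x = opX v (opA m₂ f) x)
    (hconst : ∀ w, ∀ x ∈ Ioo 0 r, opX v (fun _ => w) x =
      w + x • (((c₁ 0).toCols₂ * (c₀ 0).toCols₂⁻¹) *ᵥ w) -
        opA m₂ (opQ q a b (opX v fun _ => w)) x) :
    ∃ g : ℝ → Matrix (Fin m₂) (Fin m₂) ℂ, MemU r g ∧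
      ∀ k, ∀ x ∈ Ioo 0 r, opX v (fun t => (g t).col k) x = (c₀ x).toCols₂.col k := by
  set B := (c₀ 0).toCols₂ with hB
  have hBu : IsUnit B := isUnit_toCols₂ (h.rel₀₀ 0) (h.rel₁₀ 0)
  have hBB : B⁻¹ * B = 1 := Matrix.nonsing_inv_mul _ ((Matrix.isUnit_iff_isUnit_det _).1 hBu)
  -- The column is sought as `w + A ζ` with `w` the column of `c₀₂(0)`. By the choice of the
  -- constant in `v`, `X w` and the Taylor formula for `c₀₂` have the same affine part, so `c₀₂ - X
  -- w = A (Q X w - c₂₂)`. Since `X A ζ = K X ζ = A (I - N) X ζ`, it suffices to solve `(I - N) X ζ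
  -- = Q X w - c₂₂`.
  have main : ∀ k, ∃ ζ, MemL2 r ζ ∧ ∀ x ∈ Ioo 0 r,
      opX v (fun t => B.col k + opA m₂ ζ t) x = (c₀ x).toCols₂.col k := by
    intro k
    set w := B.col k with hw
    have hXw : MemL2 r (opX v fun _ => w) := memL2_opX hvm hv (memL2_const w)
    -- For `f` in `L²` alone, `q f` is merely integrable. The formula for `X w` shows that this
    -- function is continuous, and therefore `Q X w` is square integrable.
    have hφ1 : MemL2 r (opQ q a b (opX v fun _ => w)) := by
      have hc' := hc.memL2_opQ (f := fun x => w + x • (((c₁ 0).toCols₂ * B⁻¹) *ᵥ w) -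
        opA m₂ (opQ q a b (opX v fun _ => w)) x)
        ((by fun_prop : Continuous fun x : ℝ => w + x • (((c₁ 0).toCols₂ * B⁻¹) *ᵥ w)).continuousOn.sub
          (VPrim.opA (hc.integrable_opQ hXw)).continuousOn)
      refine memL2_congr (ae_vol_of_forall fun x hx => ?_) hc'
      exact IsCoeff.opQ_congr (fun y hy => (hconst w y hy).symm) hx
    have hφ2 : MemL2 r fun x => (c₂ x).toCols₂.col k := memL2_iff.2 fun i => h.isL2.memLp i (Sum.inr k)
    obtain ⟨y, hy, hye⟩ := h.exists_eq_sub_opN (hφ1.sub hφ2)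
    obtain ⟨C', hk⟩ := isVolterraKernel_of_bounded (r := r) (k := v) hvm
      (fun x hx t _ => hv x t hx.2)
    obtain ⟨ζ, hζ, hζe⟩ := hk.exists_solution hy
    have hXζ : opX v ζ =ᵐ[vol r] y := ae_vol_of_forall fun x hx => by
      rw [opX_apply]; exact hζe x hx
    refine ⟨ζ, hζ, fun x hx => ?_⟩
    have hx' : x ∈ Icc 0 r := ⟨hx.1.le, hx.2.le⟩
    have h0 : VPrim r (fun x => (c₀ x).toCols₂.col k) fun x => (c₁ x).toCols₂.col k :=
      fun i => h.prim₀ i (Sum.inr k)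
    have h1 : VPrim r (fun x => (c₁ x).toCols₂.col k) fun x => (c₂ x).toCols₂.col k :=
      fun i => h.prim₁ i (Sum.inr k)
    have e1 : ((c₁ 0).toCols₂ * B⁻¹) *ᵥ w = (c₁ 0).toCols₂.col k := by
      rw [hw, ← Matrix.mulVec_single_one B, Matrix.mulVec_mulVec, Matrix.mul_assoc, hBB,
        Matrix.mul_one, Matrix.mulVec_single_one]
    rw [opX_add hvm hv (memL2_const w) (memL2_opA hζ) hx, ← hsim ζ hζ x hx,
      opK_congr hXζ hx', h.opK_eq hy hx', opA_congr (ae_vol_of_forall hye) hx',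
      hconst w x hx, h0.taylor h1 hx', e1]
    have := opA_sub hφ1.integrable hφ2.integrable hx'
    rw [show ((opQ q a b (opX v fun _ => w)) - fun x => (c₂ x).toCols₂.col k) =
      fun t => opQ q a b (opX v fun _ => w) t - (c₂ t).toCols₂.col k from rfl, this]
    abel
  choose ζ hζ hζe using main
  have hp1 : ∀ k, VPrim r (fun x => -∫ t in (0 : ℝ)..x, ζ k t) fun x => -ζ k x := fun k => by
    have := VPrim.of_integral (hζ k).integrable.neg
    simp only [Pi.neg_apply, intervalIntegral.integral_neg] at this
    exact this
  have hp0 : ∀ k, VPrim r (fun x => B.col k + opA m₂ (ζ k) x) fun x => -∫ t in (0 : ℝ)..x, ζ k t :=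
    fun k i => by
      have := (HasPrim.const (r := r) (B i k)).add (VPrim.opA (hζ k).integrable i)
      simp only [zero_add] at this
      exact this
  refine ⟨fun x => Matrix.of fun i k => (B.col k + opA m₂ (ζ k) x) i, ?_, fun k x hx => hζe k x hx⟩
  refine MPrim.memU hr (f := fun x => Matrix.of fun i k => (-∫ t in (0 : ℝ)..x, ζ k t) i)
    (g := fun x => Matrix.of fun i k => (-ζ k x) i) (fun i k => hp0 k i) (fun i k => hp1 k i)
    fun i k => (memL2_iff.1 (hζ k) i).neg

theorem entrySum_le_of_continuous {κ : Type*} [Fintype κ] {u : ℝ → Matrix (Fin m₂) κ ℂ}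
    (hu : Continuous u) (r : ℝ) : ∃ C, ∀ x ∈ Ioo 0 r, entrySum (u x) ≤ C := by
  have : Continuous fun x => entrySum (u x) := by
    unfold entrySum
    exact continuous_finsetSum _ fun i _ => continuous_finsetSum _ fun k _ =>
      (hu.matrix_elem i k).norm
  obtain ⟨C, hC⟩ := isCompact_Icc.exists_bound_of_continuousOn (s := Icc 0 r) this.continuousOn
  exact ⟨C, fun x hx => (le_abs_self _).trans (hC x ⟨hx.1.le, hx.2.le⟩)⟩

/-- Take `V = u X`. Because `β = u c₀` with `u` unitary, the operator `K` of `β` satisfies `K V = u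
K₀ X`, with `K₀` the operator of `c₀`; so the gauge is undone by multiplying with `u`. -/
theorem Admissible.exists_transformation (hr : 0 < r) (hβ : Admissible β r) :
    ∃ u kV g, IsTransformation β r u kV ∧ MemU r g ∧ IsInvApply r (opV u kV) (blk₂ β) g := by
  obtain ⟨u, c₀, c₁, c₂, huc, huU, huu, hu0, h, hβu⟩ := hβ.exists_gauge hr
  obtain ⟨q, a, b, hc, hQ⟩ := h.exists_coeff hr
  obtain ⟨v, hvm, ⟨C, hC, hv⟩, hX, hconst⟩ :=
    hc.exists_intertwiner ((c₁ 0).toCols₂ * (c₀ 0).toCols₂⁻¹)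
  have hsim : ∀ f, MemL2 r f → ∀ x ∈ Ioo 0 r, opK c₀ (opX v f) x = opX v (opA m₂ f) x :=
    fun f hf x hx => h.similar hc hQ hvm hv hX hf hx
  obtain ⟨g, hgU, hg⟩ := h.exists_memU_preimage hr hc hvm hv hsim hconst
  -- The bound on `v` is known for `x < r` only, whereas the definition asks for it up to `x = r`.
  -- Cutting the kernel off there does not affect the operator on `(0,r)`.
  let kV : ℝ → ℝ → Matrix (Fin m₂) (Fin m₂) ℂ := fun x t => if x < r then v x t else 0
  have hkm : ∀ i k, Measurable fun z : ℝ × ℝ => kV z.1 z.2 i k := by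
    intro i k
    have : (fun z : ℝ × ℝ => kV z.1 z.2 i k) = fun z => if z.1 < r then v z.1 z.2 i k else 0 := by
      ext z; simp only [kV]; split_ifs <;> rfl
    rw [this]
    exact Measurable.ite (measurableSet_lt measurable_fst measurable_const) (hvm i k)
      measurable_const
  have hkC : ∀ x t, ∀ i k, ‖kV x t i k‖ ≤ C := by
    intro x t i k
    simp only [kV]
    split_ifs with hx
    · exact hv x t hx i k
    · simpa using hC
  have hopV : ∀ f, ∀ x ∈ Ioo 0 r, opV u kV f x = u x *ᵥ opX v f x := by
    intro f x hx
    simp only [opX_apply, opV, kV, if_pos hx.2]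
  have hopK : ∀ f, ∀ x ∈ Ioo 0 r, opK β (opV u kV f) x = u x *ᵥ opK c₀ (opX v f) x := by
    intro f x hx
    simp only [opK, Matrix.mulVec_smul, Matrix.mulVec_mulVec]
    rw [hβu x ⟨hx.1.le, hx.2.le⟩, Matrix.mul_assoc]
    congr 2
    refine intervalIntegral_congr_Ioo hx.1.le fun t ht => ?_
    have ht' : t ∈ Ioo 0 r := ⟨ht.1, ht.2.trans hx.2⟩
    rw [hopV f t ht', hβu t ⟨ht'.1.le, ht'.2.le⟩, Matrix.conjTranspose_mul, Matrix.mulVec_mulVec,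
      Matrix.mul_assoc, mul_eq_one_comm.1 (huu t), Matrix.mul_one]
  obtain ⟨C', hk⟩ := isVolterraKernel_of_bounded (r := r) hkm fun x _ t _ => hkC x t
  obtain ⟨D, hD⟩ := entrySum_le_of_continuous huc r
  have hinv : InvertibleOnL2 r (opV u kV) := invertibleOnL2_opV (u' := fun x => (u x)ᴴ) (C := D) hk
    (fun i j => (huc.matrix_elem i j).aestronglyMeasurable)
    (fun i j => (huc.matrix_conjTranspose.matrix_elem i j).aestronglyMeasurable) hD
    (fun x hx => by rw [entrySum_conjTranspose]; exact hD x hx)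
    fun x _ => mul_eq_one_comm.1 (huu x)
  refine ⟨u, kV, g, ⟨huU, fun x _ => ?_, hu0, hkm, ⟨C, fun x t _ _ _ => hkC x t⟩, hinv,
    fun f hf => ae_vol_of_forall fun x hx => ?_⟩, hgU, hinv, fun k => ?_, fun k =>
    ae_vol_of_forall fun x hx => ?_⟩
  · rw [Matrix.mem_unitaryGroup_iff]; exact huu x
  · rw [hopK f x hx, hsim f hf x hx, hopV _ x hx]
  · exact memL2_of_continuousOn (continuousOn_pi.2 fun i => (hgU.1 i k).continuousOn)
  · rw [hopV _ x hx, hg k x hx]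
    simp only [blk₂]
    rw [hβu x ⟨hx.1.le, hx.2.le⟩, ← Matrix.mulVec_single_one, Matrix.mulVec_mulVec,
      ← Matrix.mulVec_single_one]
    rfl

end Existence

end Similarity

/-! ### Invertibility of `V₀` and existence of `Φ₁` -/

section Normalised

variable {m₁ m₂ : ℕ} {r : ℝ} {β : ℝ → Matrix (Fin m₂) (Fin m₁ ⊕ Fin m₂) ℂ}

theorem MemU.continuousOn_mderiv {ι κ : Type*} (hr : 0 < r) {G : ℝ → Matrix ι κ ℂ}
    (h : MemU r G) : ContinuousOn (mderiv r G) (Icc 0 r) := by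
  obtain ⟨_, _, _, h1⟩ := h.exists_prim hr
  exact h1.continuousOn

theorem Admissible.isUnit_blk₂ (hr : 0 < r) (h : Admissible β r) : IsUnit (blk₂ β 0) :=
  isUnit_toCols₂ (h.isotropic 0 ⟨le_rfl, hr.le⟩) (h.normalised 0 ⟨le_rfl, hr.le⟩)

/-- The kernel of `b⁻¹ V₀ - I`, extended to the plane. -/
noncomputable def convKer (r : ℝ) (b : Matrix (Fin m₂) (Fin m₂) ℂ)
    (w : ℝ → Matrix (Fin m₂) (Fin m₂) ℂ) (x t : ℝ) : Matrix (Fin m₂) (Fin m₂) ℂ :=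
  b⁻¹ * w (clamp r (x - t))

variable {b : Matrix (Fin m₂) (Fin m₂) ℂ} {w : ℝ → Matrix (Fin m₂) (Fin m₂) ℂ}

theorem exists_isVolterraKernel_convKer (hr : 0 ≤ r) (hw : ContinuousOn w (Icc 0 r)) :
    ∃ C, IsVolterraKernel r (convKer r b w) (fun _ => C) fun _ => 1 := by
  have hc : Continuous fun y => b⁻¹ * w (clamp r y) :=
    continuous_const.matrix_mul (continuous_comp_clamp hr hw)
  obtain ⟨C, hC⟩ := entrySum_le_of_continuous hc r
  exact isVolterraKernel_of_bounded (C := C)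
    (fun i j => ((hc.matrix_elem i j).measurable.comp (measurable_fst.sub measurable_snd)))
    fun x hx t ht i j => (norm_entry_le_entrySum _ i j).trans
      (hC _ ⟨by linarith [ht.2], by linarith [ht.1, hx.2]⟩)

theorem opV₀_eq_opV (hb : IsUnit b) (hw : ContinuousOn w (Icc 0 r)) {f : ℝ → Fin m₂ → ℂ}
    (hf : MemL2 r f) {x : ℝ} (hx : x ∈ Ioo 0 r) :
    opV₀ b w f x = opV (fun _ => b) (convKer r b w) f x := by
  obtain ⟨C, hk⟩ := exists_isVolterraKernel_convKer (b := b) (hx.1.trans hx.2).le hw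
  have hbb : b * b⁻¹ = 1 := Matrix.mul_nonsing_inv _ ((Matrix.isUnit_iff_isUnit_det _).1 hb)
  simp only [opV₀, opV, Matrix.mulVec_add]
  rw [mulVec_intervalIntegral b (hk.intervalIntegrable_integrand hx hf)]
  congr 1
  refine intervalIntegral_congr_Ioo hx.1.le fun t ht => ?_
  rw [convKer, Matrix.mulVec_mulVec, ← Matrix.mul_assoc, hbb, Matrix.one_mul,
    clamp_eq ⟨by linarith [ht.2], by linarith [ht.1, hx.2]⟩]

theorem invertibleOnL2_opV₀ (hr : 0 ≤ r) (hb : IsUnit b) (hw : ContinuousOn w (Icc 0 r)) :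
    InvertibleOnL2 r (opV₀ b w) := by
  obtain ⟨C, hk⟩ := exists_isVolterraKernel_convKer (b := b) hr hw
  refine (invertibleOnL2_opV (u := fun _ => b) (u' := fun _ => b⁻¹)
    (C := max (entrySum b) (entrySum b⁻¹)) hk
    (fun i j => aestronglyMeasurable_const) (fun i j => aestronglyMeasurable_const)
    (fun _ _ => le_max_left _ _) (fun _ _ => le_max_right _ _)
    fun _ _ => Matrix.nonsing_inv_mul _ ((Matrix.isUnit_iff_isUnit_det _).1 hb)).congr
    fun f hf => ae_vol_of_forall fun x hx => (opV₀_eq_opV hb hw hf hx).symm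

theorem Admissible.exists_isPhi₁ (hr : 0 < r) (h : Admissible β r) :
    ∃ Φ₁ : ℝ → Matrix (Fin m₂) (Fin m₁) ℂ, IsPhi₁ β r Φ₁ := by
  obtain ⟨u, kV, g, hV, hg, hgV⟩ := h.exists_transformation hr
  have hE : InvertibleOnL2 r fun f => opV u kV (opV₀ (blk₂ β 0) (mderiv r g) f) :=
    hV.invertible.comp (invertibleOnL2_opV₀ hr.le (h.isUnit_blk₂ hr) (hg.continuousOn_mderiv hr))
      fun _ _ h => opV_congr_ae u kV h
  have hβ : ∀ k, MemL2 r fun x => (blk₁ β x).col k := fun k =>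
    memL2_of_continuousOn (continuousOn_pi.2 fun i => (h.memU.1 i (Sum.inl k)).continuousOn)
  choose f hf hfe using fun k => hE.surj _ (hβ k)
  exact ⟨fun x => Matrix.of fun i k => f k x i, _, ⟨u, kV, g, hV, hg, hgV, rfl⟩, hE, hf, hfe⟩

end Normalised

/-! ### Bounded operators and their adjoints -/

section BoundedOperators

variable {p : ℕ} {r : ℝ}

/-- Linear operators with a pointwise bound which implies boundedness in `L²`. -/
structure IsBoundedOp (r : ℝ) (T : Op p) : Prop where
  memL2 : ∀ f, MemL2 r f → MemL2 r (T f)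
  congr : ∀ f g, f =ᵐ[vol r] g → T f =ᵐ[vol r] T g
  add : ∀ f g, MemL2 r f → MemL2 r g → T (f + g) =ᵐ[vol r] T f + T g
  smul : ∀ (c : ℂ) f, MemL2 r f → T (c • f) =ᵐ[vol r] c • T f
  bound : ∃ C : ℝ, 0 ≤ C ∧ ∀ f, MemL2 r f →
    ∀ᵐ x ∂(vol r), ‖T f x‖ ≤ C * (‖f x‖ + ∫ t, ‖f t‖ ∂(vol r))

theorem isBoundedOp_opV {u : ℝ → Matrix (Fin p) (Fin p) ℂ} {C D : ℝ}
    {k : ℝ → ℝ → Matrix (Fin p) (Fin p) ℂ} (hk : IsVolterraKernel r k (fun _ => D) fun _ => 1)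
    (hu : ∀ i j, AEStronglyMeasurable (fun x => u x i j) (vol r))
    (hC : ∀ x ∈ Ioo 0 r, entrySum (u x) ≤ C) : IsBoundedOp r (opV u k) where
  memL2 f hf := memL2_mulVec hu hC (hf.add (hk.memL2_integral hf))
  congr f g h := opV_congr_ae u k h
  add f g hf hg := ae_vol_of_forall fun x hx => by
    simp only [opV, Pi.add_apply, Matrix.mulVec_add]
    rw [intervalIntegral.integral_add (hk.intervalIntegrable_integrand hx hf)
      (hk.intervalIntegrable_integrand hx hg), Matrix.mulVec_add]
    abel
  smul c f hf := ae_vol_of_forall fun x hx => by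
    simp only [opV, Pi.smul_apply, Matrix.mulVec_smul, intervalIntegral.integral_smul, smul_add,
      Matrix.mulVec_add]
  bound := by
    have hD := hk.left_nonneg 0
    refine ⟨|C| * (1 + D), by positivity, fun f hf => ae_vol_of_forall fun x hx => ?_⟩
    have hi : 0 ≤ ∫ t, ‖f t‖ ∂(vol r) := integral_nonneg fun _ => norm_nonneg _
    have h1 : ‖∫ t in (0 : ℝ)..x, k x t *ᵥ f t‖ ≤ D * ∫ t, ‖f t‖ ∂(vol r) := by
      calc _ ≤ ∫ t in (0 : ℝ)..x, D * ‖f t‖ := by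
            refine norm_intervalIntegral_le_vol hx.1.le
              ((integrable_vol_mono hf.integrable hx.2.le).norm.const_mul D) fun t ht => ?_
            exact (hk.norm_integrand_le hx f ht).trans (by rw [one_mul])
        _ ≤ _ := by
            rw [intervalIntegral.integral_const_mul, intervalIntegral_eq_vol _ hx.1.le]
            refine mul_le_mul_of_nonneg_left (integral_mono_measure (vol_mono hx.2.le)
              (ae_of_all _ fun _ => norm_nonneg _) hf.integrable.norm) hD
    calc _ ≤ entrySum (u x) * ‖f x + ∫ t in (0 : ℝ)..x, k x t *ᵥ f t‖ := norm_mulVec_le _ _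
      _ ≤ |C| * (‖f x‖ + D * ∫ t, ‖f t‖ ∂(vol r)) := by
          refine mul_le_mul ((hC x hx).trans (le_abs_self C)) ((norm_add_le _ _).trans
            (add_le_add le_rfl h1)) (norm_nonneg _) (abs_nonneg C)
      _ ≤ _ := by
          rw [mul_assoc]
          refine mul_le_mul_of_nonneg_left ?_ (abs_nonneg C)
          nlinarith [norm_nonneg (f x)]

theorem IsBoundedOp.of_eq {T T' : Op p} (h : IsBoundedOp r T)
    (hT : ∀ f, MemL2 r f → T f =ᵐ[vol r] T' f)
    (hc : ∀ f g, f =ᵐ[vol r] g → T' f =ᵐ[vol r] T' g) : IsBoundedOp r T' where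
  memL2 f hf := memL2_congr (hT f hf) (h.memL2 f hf)
  congr := hc
  add f g hf hg := (hT _ (hf.add hg)).symm.trans ((h.add f g hf hg).trans
    ((hT f hf).add (hT g hg)))
  smul c f hf := (hT _ (hf.const_smul c)).symm.trans ((h.smul c f hf).trans
    ((hT f hf).const_smul c))
  bound := by
    obtain ⟨C, hC, hb⟩ := h.bound
    refine ⟨C, hC, fun f hf => ?_⟩
    filter_upwards [hb f hf, hT f hf] with x hx hx'
    rwa [← hx']

theorem IsBoundedOp.comp {T T' : Op p} (h : IsBoundedOp r T) (h' : IsBoundedOp r T') :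
    IsBoundedOp r fun f => T (T' f) where
  memL2 f hf := h.memL2 _ (h'.memL2 f hf)
  congr f g hfg := h.congr _ _ (h'.congr f g hfg)
  add f g hf hg := (h.congr _ _ (h'.add f g hf hg)).trans
    (h.add _ _ (h'.memL2 f hf) (h'.memL2 g hg))
  smul c f hf := (h.congr _ _ (h'.smul c f hf)).trans (h.smul c _ (h'.memL2 f hf))
  bound := by
    obtain ⟨C, hC, hb⟩ := h.bound
    obtain ⟨C', hC', hb'⟩ := h'.bound
    set M := (vol r).real univ with hM
    have hM0 : 0 ≤ M := measureReal_nonneg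
    refine ⟨C * (C' * (2 + M)), by positivity, fun f hf => ?_⟩
    set I := ∫ t, ‖f t‖ ∂(vol r) with hI
    have hI0 : 0 ≤ I := integral_nonneg fun _ => norm_nonneg _
    have h1 : ∫ t, ‖T' f t‖ ∂(vol r) ≤ C' * (I + M * I) := by
      calc _ ≤ ∫ t, C' * (‖f t‖ + I) ∂(vol r) :=
            integral_mono_ae (h'.memL2 f hf).integrable.norm
              ((hf.integrable.norm.add (integrable_const _)).const_mul _) (hb' f hf)
        _ = _ := by
            rw [integral_const_mul, integral_add hf.integrable.norm (integrable_const _),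
              integral_const, smul_eq_mul]
    filter_upwards [hb _ (h'.memL2 f hf), hb' f hf] with x hx hx'
    calc _ ≤ C * (‖T' f x‖ + ∫ t, ‖T' f t‖ ∂(vol r)) := hx
      _ ≤ C * (C' * (‖f x‖ + I) + C' * (I + M * I)) :=
          mul_le_mul_of_nonneg_left (add_le_add hx' h1) hC
      _ ≤ C * (C' * (2 + M)) * (‖f x‖ + I) := by
          have h2 : 0 ≤ C * C' := mul_nonneg hC hC'
          have h3 : 0 ≤ ‖f x‖ * (1 + M) := by positivity
          nlinarith [mul_nonneg h2 h3]

end BoundedOperators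

/-! ### Realisation of the operators on a Hilbert space -/

section HilbertSpace

variable {p : ℕ} {r : ℝ}

/-- The Hilbert space of square integrable vector functions. -/
abbrev HilbL2 (p : ℕ) (r : ℝ) : Type := Lp (EuclideanSpace ℂ (Fin p)) 2 (vol r)

theorem MemL2.memLp_toLp {f : ℝ → Fin p → ℂ} (hf : MemL2 r f) :
    MemLp (fun x => (WithLp.toLp 2 (f x) : EuclideanSpace ℂ (Fin p))) 2 (vol r) :=
  ((EuclideanSpace.equiv (Fin p) ℂ).symm.toContinuousLinearMap).comp_memLp' hf

/-- The element of the Hilbert space which is represented by a function. -/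
noncomputable def toHilb (f : ℝ → Fin p → ℂ) (hf : MemL2 r f) : HilbL2 p r :=
  hf.memLp_toLp.toLp _

/-- A representative of an element of the Hilbert space. -/
noncomputable def ofHilb (h : HilbL2 p r) : ℝ → Fin p → ℂ := fun x => (h x).ofLp

theorem memL2_ofHilb (h : HilbL2 p r) : MemL2 r (ofHilb h) :=
  ((EuclideanSpace.equiv (Fin p) ℂ).toContinuousLinearMap).comp_memLp' (Lp.memLp h)

theorem toHilb_coe {f : ℝ → Fin p → ℂ} (hf : MemL2 r f) :
    ∀ᵐ x ∂(vol r), toHilb f hf x = WithLp.toLp 2 (f x) := hf.memLp_toLp.coeFn_toLp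

theorem ofHilb_toHilb {f : ℝ → Fin p → ℂ} (hf : MemL2 r f) :
    ofHilb (toHilb f hf) =ᵐ[vol r] f := by
  filter_upwards [toHilb_coe hf] with x hx
  simp only [ofHilb, hx]

theorem toHilb_congr {f g : ℝ → Fin p → ℂ} (hf : MemL2 r f) (hg : MemL2 r g) (h : f =ᵐ[vol r] g) :
    toHilb f hf = toHilb g hg :=
  (MemLp.toLp_eq_toLp_iff _ _).2 (h.mono fun x hx => by simp only [hx])

theorem toHilb_ofHilb (h : HilbL2 p r) : toHilb (ofHilb h) (memL2_ofHilb h) = h := by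
  refine Lp.ext ?_
  filter_upwards [toHilb_coe (memL2_ofHilb h)] with x hx
  rw [hx]; rfl

/-- The pairing `∫ a* b` on `(0,r)`. -/
noncomputable def pairing (r : ℝ) (a b : ℝ → Fin p → ℂ) : ℂ := ∫ s, star (a s) ⬝ᵥ b s ∂(vol r)

theorem inner_ofHilb (a b : HilbL2 p r) : inner ℂ a b = pairing r (ofHilb a) (ofHilb b) := by
  rw [L2.inner_def, pairing]
  refine integral_congr_ae (ae_of_all _ fun x => ?_)
  simp only [ofHilb, EuclideanSpace.inner_eq_star_dotProduct]
  exact dotProduct_comm _ _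

theorem pairing_congr {a a' b b' : ℝ → Fin p → ℂ} (ha : a =ᵐ[vol r] a') (hb : b =ᵐ[vol r] b') :
    pairing r a b = pairing r a' b' := by
  refine integral_congr_ae ?_
  filter_upwards [ha, hb] with x h1 h2
  rw [h1, h2]

theorem exists_integral_norm_le (p : ℕ) (r : ℝ) : ∃ c : ℝ, 0 ≤ c ∧ ∀ h : HilbL2 p r,
    ∫ x, ‖h x‖ ∂(vol r) ≤ c * ‖h‖ := by
  refine ⟨((vol r univ) ^ (1 / (1 : ENNReal).toReal - 1 / (2 : ENNReal).toReal)).toReal,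
    ENNReal.toReal_nonneg, fun h => ?_⟩
  have h1 := eLpNorm_le_eLpNorm_mul_rpow_measure_univ (p := 1) (q := 2) one_le_two
    (Lp.memLp h).aestronglyMeasurable
  have h2 : ∫ x, ‖h x‖ ∂(vol r) = (eLpNorm h 1 (vol r)).toReal := by
    rw [eLpNorm_one_eq_lintegral_enorm, integral_norm_eq_lintegral_enorm
      (Lp.memLp h).aestronglyMeasurable]
  rw [h2, Lp.norm_def, mul_comm, ← ENNReal.toReal_mul]
  refine ENNReal.toReal_mono ?_ h1
  refine ENNReal.mul_ne_top (Lp.eLpNorm_ne_top h) (ENNReal.rpow_ne_top_of_nonneg (by norm_num) ?_)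
  exact measure_ne_top _ _

/-- The pointwise bound compares `T h` with the scalar function `‖h‖ + ∫ ‖h‖`, whose `L²` norm is at
most a multiple of that of `h` because the interval has finite length. -/
theorem IsBoundedOp.exists_clm {T : Op p} (hT : IsBoundedOp r T) :
    ∃ E : HilbL2 p r →L[ℂ] HilbL2 p r, ∀ h, ofHilb (E h) =ᵐ[vol r] T (ofHilb h) := by
  obtain ⟨C, hC, hb⟩ := hT.bound
  obtain ⟨c, hc, hcb⟩ := exists_integral_norm_le p r
  have hadd : ∀ a b : HilbL2 p r, ofHilb (a + b) =ᵐ[vol r] ofHilb a + ofHilb b := fun a b => by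
    filter_upwards [Lp.coeFn_add a b] with x hx
    simp only [ofHilb, hx, Pi.add_apply, WithLp.ofLp_add]
  have hsmul : ∀ (s : ℂ) (a : HilbL2 p r), ofHilb (s • a) =ᵐ[vol r] s • ofHilb a := fun s a => by
    filter_upwards [Lp.coeFn_smul s a] with x hx
    simp only [ofHilb, hx, Pi.smul_apply, WithLp.ofLp_smul]
  let L : HilbL2 p r →ₗ[ℂ] HilbL2 p r :=
    { toFun := fun h => toHilb (T (ofHilb h)) (hT.memL2 _ (memL2_ofHilb h))
      map_add' := fun a b => by
        have ha := hT.memL2 _ (memL2_ofHilb a)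
        have hb := hT.memL2 _ (memL2_ofHilb b)
        refine (toHilb_congr _ (ha.add hb) ((hT.congr _ _ (hadd a b)).trans
          (hT.add _ _ (memL2_ofHilb a) (memL2_ofHilb b)))).trans ?_
        exact MemLp.toLp_add ha.memLp_toLp hb.memLp_toLp
      map_smul' := fun s a => by
        have ha := hT.memL2 _ (memL2_ofHilb a)
        refine (toHilb_congr _ (ha.const_smul s) ((hT.congr _ _ (hsmul s a)).trans
          (hT.smul s _ (memL2_ofHilb a)))).trans ?_
        exact MemLp.toLp_const_smul s ha.memLp_toLp }
  let e := (EuclideanSpace.equiv (Fin p) ℂ)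
  set D := ‖e.symm.toContinuousLinearMap‖ with hD
  set D' := ‖e.toContinuousLinearMap‖ with hD'
  have hof : ∀ (h : HilbL2 p r) x, ‖ofHilb h x‖ ≤ D' * ‖h x‖ := fun h x =>
    e.toContinuousLinearMap.le_opNorm (h x)
  set M : ℝ := ‖(memLp_const (1 : ℝ) : MemLp (fun _ : ℝ => (1 : ℝ)) 2 (vol r)).toLp _‖ with hM
  have hbound : ∀ h, ‖L h‖ ≤ D * C * D' * (1 + c * M) * ‖h‖ := by
    intro h
    set I := ∫ x, ‖h x‖ ∂(vol r) with hI
    have hI0 : 0 ≤ I := integral_nonneg fun _ => norm_nonneg _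
    let g : Lp ℝ 2 (vol r) := (Lp.memLp h).norm.toLp _ +
      I • (memLp_const (1 : ℝ) : MemLp (fun _ : ℝ => (1 : ℝ)) 2 (vol r)).toLp _
    have hg : ∀ᵐ x ∂(vol r), g x = ‖h x‖ + I := by
      filter_upwards [Lp.coeFn_add ((Lp.memLp h).norm.toLp _)
        (I • (memLp_const (1 : ℝ) : MemLp (fun _ : ℝ => (1 : ℝ)) 2 (vol r)).toLp _),
        (Lp.memLp h).norm.coeFn_toLp, Lp.coeFn_smul I
          ((memLp_const (1 : ℝ) : MemLp (fun _ : ℝ => (1 : ℝ)) 2 (vol r)).toLp _),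
        (memLp_const (1 : ℝ) : MemLp (fun _ : ℝ => (1 : ℝ)) 2 (vol r)).coeFn_toLp]
        with x h1 h2 h3 h4
      rw [h1, Pi.add_apply, h2, h3, Pi.smul_apply, h4, smul_eq_mul, mul_one]
    have h1 : ‖L h‖ ≤ D * C * D' * ‖g‖ := by
      refine Lp.norm_le_mul_norm_of_ae_le_mul ?_
      filter_upwards [toHilb_coe (hT.memL2 _ (memL2_ofHilb h)), hb _ (memL2_ofHilb h), hg]
        with x h1 h2 h3
      rw [show L h = toHilb (T (ofHilb h)) (hT.memL2 _ (memL2_ofHilb h)) from rfl, h1, h3,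
        Real.norm_of_nonneg (by positivity)]
      have h4 : ∫ t, ‖ofHilb h t‖ ∂(vol r) ≤ D' * I := by
        rw [hI, ← integral_const_mul]
        exact integral_mono (memL2_ofHilb h).integrable.norm
          (((Lp.memLp h).integrable one_le_two).norm.const_mul _) (hof h)
      calc _ ≤ D * ‖T (ofHilb h) x‖ := e.symm.toContinuousLinearMap.le_opNorm _
        _ ≤ D * (C * (D' * ‖h x‖ + D' * I)) := by
            have hD0 : 0 ≤ D := norm_nonneg _
            refine mul_le_mul_of_nonneg_left (h2.trans ?_) hD0
            exact mul_le_mul_of_nonneg_left (add_le_add (hof h x) h4) hC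
        _ = _ := by ring
    have h2 : ‖g‖ ≤ ‖h‖ + I * M := by
      refine (norm_add_le _ _).trans (add_le_add ?_ ?_)
      · rw [Lp.norm_toLp, eLpNorm_norm, Lp.norm_def]
      · rw [norm_smul, Real.norm_of_nonneg hI0]
    have hDD : 0 ≤ D * C * D' := mul_nonneg (mul_nonneg (norm_nonneg _) hC) (norm_nonneg _)
    have hM0 : 0 ≤ M := norm_nonneg _
    calc _ ≤ D * C * D' * ‖g‖ := h1
      _ ≤ D * C * D' * (‖h‖ + c * ‖h‖ * M) := by
          refine mul_le_mul_of_nonneg_left (h2.trans ?_) hDD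
          exact add_le_add le_rfl (mul_le_mul_of_nonneg_right (hcb h) hM0)
      _ = _ := by ring
  exact ⟨L.mkContinuous _ hbound, fun h => ofHilb_toHilb (hT.memL2 _ (memL2_ofHilb h))⟩

end HilbertSpace

/-! ### The dual family of an invertible bounded operator -/

section DualFamily

variable {p : ℕ} {r : ℝ}

theorem tendsto_vol_symmDiff_Ioo (x : ℝ) :
    Tendsto (fun y => vol r (symmDiff (Ioo 0 y) (Ioo 0 x))) (𝓝 x) (𝓝 0) := by
  have h1 : ∀ y, vol r (symmDiff (Ioo 0 y) (Ioo 0 x)) ≤ ENNReal.ofReal |y - x| := by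
    intro y
    refine (Measure.restrict_apply_le _ _).trans ?_
    have hsub : symmDiff (Ioo 0 y) (Ioo 0 x) ⊆ uIcc x y := by
      rintro t (⟨h1, h2⟩ | ⟨h1, h2⟩)
      · have : x ≤ t := not_lt.1 fun h => h2 ⟨h1.1, h⟩
        exact mem_uIcc.2 (Or.inl ⟨this, h1.2.le⟩)
      · have : y ≤ t := not_lt.1 fun h => h2 ⟨h1.1, h⟩
        exact mem_uIcc.2 (Or.inr ⟨this, h1.2.le⟩)
    refine (measure_mono hsub).trans ?_
    rw [Real.volume_interval]
  refine tendsto_of_tendsto_of_tendsto_of_le_of_le tendsto_const_nhds ?_ (fun _ => zero_le) h1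
  have : Tendsto (fun y : ℝ => ENNReal.ofReal |y - x|) (𝓝 x) (𝓝 (ENNReal.ofReal |x - x|)) :=
    (ENNReal.continuous_ofReal.comp (by fun_prop)).tendsto x
  simpa using this

/-- The images of the functions `χ_(0,x) v` under the adjoint of the inverse of a bounded invertible
operator. -/
theorem IsBoundedOp.exists_dual_family {T : Op p} (hT : IsBoundedOp r T)
    (hinv : InvertibleOnL2 r T) : ∃ a : ℝ → (Fin p → ℂ) → ℝ → Fin p → ℂ,
      (∀ x v, MemL2 r (a x v)) ∧
      (∀ v w, Continuous fun z : ℝ × ℝ => pairing r (a z.1 v) (a z.2 w)) ∧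
      ∀ x v h, MemL2 r h → x ∈ Icc 0 r →
        pairing r (a x v) (T h) = ∫ s in (0 : ℝ)..x, star v ⬝ᵥ h s := by
  obtain ⟨E, hE⟩ := hT.exists_clm
  have hker : E.ker = ⊥ := by
    refine LinearMap.ker_eq_bot'.2 fun h hh => ?_
    have h0 : ofHilb (0 : HilbL2 p r) =ᵐ[vol r] 0 := by
      filter_upwards [Lp.coeFn_zero (EuclideanSpace ℂ (Fin p)) 2 (vol r)] with x hx
      simp only [ofHilb, hx, Pi.zero_apply, WithLp.ofLp_zero]
    have h1 : ofHilb h =ᵐ[vol r] ofHilb (0 : HilbL2 p r) := by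
      refine hinv.inj _ _ (memL2_ofHilb h) (memL2_ofHilb 0) ((hE h).symm.trans ?_)
      have h2 := hE 0
      rw [map_zero] at h2
      rw [show E h = 0 from hh]
      exact h2
    rw [← toHilb_ofHilb h, ← toHilb_ofHilb (0 : HilbL2 p r)]
    exact toHilb_congr _ _ h1
  have hrange : E.range = ⊤ := by
    refine LinearMap.range_eq_top.2 fun g => ?_
    obtain ⟨f, hf, hfg⟩ := hinv.surj _ (memL2_ofHilb g)
    refine ⟨toHilb f hf, ?_⟩
    rw [← toHilb_ofHilb g]
    change E (toHilb f hf) = _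
    rw [← toHilb_ofHilb (E (toHilb f hf))]
    exact toHilb_congr _ _ ((hE _).trans ((hT.congr _ _ (ofHilb_toHilb hf)).trans hfg))
  -- The open mapping theorem makes the inverse bounded, which permits taking its adjoint.
  let F : HilbL2 p r →L[ℂ] HilbL2 p r :=
    (ContinuousLinearEquiv.ofBijective E hker hrange).symm.toContinuousLinearMap
  have hFE : ∀ h, F (E h) = h := fun h =>
    ContinuousLinearEquiv.ofBijective_symm_apply_apply E hker hrange h
  let e : ℝ → (Fin p → ℂ) → HilbL2 p r := fun x v =>
    indicatorConstLp 2 (measurableSet_Ioo (a := 0) (b := x)) (measure_ne_top (vol r) _)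
      (WithLp.toLp 2 v)
  have he : ∀ v, Continuous fun x => e x v := fun v =>
    continuous_indicatorConstLp_set (by norm_num) fun x => tendsto_vol_symmDiff_Ioo x
  -- With `e = χ_(0,x) v` and `a = F* e`, one gets `⟨a, E h⟩ = ⟨e, F E h⟩ = ⟨e, h⟩`. Joint
  -- continuity of the pairings comes from the norm continuity of `x ↦ χ_(0,x) v`.
  let G := ContinuousLinearMap.adjoint F
  refine ⟨fun x v => ofHilb (G (e x v)), fun x v => memL2_ofHilb _, fun v w => ?_,
    fun x v h hh hx => ?_⟩
  · simp only [← inner_ofHilb]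
    exact ((G.continuous.comp (he v)).comp continuous_fst).inner
      ((G.continuous.comp (he w)).comp continuous_snd)
  · have h1 : T h =ᵐ[vol r] ofHilb (E (toHilb h hh)) :=
      (hT.congr _ _ (ofHilb_toHilb hh).symm).trans (hE _).symm
    rw [pairing_congr (EventuallyEq.refl _ _) h1, ← inner_ofHilb,
      ContinuousLinearMap.adjoint_inner_left, hFE, L2.inner_indicatorConstLp_eq_setIntegral_inner,
      Measure.restrict_restrict measurableSet_Ioo,
      inter_eq_left.2 (Ioo_subset_Ioo_right hx.2), intervalIntegral_eq_vol _ hx.1]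
    refine integral_congr_ae ?_
    filter_upwards [(toHilb_coe hh).filter_mono (ae_mono (vol_mono hx.2))] with s hs
    rw [hs, EuclideanSpace.inner_eq_star_dotProduct]
    exact dotProduct_comm _ _

end DualFamily

/-! ### The relations `K E = E A` and `E v = β₂ v` -/

section NormalisedProperties

variable {m₁ m₂ : ℕ} {r : ℝ} {β : ℝ → Matrix (Fin m₂) (Fin m₁ ⊕ Fin m₂) ℂ}
  {u g : ℝ → Matrix (Fin m₂) (Fin m₂) ℂ} {kV : ℝ → ℝ → Matrix (Fin m₂) (Fin m₂) ℂ}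

/-- Convolution operators commute with double integration. -/
theorem comm_convolution {κ : ℝ → ℂ} (hκ : Measurable κ) {C : ℝ} (hC : ∀ y, ‖κ y‖ ≤ C) {x : ℝ}
    (hx : 0 ≤ x) {f : ℝ → ℂ} (hf : Integrable f (vol x)) :
    comm (fun w t => κ (w - t)) f x = 0 := by
  have hm : Measurable fun z : ℝ × ℝ => κ (z.1 - z.2) := hκ.comp (measurable_fst.sub measurable_snd)
  unfold comm
  rw [triangle_swap (C := C) (k := fun w t => κ (w - t)) hx (integrable_sub_vol hx) hf hm
      (fun _ _ _ _ _ => hC _),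
    triangle_swap (φ := fun w => κ (x - w)) (k := fun w t => ((t - w : ℝ) : ℂ)) (C := x) hx
      (integrable_of_kernel_row (k := fun w t => κ (w - t)) hm fun _ _ => hC _) hf (by fun_prop)
      (fun w t h1 h2 h3 => by
        rw [Complex.norm_real, Real.norm_eq_abs, abs_le]; constructor <;> linarith), sub_eq_zero]
  refine intervalIntegral.integral_congr fun t _ => ?_
  refine congrArg (· * f t) ?_
  -- The reflection `w ↦ x + t - w` of `[t,x]` exchanges the two composed kernels.
  have := intervalIntegral.integral_comp_sub_left
    (fun w => ((w - x : ℝ) : ℂ) * κ (w - t)) (a := t) (b := x) (x + t)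
  rw [show x + t - x = t by ring, show x + t - t = x by ring] at this
  rw [← this]
  refine intervalIntegral.integral_congr fun w _ => ?_
  rw [show x + t - w - t = x - w by ring, show x + t - w - x = t - w by ring, mul_comm]

theorem opA_const_mulVec (b : Matrix (Fin m₂) (Fin m₂) ℂ) {f : ℝ → Fin m₂ → ℂ} {x : ℝ}
    (hx : 0 ≤ x) (hf : Integrable f (vol x)) :
    opA m₂ (fun t => b *ᵥ f t) x = b *ᵥ opA m₂ f x := by
  simp only [opA]
  rw [mulVec_intervalIntegral b ((intervalIntegrable_zero_of_vol hx hf).continuousOn_smul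
    (by fun_prop))]
  simp only [Matrix.mulVec_smul]

theorem opV₀_congr_ae (b : Matrix (Fin m₂) (Fin m₂) ℂ) (w : ℝ → Matrix (Fin m₂) (Fin m₂) ℂ)
    {f g : ℝ → Fin m₂ → ℂ} (h : f =ᵐ[vol r] g) : opV₀ b w f =ᵐ[vol r] opV₀ b w g := by
  filter_upwards [h, ae_restrict_mem measurableSet_Ioo] with x hx hxr
  simp only [opV₀]
  rw [hx, intervalIntegral_congr_vol (r := r) (g := fun t => w (x - t) *ᵥ g t) ?_
    ⟨hxr.1.le, hxr.2.le⟩]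
  filter_upwards [h] with t ht
  rw [ht]

section Convolution

variable {b : Matrix (Fin m₂) (Fin m₂) ℂ} {w : ℝ → Matrix (Fin m₂) (Fin m₂) ℂ}

theorem isBoundedOp_opV₀ (hr : 0 ≤ r) (hb : IsUnit b) (hw : ContinuousOn w (Icc 0 r)) :
    IsBoundedOp r (opV₀ b w) := by
  obtain ⟨C, hk⟩ := exists_isVolterraKernel_convKer (b := b) hr hw
  exact (isBoundedOp_opV (u := fun _ => b) hk (fun _ _ => aestronglyMeasurable_const)
    fun _ _ => le_rfl).of_eq
    (fun f hf => ae_vol_of_forall fun x hx => (opV₀_eq_opV hb hw hf hx).symm)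
    fun f g => opV₀_congr_ae b w

theorem opA_opV₀ (hr : 0 ≤ r) (hb : IsUnit b) (hw : ContinuousOn w (Icc 0 r))
    {f : ℝ → Fin m₂ → ℂ} (hf : MemL2 r f) {x : ℝ} (hx : x ∈ Ioo 0 r) :
    opA m₂ (opV₀ b w f) x = opV₀ b w (opA m₂ f) x := by
  have hc : Continuous fun y => b⁻¹ * w (clamp r y) :=
    continuous_const.matrix_mul (continuous_comp_clamp hr hw)
  have hC : ∃ C, ∀ y, entrySum (b⁻¹ * w (clamp r y)) ≤ C := by
    have : ContinuousOn (fun y => entrySum (b⁻¹ * w (clamp r y))) (Icc 0 r) := by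
      unfold entrySum
      exact (continuous_finsetSum _ fun i _ => continuous_finsetSum _ fun k _ =>
        (hc.matrix_elem i k).norm).continuousOn
    obtain ⟨C, hC⟩ := isCompact_Icc.exists_bound_of_continuousOn this
    refine ⟨C, fun y => ?_⟩
    have := (le_abs_self _).trans (hC _ (clamp_mem hr y))
    rwa [clamp_eq (clamp_mem hr y)] at this
  obtain ⟨C, hC⟩ := hC
  have hC' : ∀ y, ∀ i k, ‖(b⁻¹ * w (clamp r y)) i k‖ ≤ C := fun y i k =>
    (norm_entry_le_entrySum _ i k).trans (hC y)
  have hm : ∀ i k, Measurable fun z : ℝ × ℝ => convKer r b w z.1 z.2 i k := fun i k =>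
    (hc.matrix_elem i k).measurable.comp (measurable_fst.sub measurable_snd)
  have hX : ∀ f : ℝ → Fin m₂ → ℂ, ∀ y, opV (fun _ => b) (convKer r b w) f y =
      b *ᵥ opX (convKer r b w) f y := fun f y => by simp only [opX_apply, opV]
  have hXf := memL2_opX hm (fun s τ _ => hC' (s - τ)) hf
  have key : opA m₂ (opX (convKer r b w) f) x = opX (convKer r b w) (opA m₂ f) x := by
    funext i
    rw [← sub_eq_zero, opA_opX_sub_apply hm (fun s τ _ => hC' (s - τ)) hf hx]
    refine Finset.sum_eq_zero fun k _ => ?_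
    exact comm_convolution (κ := fun y => (b⁻¹ * w (clamp r y)) i k)
      (hc.matrix_elem i k).measurable (fun y => hC' y i k) hx.1.le
      (integrable_vol_mono ((memL2_iff.1 hf k).integrable one_le_two) hx.2.le)
  rw [opV₀_eq_opV hb hw (memL2_opA hf) hx, hX, ← key,
    ← opA_const_mulVec b hx.1.le (integrable_vol_mono hXf.integrable hx.2.le)]
  refine opA_congr (r := r) (ae_vol_of_forall fun y hy => ?_) ⟨hx.1.le, hx.2.le⟩
  rw [opV₀_eq_opV hb hw hf hy, hX]

/-- If `w = g'` and `g(0) = b`, then `V₀` maps constants to the values of `g`. -/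
theorem opV₀_const (hr : 0 < r) (hg : MemU r g) (v : Fin m₂ → ℂ) {x : ℝ} (hx : x ∈ Ioo 0 r) :
    opV₀ (g 0) (mderiv r g) (fun _ => v) x = g x *ᵥ v := by
  obtain ⟨_, _, h1, _⟩ := hg.exists_prim hr
  have hx' : x ∈ Icc 0 r := ⟨hx.1.le, hx.2.le⟩
  have hi : ∀ i k, IntervalIntegrable (fun t => mderiv r g t i k * v k) volume 0 x := fun i k =>
    (intervalIntegrable_of_vol (h1 i k).1 ⟨le_rfl, hr.le⟩ hx').mul_const _
  rw [opV₀, intervalIntegral.integral_comp_sub_left (fun y => mderiv r g y *ᵥ v), sub_self, sub_zero]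
  funext i
  rw [Pi.add_apply, intervalIntegral_mulVec_apply hi, mulVec_apply_sum, mulVec_apply_sum,
    ← Finset.sum_add_distrib]
  refine Finset.sum_congr rfl fun k _ => ?_
  have h2 : g x i k = g 0 i k + ∫ t in (0 : ℝ)..x, mderiv r g t i k := (h1 i k).2 x hx'
  rw [intervalIntegral.integral_mul_const, h2, add_mul]

end Convolution

/-- A continuous function with `‖F(x)‖ ≤ c x` almost everywhere vanishes at `0`. -/
theorem eq_zero_of_ae_norm_le {E : Type*} [NormedAddCommGroup E] (hr : 0 < r) {F : ℝ → E}
    (hF : ContinuousOn F (Icc 0 r)) {c : ℝ} (h : ∀ᵐ x ∂(vol r), ‖F x‖ ≤ c * x) : F 0 = 0 := by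
  have h1 : (fun x => max (‖F x‖ - c * x) 0) =ᵐ[volume.restrict (Icc 0 r)] fun _ => 0 := by
    rw [← Measure.restrict_congr_set Ioo_ae_eq_Icc]
    filter_upwards [h] with x hx
    exact max_eq_right (by linarith)
  have h2 := Measure.eqOn_Icc_of_ae_eq volume hr.ne h1
    (ContinuousOn.sup (hF.norm.sub (continuousOn_const.mul continuousOn_id)) continuousOn_const)
    continuousOn_const
    (⟨le_rfl, hr.le⟩ : (0 : ℝ) ∈ Icc 0 r)
  have h3 : ‖F 0‖ - c * 0 ≤ 0 := max_eq_right_iff.1 h2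
  rw [mul_zero, sub_zero] at h3
  exact norm_le_zero_iff.1 h3

namespace IsTransformation

theorem exists_isVolterraKernel (h : IsTransformation β r u kV) :
    ∃ C, IsVolterraKernel r kV (fun _ => C) fun _ => 1 := by
  obtain ⟨C, hC⟩ := h.kernel_bounded
  exact isVolterraKernel_of_bounded h.kernel_measurable
    fun x hx t ht i j => hC x t ht.1.le ht.2.le hx.2.le i j

theorem exists_u_bound (h : IsTransformation β r u kV) :
    ∃ C, ∀ x ∈ Icc 0 r, entrySum (u x) ≤ C := by
  have : ContinuousOn (fun x => entrySum (u x)) (Icc 0 r) := by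
    unfold entrySum
    exact continuousOn_finsetSum _ fun i _ => continuousOn_finsetSum _ fun k _ =>
      (h.u_memU.1 i k).continuousOn.norm
  obtain ⟨C, hC⟩ := isCompact_Icc.exists_bound_of_continuousOn this
  exact ⟨C, fun x hx => (le_abs_self _).trans (hC x hx)⟩

theorem aestronglyMeasurable_u (h : IsTransformation β r u kV) (i j : Fin m₂) :
    AEStronglyMeasurable (fun x => u x i j) (vol r) :=
  ((h.u_memU.1 i j).continuousOn.mono Ioo_subset_Icc_self).aestronglyMeasurable measurableSet_Ioo

theorem isBoundedOp (h : IsTransformation β r u kV) : IsBoundedOp r (opV u kV) := by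
  obtain ⟨C, hk⟩ := h.exists_isVolterraKernel
  obtain ⟨D, hD⟩ := h.exists_u_bound
  exact isBoundedOp_opV hk h.aestronglyMeasurable_u fun x hx => hD x ⟨hx.1.le, hx.2.le⟩

theorem norm_mulVec_integral_le (h : IsTransformation β r u kV) :
    ∃ D, ∀ (f : ℝ → Fin m₂ → ℂ) (M : ℝ), 0 ≤ M → (∀ x ∈ Icc 0 r, ‖f x‖ ≤ M) → ∀ x ∈ Ioo 0 r,
      ‖u x *ᵥ ∫ t in (0 : ℝ)..x, kV x t *ᵥ f t‖ ≤ D * M * x := by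
  obtain ⟨C, hk⟩ := h.exists_isVolterraKernel
  obtain ⟨D, hD⟩ := h.exists_u_bound
  have hC : 0 ≤ C := hk.left_nonneg 0
  refine ⟨D * C, fun f M hM0 hM x hx => ?_⟩
  have hb : ∀ t ∈ Ioo 0 x, ‖kV x t *ᵥ f t‖ ≤ C * M := fun t ht => by
    have h1 : ‖kV x t *ᵥ f t‖ ≤ C * (1 * ‖f t‖) := hk.norm_integrand_le hx _ ht
    rw [one_mul] at h1
    exact h1.trans (mul_le_mul_of_nonneg_left (hM t ⟨ht.1.le, (ht.2.trans hx.2).le⟩) hC)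
  have h1 : ‖∫ t in (0 : ℝ)..x, kV x t *ᵥ f t‖ ≤ ∫ t in (0 : ℝ)..x, C * M :=
    norm_intervalIntegral_le_vol hx.1.le (integrable_const _) hb
  rw [intervalIntegral.integral_const, smul_eq_mul, sub_zero] at h1
  have h2 := norm_mulVec_le (u x) (∫ t in (0 : ℝ)..x, kV x t *ᵥ f t)
  have h3 := mul_le_mul_of_nonneg_left h1 (entrySum_nonneg (u x))
  have h4 := mul_le_mul_of_nonneg_right (hD x ⟨hx.1.le, hx.2.le⟩)
    (mul_nonneg hx.1.le (mul_nonneg hC hM0))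
  have h5 : D * (x * (C * M)) = D * C * M * x := by ring
  exact h2.trans (h3.trans (h4.trans h5.le))

/-- The representative of `V⁻¹ β₂` has the initial value `β₂(0)`. -/
theorem apply_zero (hr : 0 < r) (hβ : MemU r β) (h : IsTransformation β r u kV) (hg : MemU r g)
    (hgV : IsInvApply r (opV u kV) (blk₂ β) g) : g 0 = blk₂ β 0 := by
  obtain ⟨D, hD⟩ := h.norm_mulVec_integral_le
  suffices hcol : ∀ k, (g 0).col k = (blk₂ β 0).col k by
    ext i k; exact congrFun (hcol k) i
  intro k
  have hgc : ContinuousOn (fun x => (g x).col k) (Icc 0 r) :=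
    continuousOn_pi.2 fun i => (hg.1 i k).continuousOn
  obtain ⟨M, hM⟩ := isCompact_Icc.exists_bound_of_continuousOn hgc
  have hM0 : 0 ≤ M := (norm_nonneg _).trans (hM 0 ⟨le_rfl, hr.le⟩)
  have hFc : ContinuousOn (fun x => u x *ᵥ (g x).col k - (blk₂ β x).col k) (Icc 0 r) := by
    refine continuousOn_pi.2 fun i => ?_
    simp only [Pi.sub_apply, mulVec_apply_sum]
    exact (continuousOn_finsetSum _ fun l _ => (h.u_memU.1 i l).continuousOn.mul
      (hg.1 l k).continuousOn).sub (hβ.1 i (Sum.inr k)).continuousOn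
  -- `u g - β₂` equals `-u ∫₀ˣ 𝒱 g` almost everywhere, which is of order `x` since `𝒱` is bounded.
  -- By continuity it vanishes at `0`.
  have hz : u 0 *ᵥ (g 0).col k - (blk₂ β 0).col k = 0 := by
    refine eq_zero_of_ae_norm_le hr hFc (c := D * M) ?_
    filter_upwards [hgV.apply_eq k, ae_restrict_mem measurableSet_Ioo] with x hx hxr
    have e : u x *ᵥ (g x).col k - (blk₂ β x).col k =
        -(u x *ᵥ ∫ t in (0 : ℝ)..x, kV x t *ᵥ (g t).col k) := by
      have hx' : u x *ᵥ ((g x).col k + ∫ t in (0 : ℝ)..x, kV x t *ᵥ (g t).col k) =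
        (blk₂ β x).col k := hx
      rw [← hx', Matrix.mulVec_add, sub_add_cancel_left]
    rw [e, norm_neg]
    exact hD _ M hM0 hM x hxr
  rw [h.u_zero, Matrix.one_mulVec] at hz
  exact sub_eq_zero.1 hz

end IsTransformation

/-- The properties of a normalised transformation operator `E` that determine it: `E` is a bounded
operator with `K E = E A` which maps constants `v` to `β₂ v`. -/
structure Intertwines (β : ℝ → Matrix (Fin m₂) (Fin m₁ ⊕ Fin m₂) ℂ) (r : ℝ) (E : Op m₂) : Prop where
  isBoundedOp : IsBoundedOp r E
  similar : ∀ f, MemL2 r f → opK β (E f) =ᵐ[vol r] E (opA m₂ f)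
  apply_const : ∀ v, E (fun _ => v) =ᵐ[vol r] fun x => blk₂ β x *ᵥ v

/-- `K V V₀ = V A V₀ = V V₀ A`, the last step because `V₀` is a convolution operator. Since `g(0) =
β₂(0)`, the choice `𝒱₀ = g'` gives `V₀ v = g v`, and `V` maps the columns of `g` to those of `β₂`.
-/
theorem IsNormalisedTransformation.intertwines (hr : 0 < r) (hβ : Admissible β r) {E : Op m₂}
    (hE : IsNormalisedTransformation β r E) : Intertwines β r E := by
  obtain ⟨u, kV, g, hV, hg, hgV, rfl⟩ := hE
  have hb := hβ.isUnit_blk₂ hr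
  have hw := hg.continuousOn_mderiv hr
  have hV₀ := isBoundedOp_opV₀ hr.le hb hw
  have hVb := hV.isBoundedOp
  have hg0 := hV.apply_zero hr hβ.memU hg hgV
  refine ⟨hVb.comp hV₀, fun f hf => ?_, fun v => ?_⟩
  · refine (hV.similar _ (hV₀.memL2 f hf)).trans (hVb.congr _ _ ?_)
    exact ae_vol_of_forall fun x hx => opA_opV₀ hr.le hb hw hf hx
  · have h1 : opV₀ (blk₂ β 0) (mderiv r g) (fun _ => v) =ᵐ[vol r] fun x => g x *ᵥ v :=
      ae_vol_of_forall fun x hx => by rw [← hg0]; exact opV₀_const hr hg v hx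
    refine (hVb.congr _ _ h1).trans ?_
    have hcol : ∀ᵐ x ∂(vol r), ∀ k, opV u kV (fun x => (g x).col k) x = (blk₂ β x).col k :=
      ae_all_iff.2 fun k => hgV.apply_eq k
    obtain ⟨C, hk⟩ := hV.exists_isVolterraKernel
    filter_upwards [hcol, ae_restrict_mem measurableSet_Ioo] with x hx hxr
    have hsum : ∀ M : Matrix (Fin m₂) (Fin m₂) ℂ, M *ᵥ v = ∑ k, v k • M.col k := fun M => by
      funext i
      rw [mulVec_apply_sum, Finset.sum_apply]
      exact Finset.sum_congr rfl fun k _ => mul_comm _ _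
    have hI : ∫ t in (0 : ℝ)..x, kV x t *ᵥ (g t *ᵥ v) =
        ∑ k, v k • ∫ t in (0 : ℝ)..x, kV x t *ᵥ (g t).col k := by
      have hi : ∀ k, IntervalIntegrable (fun t => v k • kV x t *ᵥ (g t).col k) volume 0 x := fun k =>
        (hk.intervalIntegrable_integrand hxr (hgV.memL2 k)).smul (v k)
      simp only [hsum (g _), Matrix.mulVec_sum, Matrix.mulVec_smul]
      rw [intervalIntegral.integral_finsetSum fun k _ => hi k]
      simp only [intervalIntegral.integral_smul]
    rw [opV, hI, hsum (g x), hsum (blk₂ β x), ← Finset.sum_add_distrib, Matrix.mulVec_sum]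
    refine Finset.sum_congr rfl fun k _ => ?_
    rw [← hx k, opV, ← smul_add, Matrix.mulVec_smul]

end NormalisedProperties

/-! ### The operator identity for `K` in terms of the dual family -/

section DualFamily

variable {p : ℕ} {r : ℝ}

theorem dotProduct_intervalIntegral {ι : Type*} [Fintype ι] (v : ι → ℂ) {f : ℝ → ι → ℂ} {a b : ℝ}
    (hf : IntervalIntegrable f volume a b) :
    v ⬝ᵥ ∫ t in a..b, f t = ∫ t in a..b, v ⬝ᵥ f t :=
  congrFun (mulVec_intervalIntegral (Matrix.of fun (_ : Unit) i => v i) hf) () |>.trans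
    (intervalIntegral_apply (intervalIntegrable_const_mulVec (Matrix.of fun (_ : Unit) i => v i) hf)
      ())

theorem pairing_conj (a b : ℝ → Fin p → ℂ) : star (pairing r a b) = pairing r b a := by
  rw [pairing, pairing, Complex.star_def, ← integral_conj]
  refine integral_congr_ae (ae_of_all _ fun s => ?_)
  exact (Matrix.star_dotProduct _ _).symm

/-- Integration commutes with double integration. -/
theorem integral_opA {f : ℝ → Fin p → ℂ} (hf : Integrable f (vol r)) {x : ℝ} (hx : x ∈ Icc 0 r) :
    ∫ y in (0 : ℝ)..x, opA p f y = ∫ y in (0 : ℝ)..x, (y - x) • ∫ t in (0 : ℝ)..y, f t := by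
  have h1 := VPrim.opA hf
  have h2 := (VPrim.of_integral (memL2_of_continuousOn h1.continuousOn).integrable).taylor h1 hx
  have h3 : opA p f 0 = 0 := by simp [opA]
  rw [intervalIntegral.integral_same, h3, smul_zero, zero_add, zero_sub] at h2
  rw [h2]
  simp only [opA, smul_neg, intervalIntegral.integral_neg, neg_neg]

theorem continuousOn_integral {f : ℝ → Fin p → ℂ} (hf : Integrable f (vol r)) :
    ContinuousOn (fun x => ∫ t in (0 : ℝ)..x, f t) (Icc 0 r) := (VPrim.of_integral hf).continuousOn

end DualFamily

/-! ### The finite rank operator `K - K*` -/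

section Symplectic

variable {m₁ m₂ : ℕ} {r : ℝ} {β : ℝ → Matrix (Fin m₂) (Fin m₁ ⊕ Fin m₂) ℂ}

/-- The vector `∫₀ʳ β* f`. -/
noncomputable def totalFlux (β : ℝ → Matrix (Fin m₂) (Fin m₁ ⊕ Fin m₂) ℂ) (r : ℝ)
    (f : ℝ → Fin m₂ → ℂ) : Fin m₁ ⊕ Fin m₂ → ℂ := ∫ t in (0 : ℝ)..r, (β t)ᴴ *ᵥ f t

theorem integrable_conjTranspose_mulVec (hβ : MemU r β) {f : ℝ → Fin m₂ → ℂ} (hf : MemL2 r f) :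
    Integrable (fun t => (β t)ᴴ *ᵥ f t) (vol r) := by
  refine Integrable.of_eval fun k => ?_
  simp only [mulVec_apply_sum, Matrix.conjTranspose_apply]
  refine integrable_finsetSum _ fun i _ => ?_
  obtain ⟨C, hC⟩ := isCompact_Icc.exists_bound_of_continuousOn (hβ.1 i k).continuousOn
  exact ((memL2_iff.1 hf i).integrable one_le_two).bdd_mul
    (((hβ.1 i k).continuousOn.mono Ioo_subset_Icc_self).aestronglyMeasurable
      measurableSet_Ioo).star (c := C) (ae_vol_of_forall fun x hx => by
        rw [norm_star]; exact hC x ⟨hx.1.le, hx.2.le⟩)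

theorem memL2_opK_of_memU (hβ : MemU r β) {f : ℝ → Fin m₂ → ℂ} (hf : MemL2 r f) :
    MemL2 r (opK β f) := by
  refine memL2_of_continuousOn (continuousOn_pi.2 fun i => ?_)
  have hc := (VPrim.of_integral (integrable_conjTranspose_mulVec hβ hf)).continuousOn
  simp only [opK, Pi.smul_apply, mulVec_apply_sum, Matrix.mul_apply]
  have h1 : ContinuousOn (fun x => ∑ k, (∑ l, β x i l * jmat m₁ m₂ l k) *
      (∫ t in (0 : ℝ)..x, (β t)ᴴ *ᵥ f t) k) (Icc 0 r) :=
    continuousOn_finsetSum _ fun k _ => ContinuousOn.mul (continuousOn_finsetSum _ fun l _ =>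
      (hβ.1 i l).continuousOn.mul continuousOn_const) ((continuousOn_pi.1 hc) k)
  exact h1.const_smul Complex.I

theorem integrable_pairing {p : ℕ} {f g : ℝ → Fin p → ℂ} (hf : MemL2 r f) (hg : MemL2 r g) :
    Integrable (fun s => star (f s) ⬝ᵥ g s) (vol r) := by
  simp only [dotProduct, Pi.star_apply]
  exact integrable_finsetSum _ fun i _ =>
    ((memL2_iff.1 hf i).star).integrable_mul (memL2_iff.1 hg i)

/-- The operator `K - K*` is of finite rank. -/
theorem pairing_opK_sub (hr : 0 ≤ r) (hβ : MemU r β) {f g : ℝ → Fin m₂ → ℂ} (hf : MemL2 r f)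
    (hg : MemL2 r g) : pairing r f (opK β g) - pairing r (opK β f) g =
      Complex.I * (star (totalFlux β r f) ⬝ᵥ (jmat m₁ m₂ *ᵥ totalFlux β r g)) := by
  have hf' := integrable_conjTranspose_mulVec hβ hf
  have hg' := integrable_conjTranspose_mulVec hβ hg
  -- With `W_f(x) = ∫₀ˣ β* f`, the form `W_f* j W_g` is absolutely continuous. The two terms of its
  -- derivative are, up to the factor `i`, the integrands of the two pairings, so their total is its
  -- increment over `[0,r]`.
  have key : HasPrim r (fun x => ∑ i, star ((∫ t in (0 : ℝ)..x, (β t)ᴴ *ᵥ f t) i) *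
      ∑ l, jmat m₁ m₂ i l * (∫ t in (0 : ℝ)..x, (β t)ᴴ *ᵥ g t) l) _ :=
    HasPrim.sum Finset.univ fun i _ => (VPrim.of_integral hf' i).star.mul
      (HasPrim.sum Finset.univ fun l _ => (VPrim.of_integral hg' l).const_mul (jmat m₁ m₂ i l))
  have h1 := key.2 r ⟨hr, le_rfl⟩
  simp only [intervalIntegral.integral_same, Pi.zero_apply, star_zero, zero_mul,
    Finset.sum_const_zero, zero_add] at h1
  have h2 : star (totalFlux β r f) ⬝ᵥ (jmat m₁ m₂ *ᵥ totalFlux β r g) = _ := h1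
  rw [h2, ← intervalIntegral.integral_const_mul, intervalIntegral_eq_vol _ hr, pairing, pairing,
    ← integral_sub (integrable_pairing hf (memL2_opK_of_memU hβ hg))
      (integrable_pairing (memL2_opK_of_memU hβ hf) hg)]
  refine integral_congr_ae (ae_of_all _ fun s => ?_)
  have e1 : ∀ w : Fin m₁ ⊕ Fin m₂ → ℂ, star (f s) ⬝ᵥ (Complex.I • ((β s * jmat m₁ m₂) *ᵥ w)) =
      Complex.I * (star ((β s)ᴴ *ᵥ f s) ⬝ᵥ (jmat m₁ m₂ *ᵥ w)) := fun w => by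
    rw [dotProduct_smul, smul_eq_mul, Matrix.star_mulVec, Matrix.conjTranspose_conjTranspose,
      ← Matrix.dotProduct_mulVec, Matrix.mulVec_mulVec]
  have e2 : ∀ w : Fin m₁ ⊕ Fin m₂ → ℂ, star (Complex.I • ((β s * jmat m₁ m₂) *ᵥ w)) ⬝ᵥ g s =
      -(Complex.I * (star w ⬝ᵥ (jmat m₁ m₂ *ᵥ ((β s)ᴴ *ᵥ g s)))) := fun w => by
    rw [star_smul, smul_dotProduct, smul_eq_mul, Matrix.star_mulVec, Matrix.conjTranspose_mul,
      jmat_conjTranspose, ← Matrix.dotProduct_mulVec, Matrix.mulVec_mulVec, Complex.star_def,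
      Complex.conj_I, neg_mul]
  simp only [opK]
  rw [e1, e2, sub_neg_eq_add, ← mul_add]
  simp only [dotProduct, mulVec_apply_sum, Pi.star_apply, Finset.sum_add_distrib]

theorem totalFlux_apply (hr : 0 ≤ r) (hβ : MemU r β) {f : ℝ → Fin m₂ → ℂ} (hf : MemL2 r f)
    (κ : Fin m₁ ⊕ Fin m₂) :
    totalFlux β r f κ = star (pairing r f fun s => (β s).col κ) := by
  rw [pairing_conj, totalFlux, intervalIntegral_apply (intervalIntegrable_zero_of_vol hr
    (integrable_conjTranspose_mulVec hβ hf)), intervalIntegral_eq_vol _ hr]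
  rfl

end Symplectic

/-! ### The operator identity evaluated on the dual family -/

section Identity

variable {m₁ m₂ : ℕ} {r : ℝ} {β : ℝ → Matrix (Fin m₂) (Fin m₁ ⊕ Fin m₂) ℂ} {E : Op m₂}
  {Φ : ℝ → Matrix (Fin m₂) (Fin m₁) ℂ} {a : ℝ → (Fin m₂ → ℂ) → ℝ → Fin m₂ → ℂ}

/-- Write `h = E f`. Then `⟨a(x,v), K E f⟩ = ⟨a(x,v), E A f⟩` is the integral of `v* A f` over
`(0,x)`. Integration commutes with `A`, and each inner integral of `v* f` over `(0,y)` is again a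
pairing with the dual family. -/
theorem pairing_dual_opK (hE : Intertwines β r E) (hinv : InvertibleOnL2 r E)
    (ha : ∀ x v h, MemL2 r h → x ∈ Icc 0 r →
      pairing r (a x v) (E h) = ∫ s in (0 : ℝ)..x, star v ⬝ᵥ h s)
    {h : ℝ → Fin m₂ → ℂ} (hh : MemL2 r h) {x : ℝ} (hx : x ∈ Icc 0 r) (v : Fin m₂ → ℂ) :
    pairing r (a x v) (opK β h) =
      ∫ y in (0 : ℝ)..x, ((y - x : ℝ) : ℂ) * pairing r (a y v) h := by
  obtain ⟨f, hf, hfh⟩ := hinv.surj h hh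
  have h0 : (0 : ℝ) ∈ Icc 0 r := ⟨le_rfl, hx.1.trans hx.2⟩
  have h1 : opK β h =ᵐ[vol r] E (opA m₂ f) :=
    EventuallyEq.trans (ae_vol_of_forall fun y hy => opK_congr hfh.symm ⟨hy.1.le, hy.2.le⟩)
      (hE.similar f hf)
  have hA := memL2_opA hf
  have hJ := continuousOn_integral hf.integrable
  rw [pairing_congr (ae_of_all _ fun _ => rfl) h1, ha x v _ hA hx,
    ← dotProduct_intervalIntegral _ (intervalIntegrable_of_vol hA.integrable h0 hx),
    integral_opA hf.integrable hx, dotProduct_intervalIntegral]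
  · refine intervalIntegral.integral_congr fun y hy => ?_
    rw [uIcc_of_le hx.1] at hy
    have hy' : y ∈ Icc 0 r := ⟨hy.1, hy.2.trans hx.2⟩
    rw [pairing_congr (ae_of_all _ fun _ => rfl) hfh.symm, ha y v _ hf hy', dotProduct_smul,
      dotProduct_intervalIntegral _ (intervalIntegrable_of_vol hf.integrable h0 hy'),
      Complex.real_smul]
  · refine ContinuousOn.intervalIntegrable_of_Icc hx.1 ?_
    exact ContinuousOn.smul (continuousOn_id.sub continuousOn_const) (hJ.mono (Icc_subset_Icc_right hx.2))

/-- The form of `K - K*` on `a(x,v)` and `a(t,w)` is computed twice: by `pairing_dual_opK`, and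
through the vectors `∫₀ʳ β* a`. The latter are explicit since `β₁ = E Φ` gives integrals of `Φ` and
`β₂ = E I` gives `x v`. -/
theorem dual_identity (hr : 0 ≤ r) (hβ : MemU r β) (hE : Intertwines β r E)
    (hΦ : IsInvApply r E (blk₁ β) Φ) (haL : ∀ x v, MemL2 r (a x v))
    (ha : ∀ x v h, MemL2 r h → x ∈ Icc 0 r →
      pairing r (a x v) (E h) = ∫ s in (0 : ℝ)..x, star v ⬝ᵥ h s)
    {x t : ℝ} (hx : x ∈ Icc 0 r) (ht : t ∈ Icc 0 r) (v w : Fin m₂ → ℂ) :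
    (∫ y in (0 : ℝ)..x, ((y - x : ℝ) : ℂ) * pairing r (a y v) (a t w)) -
        (∫ y in (0 : ℝ)..t, ((y - t : ℝ) : ℂ) * pairing r (a x v) (a y w)) =
      Complex.I * ((∑ k, (∫ s in (0 : ℝ)..x, star v ⬝ᵥ (Φ s).col k) *
        star (∫ s in (0 : ℝ)..t, star w ⬝ᵥ (Φ s).col k)) - x * t * (star v ⬝ᵥ w)) := by
  have h1 := pairing_opK_sub hr hβ (haL x v) (haL t w)
  have h2 : pairing r (opK β (a x v)) (a t w) =
      ∫ y in (0 : ℝ)..t, ((y - t : ℝ) : ℂ) * pairing r (a x v) (a y w) := by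
    rw [← pairing_conj, pairing_dual_opK hE hΦ.invertible ha (haL x v) ht w, Complex.star_def,
      ← intervalIntegral.intervalIntegral_conj]
    refine intervalIntegral.integral_congr fun y _ => ?_
    simp only [map_mul, Complex.conj_ofReal]
    rw [← Complex.star_def, pairing_conj]
  rw [pairing_dual_opK hE hΦ.invertible ha (haL t w) hx v, h2] at h1
  rw [h1]
  have flux₁ : ∀ y ∈ Icc 0 r, ∀ v k, totalFlux β r (a y v) (Sum.inl k) =
      star (∫ s in (0 : ℝ)..y, star v ⬝ᵥ (Φ s).col k) := fun y hy v k => by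
    rw [totalFlux_apply hr hβ (haL y v), ← ha y v _ (hΦ.memL2 k) hy,
      pairing_congr (ae_of_all _ fun _ => rfl) (hΦ.apply_eq k)]
    rfl
  have flux₂ : ∀ y ∈ Icc 0 r, ∀ v k, totalFlux β r (a y v) (Sum.inr k) = y * v k :=
    fun y hy v k => by
    have h3 : (fun s => (β s).col (Sum.inr k)) =ᵐ[vol r] E fun _ => Pi.single k 1 := by
      refine EventuallyEq.trans (ae_of_all _ fun s => ?_) (hE.apply_const (Pi.single k 1)).symm
      rw [Matrix.mulVec_single_one]
      rfl
    rw [totalFlux_apply hr hβ (haL y v), pairing_congr (ae_of_all _ fun _ => rfl) h3,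
      ha y v _ (memL2_const _) hy, intervalIntegral.integral_const, sub_zero,
      dotProduct_single, mul_one, Pi.star_apply, Complex.real_smul, star_mul', star_star,
      Complex.star_def, Complex.conj_ofReal]
  congr 1
  have h4 : ∀ X Y : Fin m₁ ⊕ Fin m₂ → ℂ, star X ⬝ᵥ (jmat m₁ m₂ *ᵥ Y) =
      (∑ k, star (X (Sum.inl k)) * Y (Sum.inl k)) - ∑ k, star (X (Sum.inr k)) * Y (Sum.inr k) := by
    intro X Y
    simp only [dotProduct, Fintype.sum_sum_type, jmat, Matrix.fromBlocks_mulVec, Sum.elim_inl,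
      Sum.elim_inr, Pi.star_apply, Matrix.one_mulVec, Matrix.zero_mulVec, Matrix.neg_mulVec,
      add_zero, zero_add, Function.comp, Pi.neg_apply, mul_neg, Finset.sum_neg_distrib,
      sub_eq_add_neg]
  rw [h4]
  simp only [flux₁ x hx, flux₁ t ht, flux₂ x hx, flux₂ t ht, star_star]
  congr 1
  rw [dotProduct, Finset.mul_sum]
  refine Finset.sum_congr rfl fun k _ => ?_
  rw [star_mul', Complex.star_def, Complex.conj_ofReal, ← Complex.star_def, Pi.star_apply]
  ring

end Identity

/-! ### Convolutions on an interval -/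

section Antisymmetry

variable {q : ℝ × ℝ → ℂ} {ξ : ℝ}

theorem integral_ramp_eq {f : ℝ → ℂ} (hf : Continuous f) {x : ℝ} (hx : x ∈ Icc 0 ξ) :
    ∫ y in (0 : ℝ)..(ξ - x), ((y - (ξ - x) : ℝ) : ℂ) * f y =
      ∫ y in (0 : ℝ)..ξ, ((min (x + y - ξ) 0 : ℝ) : ℂ) * f y := by
  have hc : Continuous fun y => ((min (x + y - ξ) 0 : ℝ) : ℂ) * f y := by fun_prop
  rw [← intervalIntegral.integral_add_adjacent_intervals (b := ξ - x) (hc.intervalIntegrable _ _)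
    (hc.intervalIntegrable _ _)]
  have h1 : ∫ y in (ξ - x)..ξ, ((min (x + y - ξ) 0 : ℝ) : ℂ) * f y = ∫ y in (ξ - x)..ξ, (0 : ℂ) := by
    refine intervalIntegral.integral_congr fun y hy => ?_
    rw [uIcc_of_le (by linarith [hx.1])] at hy
    rw [min_eq_right (by linarith [hy.1]), Complex.ofReal_zero, zero_mul]
  rw [h1, intervalIntegral.integral_zero, add_zero]
  refine intervalIntegral.integral_congr fun y hy => ?_
  rw [uIcc_of_le (by linarith [hx.2])] at hy
  rw [min_eq_left (by linarith [hy.2]), show x + y - ξ = y - (ξ - x) by ring]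

theorem intervalIntegral_swap_of_continuous {F : ℝ × ℝ → ℂ} (hF : Continuous F) (hξ : 0 ≤ ξ) :
    ∫ x in (0 : ℝ)..ξ, ∫ y in (0 : ℝ)..ξ, F (x, y) = ∫ x in (0 : ℝ)..ξ, ∫ y in (0 : ℝ)..ξ, F (y, x) := by
  simp only [intervalIntegral_eq_vol _ hξ]
  refine integral_integral_swap (f := fun x y => F (x, y)) ?_
  rw [Measure.prod_restrict]
  exact (hF.continuousOn.integrableOn_compact (isCompact_Icc.prod isCompact_Icc)).mono_set
    (prod_mono Ioo_subset_Icc_self Ioo_subset_Icc_self)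

/-- After `x ↦ ξ - x` in the first term, both terms integrate the ramp `min (x + y - ξ) 0` over the
square, once against `q(y,x)` and once against `q(x,y)`. The ramp is symmetric, so the integrals
coincide; no symmetry of `q` is needed. -/
theorem integral_ramp_antisymm (hq : Continuous q) (hξ : 0 ≤ ξ) :
    ∫ x in (0 : ℝ)..ξ, ((∫ y in (0 : ℝ)..x, ((y - x : ℝ) : ℂ) * q (y, ξ - x)) -
      ∫ y in (0 : ℝ)..(ξ - x), ((y - (ξ - x) : ℝ) : ℂ) * q (x, y)) = 0 := by
  have c1 : Continuous fun x => ∫ y in (0 : ℝ)..x, ((y - x : ℝ) : ℂ) * q (y, ξ - x) :=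
    intervalIntegral.continuous_parametric_intervalIntegral_of_continuous
      (f := fun x y => ((y - x : ℝ) : ℂ) * q (y, ξ - x)) (by fun_prop) continuous_id
  have c2 : Continuous fun x => ∫ y in (0 : ℝ)..(ξ - x), ((y - (ξ - x) : ℝ) : ℂ) * q (x, y) :=
    intervalIntegral.continuous_parametric_intervalIntegral_of_continuous
      (f := fun x y => ((y - (ξ - x) : ℝ) : ℂ) * q (x, y)) (by fun_prop) (by fun_prop)
  rw [intervalIntegral.integral_sub (c1.intervalIntegrable _ _) (c2.intervalIntegrable _ _),
    sub_eq_zero]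
  have h1 := intervalIntegral.integral_comp_sub_left (a := 0) (b := ξ)
    (fun x => ∫ y in (0 : ℝ)..x, ((y - x : ℝ) : ℂ) * q (y, ξ - x)) ξ
  simp only [sub_sub_cancel, sub_self, sub_zero] at h1
  rw [← h1]
  have h2 : ∀ x ∈ uIcc 0 ξ, (∫ y in (0 : ℝ)..(ξ - x), ((y - (ξ - x) : ℝ) : ℂ) * q (y, x)) =
      ∫ y in (0 : ℝ)..ξ, ((min (x + y - ξ) 0 : ℝ) : ℂ) * q (y, x) := fun x hx =>
    integral_ramp_eq (f := fun y => q (y, x)) (by fun_prop) (by rwa [uIcc_of_le hξ] at hx)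
  have h3 : ∀ x ∈ uIcc 0 ξ, (∫ y in (0 : ℝ)..(ξ - x), ((y - (ξ - x) : ℝ) : ℂ) * q (x, y)) =
      ∫ y in (0 : ℝ)..ξ, ((min (x + y - ξ) 0 : ℝ) : ℂ) * q (x, y) := fun x hx =>
    integral_ramp_eq (f := fun y => q (x, y)) (by fun_prop) (by rwa [uIcc_of_le hξ] at hx)
  rw [intervalIntegral.integral_congr h2, intervalIntegral.integral_congr h3,
    intervalIntegral_swap_of_continuous
      (F := fun z => ((min (z.1 + z.2 - ξ) 0 : ℝ) : ℂ) * q z) (by fun_prop) hξ]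
  simp only [add_comm]

end Antisymmetry

/-! ### Convolution of square integrable functions -/

section Convolution

variable {r : ℝ} {f g : ℝ → ℂ}

/-- The convolution `∫₀ˣ f(x-t) g(t) dt`. -/
noncomputable def conv (f g : ℝ → ℂ) (x : ℝ) : ℂ := ∫ t in (0 : ℝ)..x, f (x - t) * g t

/-- The primitive `∫₀ˣ f`. -/
noncomputable def prim (f : ℝ → ℂ) (x : ℝ) : ℂ := ∫ t in (0 : ℝ)..x, f t

theorem conv_comm (f g : ℝ → ℂ) (x : ℝ) : conv f g x = conv g f x := by
  have := intervalIntegral.integral_comp_sub_left (a := 0) (b := x) (fun t => f (x - t) * g t) x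
  simp only [sub_sub_cancel, sub_self, sub_zero] at this
  rw [conv, ← this, conv]
  simp only [mul_comm]

theorem indicator_conv {x : ℝ} (hx : x ≤ r) (t : ℝ) :
    (Ioo 0 r).indicator f (x - t) * (Ioo 0 r).indicator g t =
      (Ioo 0 x).indicator (fun t => f (x - t) * g t) t := by
  by_cases ht : t ∈ Ioo 0 x
  · have h1 : x - t ∈ Ioo 0 r := ⟨by linarith [ht.2], by linarith [ht.1]⟩
    have h2 : t ∈ Ioo 0 r := ⟨ht.1, ht.2.trans_le hx⟩
    rw [indicator_of_mem ht, indicator_of_mem h1, indicator_of_mem h2]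
  · rw [indicator_of_notMem ht]
    by_cases h0 : 0 < t
    · rw [indicator_of_notMem (fun h : x - t ∈ Ioo 0 r => ht ⟨h0, by linarith [h.1]⟩), zero_mul]
    · rw [indicator_of_notMem (fun h : t ∈ Ioo 0 r => h0 h.1), mul_zero]

theorem conv_eq_integral {x : ℝ} (hx : x ∈ Icc 0 r) :
    conv f g x = ∫ t, (Ioo 0 r).indicator f (x - t) * (Ioo 0 r).indicator g t := by
  simp only [indicator_conv hx.2]
  rw [integral_indicator measurableSet_Ioo, conv, intervalIntegral_eq_vol _ hx.1]

theorem memLp_indicator (hf : MemLp f 2 (vol r)) : MemLp ((Ioo 0 r).indicator f) 2 volume :=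
  (memLp_indicator_iff_restrict measurableSet_Ioo).2 hf

theorem memLp_comp_sub (hf : MemLp f 2 (vol r)) (x : ℝ) :
    MemLp (fun t => (Ioo 0 r).indicator f (x - t)) 2 volume :=
  (memLp_indicator hf).comp_measurePreserving (Measure.measurePreserving_sub_left volume x)

theorem integrable_conv (hf : MemLp f 2 (vol r)) (hg : MemLp g 2 (vol r)) {x : ℝ}
    (hx : x ≤ r) : Integrable (fun t => f (x - t) * g t) (vol x) := by
  have := (memLp_comp_sub hf x).integrable_mul (memLp_indicator hg)
  refine (integrable_indicator_iff measurableSet_Ioo).1 ?_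
  exact this.congr (ae_of_all _ fun t => indicator_conv hx t)

/-- The convolution of square integrable functions is continuous. -/
theorem continuousOn_conv (hf : MemLp f 2 (vol r)) (hg : MemLp g 2 (vol r)) :
    ContinuousOn (conv f g) (Icc 0 r) := by
  have hmp : ∀ x : ℝ, MeasurePreserving (ContinuousMap.mk (fun t : ℝ => x - t) (by fun_prop))
      volume volume := fun x => Measure.measurePreserving_sub_left volume x
  have hF := memLp_indicator hf
  have hG := memLp_indicator (hg.star)
  -- The reflected translates `f(x - ·)`, extended by zero, depend continuously on `x` in `L²`. The
  -- convolution is their inner product with the conjugate of `g`.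
  have hc : Continuous fun x : ℝ => Lp.compMeasurePreserving _ (hmp x) (hF.toLp _) := by
    refine Continuous.compMeasurePreservingLp continuous_const ?_ hmp (by norm_num)
    exact ContinuousMap.continuous_of_continuous_uncurry _ (continuous_fst.sub continuous_snd)
  have hi : Continuous fun x : ℝ =>
      inner ℂ (hG.toLp _) (Lp.compMeasurePreserving _ (hmp x) (hF.toLp _)) :=
    continuous_const.inner hc
  refine hi.continuousOn.congr fun x hx => ?_
  refine (conv_eq_integral hx).trans ?_
  simp only [L2.inner_def]
  refine integral_congr_ae ?_
  have h1 : Lp.compMeasurePreserving _ (hmp x) (hF.toLp _) =ᵐ[volume]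
      fun t => (Ioo 0 r).indicator f (x - t) := by
    rw [Lp.toLp_compMeasurePreserving]
    exact MemLp.coeFn_toLp _
  filter_upwards [h1, hG.coeFn_toLp] with t h1 h2
  rw [h1, h2, RCLike.inner_apply]
  congr 1
  by_cases ht : t ∈ Ioo 0 r
  · rw [indicator_of_mem ht, indicator_of_mem ht]
    exact (Complex.conj_conj _).symm
  · rw [indicator_of_notMem ht, indicator_of_notMem ht, map_zero]

theorem integral_indicator_shift {x t : ℝ} (hx : x ∈ Icc 0 r) (ht : 0 < t)
    (hf : Integrable f (vol r)) :
    ∫ w in (0 : ℝ)..x, (Ioo 0 r).indicator f (w - t) = (Ioo 0 r).indicator (prim f) (x - t) := by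
  have hF : Integrable ((Ioo 0 r).indicator f) := (integrable_indicator_iff measurableSet_Ioo).2 hf
  have hz : ∀ {a b : ℝ}, a ≤ 0 → b ≤ 0 → ∫ w in a..b, (Ioo 0 r).indicator f w = 0 := by
    intro a b ha hb
    rw [← intervalIntegral.integral_zero (a := a) (b := b) (E := ℂ) (μ := volume)]
    refine intervalIntegral.integral_congr fun w hw => ?_
    exact indicator_of_notMem (fun h => absurd h.1 (not_lt.2 (hw.2.trans (max_le ha hb)))) _
  rw [intervalIntegral.integral_comp_sub_right (fun w => (Ioo 0 r).indicator f w), zero_sub]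
  rcases lt_or_ge t x with h | h
  · have h1 : x - t ∈ Ioo 0 r := ⟨by linarith, by linarith [hx.2]⟩
    rw [indicator_of_mem h1, ← intervalIntegral.integral_add_adjacent_intervals (b := 0) hF.intervalIntegrable
        hF.intervalIntegrable, hz (by linarith) le_rfl, zero_add, prim]
    exact intervalIntegral_congr_Ioo (by linarith) fun w hw => by
      have h2 : w ∈ Ioo 0 r := ⟨hw.1, by linarith [hw.2, hx.2]⟩
      rw [indicator_of_mem h2]
  · rw [hz (by linarith) (by linarith), indicator_of_notMem]
    exact fun h' => by linarith [h'.1]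

/-- Integration commutes with convolution. -/
theorem conv_prim (hf : Integrable f (vol r)) (hg : Integrable g (vol r)) {x : ℝ}
    (hx : x ∈ Icc 0 r) : conv (prim f) g x = prim (conv f g) x := by
  have hF : Integrable ((Ioo 0 r).indicator f) := (integrable_indicator_iff measurableSet_Ioo).2 hf
  have hG : Integrable ((Ioo 0 r).indicator g) := (integrable_indicator_iff measurableSet_Ioo).2 hg
  have h1 : prim (conv f g) x = ∫ w, (∫ t, (Ioo 0 r).indicator f (w - t) *
      (Ioo 0 r).indicator g t) ∂(vol x) := by
    rw [prim, intervalIntegral_eq_vol _ hx.1]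
    exact integral_congr_ae (ae_vol_of_forall fun w hw =>
      conv_eq_integral ⟨hw.1.le, hw.2.le.trans hx.2⟩)
  have hI : Integrable (Function.uncurry fun w t => (Ioo 0 r).indicator f (w - t) *
      (Ioo 0 r).indicator g t) ((vol x).prod volume) := by
    have h2 := (hG.convolution_integrand (ContinuousLinearMap.mul ℂ ℂ) hF).mono_measure
      (Measure.prod_mono (Measure.restrict_le_self (s := Ioo 0 x)) le_rfl)
    refine h2.congr (ae_of_all _ fun z => ?_)
    exact mul_comm _ _
  rw [h1, integral_integral_swap hI, conv_eq_integral hx]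
  refine integral_congr_ae (ae_of_all _ fun t => ?_)
  simp only
  rw [← intervalIntegral_eq_vol _ hx.1, intervalIntegral.integral_mul_const]
  by_cases ht : 0 < t
  · rw [integral_indicator_shift hx ht hf]
  · rw [indicator_of_notMem (fun h : t ∈ Ioo 0 r => ht h.1), mul_zero, mul_zero]

theorem hasPrim_prim (hf : Integrable f (vol r)) : HasPrim r (prim f) f :=
  ⟨hf, fun x _ => by simp [prim]⟩

theorem memLp_of_continuousOn {F : ℝ → ℂ} (hF : ContinuousOn F (Icc 0 r)) (s : ENNReal) :
    MemLp F s (vol r) := by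
  obtain ⟨C, hC⟩ := isCompact_Icc.exists_bound_of_continuousOn hF
  exact memLp_of_bounded ((hF.mono Ioo_subset_Icc_self).aestronglyMeasurable measurableSet_Ioo)
    (fun x hx => hC x ⟨hx.1.le, hx.2.le⟩) s

theorem conv_prim_prim (hf : MemLp f 2 (vol r)) (hg : MemLp g 2 (vol r)) {x : ℝ}
    (hx : x ∈ Icc 0 r) : conv (prim f) (prim g) x = prim (prim (conv f g)) x := by
  have hf' := hf.integrable one_le_two
  have hg' := hg.integrable one_le_two
  rw [conv_prim hf' ((memLp_of_continuousOn (hasPrim_prim hg').continuousOn 2).integrable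
    one_le_two) hx, prim, prim]
  refine intervalIntegral_congr_Ioo hx.1 fun w hw => ?_
  rw [conv_comm, conv_prim hg' hf' ⟨hw.1.le, hw.2.le.trans hx.2⟩]
  simp only [prim, conv_comm g f]

theorem eq_zero_of_prim_eq_zero (hr : 0 < r) {F : ℝ → ℂ} (hF : ContinuousOn F (Icc 0 r))
    (h : ∀ x ∈ Icc 0 r, prim F x = 0) : ∀ x ∈ Icc 0 r, F x = 0 := by
  have h0 := (hasPrim_prim ((memLp_of_continuousOn hF 2).integrable one_le_two)).ae_eq_zero
    fun x hx => (h x hx).trans (h 0 ⟨le_rfl, hr.le⟩).symm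
  have h1 : F =ᵐ[volume.restrict (Icc 0 r)] fun _ => 0 := by
    rwa [← Measure.restrict_congr_set Ioo_ae_eq_Icc]
  exact Measure.eqOn_Icc_of_ae_eq volume hr.ne h1 hF continuousOn_const

theorem integrable_of_continuousOn {F : ℝ → ℂ} (hF : ContinuousOn F (Icc 0 r)) :
    Integrable F (vol r) := (memLp_of_continuousOn hF 2).integrable one_le_two

/-- A convolution identity between square integrable functions holds if the identity between their
primitives does. -/
theorem sum_conv_eq_of_prim (hr : 0 < r) {ι : Type*} (s : Finset ι) {f g : ι → ℝ → ℂ}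
    (hf : ∀ k, MemLp (f k) 2 (vol r)) (hg : ∀ k, MemLp (g k) 2 (vol r)) (c : ι → ℂ)
    (h : ∀ x ∈ Icc 0 r, ∑ k ∈ s, c k * conv (prim (f k)) (prim (g k)) x = 0) :
    ∀ x ∈ Icc 0 r, ∑ k ∈ s, c k * conv (f k) (g k) x = 0 := by
  have hc : ∀ k, ContinuousOn (conv (f k) (g k)) (Icc 0 r) := fun k => continuousOn_conv (hf k) (hg k)
  have hp : ∀ {F : ℝ → ℂ}, ContinuousOn F (Icc 0 r) → ContinuousOn (prim F) (Icc 0 r) :=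
    fun hF => (hasPrim_prim (integrable_of_continuousOn hF)).continuousOn
  have hlin : ∀ {F : ι → ℝ → ℂ}, (∀ k, ContinuousOn (F k) (Icc 0 r)) → ∀ x ∈ Icc 0 r,
      prim (fun y => ∑ k ∈ s, c k * F k y) x = ∑ k ∈ s, c k * prim (F k) x := fun hF x hx => by
    have hi : ∀ k ∈ s, IntervalIntegrable (fun y => c k * _) volume 0 x := fun k _ =>
      (intervalIntegrable_of_vol (integrable_of_continuousOn (hF k)) ⟨le_rfl, hr.le⟩
        hx).const_mul (c k)
    rw [prim, intervalIntegral.integral_finsetSum hi]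
    simp only [intervalIntegral.integral_const_mul, prim]
  have hcs : ∀ {F : ι → ℝ → ℂ}, (∀ k, ContinuousOn (F k) (Icc 0 r)) →
      ContinuousOn (fun y => ∑ k ∈ s, c k * F k y) (Icc 0 r) := fun hF =>
    continuousOn_finsetSum _ fun k _ => continuousOn_const.mul (hF k)
  -- The convolution of two primitives is the second primitive of the convolution. As all functions
  -- involved are continuous, the two integrations can be removed one after the other.
  have h1 : ∀ x ∈ Icc 0 r, ∑ k ∈ s, c k * prim (conv (f k) (g k)) x = 0 := by
    refine eq_zero_of_prim_eq_zero hr (hcs fun k => hp (hc k)) fun x hx => ?_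
    rw [hlin (fun k => hp (hc k)) x hx, ← h x hx]
    exact Finset.sum_congr rfl fun k _ => by rw [conv_prim_prim (hf k) (hg k) hx]
  refine eq_zero_of_prim_eq_zero hr (hcs hc) fun x hx => ?_
  rw [hlin hc x hx, h1 x hx]

end Convolution

/-! ### The convolution identity for `Φ₁` -/

section ConvolutionIdentity

variable {m₁ m₂ : ℕ} {r : ℝ} {β : ℝ → Matrix (Fin m₂) (Fin m₁ ⊕ Fin m₂) ℂ} {E : Op m₂}
  {Φ : ℝ → Matrix (Fin m₂) (Fin m₁) ℂ}

theorem star_prim (f : ℝ → ℂ) (x : ℝ) : star (prim f x) = prim (fun t => star (f t)) x := by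
  rw [prim, prim, Complex.star_def, ← intervalIntegral.intervalIntegral_conj]

theorem single_dotProduct_star {p : ℕ} (i : Fin p) (u : Fin p → ℂ) :
    star (Pi.single i (1 : ℂ)) ⬝ᵥ u = u i := by
  rw [← Pi.single_star, star_one, single_dotProduct, one_mul]

/-- The integrated form of the convolution identity. -/
theorem sum_conv_prim (hr : 0 < r) (hβ : MemU r β) (hE : Intertwines β r E)
    (hΦ : IsInvApply r E (blk₁ β) Φ) (i l : Fin m₂) {ξ : ℝ} (hξ : ξ ∈ Icc 0 r) :
    (∑ k, conv (prim fun t => Φ t i k) (prim fun t => star (Φ t l k)) ξ) =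
      (1 : Matrix (Fin m₂) (Fin m₂) ℂ) i l * conv (prim fun _ => 1) (prim fun _ => 1) ξ := by
  obtain ⟨a, haL, hac, ha⟩ := hE.isBoundedOp.exists_dual_family hΦ.invertible
  have hΦi : ∀ i k, Integrable (fun t => Φ t i k) (vol r) := fun i k =>
    ((memL2_iff.1 (hΦ.memL2 k)) i).integrable one_le_two
  have hp : ∀ {f : ℝ → ℂ}, Integrable f (vol r) → ContinuousOn (prim f) (Icc 0 r) := fun hf =>
    (hasPrim_prim hf).continuousOn
  have hle : ∀ x ∈ uIcc 0 ξ, x ∈ Icc 0 r ∧ ξ - x ∈ Icc 0 r := fun x hx => by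
    rw [uIcc_of_le hξ.1] at hx
    exact ⟨⟨hx.1, hx.2.trans hξ.2⟩, by linarith [hx.2], by linarith [hx.1, hξ.2]⟩
  have hint : ∀ {F G : ℝ → ℂ}, ContinuousOn F (Icc 0 r) → ContinuousOn G (Icc 0 r) →
      IntervalIntegrable (fun t => F (ξ - t) * G t) volume 0 ξ := fun hF hG => by
    refine ContinuousOn.intervalIntegrable (ContinuousOn.mul (hF.comp (by fun_prop) fun x hx =>
      (hle x hx).2) (hG.mono fun x hx => (hle x hx).1))
  -- `dual_identity` is used along `t = ξ - x`. Integrated over `0 < x < ξ`, its left side vanishes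
  -- and its right side becomes a difference of convolutions at `ξ`.
  have h1 := integral_ramp_antisymm (hac (Pi.single i 1) (Pi.single l 1)) hξ.1
  have h2 : ∀ x ∈ uIcc 0 ξ, ((∫ y in (0 : ℝ)..x, ((y - x : ℝ) : ℂ) *
        pairing r (a y (Pi.single i 1)) (a (ξ - x) (Pi.single l 1))) -
      ∫ y in (0 : ℝ)..(ξ - x), ((y - (ξ - x) : ℝ) : ℂ) *
        pairing r (a x (Pi.single i 1)) (a y (Pi.single l 1))) =
      Complex.I * ((∑ k, prim (fun t => star (Φ t l k)) (ξ - x) * prim (fun t => Φ t i k) x) -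
        (1 : Matrix (Fin m₂) (Fin m₂) ℂ) i l * (prim (fun _ => 1) (ξ - x) * prim (fun _ => 1) x)) := by
    intro x hx
    rw [dual_identity hr.le hβ hE hΦ haL ha (hle x hx).1 (hle x hx).2]
    simp only [single_dotProduct_star, ← star_prim]
    congr 2
    · exact Finset.sum_congr rfl fun k _ => mul_comm _ _
    · simp only [prim, intervalIntegral.integral_const, sub_zero, Complex.real_smul, mul_one,
        Pi.single_apply, Matrix.one_apply]
      ring
  rw [intervalIntegral.integral_congr h2, intervalIntegral.integral_const_mul,
    mul_eq_zero, or_iff_right Complex.I_ne_zero] at h1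
  have hstar : ∀ k, Integrable (fun t => star (Φ t l k)) (vol r) := fun k =>
    (((memL2_iff.1 (hΦ.memL2 k)) l).star).integrable one_le_two
  have i1 : ∀ k ∈ Finset.univ, IntervalIntegrable (fun x => prim (fun t => star (Φ t l k)) (ξ - x) *
      prim (fun t => Φ t i k) x) volume 0 ξ := fun k _ => hint (hp (hstar k)) (hp (hΦi i k))
  have i2 := hint (hp (integrable_const (μ := vol r) (1 : ℂ)))
    (hp (integrable_const (μ := vol r) (1 : ℂ)))
  have i3 := IntervalIntegrable.sum _ i1
  rw [Finset.sum_fn] at i3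
  rw [intervalIntegral.integral_sub i3 (i2.const_mul _),
    intervalIntegral.integral_finsetSum i1, intervalIntegral.integral_const_mul, sub_eq_zero] at h1
  rw [← conv] at h1
  rw [← h1]
  exact Finset.sum_congr rfl fun k _ => conv_comm _ _ _

/-- The convolution identity for `Φ = E⁻¹ β₁`. -/
theorem mint_conv_eq (hr : 0 < r) (hβ : MemU r β) (hE : Intertwines β r E)
    (hΦ : IsInvApply r E (blk₁ β) Φ) {ξ : ℝ} (hξ : ξ ∈ Icc 0 r) :
    mint 0 ξ (fun t => Φ (ξ - t) * (Φ t)ᴴ) = (ξ : ℂ) • 1 := by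
  ext i l
  have hΦi : ∀ i k, MemLp (fun t => Φ t i k) 2 (vol r) := fun i k => (memL2_iff.1 (hΦ.memL2 k)) i
  -- The additional index `none` carries the term `-δ_il (1 * 1)`, which brings the identity into
  -- the form of a vanishing sum of convolutions.
  have h := sum_conv_eq_of_prim hr (Finset.univ : Finset (Option (Fin m₁)))
    (f := fun o => o.elim (fun _ => 1) fun k t => Φ t i k)
    (g := fun o => o.elim (fun _ => 1) fun k t => star (Φ t l k))
    (fun o => by cases o; exacts [memLp_const _, hΦi i _])
    (fun o => by cases o; exacts [memLp_const _, (hΦi l _).star])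
    (fun o => o.elim (-(1 : Matrix (Fin m₂) (Fin m₂) ℂ) i l) fun _ => 1)
    (fun x hx => by
      simp only [Fintype.sum_option, Option.elim, one_mul]
      rw [sum_conv_prim hr hβ hE hΦ i l hx]
      ring) ξ hξ
  simp only [Fintype.sum_option, Option.elim, one_mul] at h
  have h1 : conv (fun _ => 1) (fun _ => 1) ξ = ξ := by simp [conv]
  rw [h1] at h
  simp only [mint, Matrix.of_apply, Matrix.mul_apply, Matrix.conjTranspose_apply]
  have hi : ∀ k ∈ Finset.univ, IntervalIntegrable (fun t => Φ (ξ - t) i k * star (Φ t l k))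
      volume 0 ξ := fun k _ => intervalIntegrable_zero_of_vol hξ.1
    (integrable_conv (hΦi i k) (hΦi l k).star hξ.2)
  rw [intervalIntegral.integral_finsetSum hi, Matrix.smul_apply, smul_eq_mul]
  simp only [conv] at h
  linear_combination h

theorem IsPhi₁.mint_conv_eq (hr : 0 < r) (hβ : Admissible β r) (hΦ : IsPhi₁ β r Φ) {ξ : ℝ}
    (hξ : ξ ∈ Icc 0 r) : mint 0 ξ (fun t => Φ (ξ - t) * (Φ t)ᴴ) = (ξ : ℂ) • 1 := by
  obtain ⟨E, hE, hEΦ⟩ := hΦ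
  exact GenCanonical.mint_conv_eq hr hβ.memU (hE.intertwines hr hβ) hEΦ hξ

end ConvolutionIdentity

/-! ### Uniqueness of the transformation operator -/

section Uniqueness

variable {p : ℕ} {r R : ℝ}

theorem memL2_indicator {f : ℝ → Fin p → ℂ} (hf : MemL2 r f) :
    MemL2 R ((Ioo 0 r).indicator f) :=
  ((memLp_indicator_iff_restrict measurableSet_Ioo).2 hf).mono_measure Measure.restrict_le_self

theorem indicator_ae_eq (f : ℝ → Fin p → ℂ) : (Ioo 0 r).indicator f =ᵐ[vol r] f :=
  ae_vol_of_forall fun _ hx => indicator_of_mem hx f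

theorem MemL2.mono {f : ℝ → Fin p → ℂ} (hf : MemL2 R f) (hr : r ≤ R) : MemL2 r f :=
  hf.mono_measure (vol_mono hr)

/-- The restriction of a causal bounded operator to a smaller interval is bounded. -/
theorem IsBoundedOp.restrict {T : Op p} (hT : IsBoundedOp R T) (hr : r ≤ R)
    (hc : ∀ f g, f =ᵐ[vol r] g → T f =ᵐ[vol r] T g) : IsBoundedOp r T where
  -- Functions on `(0,r)` are extended by zero. The hypothesis `hc` says that the values of `T f` on
  -- `(0,r)` depend only on `f` there, so the extension does not matter.
  memL2 f hf := memL2_congr (hc _ _ (indicator_ae_eq f))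
    ((hT.memL2 _ (memL2_indicator hf)).mono hr)
  congr := hc
  add f g hf hg := by
    have h1 := (hT.add _ _ (memL2_indicator hf) (memL2_indicator hg)).filter_mono
      (ae_mono (vol_mono hr))
    rw [← indicator_add'] at h1
    exact (hc _ _ (indicator_ae_eq _)).symm.trans
      (h1.trans ((hc _ _ (indicator_ae_eq f)).add (hc _ _ (indicator_ae_eq g))))
  smul c f hf := by
    have h1 := (hT.smul c _ (memL2_indicator hf)).filter_mono (ae_mono (vol_mono hr))
    rw [show c • (Ioo 0 r).indicator f = (Ioo 0 r).indicator (c • f) from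
      (indicator_const_smul (Ioo 0 r) c f).symm] at h1
    exact (hc _ _ (indicator_ae_eq _)).symm.trans
      (h1.trans ((hc _ _ (indicator_ae_eq f)).const_smul c))
  bound := by
    obtain ⟨C, hC, hb⟩ := hT.bound
    refine ⟨C, hC, fun f hf => ?_⟩
    filter_upwards [(hb _ (memL2_indicator hf)).filter_mono (ae_mono (vol_mono hr)),
      hc _ _ (indicator_ae_eq f), indicator_ae_eq f] with x h1 h2 h3
    rw [h2, h3] at h1
    have h4 : ∫ t, ‖(Ioo 0 r).indicator f t‖ ∂(vol R) = ∫ t, ‖f t‖ ∂(vol r) := by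
      simp only [norm_indicator_eq_indicator_norm]
      rw [integral_indicator measurableSet_Ioo, Measure.restrict_restrict measurableSet_Ioo,
        inter_eq_left.2 (Ioo_subset_Ioo_right hr)]
    rwa [h4] at h1

/-- Two bounded operators which agree on an `L¹`-dense set agree. -/
theorem IsBoundedOp.ae_eq_of_approx {T T' : Op p} (hr : 0 ≤ r) (hT : IsBoundedOp r T)
    (hT' : IsBoundedOp r T') {f : ℝ → Fin p → ℂ} (hf : MemL2 r f)
    (h : ∀ ε : ℝ, 0 < ε → ∃ g, MemL2 r g ∧ T g =ᵐ[vol r] T' g ∧ ∫ t, ‖f t - g t‖ ∂(vol r) ≤ ε) :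
    T f =ᵐ[vol r] T' f := by
  obtain ⟨C, hC, hb⟩ := hT.bound
  obtain ⟨C', hC', hb'⟩ := hT'.bound
  have hi : Integrable (fun x => ‖T f x - T' f x‖) (vol r) :=
    ((hT.memL2 f hf).integrable.sub (hT'.memL2 f hf).integrable).norm
  have key : ∀ ε : ℝ, 0 < ε → ∫ x, ‖T f x - T' f x‖ ∂(vol r) ≤ 0 + ε := by
    intro ε hε
    have hK : 0 < (C + C') * (1 + r) + 1 := by positivity
    obtain ⟨g, hg, hgT, hfg⟩ := h (ε / ((C + C') * (1 + r) + 1)) (div_pos hε hK)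
    have hd : MemL2 r (f - g) := hf.sub hg
    have e1 := hT.add _ _ hg hd
    have e2 := hT'.add _ _ hg hd
    rw [add_sub_cancel] at e1 e2
    have hle : ∀ᵐ x ∂(vol r), ‖T f x - T' f x‖ ≤
        (C + C') * (‖f x - g x‖ + ∫ t, ‖f t - g t‖ ∂(vol r)) := by
      filter_upwards [e1, e2, hgT, hb _ hd, hb' _ hd] with x h1 h2 h3 h4 h5
      rw [h1, h2, Pi.add_apply, Pi.add_apply, h3, add_sub_add_left_eq_sub]
      refine (norm_sub_le _ _).trans ((add_le_add h4 h5).trans ?_)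
      rw [← add_mul]
      rfl
    have hdi : Integrable (fun x => ‖f x - g x‖) (vol r) := hd.integrable.norm
    have h6 : ∫ x, ‖T f x - T' f x‖ ∂(vol r) ≤
        ∫ x, (C + C') * (‖f x - g x‖ + ∫ t, ‖f t - g t‖ ∂(vol r)) ∂(vol r) :=
      integral_mono_ae hi ((hdi.add (integrable_const _)).const_mul _) hle
    rw [integral_const_mul, integral_add hdi (integrable_const _), integral_const, smul_eq_mul,
      measureReal_restrict_apply_univ, Real.volume_real_Ioo_of_le hr, sub_zero] at h6
    calc _ ≤ _ := h6
      _ = (C + C') * (1 + r) * ∫ t, ‖f t - g t‖ ∂(vol r) := by ring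
      _ ≤ ((C + C') * (1 + r) + 1) * (ε / ((C + C') * (1 + r) + 1)) :=
          mul_le_mul (by linarith) hfg (integral_nonneg fun _ => norm_nonneg _) hK.le
      _ = 0 + ε := by rw [mul_div_cancel₀ _ hK.ne', zero_add]
  have h0 := le_of_forall_pos_le_add key
  have h1 := (integral_eq_zero_iff_of_nonneg (fun _ => norm_nonneg _) hi).1
    (le_antisymm h0 (integral_nonneg fun _ => norm_nonneg _))
  filter_upwards [h1] with x hx
  exact sub_eq_zero.1 (norm_eq_zero.1 hx)

/-- Repeated application of `A` to a constant vector thus generates all even powers of `x` times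
that vector. -/
theorem opA_pow (n : ℕ) (v : Fin p → ℂ) (x : ℝ) :
    opA p (fun t => ((t ^ 2) ^ n : ℝ) • v) x =
      (-((2 * n + 1) * (2 * n + 2) : ℝ)⁻¹) • ((x ^ 2) ^ (n + 1) : ℝ) • v := by
  have h0 : ∫ t in (0 : ℝ)..x, (t - x) * (t ^ 2) ^ n =
      -((2 * n + 1) * (2 * n + 2) : ℝ)⁻¹ * (x ^ 2) ^ (n + 1) := by
    have e : ∀ t : ℝ, (t - x) * (t ^ 2) ^ n = t ^ (2 * n + 1) - x * t ^ (2 * n) := fun t => by ring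
    simp only [e]
    rw [intervalIntegral.integral_sub ((continuous_pow _).intervalIntegrable _ _)
      (((continuous_pow _).const_mul x).intervalIntegrable _ _), intervalIntegral.integral_const_mul,
      integral_pow, integral_pow]
    have h1 : (2 * n + 1 : ℝ) ≠ 0 := by positivity
    have h2 : (2 * n + 2 : ℝ) ≠ 0 := by positivity
    push_cast
    field_simp
    ring
  simp only [opA, smul_smul]
  rw [intervalIntegral.integral_smul_const, h0]

variable {m₁ m₂ : ℕ} {β : ℝ → Matrix (Fin m₂) (Fin m₁ ⊕ Fin m₂) ℂ} {E E' : Op m₂}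

theorem Intertwines.restrict (hE : Intertwines β R E) (hr : r ≤ R)
    (hc : ∀ f g, f =ᵐ[vol r] g → E f =ᵐ[vol r] E g) : Intertwines β r E where
  isBoundedOp := hE.isBoundedOp.restrict hr hc
  similar f hf := by
    have h1 := (hE.similar _ (memL2_indicator hf)).filter_mono (ae_mono (vol_mono hr))
    refine EventuallyEq.trans (ae_vol_of_forall fun x hx => ?_) (h1.trans (hc _ _ ?_))
    · exact opK_congr (hc _ _ (indicator_ae_eq f).symm) ⟨hx.1.le, hx.2.le⟩
    · exact ae_vol_of_forall fun x hx => opA_congr (indicator_ae_eq f) ⟨hx.1.le, hx.2.le⟩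
  apply_const v := (hE.apply_const v).filter_mono (ae_mono (vol_mono hr))

namespace Intertwines

theorem real_smul (hE : Intertwines β r E) (c : ℝ) {f : ℝ → Fin m₂ → ℂ} (hf : MemL2 r f) :
    E (fun x => c • f x) =ᵐ[vol r] fun x => c • E f x := by
  have := hE.isBoundedOp.smul (c : ℂ) f hf
  have e : ∀ g : ℝ → Fin m₂ → ℂ, (c : ℂ) • g = fun x => c • g x := fun g => by
    funext x; exact Complex.coe_smul c (g x)
  rwa [e, e] at this

theorem memL2_pow (n : ℕ) (v : Fin m₂ → ℂ) : MemL2 r fun x => ((x ^ 2) ^ n : ℝ) • v :=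
  memL2_of_continuousOn (Continuous.continuousOn (by fun_prop))

/-- If `E` and `E'` agree on `f`, they agree on `A f`, because `E A f = K E f = K E' f = E' A f`.
The induction starts at the constants, where both are given by `β₂`. -/
theorem ae_eq_pow (hE : Intertwines β r E) (hE' : Intertwines β r E') (v : Fin m₂ → ℂ) (n : ℕ) :
    E (fun x => ((x ^ 2) ^ n : ℝ) • v) =ᵐ[vol r] E' fun x => ((x ^ 2) ^ n : ℝ) • v := by
  induction n with
  | zero =>
    simp only [pow_zero, one_smul]
    exact (hE.apply_const v).trans (hE'.apply_const v).symm
  | succ n ih =>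
    have h1 : opK β (E fun x => ((x ^ 2) ^ n : ℝ) • v) =ᵐ[vol r]
        opK β (E' fun x => ((x ^ 2) ^ n : ℝ) • v) :=
      ae_vol_of_forall fun x hx => opK_congr ih ⟨hx.1.le, hx.2.le⟩
    have h2 := (hE.similar _ (memL2_pow n v)).symm.trans (h1.trans (hE'.similar _ (memL2_pow n v)))
    have e : opA m₂ (fun t => ((t ^ 2) ^ n : ℝ) • v) = _ := funext (opA_pow n v)
    rw [e] at h2
    have h3 := (hE.real_smul _ (memL2_pow (n + 1) v)).symm.trans
      (h2.trans (hE'.real_smul _ (memL2_pow (n + 1) v)))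
    filter_upwards [h3] with x hx
    have hne : (-((2 * n + 1) * (2 * n + 2) : ℝ)⁻¹) ≠ 0 :=
      neg_ne_zero.2 (inv_ne_zero (by positivity))
    exact smul_right_injective _ hne hx

theorem ae_eq_polynomial (hE : Intertwines β r E) (hE' : Intertwines β r E') (v : Fin m₂ → ℂ)
    (P : Polynomial ℝ) :
    E (fun x => P.eval (x ^ 2) • v) =ᵐ[vol r] E' fun x => P.eval (x ^ 2) • v := by
  have hm : ∀ P : Polynomial ℝ, MemL2 r fun x => P.eval (x ^ 2) • v := fun P =>
    memL2_of_continuousOn (Continuous.continuousOn (by fun_prop))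
  induction P using Polynomial.induction_on' with
  | add P Q hP hQ =>
    have h1 := hE.isBoundedOp.add _ _ (hm P) (hm Q)
    have h2 := hE'.isBoundedOp.add _ _ (hm P) (hm Q)
    have e : (fun x => (P + Q).eval (x ^ 2) • v) =
        (fun x => P.eval (x ^ 2) • v) + fun x => Q.eval (x ^ 2) • v := by
      funext x; simp only [Polynomial.eval_add, add_smul, Pi.add_apply]
    rw [e]
    exact h1.trans ((hP.add hQ).trans h2.symm)
  | monomial n c =>
    simp only [Polynomial.eval_monomial, mul_smul]
    filter_upwards [hE.real_smul c (memL2_pow n v), hE'.real_smul c (memL2_pow n v),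
      hE.ae_eq_pow hE' v n] with x h1 h2 h3
    rw [h1, h2, h3]

theorem ae_eq_real (hr : 0 ≤ r) (hE : Intertwines β r E) (hE' : Intertwines β r E')
    (v : Fin m₂ → ℂ) {φ : ℝ → ℝ} (hφ : Continuous φ) :
    E (fun x => φ x • v) =ᵐ[vol r] E' fun x => φ x • v := by
  refine hE.isBoundedOp.ae_eq_of_approx hr hE'.isBoundedOp
    (memL2_of_continuousOn (Continuous.continuousOn (by fun_prop))) fun ε hε => ?_
  have hK : 0 < r * ‖v‖ + 1 := by positivity
  -- Only polynomials in `x²` are available. The substitution `y = x²` reduces the approximation of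
  -- `φ` on `[0,r]` to that of `φ (√y)` on `[0,r²]` by arbitrary polynomials.
  obtain ⟨P, hP⟩ := exists_polynomial_near_of_continuousOn 0 (r ^ 2) (fun y => φ (Real.sqrt y))
    (by fun_prop) (ε / (r * ‖v‖ + 1)) (div_pos hε hK)
  refine ⟨fun x => P.eval (x ^ 2) • v, memL2_of_continuousOn (Continuous.continuousOn (by fun_prop)),
    hE.ae_eq_polynomial hE' v P, ?_⟩
  have hle : ∀ᵐ x ∂(vol r), ‖φ x • v - P.eval (x ^ 2) • v‖ ≤ ε / (r * ‖v‖ + 1) * ‖v‖ := by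
    refine ae_vol_of_forall fun x hx => ?_
    have h1 := (hP (x ^ 2) ⟨by positivity, pow_le_pow_left₀ hx.1.le hx.2.le 2⟩).le
    rw [Real.sqrt_sq hx.1.le, abs_sub_comm] at h1
    rw [← sub_smul, norm_smul]
    exact mul_le_mul_of_nonneg_right h1 (norm_nonneg v)
  have hi : Integrable (fun x => ‖φ x • v - P.eval (x ^ 2) • v‖) (vol r) :=
    (memL2_of_continuousOn (r := r) (f := fun x => φ x • v - P.eval (x ^ 2) • v)
      (Continuous.continuousOn (by fun_prop))).integrable.norm
  refine (integral_mono_ae hi (integrable_const _) hle).trans ?_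
  rw [integral_const, smul_eq_mul, measureReal_restrict_apply_univ, Real.volume_real_Ioo_of_le hr,
    sub_zero]
  calc r * (ε / (r * ‖v‖ + 1) * ‖v‖) = (r * ‖v‖) * (ε / (r * ‖v‖ + 1)) := by ring
    _ ≤ (r * ‖v‖ + 1) * (ε / (r * ‖v‖ + 1)) :=
        mul_le_mul_of_nonneg_right (by linarith) (div_pos hε hK).le
    _ = ε := mul_div_cancel₀ _ hK.ne'

theorem ae_eq_sum {ι : Type*} (hE : Intertwines β r E) (hE' : Intertwines β r E') (s : Finset ι)
    {f : ι → ℝ → Fin m₂ → ℂ} (hf : ∀ i, MemL2 r (f i)) (h : ∀ i, E (f i) =ᵐ[vol r] E' (f i)) :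
    E (∑ i ∈ s, f i) =ᵐ[vol r] E' (∑ i ∈ s, f i) := by
  classical
  induction s using Finset.induction_on with
  | empty =>
    have h1 := hE.real_smul 0 (memL2_const (r := r) 0)
    have h2 := hE'.real_smul 0 (memL2_const (r := r) 0)
    simp only [zero_smul] at h1 h2
    exact h1.trans h2.symm
  | insert i s hi ih =>
    rw [Finset.sum_insert hi]
    have hs : MemL2 r (∑ i ∈ s, f i) := memLp_finsetSum' s fun i _ => hf i
    exact (hE.isBoundedOp.add _ _ (hf i) hs).trans
      (((h i).add ih).trans (hE'.isBoundedOp.add _ _ (hf i) hs).symm)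

/-- The relations `K E = E A` and `E v = β₂ v` determine `E`. -/
theorem ae_eq (hr : 0 ≤ r) (hE : Intertwines β r E) (hE' : Intertwines β r E')
    {f : ℝ → Fin m₂ → ℂ} (hf : MemL2 r f) : E f =ᵐ[vol r] E' f := by
  refine hE.isBoundedOp.ae_eq_of_approx hr hE'.isBoundedOp hf fun ε hε => ?_
  obtain ⟨g, hg, -⟩ := hf.integrable.exists_boundedContinuous_integral_sub_le hε
  refine ⟨g, memL2_of_continuousOn g.continuous.continuousOn, ?_, hg⟩
  -- A continuous vector function is split into real scalar functions times the fixed vectors `e_i`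
  -- and `i e_i`, the case already settled.
  have e : (g : ℝ → Fin m₂ → ℂ) = ∑ i, ((fun x => (g x i).re • (Pi.single i 1 : Fin m₂ → ℂ)) +
      fun x => (g x i).im • (Pi.single i Complex.I : Fin m₂ → ℂ)) := by
    funext x i
    simp only [Finset.sum_apply, Pi.add_apply, Pi.smul_apply, Pi.single_apply, smul_ite, smul_zero,
      Finset.sum_add_distrib, Finset.sum_ite_eq, Finset.mem_univ, if_true, Complex.real_smul, mul_one]
    exact (Complex.re_add_im _).symm
  rw [e]
  have hc : ∀ i, Continuous fun x => g x i := fun i => (continuous_apply i).comp g.continuous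
  have h1 : ∀ i, Continuous fun x => (g x i).re := fun i => Complex.continuous_re.comp (hc i)
  have h2 : ∀ i, Continuous fun x => (g x i).im := fun i => Complex.continuous_im.comp (hc i)
  have hm : ∀ {φ : ℝ → ℝ} (v : Fin m₂ → ℂ), Continuous φ → MemL2 r fun x => φ x • v :=
    fun v hφ => memL2_of_continuousOn (Continuous.continuousOn (by fun_prop))
  refine hE.ae_eq_sum hE' _ (fun i => (hm _ (h1 i)).add (hm _ (h2 i))) fun i => ?_
  exact (hE.isBoundedOp.add _ _ (hm _ (h1 i)) (hm _ (h2 i))).trans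
    (((hE.ae_eq_real hr hE' _ (h1 i)).add (hE.ae_eq_real hr hE' _ (h2 i))).trans
      (hE'.isBoundedOp.add _ _ (hm _ (h1 i)) (hm _ (h2 i))).symm)

end Intertwines

theorem IsNormalisedTransformation.congr_ae (hE : IsNormalisedTransformation β R E)
    {f g : ℝ → Fin m₂ → ℂ} (h : f =ᵐ[vol r] g) : E f =ᵐ[vol r] E g := by
  obtain ⟨u, kV, g, -, -, -, rfl⟩ := hE
  exact opV_congr_ae _ _ (opV₀_congr_ae _ _ h)

/-- The functions `E⁻¹ β₁` on different intervals are compatible. -/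
theorem IsPhi₁.ae_eq (hr : 0 < r) (hrR : r ≤ R) (hβ : Admissible β r) (hβR : Admissible β R)
    {Φ Ψ : ℝ → Matrix (Fin m₂) (Fin m₁) ℂ} (hΦ : IsPhi₁ β r Φ) (hΨ : IsPhi₁ β R Ψ) :
    ∀ᵐ x ∂(vol r), Φ x = Ψ x := by
  obtain ⟨E, hE, hEΦ⟩ := hΦ
  obtain ⟨F, hF, hFΨ⟩ := hΨ
  have h1 := hE.intertwines hr hβ
  -- The operator of the larger interval, restricted to `(0,r)`, satisfies the same two relations.
  -- By uniqueness it coincides with `E`, and injectivity of `E` identifies the preimages of `β₁`.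
  have h2 := (hF.intertwines (hr.trans_le hrR) hβR).restrict hrR fun _ _ h => hF.congr_ae h
  have h3 : ∀ k, (fun x => (Φ x).col k) =ᵐ[vol r] fun x => (Ψ x).col k := fun k => by
    have hm := (hFΨ.memL2 k).mono hrR
    refine hEΦ.invertible.inj _ _ (hEΦ.memL2 k) hm ((hEΦ.apply_eq k).trans ?_)
    exact ((hFΨ.apply_eq k).filter_mono (ae_mono (vol_mono hrR))).symm.trans (h2.ae_eq hr.le h1 hm)
  filter_upwards [ae_all_iff.2 h3] with x hx
  ext i k
  exact congrFun (hx k) i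

theorem IsPhi₁.congr_ae {Φ Ψ : ℝ → Matrix (Fin m₂) (Fin m₁) ℂ} (hΦ : IsPhi₁ β r Φ)
    (h : ∀ᵐ x ∂(vol r), Φ x = Ψ x) : IsPhi₁ β r Ψ := by
  obtain ⟨E, hE, hEΦ⟩ := hΦ
  have h1 : ∀ k, (fun x => (Φ x).col k) =ᵐ[vol r] fun x => (Ψ x).col k := fun k => by
    filter_upwards [h] with x hx
    rw [hx]
  exact ⟨E, hE, hEΦ.invertible, fun k => memL2_congr (h1 k) (hEΦ.memL2 k), fun k =>
    (hE.congr_ae (h1 k)).symm.trans (hEΦ.apply_eq k)⟩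

theorem exists_isPhi₁_global (h : ∀ r : ℝ, 0 < r → Admissible β r) :
    ∃ Φ : ℝ → Matrix (Fin m₂) (Fin m₁) ℂ, ∀ r : ℝ, 0 < r → IsPhi₁ β r Φ := by
  have hn : ∀ n : ℕ, (0 : ℝ) < n + 1 := fun n => by positivity
  choose Ψ hΨ using fun n : ℕ => (h (n + 1) (hn n)).exists_isPhi₁ (hn n)
  -- At `x` the solution belonging to `(0, ⌊x⌋ + 1)` is taken, an interval that contains `x` when `x
  -- > 0`. Compatibility with each of the countably many `Ψ n` identifies the result on `(0,r)`
  -- almost everywhere.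
  refine ⟨fun x => Ψ ⌊x⌋₊ x, fun r hr => ?_⟩
  obtain ⟨Φ, hΦ⟩ := (h r hr).exists_isPhi₁ hr
  refine hΦ.congr_ae ?_
  have h1 : ∀ n : ℕ, ∀ᵐ x : ℝ, x ∈ Ioo 0 r → x < n + 1 → Φ x = Ψ n x := fun n => by
    rcases le_total r (n + 1) with hle | hle
    · have := (ae_restrict_iff' measurableSet_Ioo).1
        (hΦ.ae_eq hr hle (h r hr) (h _ (hn n)) (hΨ n))
      filter_upwards [this] with x hx h1 _ using hx h1
    · have := (ae_restrict_iff' measurableSet_Ioo).1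
        ((hΨ n).ae_eq (hn n) hle (h _ (hn n)) (h r hr) hΦ)
      filter_upwards [this] with x hx h1 h2 using (hx ⟨h1.1, h2⟩).symm
  refine (ae_restrict_iff' measurableSet_Ioo).2 ?_
  filter_upwards [ae_all_iff.2 h1] with x hx hxr
  exact hx _ hxr (Nat.lt_floor_add_one x)

end Uniqueness

end GenCanonical

/-! ### The finite interval and the half line -/

theorem corollary4p5 {m₁ m₂ : ℕ} (β : ℝ → Matrix (Fin m₂) (Fin m₁ ⊕ Fin m₂) ℂ) :
    (∀ r : ℝ, 0 < r → GenCanonical.Admissible β r →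
      (∃ Φ₁ : ℝ → Matrix (Fin m₂) (Fin m₁) ℂ, GenCanonical.IsPhi₁ β r Φ₁) ∧
      ∀ Φ₁ : ℝ → Matrix (Fin m₂) (Fin m₁) ℂ, GenCanonical.IsPhi₁ β r Φ₁ →
        ∀ ξ ∈ Set.Icc (0 : ℝ) r,
          GenCanonical.mint 0 ξ (fun t => Φ₁ (ξ - t) * (Φ₁ t)ᴴ) = (ξ : ℂ) • 1) ∧
    ((∀ r : ℝ, 0 < r → GenCanonical.Admissible β r) →
      (∃ Φ₁ : ℝ → Matrix (Fin m₂) (Fin m₁) ℂ, ∀ r : ℝ, 0 < r → GenCanonical.IsPhi₁ β r Φ₁) ∧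
      ∀ Φ₁ : ℝ → Matrix (Fin m₂) (Fin m₁) ℂ, (∀ r : ℝ, 0 < r → GenCanonical.IsPhi₁ β r Φ₁) →
        ∀ ξ ∈ Set.Ici (0 : ℝ),
          GenCanonical.mint 0 ξ (fun t => Φ₁ (ξ - t) * (Φ₁ t)ᴴ) = (ξ : ℂ) • 1) := by
  refine ⟨fun r hr hβ => ⟨hβ.exists_isPhi₁ hr, fun Φ₁ hΦ ξ hξ => hΦ.mint_conv_eq hr hβ hξ⟩,
    fun hβ => ⟨GenCanonical.exists_isPhi₁_global hβ, fun Φ₁ hΦ ξ hξ => ?_⟩⟩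
  -- Any `r ≥ ξ` would do; the `1` keeps the interval nondegenerate when `ξ = 0`.
  have hr : 0 < max ξ 1 := lt_max_of_lt_right one_pos
  exact (hΦ _ hr).mint_conv_eq hr (hβ _ hr) ⟨hξ, le_max_left ξ 1⟩
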